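/- **Lemma 2.4.** Let $Y$ be a smooth ($C^\infty$) $5$-manifold and let $D\subset TY$ be a $(2,3,5)$-distribution, i.e. $D$ has rank two and near every point there is a local frame $\eta_1,\eta_2$ of $D$ such that $\eta_1,\ \eta_2,\ [\eta_1,\eta_2],\ [\eta_1,[\eta_1,\eta_2]],\ [\eta_2,[\eta_1,\eta_2]]$ is a local frame of $TY$. Let $Z=P(D)=\{(y,\ell): \ell\subset D_y,\ \dim\ell=1\}$, a $6$-manifold with projection $\pi_Y:Z\to Y$, let $E\subset TZ$, $E_{(y,\ell)}=\pi_{Y*}^{-1}(\ell)$, be the prolongation of $D$, let $L=\operatorname{Ker}\pi_{Y*}$, and let $\partial^{(0)}E=E$, $\partial^{(k+1)}E=[E,\partial^{(k)}E]$ (that is, $E+\partial^{(k)}E$ plus the brackets of local sections) be the derived systems. A singular $D$-path is an immersed smooth $D$-curve $\gamma$ that lifts to an abnormal bi-extremal $(\gamma,p)$, $p\neq0$ (with $H(x,p,u)=\langle p,\sum u_if_i(x)\rangle$ for a local frame $f_1,f_2$ of $D$: $\dot x=\partial H/\partial p$, $\dot p=-\partial H/\partial x$, $\partial H/\partial u=0$);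 its lift to $Z$ is $t\mapsto(\gamma(t),\mathbb R\dot\gamma(t))$. For an open set $W\subset Z$ and a $5$-manifold $X$, a map $\pi_X:W\to X$ is called a path-space projection if it is a smooth submersion each of whose fibres is the lift of one singular $D$-path. For open $W'\subset W$ put $$C_x(W')=\bigcup_{z\in W',\ \pi_X(z)=x}\pi_{X*}(L_z)\subset T_xX\qquad(x\in\pi_X(W')).$$ (i) Every point of $Z$ lies in an open set $W$ that has a path-space projection to $\mathbb R^5$. (ii) For every path-space projection $\pi_X:W\to X$ there is a contact structure $D'$ on the open set $\pi_X(W)$ induced by $\partial^{(3)}E$, i.e. $(\pi_{X*})_z^{-1}(D'_{\pi_X(z)})=\partial^{(3)}E_z$ for all $z\in W$. Moreover every point of $W$ has arbitrarily small open neighbourhoods $W'\subset W$ such that $\pi_X(W')$ is open, $\pi_X|_{W'}$ is a path-space projection, and the cone field $C=C(W')$ is a non-degenerate Lagrangian cone structure for $D'$ on $\pi_X(W')$, which means: - (cone structure, non-singular) there is an $\mathbb R^\times$-invariant model cone $\underline C\subset\mathbb R^5$, with $\underline C\setminus\{0\}$ an embedded submanifold, such that every point of $\pi_X(W')$ has an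 open neighbourhood $N$ with a local triviality $TX|_N\to N\times\mathbb R^5$ (a fibre-preserving bijection, homogeneous of degree one on the fibres but not necessarily linear, and a diffeomorphism off the zero sections) that maps $C|_N$ onto $N\times\underline C$; - (Lagrangian) $C\subset D'$, and for every $x$ and every $v\in C_x\setminus\{0\}$ the tangent space of $C_x\setminus\{0\}$ at $v$ is a Lagrangian ($2$-dimensional isotropic) subspace of $D'_x$ for the conformal symplectic structure $D'_x\times D'_x\to T_xX/D'_x$ given by the Lie bracket of sections of $D'$; - (non-degenerate) for every $x$, $P(C_x)$ is a non-empty curve in $P(D'_x)\cong P^3$ whose first, second and third derivatives, with respect to any regular local parametrization, are linearly independent (equivalently $c,c',c'',c'''$ are linearly independent for every lift $c$ of the parametrization to $C_x\setminus\{0\}$). -/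

import Mathlib

open scoped Manifold ContDiff Topology

noncomputable section

namespace CartanDuality

/-- The model vector space `ℝ⁵`. -/
abbrev E5 : Type := EuclideanSpace ℝ (Fin 5)

/-! ### Distributions on manifolds modelled on an arbitrary normed space -/

section Distributions

variable {H : Type*} [NormedAddCommGroup H] [NormedSpace ℝ H]
  {M : Type*} [TopologicalSpace M] [ChartedSpace H M] [IsManifold 𝓘(ℝ, H) ∞ M]

/-- The vector fields `η 0, …, η (r - 1)` are a smooth local frame, over the open set `U`, of the
field of subspaces `F`. -/
structure IsFrameOf {r : ℕ} (U : Set M) (F : ∀ x : M, Submodule ℝ (TangentSpace 𝓘(ℝ, H) x))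
    (η : Fin r → ∀ x : M, TangentSpace 𝓘(ℝ, H) x) : Prop where
  isOpen : IsOpen U
  smooth : ∀ i, ContMDiffOn 𝓘(ℝ, H) 𝓘(ℝ, H).tangent ∞
    (fun x => (⟨x, η i x⟩ : TangentBundle 𝓘(ℝ, H) M)) U
  linearIndependent : ∀ x ∈ U, LinearIndependent ℝ (fun i => η i x)
  span_eq : ∀ x ∈ U, Submodule.span ℝ (Set.range fun i => η i x) = F x

/-- `F` is a smooth distribution of rank `r` over the set `U`. -/
def IsDistributionOn (r : ℕ) (U : Set M) (F : ∀ x : M, Submodule ℝ (TangentSpace 𝓘(ℝ, H) x)) :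
    Prop :=
  ∀ x ∈ U, ∃ (N : Set M) (η : Fin r → ∀ x : M, TangentSpace 𝓘(ℝ, H) x), x ∈ N ∧ IsFrameOf N F η

/-- `V` is a smooth section of `F` over the open set `U`. -/
structure IsSectionOn (U : Set M) (F : ∀ x : M, Submodule ℝ (TangentSpace 𝓘(ℝ, H) x))
    (V : ∀ x : M, TangentSpace 𝓘(ℝ, H) x) : Prop where
  isOpen : IsOpen U
  smooth : ContMDiffOn 𝓘(ℝ, H) 𝓘(ℝ, H).tangent ∞
    (fun x => (⟨x, V x⟩ : TangentBundle 𝓘(ℝ, H) M)) U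
  mem : ∀ x ∈ U, V x ∈ F x

/-- The subspaces `F x + G x + [ℱ, 𝒢] x`, where `ℱ`, `𝒢` are the sheaves of smooth local sections
of `F` and `G`. -/
def bracketField (F G : ∀ x : M, Submodule ℝ (TangentSpace 𝓘(ℝ, H) x)) (x : M) :
    Submodule ℝ (TangentSpace 𝓘(ℝ, H) x) :=
  F x ⊔ G x ⊔ Submodule.span ℝ {v | ∃ (U : Set M) (V W : ∀ x : M, TangentSpace 𝓘(ℝ, H) x),
    x ∈ U ∧ IsSectionOn U F V ∧ IsSectionOn U G W ∧ v = VectorField.mlieBracket 𝓘(ℝ, H) V W x}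

/-- The iterated derived systems `∂⁽⁰⁾F = F`, `∂⁽ᵏ⁺¹⁾F = [F, ∂⁽ᵏ⁾F]`. -/
def derivedSystem (F : ∀ x : M, Submodule ℝ (TangentSpace 𝓘(ℝ, H) x)) :
    ℕ → ∀ x : M, Submodule ℝ (TangentSpace 𝓘(ℝ, H) x)
  | 0 => F
  | k + 1 => bracketField F (derivedSystem F k)

/-- The vectors `v`, `w` at `x` are orthogonal for the Levi form
`F x × F x → T_x M / F x`, `(V x, W x) ↦ [V, W] x mod F x` (`V`, `W` local sections of `F`). -/
def LeviOrthogonal (F : ∀ x : M, Submodule ℝ (TangentSpace 𝓘(ℝ, H) x)) (x : M)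
    (v w : TangentSpace 𝓘(ℝ, H) x) : Prop :=
  ∀ (U : Set M) (V W : ∀ x : M, TangentSpace 𝓘(ℝ, H) x), x ∈ U → IsSectionOn U F V →
    IsSectionOn U F W → V x = v → W x = w → VectorField.mlieBracket 𝓘(ℝ, H) V W x ∈ F x

end Distributions

/-! ### Rank two distributions on 5-manifolds and the space of their tangential lines -/

section PlaneFields

/-- A smooth distribution of rank two. -/
structure PlaneField (Y : Type*) [TopologicalSpace Y] [ChartedSpace E5 Y]
    [IsManifold 𝓘(ℝ, E5) ∞ Y] where
  space : ∀ y : Y, Submodule ℝ (TangentSpace 𝓘(ℝ, E5) y)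
  isDistribution : IsDistributionOn 2 Set.univ space

variable {Y : Type*} [TopologicalSpace Y] [ChartedSpace E5 Y] [IsManifold 𝓘(ℝ, E5) ∞ Y]

/-- `D` is a `(2,3,5)`-distribution: near every point there is a local frame `η 0, η 1` of `D` such
that `η 0`, `η 1`, `[η 0, η 1]`, `[η 0, [η 0, η 1]]`, `[η 1, [η 0, η 1]]` form a frame of the
tangent bundle. -/
def PlaneField.Is235 (D : PlaneField Y) : Prop :=
  ∀ y₀ : Y, ∃ (U : Set Y) (η : Fin 2 → ∀ y : Y, TangentSpace 𝓘(ℝ, E5) y),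
    y₀ ∈ U ∧ IsFrameOf U D.space η ∧ ∀ y ∈ U, LinearIndependent ℝ ![η 0 y, η 1 y,
      VectorField.mlieBracket 𝓘(ℝ, E5) (η 0) (η 1) y,
      VectorField.mlieBracket 𝓘(ℝ, E5) (η 0)
        (VectorField.mlieBracket 𝓘(ℝ, E5) (η 0) (η 1)) y,
      VectorField.mlieBracket 𝓘(ℝ, E5) (η 1)
        (VectorField.mlieBracket 𝓘(ℝ, E5) (η 0) (η 1)) y]

/-- The space `P(D)` of pairs `(y, ℓ)`, where `ℓ` is a line in `D y`. -/
@[ext]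
structure ProjSpace (D : PlaneField Y) where
  base : Y
  line : Submodule ℝ (TangentSpace 𝓘(ℝ, E5) base)
  finrank_line : Module.finrank ℝ line = 1
  line_le : line ≤ D.space base

namespace ProjSpace

variable {D : PlaneField Y}

/-- A line of `D` is spanned by a vector `α • η 0 + β • η 1`. -/
theorem exists_coeff {U : Set Y} {η : Fin 2 → ∀ y : Y, TangentSpace 𝓘(ℝ, E5) y}
    (h : IsFrameOf U D.space η) (z : ProjSpace D) (hz : z.base ∈ U) :
    ∃ α β : ℝ, (α ≠ 0 ∨ β ≠ 0) ∧
      z.line = Submodule.span ℝ {α • η 0 z.base + β • η 1 z.base} := by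
  obtain ⟨v, hv0, hv⟩ := finrank_eq_one_iff'.1 z.finrank_line
  have hvD : (v : TangentSpace 𝓘(ℝ, E5) z.base) ∈ D.space z.base := z.line_le v.2
  rw [← h.span_eq _ hz] at hvD
  have hr : (Set.range fun i => η i z.base) = {η 0 z.base, η 1 z.base} := by
    ext w; simp [Fin.exists_fin_two, eq_comm]
  rw [hr, Submodule.mem_span_pair] at hvD
  obtain ⟨α, β, hab⟩ := hvD
  refine ⟨α, β, ?_, ?_⟩
  · by_contra hcon
    push Not at hcon
    apply hv0
    ext
    simp [← hab, hcon.1, hcon.2]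
  · rw [hab]
    ext w
    rw [Submodule.mem_span_singleton]
    constructor
    · intro hw
      obtain ⟨c, hc⟩ := hv ⟨w, hw⟩
      exact ⟨c, by simpa using congrArg Subtype.val hc⟩
    · rintro ⟨c, rfl⟩
      exact z.line.smul_mem _ v.2

/-- A combination of two independent vectors lies in the line spanned by another one only if the
coefficients are proportional. -/
theorem mem_span_comb {W : Type*} [AddCommGroup W] [Module ℝ W] {e : Fin 2 → W}
    (he : LinearIndependent ℝ e) {α β s t : ℝ} (hab : α ≠ 0 ∨ β ≠ 0) :
    s • e 0 + t • e 1 ∈ Submodule.span ℝ {α • e 0 + β • e 1} ↔ s * β = t * α := by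
  rw [Submodule.mem_span_singleton]
  have key : ∀ p q : ℝ, p • e 0 + q • e 1 = 0 → p = 0 ∧ q = 0 := by
    have := LinearIndependent.pair_iff.1 (show LinearIndependent ℝ ![e 0, e 1] by
      convert he using 1; ext i; fin_cases i <;> rfl)
    exact this
  constructor
  · rintro ⟨c, hc⟩
    have := key (c * α - s) (c * β - t) (by
      have h2 := sub_eq_zero.2 hc
      rw [← h2]; module)
    have h1 : s = c * α := by linarith [this.1]
    have h2 : t = c * β := by linarith [this.2]
    rw [h1, h2]; ring
  · intro hst
    rcases hab with ha | hb
    · refine ⟨s / α, ?_⟩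
      rw [smul_add, smul_smul, smul_smul]
      congr 2
      · field_simp
      · field_simp; linarith
    · refine ⟨t / β, ?_⟩
      rw [smul_add, smul_smul, smul_smul]
      congr 2
      · field_simp; linarith
      · field_simp

open Classical in
/-- The affine coordinate `t` of the line spanned by `η 0 + t • η 1`. -/
def slope (η : Fin 2 → ∀ y : Y, TangentSpace 𝓘(ℝ, E5) y) (z : ProjSpace D) : ℝ :=
  if h : ∃ t : ℝ, η 0 z.base + t • η 1 z.base ∈ z.line then h.choose else 0

theorem slope_eq {U : Set Y} {η : Fin 2 → ∀ y : Y, TangentSpace 𝓘(ℝ, E5) y}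
    (h : IsFrameOf U D.space η) (z : ProjSpace D) (hz : z.base ∈ U) {α β : ℝ} (hα : α ≠ 0)
    (hl : z.line = Submodule.span ℝ {α • η 0 z.base + β • η 1 z.base}) :
    slope η z = β / α := by
  have hm : ∀ t : ℝ, η 0 z.base + t • η 1 z.base ∈ z.line ↔ t = β / α := by
    intro t
    have := mem_span_comb (s := 1) (t := t) (β := β) (h.linearIndependent _ hz) (Or.inl hα)
    rw [one_smul] at this
    rw [hl, this, eq_div_iff hα, one_mul, eq_comm]
  have hex : ∃ t : ℝ, η 0 z.base + t • η 1 z.base ∈ z.line := ⟨β / α, (hm _).2 rfl⟩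
  rw [slope, dif_pos hex]
  exact (hm _).1 hex.choose_spec

theorem notMem_line_iff {U : Set Y} {η : Fin 2 → ∀ y : Y, TangentSpace 𝓘(ℝ, E5) y}
    (h : IsFrameOf U D.space η) (z : ProjSpace D) (hz : z.base ∈ U) {α β : ℝ}
    (hab : α ≠ 0 ∨ β ≠ 0)
    (hl : z.line = Submodule.span ℝ {α • η 0 z.base + β • η 1 z.base}) :
    η 1 z.base ∉ z.line ↔ α ≠ 0 := by
  have := mem_span_comb (s := 0) (t := 1) (h.linearIndependent _ hz) hab
  rw [zero_smul, one_smul, zero_add] at this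
  rw [hl, this]
  simp [eq_comm]

/-- The point `(y, ℝ(η 0 + t • η 1))` of `P(D)`. -/
def ofSlope {U : Set Y} {η : Fin 2 → ∀ y : Y, TangentSpace 𝓘(ℝ, E5) y}
    (h : IsFrameOf U D.space η) (y : Y) (hy : y ∈ U) (t : ℝ) : ProjSpace D where
  base := y
  line := Submodule.span ℝ {η 0 y + t • η 1 y}
  finrank_line := by
    apply finrank_span_singleton
    intro h0
    have := LinearIndependent.pair_iff.1 (show LinearIndependent ℝ ![η 0 y, η 1 y] by
      convert h.linearIndependent _ hy using 1; ext i; fin_cases i <;> rfl) 1 t (by simpa using h0)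
    exact one_ne_zero this.1
  line_le := by
    rw [Submodule.span_singleton_le_iff_mem, ← h.span_eq _ hy]
    exact Submodule.add_mem _ (Submodule.subset_span ⟨0, rfl⟩)
      (Submodule.smul_mem _ _ (Submodule.subset_span ⟨1, rfl⟩))

open Classical in
/-- The affine chart `(y, ℝ(η 0 + t • η 1)) ↦ (y, t)` of `P(D)`, where `y` is read in the chart of
`Y` at `a`. (The point `z₀` is a dummy value off the target.) -/
def affineChart {U : Set Y} {η : Fin 2 → ∀ y : Y, TangentSpace 𝓘(ℝ, E5) y}
    (h : IsFrameOf U D.space η) (a : Y) (z₀ : ProjSpace D) :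
    PartialEquiv (ProjSpace D) (E5 × ℝ) where
  toFun z := (chartAt E5 a z.base, slope η z)
  invFun p := if hp : (chartAt E5 a).symm p.1 ∈ U then ofSlope h _ hp p.2 else z₀
  source := {z | z.base ∈ (chartAt E5 a).source ∧ z.base ∈ U ∧ η 1 z.base ∉ z.line}
  target := {p | p.1 ∈ (chartAt E5 a).target ∧ (chartAt E5 a).symm p.1 ∈ U}
  map_source' := by
    rintro z ⟨h1, h2, -⟩
    exact ⟨(chartAt E5 a).map_source h1, by rwa [(chartAt E5 a).left_inv h1]⟩
  map_target' := by
    rintro p ⟨h1, h2⟩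
    rw [dif_pos h2]
    refine ⟨(chartAt E5 a).map_target h1, h2, ?_⟩
    refine (notMem_line_iff (α := 1) (β := p.2) h (ofSlope h _ h2 p.2) h2 (Or.inl one_ne_zero)
      ?_).2 one_ne_zero
    rw [one_smul]; rfl
  left_inv' := by
    rintro z ⟨h1, h2, h3⟩
    have e := (chartAt E5 a).left_inv h1
    have h2' : (chartAt E5 a).symm (chartAt E5 a z.base) ∈ U := by rwa [e]
    simp only [dif_pos h2']
    obtain ⟨α, β, hab, hl⟩ := exists_coeff h z h2
    have hα := (notMem_line_iff h z h2 hab hl).1 h3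
    rw [slope_eq h z h2 hα hl]
    obtain ⟨y, l, p, q⟩ := z
    dsimp only at *
    have gen : ∀ (y' : Y) (hy' : y' ∈ U), y' = y →
        ofSlope h y' hy' (β / α) = (⟨y, l, p, q⟩ : ProjSpace D) := by
      rintro y' hy' rfl
      have : l = Submodule.span ℝ {η 0 y' + (β / α) • η 1 y'} := by
        rw [hl]
        have e2 : α • η 0 y' + β • η 1 y' = α • (η 0 y' + (β / α) • η 1 y') := by
          rw [smul_add, smul_smul, mul_div_cancel₀ _ hα]
        rw [e2, Submodule.span_singleton_smul_eq (IsUnit.mk0 _ hα)]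
      subst this
      rfl
    exact gen _ _ e
  right_inv' := by
    rintro p ⟨h1, h2⟩
    rw [dif_pos h2]
    refine Prod.ext ((chartAt E5 a).right_inv h1) ?_
    have := slope_eq (α := 1) (β := p.2) h (ofSlope h _ h2 p.2) h2 one_ne_zero
      (by rw [one_smul]; rfl)
    simpa using this

theorem affineChart_symm_apply {U : Set Y} {η : Fin 2 → ∀ y : Y, TangentSpace 𝓘(ℝ, E5) y}
    (h : IsFrameOf U D.space η) (a : Y) (z₀ : ProjSpace D) (p : E5 × ℝ)
    (hp : (chartAt E5 a).symm p.1 ∈ U) :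
    (affineChart h a z₀).symm p = ofSlope h _ hp p.2 :=
  dif_pos hp

/-- The coordinates, in the chart at `a`, of the tangent vector `η y` at the point `y` with
coordinates `u`. -/
def coordVec (a : Y) (ξ : ∀ y : Y, TangentSpace 𝓘(ℝ, E5) y) (u : E5) : E5 :=
  (trivializationAt E5 (TangentSpace 𝓘(ℝ, E5) : Y → Type _) a).linearMapAt ℝ
    ((chartAt E5 a).symm u) (ξ ((chartAt E5 a).symm u))

theorem contDiffOn_coordVec (a : Y) {U : Set Y} (hU : IsOpen U)
    {ξ : ∀ y : Y, TangentSpace 𝓘(ℝ, E5) y}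
    (hξ : ContMDiffOn 𝓘(ℝ, E5) 𝓘(ℝ, E5).tangent ∞
      (fun y => (⟨y, ξ y⟩ : TangentBundle 𝓘(ℝ, E5) Y)) U) :
    ContDiffOn ℝ ∞ (coordVec a ξ)
      ((chartAt E5 a).target ∩ (chartAt E5 a).symm ⁻¹' U) := by
  rw [← contMDiffOn_iff_contDiffOn]
  have hs : (trivializationAt E5 (TangentSpace 𝓘(ℝ, E5) : Y → Type _) a).baseSet =
      (chartAt E5 a).source := TangentBundle.trivializationAt_baseSet a
  have h1 := (Bundle.Trivialization.contMDiffOn_section_iff (n := ∞) (IB := 𝓘(ℝ, E5)) (s := ξ)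
    (trivializationAt E5 (TangentSpace 𝓘(ℝ, E5) : Y → Type _) a)
    (hU.inter (chartAt E5 a).open_source) (by rw [hs]; exact Set.inter_subset_right)).1
    (hξ.mono Set.inter_subset_left)
  have h2 := h1.comp ((contMDiffOn_chart_symm (I := 𝓘(ℝ, E5)) (n := ∞) (x := a)).mono
    (Set.inter_subset_left : (chartAt E5 a).target ∩ (chartAt E5 a).symm ⁻¹' U ⊆ _))
    (fun u hu => ⟨hu.2, (chartAt E5 a).map_target hu.1⟩)
  refine h2.congr fun u hu => ?_
  have hb : (chartAt E5 a).symm u ∈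
      (trivializationAt E5 (TangentSpace 𝓘(ℝ, E5) : Y → Type _) a).baseSet := by
    rw [hs]; exact (chartAt E5 a).map_target hu.1
  simp only [coordVec, Function.comp]
  rw [Bundle.Trivialization.coe_linearMapAt_of_mem _ hb]

/-- Recovering the coefficients of a vector in the span of two independent vectors. -/
theorem gram_coeff {g : Fin 2 → E5} (hg : LinearIndependent ℝ g) {v : E5} {α β : ℝ}
    (hv : v = α • g 0 + β • g 1) :
    ∃ G : ℝ, G ≠ 0 ∧
      inner ℝ (g 1) (g 1) * inner ℝ v (g 0) - inner ℝ (g 0) (g 1) * inner ℝ v (g 1) = G * α ∧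
      inner ℝ (g 0) (g 0) * inner ℝ v (g 1) - inner ℝ (g 0) (g 1) * inner ℝ v (g 0) = G * β := by
  refine ⟨inner ℝ (g 0) (g 0) * inner ℝ (g 1) (g 1) - inner ℝ (g 0) (g 1) * inner ℝ (g 0) (g 1),
    ?_, ?_, ?_⟩
  · intro h0
    have hw : (inner ℝ (g 1) (g 1) : ℝ) • g 0 + (-inner ℝ (g 0) (g 1) : ℝ) • g 1 = 0 := by
      rw [← inner_self_eq_zero (𝕜 := ℝ)]
      simp only [inner_add_left, inner_add_right, inner_smul_left, inner_smul_right,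
        conj_trivial, real_inner_comm (g 0) (g 1)]
      linear_combination (inner ℝ (g 1) (g 1)) * h0
    have := (LinearIndependent.pair_iff.1 (show LinearIndependent ℝ ![g 0, g 1] by
      convert hg using 1; ext i; fin_cases i <;> rfl) _ _ hw).1
    exact hg.ne_zero 1 (inner_self_eq_zero.1 this)
  · rw [hv]
    simp only [inner_add_left, inner_smul_left, conj_trivial, real_inner_comm (g 0) (g 1)]
    ring
  · rw [hv]
    simp only [inner_add_left, inner_smul_left, conj_trivial, real_inner_comm (g 0) (g 1)]
    ring

/-- The denominator of the change of affine coordinate between the frames `η`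
and `ζ`. -/
def den (a : Y) (η ζ : Fin 2 → ∀ y : Y, TangentSpace 𝓘(ℝ, E5) y) (p : E5 × ℝ) : ℝ :=
  inner ℝ (coordVec a (ζ 1) p.1) (coordVec a (ζ 1) p.1) *
      inner ℝ (coordVec a (η 0) p.1 + p.2 • coordVec a (η 1) p.1) (coordVec a (ζ 0) p.1) -
    inner ℝ (coordVec a (ζ 0) p.1) (coordVec a (ζ 1) p.1) *
      inner ℝ (coordVec a (η 0) p.1 + p.2 • coordVec a (η 1) p.1) (coordVec a (ζ 1) p.1)

/-- The numerator of the change of affine coordinate. -/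
def num (a : Y) (η ζ : Fin 2 → ∀ y : Y, TangentSpace 𝓘(ℝ, E5) y) (p : E5 × ℝ) : ℝ :=
  inner ℝ (coordVec a (ζ 0) p.1) (coordVec a (ζ 0) p.1) *
      inner ℝ (coordVec a (η 0) p.1 + p.2 • coordVec a (η 1) p.1) (coordVec a (ζ 1) p.1) -
    inner ℝ (coordVec a (ζ 0) p.1) (coordVec a (ζ 1) p.1) *
      inner ℝ (coordVec a (η 0) p.1 + p.2 • coordVec a (η 1) p.1) (coordVec a (ζ 0) p.1)

theorem slope_change {U U' : Set Y} {η ζ : Fin 2 → ∀ y : Y, TangentSpace 𝓘(ℝ, E5) y}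
    (h : IsFrameOf U D.space η) (h' : IsFrameOf U' D.space ζ) (a : Y) {p : E5 × ℝ}
    (hp : p.1 ∈ (chartAt E5 a).target) (hU : (chartAt E5 a).symm p.1 ∈ U)
    (hU' : (chartAt E5 a).symm p.1 ∈ U') :
    (ζ 1 ((chartAt E5 a).symm p.1) ∉ (ofSlope h _ hU p.2).line ↔ den a η ζ p ≠ 0) ∧
      (den a η ζ p ≠ 0 → slope ζ (ofSlope h _ hU p.2) = num a η ζ p / den a η ζ p) := by
  set y := (chartAt E5 a).symm p.1 with hy
  set T := (trivializationAt E5 (TangentSpace 𝓘(ℝ, E5) : Y → Type _) a).linearMapAt ℝ y with hT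
  have hb : y ∈ (trivializationAt E5 (TangentSpace 𝓘(ℝ, E5) : Y → Type _) a).baseSet := by
    rw [TangentBundle.trivializationAt_baseSet]; exact (chartAt E5 a).map_target hp
  have hTinj : Function.Injective T := by
    intro v w hvw
    have := congrArg
      ((trivializationAt E5 (TangentSpace 𝓘(ℝ, E5) : Y → Type _) a).symmₗ ℝ y) hvw
    simpa [hT, Bundle.Trivialization.symmₗ_linearMapAt _ hb] using this
  obtain ⟨α, β, hab, hl⟩ := exists_coeff h' (ofSlope h y hU p.2) hU'
  -- rescale so that the spanning vector is `η 0 + t • η 1` itself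
  have hmem : η 0 y + p.2 • η 1 y ∈ Submodule.span ℝ {α • ζ 0 y + β • ζ 1 y} := by
    have h1 : η 0 y + p.2 • η 1 y ∈ (ofSlope h y hU p.2).line :=
      Submodule.mem_span_singleton_self _
    rw [hl] at h1; exact h1
  obtain ⟨c, hc⟩ := Submodule.mem_span_singleton.1 hmem
  have hne : η 0 y + p.2 • η 1 y ≠ 0 := by
    intro h0
    have := LinearIndependent.pair_iff.1 (show LinearIndependent ℝ ![η 0 y, η 1 y] by
      convert h.linearIndependent _ hU using 1; ext i; fin_cases i <;> rfl) 1 p.2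
        (by simpa using h0)
    exact one_ne_zero this.1
  have hc0 : c ≠ 0 := by
    rintro rfl
    exact hne (by rw [← hc, zero_smul])
  have hind : LinearIndependent ℝ fun i => coordVec a (ζ i) p.1 :=
    (h'.linearIndependent y hU').map' T (LinearMap.ker_eq_bot.2 hTinj)
  have hv : coordVec a (η 0) p.1 + p.2 • coordVec a (η 1) p.1 =
      (c * α) • coordVec a (ζ 0) p.1 + (c * β) • coordVec a (ζ 1) p.1 := by
    have := congrArg T hc
    simp only [map_add, map_smul, smul_add, smul_smul] at this
    exact this.symm
  obtain ⟨G, hG, hd, hn⟩ := gram_coeff (g := fun i => coordVec a (ζ i) p.1) hind hv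
  have hd' : den a η ζ p = G * (c * α) := hd
  have hn' : num a η ζ p = G * (c * β) := hn
  have hd0 : den a η ζ p ≠ 0 ↔ α ≠ 0 := by rw [hd']; simp [hG, hc0]
  refine ⟨(notMem_line_iff h' (ofSlope h y hU p.2) hU' hab hl).trans hd0.symm, fun hden => ?_⟩
  have hα := hd0.1 hden
  rw [slope_eq h' (ofSlope h y hU p.2) hU' hα hl, hd', hn']
  field_simp

theorem contDiffOn_num_den (a : Y) {U U' : Set Y}
    {η ζ : Fin 2 → ∀ y : Y, TangentSpace 𝓘(ℝ, E5) y}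
    (h : IsFrameOf U D.space η) (h' : IsFrameOf U' D.space ζ) :
    ContDiffOn ℝ ∞ (num a η ζ) {p | p.1 ∈ (chartAt E5 a).target ∩
        (chartAt E5 a).symm ⁻¹' (U ∩ U')} ∧
      ContDiffOn ℝ ∞ (den a η ζ) {p | p.1 ∈ (chartAt E5 a).target ∩
        (chartAt E5 a).symm ⁻¹' (U ∩ U')} := by
  have hη : ∀ i, ContDiffOn ℝ ∞ (fun p : E5 × ℝ => coordVec a (η i) p.1)
      {p | p.1 ∈ (chartAt E5 a).target ∩ (chartAt E5 a).symm ⁻¹' (U ∩ U')} := fun i =>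
    (contDiffOn_coordVec a h.isOpen (h.smooth i)).comp contDiff_fst.contDiffOn
      fun p hp => ⟨hp.1, hp.2.1⟩
  have hζ : ∀ i, ContDiffOn ℝ ∞ (fun p : E5 × ℝ => coordVec a (ζ i) p.1)
      {p | p.1 ∈ (chartAt E5 a).target ∩ (chartAt E5 a).symm ⁻¹' (U ∩ U')} := fun i =>
    (contDiffOn_coordVec a h'.isOpen (h'.smooth i)).comp contDiff_fst.contDiffOn
      fun p hp => ⟨hp.1, hp.2.2⟩
  have hv := (hη 0).add (contDiff_snd.contDiffOn.smul (hη 1))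
  constructor
  · exact (((hζ 0).inner ℝ (hζ 0)).mul (hv.inner ℝ (hζ 1))).sub
      (((hζ 0).inner ℝ (hζ 1)).mul (hv.inner ℝ (hζ 0)))
  · exact (((hζ 1).inner ℝ (hζ 1)).mul (hv.inner ℝ (hζ 0))).sub
      (((hζ 0).inner ℝ (hζ 1)).mul (hv.inner ℝ (hζ 1)))

theorem transition_source {U U' : Set Y} {η ζ : Fin 2 → ∀ y : Y, TangentSpace 𝓘(ℝ, E5) y}
    (h : IsFrameOf U D.space η) (h' : IsFrameOf U' D.space ζ) (a a' : Y)
    (z₀ z₀' : ProjSpace D) :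
    ((affineChart h a z₀).symm.trans (affineChart h' a' z₀')).source =
      {p | p.1 ∈ (chartAt E5 a).target ∩ (chartAt E5 a).symm ⁻¹' (U ∩ U')} ∩
        {p | p.1 ∈ (chartAt E5 a).target ∩
          (chartAt E5 a).symm ⁻¹' (chartAt E5 a').source} ∩ {p | den a η ζ p ≠ 0} := by
  ext p
  rw [PartialEquiv.trans_source]
  simp only [PartialEquiv.symm_source, Set.mem_inter_iff, Set.mem_preimage, Set.mem_ofPred_eq]
  constructor
  · rintro ⟨⟨h1, h2⟩, h3⟩
    rw [affineChart_symm_apply h a z₀ p h2] at h3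
    obtain ⟨h4, h5, h6⟩ := h3
    exact ⟨⟨⟨h1, h2, h5⟩, h1, h4⟩, (slope_change h h' a h1 h2 h5).1.1 h6⟩
  · rintro ⟨⟨⟨h1, h2, h5⟩, -, h4⟩, h6⟩
    refine ⟨⟨h1, h2⟩, ?_⟩
    rw [affineChart_symm_apply h a z₀ p h2]
    exact ⟨h4, h5, (slope_change h h' a h1 h2 h5).1.2 h6⟩

theorem isOpen_transition_source {U U' : Set Y}
    {η ζ : Fin 2 → ∀ y : Y, TangentSpace 𝓘(ℝ, E5) y}
    (h : IsFrameOf U D.space η) (h' : IsFrameOf U' D.space ζ) (a a' : Y)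
    (z₀ z₀' : ProjSpace D) :
    IsOpen ((affineChart h a z₀).symm.trans (affineChart h' a' z₀')).source := by
  rw [transition_source, Set.inter_right_comm]
  have o1 : IsOpen {p : E5 × ℝ | p.1 ∈ (chartAt E5 a).target ∩
      (chartAt E5 a).symm ⁻¹' (U ∩ U')} :=
    ((chartAt E5 a).isOpen_inter_preimage_symm (h.isOpen.inter h'.isOpen)).preimage continuous_fst
  have o2 : IsOpen {p : E5 × ℝ | p.1 ∈ (chartAt E5 a).target ∩
      (chartAt E5 a).symm ⁻¹' (chartAt E5 a').source} :=
    ((chartAt E5 a).isOpen_inter_preimage_symm (chartAt E5 a').open_source).preimage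
      continuous_fst
  have o3 := (contDiffOn_num_den a h h').2.continuousOn.isOpen_inter_preimage o1
    (isOpen_compl_singleton (x := (0 : ℝ)))
  exact (o3.inter o2)

theorem contDiffOn_transition {U U' : Set Y} {η ζ : Fin 2 → ∀ y : Y, TangentSpace 𝓘(ℝ, E5) y}
    (h : IsFrameOf U D.space η) (h' : IsFrameOf U' D.space ζ) (a a' : Y)
    (z₀ z₀' : ProjSpace D) :
    ContDiffOn ℝ ∞ ((affineChart h a z₀).symm.trans (affineChart h' a' z₀'))
      ((affineChart h a z₀).symm.trans (affineChart h' a' z₀')).source := by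
  rw [transition_source]
  have hc : ContDiffOn ℝ ∞ (chartAt E5 a' ∘ (chartAt E5 a).symm)
      ((chartAt E5 a).target ∩ (chartAt E5 a).symm ⁻¹' (chartAt E5 a').source) := by
    rw [← contMDiffOn_iff_contDiffOn]
    exact (contMDiffOn_chart (I := 𝓘(ℝ, E5)) (n := ∞) (x := a')).comp
      ((contMDiffOn_chart_symm (I := 𝓘(ℝ, E5)) (n := ∞) (x := a)).mono Set.inter_subset_left)
      fun u hu => hu.2
  have h1 := (hc.comp contDiff_fst.contDiffOn (fun (p : E5 × ℝ) hp => hp) :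
    ContDiffOn ℝ ∞ (fun p : E5 × ℝ => chartAt E5 a' ((chartAt E5 a).symm p.1))
      {p | p.1 ∈ (chartAt E5 a).target ∩ (chartAt E5 a).symm ⁻¹' (chartAt E5 a').source})
  obtain ⟨hn, hd⟩ := contDiffOn_num_den a h h'
  have h2 := ((hn.mono (Set.inter_subset_left)).div (hd.mono Set.inter_subset_left)
    (fun p hp => hp.2) : ContDiffOn ℝ ∞ (fun p => num a η ζ p / den a η ζ p)
      ({p | p.1 ∈ (chartAt E5 a).target ∩ (chartAt E5 a).symm ⁻¹' (U ∩ U')} ∩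
        {p | den a η ζ p ≠ 0}))
  have h3 := (h1.mono (fun p hp => hp.1.2)).prodMk (h2.mono (fun p hp => ⟨hp.1.1, hp.2⟩) :
    ContDiffOn ℝ ∞ _ ({p | p.1 ∈ (chartAt E5 a).target ∩ (chartAt E5 a).symm ⁻¹' (U ∩ U')} ∩
        {p | p.1 ∈ (chartAt E5 a).target ∩
          (chartAt E5 a).symm ⁻¹' (chartAt E5 a').source} ∩ {p | den a η ζ p ≠ 0}))
  refine h3.congr ?_
  rintro p ⟨⟨⟨g1, g2, g3⟩, -, -⟩, g4⟩
  rw [PartialEquiv.coe_trans, Function.comp_apply, affineChart_symm_apply h a z₀ p g2]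
  exact Prod.ext rfl ((slope_change h h' a g1 g2 g3).2 g4)

/-- Every point of `P(D)` lies in an affine chart. -/
theorem exists_affineChart (z : ProjSpace D) :
    ∃ e : PartialEquiv (ProjSpace D) (E5 × ℝ), z ∈ e.source ∧
      ∃ (U : Set Y) (η : Fin 2 → ∀ y : Y, TangentSpace 𝓘(ℝ, E5) y)
        (h : IsFrameOf U D.space η) (a : Y) (z₀ : ProjSpace D), e = affineChart h a z₀ := by
  obtain ⟨U, η, hzU, h⟩ := D.isDistribution z.base trivial
  obtain ⟨α, β, hab, hl⟩ := exists_coeff h z hzU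
  by_cases hα : α = 0
  · -- exchange the two vectors of the frame
    have hβ : β ≠ 0 := by simpa [hα] using hab
    have hs : IsFrameOf U D.space (fun i => η (Equiv.swap 0 1 i)) :=
      { isOpen := h.isOpen
        smooth := fun i => h.smooth _
        linearIndependent := fun x hx =>
          (h.linearIndependent x hx).comp _ (Equiv.swap 0 1).injective
        span_eq := fun x hx => by
          rw [← h.span_eq x hx]
          exact congrArg _ ((Equiv.swap (0 : Fin 2) 1).surjective.range_comp fun i => η i x) }
    refine ⟨affineChart hs z.base z, ⟨mem_chart_source _ _, hzU, ?_⟩, U, _, hs, _, _, rfl⟩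
    refine (notMem_line_iff (α := β) (β := α) hs z hzU (Or.inl hβ) ?_).2 hβ
    rw [hl, add_comm]
    simp
  · exact ⟨affineChart h z.base z,
      ⟨mem_chart_source _ _, hzU, (notMem_line_iff h z hzU hab hl).2 hα⟩, U, η, h, _, _, rfl⟩

variable (D) in
/-- The atlas of all the affine charts of `P(D)`. -/
def atlasCore : ChartedSpaceCore (E5 × ℝ) (ProjSpace D) where
  atlas := {e | ∃ (U : Set Y) (η : Fin 2 → ∀ y : Y, TangentSpace 𝓘(ℝ, E5) y)
    (h : IsFrameOf U D.space η) (a : Y) (z₀ : ProjSpace D), e = affineChart h a z₀}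
  chartAt z := (exists_affineChart z).choose
  mem_chart_source z := (exists_affineChart z).choose_spec.1
  chart_mem_atlas z := (exists_affineChart z).choose_spec.2
  open_source := by
    rintro _ _ ⟨U, η, h, a, z₀, rfl⟩ ⟨U', ζ, h', a', z₀', rfl⟩
    exact isOpen_transition_source h h' a a' z₀ z₀'
  continuousOn_toFun := by
    rintro _ _ ⟨U, η, h, a, z₀, rfl⟩ ⟨U', ζ, h', a', z₀', rfl⟩
    exact (contDiffOn_transition h h' a a' z₀ z₀').continuousOn

instance : TopologicalSpace (ProjSpace D) := (atlasCore D).toTopologicalSpace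

instance : ChartedSpace (E5 × ℝ) (ProjSpace D) := (atlasCore D).toChartedSpace

/-- `P(D)` is a smooth manifold of dimension six. -/
instance : IsManifold 𝓘(ℝ, E5 × ℝ) ∞ (ProjSpace D) := by
  refine isManifold_of_contDiffOn _ _ _ ?_
  intro e e' he he'
  change e ∈ ⋃ (e : PartialEquiv (ProjSpace D) (E5 × ℝ)) (he : e ∈ (atlasCore D).atlas),
    {(atlasCore D).openPartialHomeomorph e he} at he
  change e' ∈ ⋃ (e : PartialEquiv (ProjSpace D) (E5 × ℝ)) (he : e ∈ (atlasCore D).atlas),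
    {(atlasCore D).openPartialHomeomorph e he} at he'
  simp only [Set.mem_iUnion, Set.mem_singleton_iff] at he he'
  obtain ⟨e, ⟨U, η, h, a, z₀, rfl⟩, rfl⟩ := he
  obtain ⟨e', ⟨U', ζ, h', a', z₀', rfl⟩, rfl⟩ := he'
  refine (contDiffOn_transition h h' a a' z₀ z₀').mono ?_
  intro p hp
  exact hp.1

end ProjSpace

end PlaneFields

/-! ### Singular paths and the double fibration -/

section DoubleFibration

variable {Y : Type*} [TopologicalSpace Y] [ChartedSpace E5 Y] [IsManifold 𝓘(ℝ, E5) ∞ Y]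

/-- The velocity of a curve in a 5-manifold. -/
def velocity {M : Type*} [TopologicalSpace M] [ChartedSpace E5 M] (γ : ℝ → M) (t : ℝ) :
    TangentSpace 𝓘(ℝ, E5) (γ t) :=
  mfderiv 𝓘(ℝ, ℝ) 𝓘(ℝ, E5) γ t (1 : ℝ)

/-- `γ : (a, b) → Y` is a singular `D`-path: an immersed smooth curve tangent to `D` which has a
nowhere zero lift `p` to the annihilator of `D` in the cotangent bundle that solves the Hamiltonian
equations of an abnormal bi-extremal. If `u` is the control of `γ`, i.e. `γ' = ∑ uᵢ fᵢ` for a local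
frame `fᵢ` of `D`, the equations
`ẋ = ∂H/∂p`, `ṗ = -∂H/∂x`, `∂H/∂u = 0` for `H(x, p, u) = ⟨p, ∑ uᵢ fᵢ(x)⟩` mean that `p`
annihilates `D` and that `d/dt ⟨p, V⟩ = ⟨p, [F, V]⟩` for all local vector fields `V` and
`F = ∑ uᵢ(t) fᵢ` (`t` frozen); as `p` annihilates `D`, the right hand side is the same for all local
sections `F` of `D` with `F (γ t) = γ' t`. -/
def PlaneField.IsSingularPath (D : PlaneField Y) (γ : ℝ → Y) (a b : ℝ) : Prop :=
  ContMDiffOn 𝓘(ℝ, ℝ) 𝓘(ℝ, E5) ∞ γ (Set.Ioo a b) ∧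
  (∀ t ∈ Set.Ioo a b, velocity γ t ≠ 0 ∧ velocity γ t ∈ D.space (γ t)) ∧
  ∃ p : ∀ t : ℝ, Module.Dual ℝ (TangentSpace 𝓘(ℝ, E5) (γ t)), ∀ t ∈ Set.Ioo a b,
    p t ≠ 0 ∧ (∀ v ∈ D.space (γ t), p t v = 0) ∧
    ∀ (U : Set Y) (F V : ∀ y : Y, TangentSpace 𝓘(ℝ, E5) y), γ t ∈ U →
      IsSectionOn U D.space F → F (γ t) = velocity γ t → IsSectionOn U (fun _ => ⊤) V →
      HasDerivAt (fun s => p s (V (γ s))) (p t (VectorField.mlieBracket 𝓘(ℝ, E5) F V (γ t))) t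

variable (D : PlaneField Y)

/-- The differential of the projection `π_Y : P(D) → Y`. -/
def dproj (z : ProjSpace D) :
    TangentSpace 𝓘(ℝ, E5 × ℝ) z →L[ℝ] TangentSpace 𝓘(ℝ, E5) z.base :=
  mfderiv 𝓘(ℝ, E5 × ℝ) 𝓘(ℝ, E5) (ProjSpace.base : ProjSpace D → Y) z

/-- The Cartan prolongation `E` of `D`: `E z = π_{Y*}⁻¹(ℓ)` for `z = (y, ℓ)`. -/
def prolongation (z : ProjSpace D) : Submodule ℝ (TangentSpace 𝓘(ℝ, E5 × ℝ) z) :=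
  z.line.comap (dproj D z).toLinearMap

/-- The line field `L = Ker π_{Y*}`. -/
def vertical (z : ProjSpace D) : Submodule ℝ (TangentSpace 𝓘(ℝ, E5 × ℝ) z) :=
  LinearMap.ker (dproj D z).toLinearMap

/-- `c : (a, b) → P(D)` is the lift `t ↦ (γ t, ℝ γ' t)` of a singular `D`-path `γ`. -/
def IsSingularLift (c : ℝ → ProjSpace D) (a b : ℝ) : Prop :=
  D.IsSingularPath (fun t => (c t).base) a b ∧
  ∀ t ∈ Set.Ioo a b, velocity (fun t => (c t).base) t ∈ (c t).line

variable {X : Type*} [TopologicalSpace X] [ChartedSpace E5 X] [IsManifold 𝓘(ℝ, E5) ∞ X]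

/-- The differential of a map `π : P(D) → X`. -/
def dpi (π : ProjSpace D → X) (z : ProjSpace D) :
    TangentSpace 𝓘(ℝ, E5 × ℝ) z →L[ℝ] TangentSpace 𝓘(ℝ, E5) (π z) :=
  mfderiv 𝓘(ℝ, E5 × ℝ) 𝓘(ℝ, E5) π z

/-- The map `π` is, on the open set `W ⊆ P(D)`, a smooth submersion whose fibres are the lifts of
singular `D`-paths: `Y ← W → π(W)` is a local double fibration, and the open set `π(W) ⊆ X` is the
space of the singular `D`-paths lifted to `W`. -/
structure IsPathSpace (W : Set (ProjSpace D)) (π : ProjSpace D → X) : Prop where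
  isOpen : IsOpen W
  smooth : ContMDiffOn 𝓘(ℝ, E5 × ℝ) 𝓘(ℝ, E5) ∞ π W
  submersive : ∀ z ∈ W, Function.Surjective (dpi D π z)
  fibre : ∀ z ∈ W, ∃ (c : ℝ → ProjSpace D) (a b : ℝ), IsSingularLift D c a b ∧
    c '' Set.Ioo a b = {z' ∈ W | π z' = π z}

/-- The cone field `C ⊆ TX`, `C_x = ⋃ π_*(L_z)`, the union over the points `z` of `W` over `x`. -/
def coneField (W : Set (ProjSpace D)) (π : ProjSpace D → X) : Set (TangentBundle 𝓘(ℝ, E5) X) :=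
  {q | ∃ z ∈ W, ∃ ξ ∈ vertical D z, q = ⟨π z, dpi D π z ξ⟩}

end DoubleFibration

/-! ### Lagrangian cone structures on 5-manifolds -/

section Cones

variable {X : Type*} [TopologicalSpace X] [ChartedSpace E5 X] [IsManifold 𝓘(ℝ, E5) ∞ X]

/-- The cone `C_x = C ∩ T_x X` (recall that `T_x X` is the vector space `ℝ⁵`). -/
def fibreAt (C : Set (TangentBundle 𝓘(ℝ, E5) X)) (x : X) : Set E5 :=
  {v | (⟨x, (v : TangentSpace 𝓘(ℝ, E5) x)⟩ : TangentBundle 𝓘(ℝ, E5) X) ∈ C}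

/-- `S` is an embedded smooth submanifold of `ℝ⁵` of dimension `k`. -/
def IsSubmanifold (k : ℕ) (S : Set E5) : Prop :=
  ∀ v ∈ S, ∃ (φ : OpenPartialHomeomorph E5 E5) (P : Submodule ℝ E5), v ∈ φ.source ∧
    ContDiffOn ℝ ∞ φ φ.source ∧ ContDiffOn ℝ ∞ φ.symm φ.target ∧ Module.finrank ℝ P = k ∧
    ∀ w ∈ φ.source, w ∈ S ↔ φ w ∈ P

/-- The tangent space at `v` of a submanifold `S` of `ℝ⁵`: the space of the velocities at `v` of
smooth curves in `S`. -/
def tangentTo (S : Set E5) (v : E5) : Submodule ℝ E5 :=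
  Submodule.span ℝ {w | ∃ c : ℝ → E5, ContDiffAt ℝ ∞ c 0 ∧ (∀ᶠ t in 𝓝 0, c t ∈ S) ∧ c 0 = v ∧
    deriv c 0 = w}

/-- `Φ` is a local triviality of `TX` over the open set `N`, as a bundle of cones: a fibre-preserving
bijection `TX|_N → N × ℝ⁵`, `(x, v) ↦ (x, Φ x v)`, with inverse `(x, w) ↦ (x, Ψ x w)`, that commutes
with multiplication by scalars and is a diffeomorphism off the zero section. It need not be linear on
the fibres. -/
structure IsConeTriviality (N : Set X) (Φ : ∀ x : X, TangentSpace 𝓘(ℝ, E5) x → E5)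
    (Ψ : ∀ x : X, E5 → TangentSpace 𝓘(ℝ, E5) x) : Prop where
  isOpen : IsOpen N
  left_inv : ∀ x ∈ N, ∀ v, Ψ x (Φ x v) = v
  right_inv : ∀ x ∈ N, ∀ w, Φ x (Ψ x w) = w
  map_smul : ∀ x ∈ N, ∀ (r : ℝ) (v : TangentSpace 𝓘(ℝ, E5) x), Φ x (r • v) = r • Φ x v
  smooth : ContMDiffOn 𝓘(ℝ, E5).tangent 𝓘(ℝ, E5) ∞
    (fun q : TangentBundle 𝓘(ℝ, E5) X => Φ q.1 q.2) {q | q.1 ∈ N ∧ q.2 ≠ 0}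
  smooth_inv : ContMDiffOn (𝓘(ℝ, E5).prod 𝓘(ℝ, E5)) 𝓘(ℝ, E5).tangent ∞
    (fun q : X × E5 => (⟨q.1, Ψ q.1 q.2⟩ : TangentBundle 𝓘(ℝ, E5) X)) {q | q.1 ∈ N ∧ q.2 ≠ 0}

/-- Over the open set `U ⊆ X`, the set `C ⊆ TX` is a cone structure whose model cone `A ⊆ ℝ⁵` is
non-singular away from the origin. -/
def IsConeStructureOn (U : Set X) (C : Set (TangentBundle 𝓘(ℝ, E5) X)) : Prop :=
  ∃ A : Set E5, (∀ r : ℝ, r ≠ 0 → ∀ v ∈ A, r • v ∈ A) ∧ (∃ k, IsSubmanifold k (A \ {0})) ∧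
    ∀ x ∈ U, ∃ (N : Set X) (Φ : ∀ x : X, TangentSpace 𝓘(ℝ, E5) x → E5)
      (Ψ : ∀ x : X, E5 → TangentSpace 𝓘(ℝ, E5) x),
      x ∈ N ∧ N ⊆ U ∧ IsConeTriviality N Φ Ψ ∧ ∀ x ∈ N, Φ x '' fibreAt C x = A

/-- `D'` is a contact structure over the open set `U` of a 5-manifold: a smooth distribution of rank
four with non-degenerate Levi form. -/
def IsContactOn (U : Set X) (D' : ∀ x : X, Submodule ℝ (TangentSpace 𝓘(ℝ, E5) x)) : Prop :=
  IsDistributionOn 4 U D' ∧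
  ∀ x ∈ U, ∀ v ∈ D' x, (∀ w ∈ D' x, LeviOrthogonal D' x v w) → v = 0

/-- `P` is a Lagrangian subspace of the conformal symplectic vector space `D' x` (of dimension
four). -/
def IsLagrangian (D' : ∀ x : X, Submodule ℝ (TangentSpace 𝓘(ℝ, E5) x)) (x : X)
    (P : Submodule ℝ (TangentSpace 𝓘(ℝ, E5) x)) : Prop :=
  P ≤ D' x ∧ Module.finrank ℝ P = 2 ∧ ∀ v ∈ P, ∀ w ∈ P, LeviOrthogonal D' x v w

/-- Over the open set `U`, `C` is a Lagrangian cone structure for the contact structure `D'`: it is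
a cone structure contained in `D'`, and every `C_x \ {0}` is a Lagrangian submanifold of `D' x`. -/
structure IsLagrangianConeStructureOn (U : Set X) (C : Set (TangentBundle 𝓘(ℝ, E5) X))
    (D' : ∀ x : X, Submodule ℝ (TangentSpace 𝓘(ℝ, E5) x)) : Prop where
  cone : IsConeStructureOn U C
  contact : IsContactOn U D'
  subset : ∀ x ∈ U, ∀ v ∈ fibreAt C x, v ∈ D' x
  lagrangian : ∀ x ∈ U, ∀ v ∈ fibreAt C x \ {0}, IsLagrangian D' x (tangentTo (fibreAt C x \ {0}) v)

/-- The germ of the curve `c` at `0` is a lift to `C_x \ {0}` of a regular smooth parametrization of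
the projective curve `P(C_x)` near the point `[v]`. -/
def IsParametrizationAt (S : Set E5) (v : E5) (c : ℝ → E5) : Prop :=
  ContDiffAt ℝ ∞ c 0 ∧ (∀ᶠ t in 𝓝 0, c t ∈ S \ {0}) ∧ c 0 = v ∧
    LinearIndependent ℝ ![c 0, deriv c 0]

/-- Over `U`, all the projectivized cones `P(C_x)` are non-degenerate curves: they have regular
parametrizations near every point, and the first three derivatives of any of these in the projective
space are linearly independent; in terms of a lift `c` of the parametrization to the cone, `c` and its first three
derivatives are linearly independent. -/
def IsNondegenerateOn (U : Set X) (C : Set (TangentBundle 𝓘(ℝ, E5) X)) : Prop :=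
  ∀ x ∈ U, (fibreAt C x \ {0}).Nonempty ∧ ∀ v ∈ fibreAt C x \ {0},
    (∃ c : ℝ → E5, IsParametrizationAt (fibreAt C x) v c) ∧
    ∀ c : ℝ → E5, IsParametrizationAt (fibreAt C x) v c →
      LinearIndependent ℝ fun i : Fin 4 => iteratedDeriv i c 0

end Cones

end CartanDuality

end

open CartanDuality

/-! ### Inverse function theorem, exterior derivatives of one-forms, scalar linear equations. -/

open scoped Manifold ContDiff Topology

noncomputable section

namespace CartanDuality

section Calculus

variable {E F : Type*} [NormedAddCommGroup E] [NormedSpace ℝ E] [NormedAddCommGroup F]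
  [NormedSpace ℝ F]

/-! In an adapted chart `D` is spanned by `e 0`, `e 1`, with `e 2 = [e 0, e 1]`, `e 3 = [e 0, e 2]`,
`e 4 = [e 1, e 2]`, and the point `(y, t)` of `P(D)` is the line of `e 0 + t e 1`. Everything is
governed by one form on `P(D)`, namely α = ε₄ - t ε₃ (`charForm`), where ε is the dual coframe.
Brackets with the lift of `e 0 + t e 1` add successively `e 1`, `e 2`, `e 3 + t e 4` to `E`, so the
third derived system is ker α (`IsAdaptedChart.mem_derived_three`).

On the five-dimensional space ker α the two-form dα has a one-dimensional radical, spanned by a lift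
K of `e 0 + t e 1` (`charField`; see `dForm_charField_eq_zero` and `mem_span_charField`). An
abnormal covector p kills `e 0` and `e 1`; differentiating this along the path gives p(e 2) = 0,
then p(e 3 + t e 4) = 0, so p is a multiple of ε₄ - t ε₃, and one more differentiation gives the
derivative of t. Hence lifts of singular paths are exactly the reparametrized integral curves of K
(`hasDerivAt_of_isSingularLift`, `isSingularLift_of_hasDerivAt`). Straightening K
(`exists_straightening`, which rests on the smoothness of flows) yields local path-space
projections.

Given any path-space projection π, its fibres are tangent to K. Since dα(K, ·) is a multiple of α,
the hyperplane Dπ(ker α) is constant along a fibre; fibres are connected, so it is a well-defined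
hyperplane field `pathField` on the path space. Its Levi form is, up to sign, dα on ker α / K, which
is non-degenerate: the field is contact.

The cone at x is generated by the curve c(s) = Dπ(∂ₜ) along the fibre over x. The derivative of
Dπ(V) along K is Dπ([K, V]) (`IsCharProjection.fderiv_apply_field`), and K has a chain of brackets:
modulo ∂ₜ and ker Dπ, [K, ∂ₜ] = -e 1, [K, e 1] = e 2, [K, e 2] = e 3 + t e 4. So c, c', c'', c'''
are a triangular transform of the images of ∂ₜ, `e 1`, `e 2`, `e 3 + t e 4`, which are independent.
The tangent plane of the cone is the image of the span of ∂ₜ and `e 1`, on which dα vanishes, so the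
cone is Lagrangian.

Local triviality is the remaining point. The parameter s is chosen to be the slope l₁ c / l₀ c for
two functionals (`IsCharBox`), so the normalized curve is f₀ + s f₁ + G(x, s) with l₀ G = l₁ G = 0
and G small on a small box. A homogeneous, cut-off perturbation of the identity subtracts G and
takes all the cones at once to one sector of the plane of f₀, f₁ (`exists_coneTriviality`). The
smallness of G is the reason for shrinking to W'. -/

/-- The inverse function theorem for smooth maps, with an inverse that is smooth on an open set. -/
theorem exists_smooth_local_inverse [CompleteSpace E] {f : E → F} {Ω : Set E} (hΩ : IsOpen Ω)
    (hf : ContDiffOn ℝ ∞ f Ω) {u₀ : E} (hu₀ : u₀ ∈ Ω) (hinv : (fderiv ℝ f u₀).IsInvertible) :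
    ∃ Ψ : OpenPartialHomeomorph E F, u₀ ∈ Ψ.source ∧ Ψ.source ⊆ Ω ∧ (∀ u, Ψ u = f u) ∧
      ContDiffOn ℝ ∞ Ψ Ψ.source ∧ ContDiffOn ℝ ∞ Ψ.symm Ψ.target ∧
      ∀ u ∈ Ψ.source, (fderiv ℝ f u).IsInvertible := by
  have hat : ∀ u ∈ Ω, ContDiffAt ℝ ∞ f u := fun u hu => hf.contDiffAt (hΩ.mem_nhds hu)
  obtain ⟨f', hf'⟩ := hinv
  have hfd : HasFDerivAt f (f' : E →L[ℝ] F) u₀ := by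
    rw [hf']; exact ((hat u₀ hu₀).differentiableAt (by simp)).hasFDerivAt
  let Ψ₀ := (hat u₀ hu₀).toOpenPartialHomeomorph f hfd (by simp)
  have hcont : ContinuousOn (fderiv ℝ f) Ω := hf.continuousOn_fderiv_of_isOpen hΩ (by simp)
  -- The inverse is smooth at each point whose preimage has invertible derivative. This is an open
  -- condition; the source is cut down to it so that smoothness holds on the whole target.
  have hopen : IsOpen (Ω ∩ (fderiv ℝ f) ⁻¹' {A | A.IsInvertible}) :=
    hcont.isOpen_inter_preimage hΩ (ContinuousLinearEquiv.isOpen (𝕜 := ℝ) (E := E) (F := F))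
  let Ψ := Ψ₀.restrOpen _ hopen
  have hsrc : Ψ.source = Ψ₀.source ∩ (Ω ∩ (fderiv ℝ f) ⁻¹' {A | A.IsInvertible}) :=
    Ψ₀.restrOpen_source _ hopen
  have hcoe : ∀ u, Ψ u = f u := fun u => rfl
  refine ⟨Ψ, ?_, ?_, hcoe, ?_, ?_, ?_⟩
  · rw [hsrc]
    exact ⟨(hat u₀ hu₀).mem_toOpenPartialHomeomorph_source hfd (by simp), hu₀, f', hf'⟩
  · rw [hsrc]; exact fun u hu => hu.2.1
  · exact (hf.mono (by rw [hsrc]; exact fun u hu => hu.2.1)).congr fun u _ => hcoe u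
  · intro x hx
    have hs : Ψ.symm x ∈ Ψ.source := Ψ.map_target hx
    have hs' := hs
    rw [hsrc] at hs'
    obtain ⟨g, hg⟩ := hs'.2.2
    have hd : ContDiffAt ℝ ∞ f (Ψ.symm x) := hat _ hs'.2.1
    exact (Ψ.contDiffAt_symm (f₀' := g) hx
      (by rw [hg]; exact (hd.differentiableAt (by simp)).hasFDerivAt) hd).contDiffWithinAt
  · intro u hu
    rw [hsrc] at hu
    exact hu.2.2

/-- The exterior derivative of a field of linear forms. -/
def dForm (α : E → E →L[ℝ] ℝ) (u v w : E) : ℝ := fderiv ℝ α u v w - fderiv ℝ α u w v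

theorem dForm_add_left (α : E → E →L[ℝ] ℝ) (u v v' w : E) :
    dForm α u (v + v') w = dForm α u v w + dForm α u v' w := by
  simp only [dForm, map_add, add_apply]; ring

theorem dForm_smul_left (α : E → E →L[ℝ] ℝ) (u v w : E) (r : ℝ) :
    dForm α u (r • v) w = r * dForm α u v w := by
  simp only [dForm, map_smul, smul_apply, smul_eq_mul]; ring

theorem dForm_swap (α : E → E →L[ℝ] ℝ) (u v w : E) : dForm α u v w = -dForm α u w v := by
  simp only [dForm]; ring

theorem dForm_self (α : E → E →L[ℝ] ℝ) (u v : E) : dForm α u v v = 0 := by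
  simp only [dForm]; ring

theorem dForm_add_right (α : E → E →L[ℝ] ℝ) (u v w w' : E) :
    dForm α u v (w + w') = dForm α u v w + dForm α u v w' := by
  simp only [dForm, map_add, add_apply]; ring

theorem dForm_smul_right (α : E → E →L[ℝ] ℝ) (u v w : E) (r : ℝ) :
    dForm α u v (r • w) = r * dForm α u v w := by
  simp only [dForm, map_smul, smul_apply, smul_eq_mul]; ring

/-- Cartan's formula: by the product rule, the terms in which `V` and `W` are differentiated are
those of the bracket. -/
theorem dForm_eq {α : E → E →L[ℝ] ℝ} {u : E} {V W : E → E} (hα : DifferentiableAt ℝ α u)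
    (hV : DifferentiableAt ℝ V u) (hW : DifferentiableAt ℝ W u) :
    dForm α u (V u) (W u) = fderiv ℝ (fun x => α x (W x)) u (V u) -
      fderiv ℝ (fun x => α x (V x)) u (W u) - α u (VectorField.lieBracket ℝ V W u) := by
  rw [fderiv_clm_apply hα hW, fderiv_clm_apply hα hV]
  simp [dForm, VectorField.lieBracket]; ring

/-- The exterior derivative of a form on two sections of its kernel. -/
theorem apply_lieBracket_of_mem_ker {α : E → E →L[ℝ] ℝ} {u : E} {V W : E → E}
    (hα : DifferentiableAt ℝ α u) (hV : DifferentiableAt ℝ V u) (hW : DifferentiableAt ℝ W u)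
    (hV0 : ∀ᶠ x in 𝓝 u, α x (V x) = 0) (hW0 : ∀ᶠ x in 𝓝 u, α x (W x) = 0) :
    α u (VectorField.lieBracket ℝ V W u) = -dForm α u (V u) (W u) := by
  have h1 : fderiv ℝ (fun x => α x (V x)) u = 0 := by
    rw [Filter.EventuallyEq.fderiv_eq (f := fun _ => (0 : ℝ)) hV0]; simp
  have h2 : fderiv ℝ (fun x => α x (W x)) u = 0 := by
    rw [Filter.EventuallyEq.fderiv_eq (f := fun _ => (0 : ℝ)) hW0]; simp
  rw [dForm_eq hα hV hW, h1, h2]; simp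

/-- The exterior derivative commutes with pull-backs. -/
theorem dForm_pullback {α : F → F →L[ℝ] ℝ} {S : E → F} {p : E}
    (hα : DifferentiableAt ℝ α (S p)) (hS : ContDiffAt ℝ 2 S p) (v w : E) :
    dForm (fun q => (α (S q)).comp (fderiv ℝ S q)) p v w =
      dForm α (S p) (fderiv ℝ S p v) (fderiv ℝ S p w) := by
  have hSd : DifferentiableAt ℝ S p := hS.differentiableAt (by simp)
  have hfS : DifferentiableAt ℝ (fderiv ℝ S) p :=
    (hS.fderiv_right (m := 1) (by norm_num)).differentiableAt (by simp)
  have hc : DifferentiableAt ℝ (fun q => α (S q)) p := hα.comp p hSd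
  -- The terms `α (D²S (v, w))` and `α (D²S (w, v))` cancel by the symmetry of the second
  -- derivative.
  have hsym := (hS.isSymmSndFDerivAt (by simp)).eq v w
  have hfc : fderiv ℝ (fun q => α (S q)) p = (fderiv ℝ α (S p)).comp (fderiv ℝ S p) :=
    fderiv_comp p hα hSd
  simp only [dForm]
  rw [fderiv_clm_comp hc hfS, hfc]
  simp only [add_apply, ContinuousLinearMap.comp_apply,
    ContinuousLinearMap.compL_apply, ContinuousLinearMap.flip_apply]
  rw [hsym]; ring

/-- A positive solution of a scalar linear differential equation. -/
theorem exists_pos_hasDerivAt_mul {m : ℝ → ℝ} {a b : ℝ} (hm : ContinuousOn m (Set.Ioo a b)) :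
    ∃ l : ℝ → ℝ, ∀ t ∈ Set.Ioo a b, 0 < l t ∧ HasDerivAt l (m t * l t) t := by
  by_cases hab : a < b
  swap
  · exact ⟨fun _ => 1, fun t ht => absurd (ht.1.trans ht.2) hab⟩
  obtain ⟨c, hc⟩ := exists_between hab
  refine ⟨fun t => Real.exp (∫ s in c..t, m s), fun t ht => ⟨Real.exp_pos _, ?_⟩⟩
  have hsub : Set.uIcc c t ⊆ Set.Ioo a b :=
    Set.OrdConnected.uIcc_subset Set.ordConnected_Ioo hc ht
  have hd : HasDerivAt (fun t => ∫ s in c..t, m s) (m t) t := by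
    refine intervalIntegral.integral_hasDerivAt_right
      ((hm.mono hsub).intervalIntegrable) ?_ (hm.continuousAt (isOpen_Ioo.mem_nhds ht))
    exact hm.stronglyMeasurableAtFilter isOpen_Ioo t ht
  simpa [mul_comm] using hd.exp

/-- A solution of a scalar linear differential equation that vanishes at a point is zero. -/
theorem eq_zero_of_hasDerivAt_mul {m y : ℝ → ℝ} {a b : ℝ} (hm : ContinuousOn m (Set.Ioo a b))
    (hy : ∀ t ∈ Set.Ioo a b, HasDerivAt y (m t * y t) t) {t₀ : ℝ} (ht₀ : t₀ ∈ Set.Ioo a b)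
    (h0 : y t₀ = 0) : ∀ t ∈ Set.Ioo a b, y t = 0 := by
  -- Integrating factor: `l' = -m l` makes `l * y` constant, hence zero, and `l` is positive.
  obtain ⟨l, hl⟩ := exists_pos_hasDerivAt_mul hm.neg
  intro t ht
  have hd : ∀ s ∈ Set.Ioo a b, HasDerivAt (fun s => l s * y s) 0 s := by
    intro s hs
    refine ((hl s hs).2.mul (hy s hs)).congr_deriv ?_
    simp only [Pi.neg_apply]; ring
  have := (convex_Ioo a b).is_const_of_fderivWithin_eq_zero (𝕜 := ℝ)
    (fun s hs => (hd s hs).differentiableAt.differentiableWithinAt)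
    (fun s hs => by
      rw [fderivWithin_of_isOpen isOpen_Ioo hs]
      ext; simpa using (hd s hs).deriv) ht ht₀
  simp only [h0, mul_zero, mul_eq_zero] at this
  exact this.resolve_left (hl t ht).1.ne'

end Calculus

end CartanDuality

end

/-! ### Smooth local flows and straightening of vector fields. -/

open scoped Manifold ContDiff Topology

noncomputable section

namespace CartanDuality

section Flow

variable {I : Type} [TopologicalSpace I] [CompactSpace I]
  {E F : Type} [NormedAddCommGroup E] [NormedSpace ℝ E] [NormedAddCommGroup F] [NormedSpace ℝ F]

set_option linter.unusedSectionVars false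

/-- The superposition operator `γ ↦ f ∘ γ`. -/
def superposition (I : Type) [TopologicalSpace I] {E F : Type} [NormedAddCommGroup E]
    [NormedAddCommGroup F] (f : E → F) (hf : Continuous f) (γ : C(I, E)) : C(I, F) :=
  (ContinuousMap.mk f hf).comp γ

theorem continuous_superposition {f : E → F} (hf : Continuous f) :
    Continuous (superposition I f hf) :=
  ContinuousMap.continuous_postcomp _

/-- The pointwise application of a family of linear maps. -/
def pointwiseApply (I : Type) [TopologicalSpace I] [CompactSpace I] (E F : Type)
    [NormedAddCommGroup E] [NormedSpace ℝ E] [NormedAddCommGroup F] [NormedSpace ℝ F] :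
    C(I, E →L[ℝ] F) →L[ℝ] C(I, E) →L[ℝ] C(I, F) :=
  LinearMap.mkContinuous₂
    (LinearMap.mk₂ ℝ (fun (A : C(I, E →L[ℝ] F)) (γ : C(I, E)) =>
        (⟨fun t => A t (γ t), A.continuous.clm_apply γ.continuous⟩ : C(I, F)))
      (fun _ _ _ => by ext; simp) (fun _ _ _ => by ext; simp) (fun _ _ _ => by ext; simp)
      (fun _ _ _ => by ext; simp)) 1 (by
    intro A γ
    rw [one_mul, ContinuousMap.norm_le _ (by positivity)]
    intro t
    exact (A t).le_of_opNorm_le_of_le (A.norm_coe_le_norm t) (γ.norm_coe_le_norm t))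

/-- Continuity of `γ ↦ Df ∘ γ` in the sup norm makes `Df` vary by at most `c` in a tube around `γ`,
uniformly in time; the mean value inequality at each time bounds the remainder by `c ‖η‖`. -/
theorem hasFDerivAt_superposition {f : E → F} (hf : ContDiff ℝ 1 f) (γ : C(I, E)) :
    HasFDerivAt (superposition I f hf.continuous) (pointwiseApply I E F
      (superposition I (fderiv ℝ f) (hf.continuous_fderiv (by simp)) γ)) γ := by
  have hc := continuous_superposition (I := I) (hf.continuous_fderiv (by simp))
  rw [hasFDerivAt_iff_isLittleO_nhds_zero, Asymptotics.isLittleO_iff]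
  intro c hcpos
  obtain ⟨δ, hδ, h⟩ := Metric.continuousAt_iff.1 (hc.continuousAt (x := γ)) c hcpos
  filter_upwards [Metric.ball_mem_nhds (0 : C(I, E)) hδ] with η hη
  rw [ContinuousMap.norm_le _ (by positivity)]
  intro t
  have hηt : ‖η t‖ ≤ ‖η‖ := η.norm_coe_le_norm t
  have hη' : ‖η‖ < δ := by simpa using hη
  have key := (convex_ball (γ t) δ).norm_image_sub_le_of_norm_hasFDerivWithin_le'
    (f := f) (f' := fderiv ℝ f) (φ := fderiv ℝ f (γ t)) (C := c) (x := γ t) (y := γ t + η t)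
    (fun x _ => ((hf.differentiable (by simp)) x).hasFDerivAt.hasFDerivWithinAt)
    (fun x hx => by
      -- A point `x` near `γ t` is reached by translating the whole curve by `x - γ t`, so the
      -- estimate for curves applies at `x`.
      have h1 : dist (γ + ContinuousMap.const I (x - γ t)) γ < δ := by
        rw [dist_eq_norm, add_sub_cancel_left]
        refine lt_of_le_of_lt ((ContinuousMap.norm_le _ (norm_nonneg (x - γ t))).2 fun _ => le_rfl) ?_
        exact (dist_eq_norm x (γ t)).symm.trans_lt hx
      have h2 := (ContinuousMap.dist_apply_le_dist t).trans (h h1).le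
      simpa [superposition, dist_eq_norm] using h2)
    (Metric.mem_ball_self hδ) (by simpa using hηt.trans_lt hη')
  simp only [add_sub_cancel_left] at key
  exact key.trans (by gcongr)

/-- The derivative is again a superposition operator, for `fderiv ℝ f`, followed by a bounded linear
map; each degree of smoothness of `f` passes over by induction. The target `F` varies because
`fderiv ℝ f` has values in another space. -/
theorem contDiff_superposition_nat (n : ℕ) : ∀ {F : Type} [NormedAddCommGroup F]
    [NormedSpace ℝ F] {f : E → F} (hf : ContDiff ℝ n f),
    ContDiff ℝ n (superposition I f hf.continuous) := by
  induction n with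
  | zero =>
    intro F _ _ f hf
    exact contDiff_zero.2 (continuous_superposition hf.continuous)
  | succ n ih =>
    intro F _ _ f hf
    have h1 : ContDiff ℝ 1 f := hf.of_le (by exact_mod_cast Nat.le_add_left 1 n)
    have hd := fun γ => hasFDerivAt_superposition (I := I) h1 γ
    have hf' : ContDiff ℝ n (fderiv ℝ f) := hf.fderiv_right (by simp)
    have e : fderiv ℝ (superposition I f h1.continuous) = fun γ => pointwiseApply I E F
      (superposition I (fderiv ℝ f) hf'.continuous γ) := funext fun γ => (hd γ).fderiv
    push_cast
    rw [contDiff_succ_iff_fderiv]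
    refine ⟨fun γ => (hd γ).differentiableAt, by simp, ?_⟩
    rw [e]
    exact (pointwiseApply I E F).contDiff.comp (ih hf')

theorem contDiff_superposition {f : E → F} (hf : ContDiff ℝ ∞ f) :
    ContDiff ℝ ∞ (superposition I f hf.continuous) := by
  rw [contDiff_infty]
  intro n
  exact contDiff_superposition_nat n (hf.of_le (by exact_mod_cast le_top))

theorem neg_one_le_one_real : (-1 : ℝ) ≤ 1 := by norm_num

/-- The integration operator `γ ↦ ∫₀ᵗ γ` for curves on `[-1, 1]`. -/
def integration (E : Type) [NormedAddCommGroup E] [NormedSpace ℝ E] :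
    C(Set.Icc (-1 : ℝ) 1, E) →L[ℝ] C(Set.Icc (-1 : ℝ) 1, E) :=
  LinearMap.mkContinuous
    { toFun := fun γ => ⟨fun t => ∫ s in (0 : ℝ)..t, Set.IccExtend neg_one_le_one_real γ s, by
        have := intervalIntegral.continuous_primitive (μ := MeasureTheory.volume)
          (f := Set.IccExtend neg_one_le_one_real γ)
          (fun a b => (γ.continuous.Icc_extend').intervalIntegrable a b) 0
        exact this.comp continuous_subtype_val⟩
      map_add' := fun γ η => by
        ext t
        simp only [ContinuousMap.coe_mk, ContinuousMap.add_apply]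
        rw [← intervalIntegral.integral_add
          ((γ.continuous.Icc_extend').intervalIntegrable _ _)
          ((η.continuous.Icc_extend').intervalIntegrable _ _)]
        rfl
      map_smul' := fun r γ => by
        ext t
        simp only [ContinuousMap.coe_mk, ContinuousMap.smul_apply, RingHom.id_apply]
        rw [← intervalIntegral.integral_smul]
        rfl } 1 (by
    intro γ
    rw [one_mul, ContinuousMap.norm_le _ (norm_nonneg _)]
    intro t
    refine (intervalIntegral.norm_integral_le_of_norm_le_const (C := ‖γ‖)
      fun s _ => γ.norm_coe_le_norm _).trans ?_
    rw [sub_zero]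
    exact mul_le_of_le_one_right (norm_nonneg _) (abs_le.2 t.2))

/-- The constant curves. -/
def constCurve (I : Type) [TopologicalSpace I] [CompactSpace I] (E : Type) [NormedAddCommGroup E]
    [NormedSpace ℝ E] : E →L[ℝ] C(I, E) :=
  LinearMap.mkContinuous
    { toFun := fun x => ContinuousMap.const I x
      map_add' := fun _ _ => rfl
      map_smul' := fun _ _ => rfl } 1 (by
    intro x
    rw [one_mul]
    exact (ContinuousMap.norm_le _ (norm_nonneg _)).2 fun _ => le_rfl)

/-- The integral equation of the curves `γ` with `γ' = s • K γ`, `γ 0 = x`. -/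
def flowEquation (K : E → E) (hK : Continuous K)
    (q : (E × ℝ) × C(Set.Icc (-1 : ℝ) 1, E)) : C(Set.Icc (-1 : ℝ) 1, E) :=
  q.2 - constCurve _ E q.1.1 - q.1.2 • integration E (superposition _ K hK q.2)

theorem contDiff_flowEquation {K : E → E} (hK : ContDiff ℝ ∞ K) :
    ContDiff ℝ ∞ (flowEquation K hK.continuous) := by
  refine (contDiff_snd.sub ((constCurve _ E).contDiff.comp ((contDiff_fst (E := E) (F := ℝ)).comp contDiff_fst))).sub
    (((contDiff_snd (E := E) (F := ℝ)).comp contDiff_fst).smul ((integration E).contDiff.comp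
      ((contDiff_superposition hK).comp contDiff_snd)))

/-- At `s = 0` the integral term does not contribute to the derivative in the curve, so the
derivative is block triangular with identities on the diagonal; `B` carries the other block up to
sign, and changing its sign gives the inverse. -/
theorem isInvertible_fderiv_flowEquation {K : E → E} (hK : ContDiff ℝ ∞ K) (u₀ : E) :
    (fderiv ℝ (fun q : (E × ℝ) × C(Set.Icc (-1 : ℝ) 1, E) => (q.1, flowEquation K hK.continuous q))
      ((u₀, 0), constCurve _ E u₀)).IsInvertible := by
  let I := Set.Icc (-1 : ℝ) 1
  set c := integration E (superposition I K hK.continuous (constCurve _ E u₀)) with hc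
  let B : E × ℝ →L[ℝ] C(I, E) := (constCurve I E).comp (ContinuousLinearMap.fst ℝ E ℝ) +
    (ContinuousLinearMap.snd ℝ E ℝ).smulRight c
  let π₁ := ContinuousLinearMap.fst ℝ (E × ℝ) C(I, E)
  let π₂ := ContinuousLinearMap.snd ℝ (E × ℝ) C(I, E)
  have h0 : HasFDerivAt (fun q : (E × ℝ) × C(I, E) => integration E (superposition I K hK.continuous q.2))
      (fderiv ℝ (fun q : (E × ℝ) × C(I, E) => integration E (superposition I K hK.continuous q.2))
        ((u₀, 0), constCurve _ E u₀)) ((u₀, 0), constCurve _ E u₀) :=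
    (((integration E).contDiff.comp ((contDiff_superposition hK).comp
      contDiff_snd)).differentiable (by simp) _).hasFDerivAt
  have h1 := ((π₂.hasFDerivAt (x := ((u₀, 0), constCurve _ E u₀))).sub
    (((constCurve I E).comp ((ContinuousLinearMap.fst ℝ E ℝ).comp π₁)).hasFDerivAt
      (x := ((u₀, 0), constCurve _ E u₀)))).sub
    ((((ContinuousLinearMap.snd ℝ E ℝ).comp π₁).hasFDerivAt
      (x := ((u₀, 0), constCurve _ E u₀))).smul h0)
  have h2 := (π₁.hasFDerivAt (x := ((u₀, 0), constCurve _ E u₀))).prodMk h1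
  have h3 : HasFDerivAt (fun q : (E × ℝ) × C(I, E) => (q.1, flowEquation K hK.continuous q))
      (π₁.prod (π₂ - B.comp π₁)) ((u₀, 0), constCurve _ E u₀) := by
    refine h2.congr_fderiv ?_
    ext q <;> simp [B, π₁, π₂, hc, sub_sub]
  rw [h3.fderiv]
  refine ContinuousLinearMap.IsInvertible.of_inverse (g := π₁.prod (π₂ + B.comp π₁)) ?_ ?_ <;>
  · ext q <;> simp [π₁, π₂]

theorem flowEquation_eq_zero_iff {K : E → E} (hK : Continuous K) (x : E) (s : ℝ)
    (γ : C(Set.Icc (-1 : ℝ) 1, E)) : flowEquation K hK ((x, s), γ) = 0 ↔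
      ∀ t : Set.Icc (-1 : ℝ) 1, γ t = x + s • ∫ r in (0 : ℝ)..t,
        K (Set.IccExtend neg_one_le_one_real γ r) := by
  rw [ContinuousMap.ext_iff]
  refine forall_congr' fun t => ?_
  have : flowEquation K hK ((x, s), γ) t = γ t - x - s • ∫ r in (0 : ℝ)..t,
        K (Set.IccExtend neg_one_le_one_real γ r) := rfl
  rw [this, ContinuousMap.zero_apply, sub_sub, sub_eq_zero]

/-- The local flow of a smooth vector field is smooth. -/
theorem exists_flow [CompleteSpace E] {K : E → E} (hK : ContDiff ℝ ∞ K) (u₀ : E) :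
    ∃ r > 0, ∃ φ : E × ℝ → E, ContDiffOn ℝ ∞ φ (Metric.ball u₀ r ×ˢ Set.Ioo (-r) r) ∧
      ∀ x ∈ Metric.ball u₀ r, φ (x, 0) = x ∧
        ∀ s ∈ Set.Ioo (-r) r, HasDerivAt (fun s => φ (x, s)) (K (φ (x, s))) s := by
  let I := Set.Icc (-1 : ℝ) 1
  have h1I : (1 : ℝ) ∈ I := by simp [I]
  set p₀ : (E × ℝ) × C(I, E) := ((u₀, 0), constCurve _ E u₀) with hp₀
  -- The flow time enters as the parameter `s` of the rescaled equation on the fixed interval `[-1,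
  -- 1]`, and the flow is the value at `1` of its solution. The inverse function theorem in the
  -- space of curves then gives smoothness in `(x, s)` jointly.
  obtain ⟨Ψ, hmem, -, hΨ, -, hΨs, -⟩ := exists_smooth_local_inverse isOpen_univ
    ((contDiff_fst.prodMk (contDiff_flowEquation hK)).contDiffOn) (Set.mem_univ p₀)
    (isInvertible_fderiv_flowEquation hK u₀)
  have hz0 : flowEquation K hK.continuous p₀ = 0 := by
    rw [hp₀, flowEquation_eq_zero_iff]; intro t; simp [constCurve]; rfl
  have hΨ0 : Ψ p₀ = ((u₀, 0), 0) := by rw [hΨ, hz0]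
  have htgt : ((u₀, (0 : ℝ)), (0 : C(I, E))) ∈ Ψ.target := hΨ0 ▸ Ψ.map_source hmem
  let j : E × ℝ → (E × ℝ) × C(I, E) := fun p => (p, 0)
  have hj : ContDiff ℝ ∞ j := contDiff_id.prodMk contDiff_const
  -- a ball of parameters on which the solution exists and is close to a constant
  obtain ⟨ρ, hρ, hρs⟩ := Metric.mem_nhds_iff.1 (Ψ.open_source.mem_nhds hmem)
  have hnear : ∀ᶠ p in 𝓝 (u₀, (0 : ℝ)), j p ∈ Ψ.target ∧ Ψ.symm (j p) ∈ Metric.ball p₀ ρ := by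
    have h1 : ContinuousAt (fun p => Ψ.symm (j p)) (u₀, 0) :=
      ContinuousAt.comp (f := j) (Ψ.continuousAt_symm htgt) hj.continuous.continuousAt
    have h2 : Ψ.symm (j (u₀, 0)) = p₀ := by
      change Ψ.symm ((u₀, 0), 0) = p₀
      rw [← hΨ0, Ψ.left_inv hmem]
    exact (hj.continuous.continuousAt.eventually (Ψ.open_target.mem_nhds htgt)).and
      (h1.eventually (by
        change _ ∈ 𝓝 (Ψ.symm (j (u₀, 0)))
        rw [h2]; exact Metric.ball_mem_nhds _ hρ))
  obtain ⟨R, hR, hRs⟩ := Metric.eventually_nhds_iff_ball.1 hnear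
  set g : E × ℝ → C(I, E) := fun p => (Ψ.symm (j p)).2 with hg
  have hgfst : ∀ p ∈ Metric.ball (u₀, (0 : ℝ)) R, Ψ.symm (j p) = (p, g p) := by
    intro p hp
    have := Ψ.right_inv (hRs p hp).1
    rw [hΨ] at this
    exact Prod.ext (Prod.ext_iff.1 this).1 rfl
  have hgz : ∀ p ∈ Metric.ball (u₀, (0 : ℝ)) R, flowEquation K hK.continuous (p, g p) = 0 := by
    intro p hp
    have := Ψ.right_inv (hRs p hp).1
    rw [hΨ, hgfst p hp] at this
    exact congrArg Prod.snd this
  have hball : ∀ x ∈ Metric.ball u₀ R, ∀ s ∈ Set.Ioo (-R) R, (x, s) ∈ Metric.ball (u₀, (0 : ℝ)) R := by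
    intro x hx s hs
    rw [← ball_prod_same]
    exact ⟨hx, by simpa [abs_lt] using hs⟩
  -- The solution for time `τ s` is the solution for time `s` slowed down by `τ`: both solve the
  -- same integral equation and both lie in `Ψ.source`, where `Ψ` is injective.
  have hscale : ∀ x ∈ Metric.ball u₀ R, ∀ s ∈ Set.Ioo (-R) R, ∀ τ : I,
      g (x, τ * s) ⟨1, h1I⟩ = g (x, s) τ := by
    intro x hx s hs τ
    have hτ1 : |(τ : ℝ)| ≤ 1 := abs_le.2 τ.2
    have hτs : (τ : ℝ) * s ∈ Set.Ioo (-R) R := by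
      rw [Set.mem_Ioo, ← abs_lt, abs_mul]
      exact (mul_le_of_le_one_left (abs_nonneg _) hτ1).trans_lt (abs_lt.2 hs)
    have hmulI : ∀ t : I, (τ : ℝ) * t ∈ I := fun t => by
      change _ ∈ Set.Icc (-1 : ℝ) 1
      rw [Set.mem_Icc, ← abs_le, abs_mul]
      exact mul_le_one₀ hτ1 (abs_nonneg _) (abs_le.2 t.2)
    let η : C(I, E) := (g (x, s)).comp ⟨fun t => ⟨τ * t, hmulI t⟩, by fun_prop⟩
    have h1 := (flowEquation_eq_zero_iff hK.continuous x s _).1 (hgz _ (hball x hx s hs))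
    have hηz : flowEquation K hK.continuous ((x, τ * s), η) = 0 := by
      rw [flowEquation_eq_zero_iff]
      intro t
      have h2 := h1 ⟨τ * t, hmulI t⟩
      change g (x, s) ⟨τ * t, hmulI t⟩ = _
      rw [h2, mul_comm (τ : ℝ) s, mul_smul]
      have h3 := intervalIntegral.smul_integral_comp_mul_left (a := 0) (b := t)
        (fun r => K (Set.IccExtend neg_one_le_one_real (g (x, s)) r)) (τ : ℝ)
      rw [mul_zero] at h3
      rw [← h3]
      congr 3
      refine intervalIntegral.integral_congr fun r hr => ?_
      have hrI : r ∈ I := Set.OrdConnected.uIcc_subset Set.ordConnected_Icc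
        (by simp) t.2 hr
      change K _ = K _
      rw [Set.IccExtend_of_mem _ _ hrI, Set.IccExtend_of_mem _ _ (hmulI ⟨r, hrI⟩)]
      rfl
    have hηs : ((x, τ * s), η) ∈ Ψ.source := by
      apply hρs
      have h3 := (hRs _ (hball x hx s hs)).2
      have h4 := (hRs _ (hball x hx _ hτs)).2
      rw [hgfst _ (hball x hx s hs)] at h3
      rw [hgfst _ (hball x hx _ hτs)] at h4
      rw [hp₀, ← ball_prod_same] at h3 h4 ⊢
      refine ⟨h4.1, ?_⟩
      have h5 : dist (g (x, s)) (constCurve I E u₀) < ρ := h3.2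
      rw [Metric.mem_ball, ContinuousMap.dist_lt_iff hρ] at *
      exact fun t => h5 ⟨τ * t, hmulI t⟩
    have hgs : ((x, τ * s), g (x, τ * s)) ∈ Ψ.source := by
      rw [← hgfst _ (hball x hx _ hτs)]
      exact Ψ.map_target (hRs _ (hball x hx _ hτs)).1
    have h6 : ((x, τ * s), η) = ((x, τ * s), g (x, τ * s)) :=
      Ψ.injOn hηs hgs (by rw [hΨ, hΨ, hηz, hgz _ (hball x hx _ hτs)])
    have h7 : η = g (x, τ * s) := (Prod.ext_iff.1 h6).2
    rw [← h7]
    change g (x, s) ⟨τ * 1, _⟩ = _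
    congr 1
    ext; simp
  refine ⟨R, hR, fun p => g p ⟨1, h1I⟩, ?_, ?_⟩
  · have h1 : ContDiffOn ℝ ∞ g (Metric.ball (u₀, (0 : ℝ)) R) :=
      contDiff_snd.comp_contDiffOn (hΨs.comp hj.contDiffOn fun p hp => (hRs p hp).1)
    refine (ContDiff.comp_contDiffOn (ContinuousMap.evalCLM ℝ
      (⟨1, h1I⟩ : I)).contDiff h1).mono ?_
    exact fun p hp => hball p.1 hp.1 p.2 hp.2
  · intro x hx
    constructor
    · have h1 := (flowEquation_eq_zero_iff hK.continuous x 0 _).1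
        (hgz _ (hball x hx 0 ⟨by linarith, hR⟩)) ⟨1, h1I⟩
      simpa using h1
    · intro s hs
      -- A positive time `s'` between `|s|` and `R`, also when `s = 0`. Near `s` the flow is then
      -- read off a single curve at the moments `σ / s'`, and the integral equation of that curve
      -- can be differentiated.
      set s' := (|s| + R) / 2 with hs'
      have hsR : |s| < R := abs_lt.2 hs
      have hs'pos : 0 < s' := by positivity
      have hs'I : s' ∈ Set.Ioo (-R) R := ⟨by linarith [abs_nonneg s], by linarith⟩
      have h1 := (flowEquation_eq_zero_iff hK.continuous x s' _).1 (hgz _ (hball x hx s' hs'I))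
      set γ := Set.IccExtend neg_one_le_one_real (g (x, s')) with hγ
      have hγc : Continuous γ := (g (x, s')).continuous.Icc_extend'
      have hsI : s / s' ∈ Set.Ioo (-1 : ℝ) 1 := by
        rw [Set.mem_Ioo, ← abs_lt, abs_div, abs_of_pos hs'pos, div_lt_one hs'pos]
        linarith
      have hev : (fun σ => g (x, σ) ⟨1, h1I⟩) =ᶠ[𝓝 s]
          fun σ => x + s' • ∫ r in (0 : ℝ)..σ / s', K (γ r) := by
        have h2 : ∀ᶠ σ in 𝓝 s, σ / s' ∈ Set.Ioo (-1 : ℝ) 1 :=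
          (continuous_id.div_const s').continuousAt.eventually (isOpen_Ioo.mem_nhds hsI)
        filter_upwards [h2] with σ hσ
        have h3 := hscale x hx s' hs'I ⟨σ / s', Set.Ioo_subset_Icc_self hσ⟩
        rw [div_mul_cancel₀ _ hs'pos.ne'] at h3
        rw [h3, h1]
      have h4 : HasDerivAt (fun σ => ∫ r in (0 : ℝ)..σ, K (γ r)) (K (γ (s / s'))) (s / s') :=
        intervalIntegral.integral_hasDerivAt_right
          ((hK.continuous.comp hγc).intervalIntegrable _ _)
          ((hK.continuous.comp hγc).stronglyMeasurableAtFilter _ _)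
          (hK.continuous.comp hγc).continuousAt
      have h5 := ((h4.scomp s ((hasDerivAt_id s).div_const s')).const_smul s').const_add x
      have h6 : γ (s / s') = g (x, s) ⟨1, h1I⟩ := by
        have h3 := hscale x hx s' hs'I ⟨s / s', Set.Ioo_subset_Icc_self hsI⟩
        rw [div_mul_cancel₀ _ hs'pos.ne'] at h3
        rw [h3, hγ, Set.IccExtend_of_mem _ _ (Set.Ioo_subset_Icc_self hsI)]
      refine (h5.congr_of_eventuallyEq hev).congr_deriv ?_
      rw [h6, smul_smul, mul_one_div_cancel hs'pos.ne', one_smul]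

/-- Multiplying by a bump function extends a smooth map from a neighbourhood of a point. -/
theorem exists_contDiff_eventuallyEq [FiniteDimensional ℝ E] {K : E → F} {Ω : Set E}
    (hΩ : IsOpen Ω) (hK : ContDiffOn ℝ ∞ K Ω) {u₀ : E} (hu₀ : u₀ ∈ Ω) :
    ∃ K' : E → F, ContDiff ℝ ∞ K' ∧ ∀ᶠ u in 𝓝 u₀, K' u = K u := by
  obtain ⟨r, hr, hrs⟩ := Metric.isOpen_iff.1 hΩ u₀ hu₀
  let f : ContDiffBump u₀ := ⟨r / 3, r / 2, by positivity, by linarith⟩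
  refine ⟨fun u => f u • K u, contDiff_iff_contDiffAt.2 fun u => ?_, ?_⟩
  · by_cases hu : u ∈ Metric.ball u₀ r
    · exact f.contDiffAt.smul (hK.contDiffAt (hΩ.mem_nhds (hrs hu)))
    · have h0 : u ∉ tsupport f := by
        rw [f.tsupport_eq]
        intro hc
        exact hu (Metric.closedBall_subset_ball (by change r / 2 < r; linarith) hc)
      have h1 : (fun u => f u • K u) =ᶠ[𝓝 u] fun _ => 0 := by
        filter_upwards [(isClosed_tsupport f).isOpen_compl.mem_nhds h0] with w hw
        rw [image_eq_zero_of_notMem_tsupport hw, zero_smul]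
      exact contDiffAt_const.congr_of_eventuallyEq h1
  · filter_upwards [Metric.closedBall_mem_nhds u₀ (show 0 < r / 3 by positivity)] with u hu
    rw [f.one_of_mem_closedBall hu, one_smul]

/-- A smooth vector field can be straightened near a point where it does not vanish. -/
theorem exists_straightening [FiniteDimensional ℝ E] {K : E → E} {Ω : Set E} (hΩ : IsOpen Ω)
    (hK : ContDiffOn ℝ ∞ K Ω) {u₀ : E} (hu₀ : u₀ ∈ Ω) (J : (F × ℝ) ≃L[ℝ] E)
    (hJ : J (0, 1) = K u₀) :
    ∃ S : OpenPartialHomeomorph (F × ℝ) E, (0, 0) ∈ S.source ∧ S (0, 0) = u₀ ∧ S.target ⊆ Ω ∧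
      ContDiffOn ℝ ∞ S S.source ∧ ContDiffOn ℝ ∞ S.symm S.target ∧
      ∀ p ∈ S.source, HasDerivAt (fun s => S (p.1, s)) (K (S p)) p.2 := by
  have : CompleteSpace E := FiniteDimensional.complete ℝ E
  have : FiniteDimensional ℝ (F × ℝ) := J.symm.toLinearEquiv.finiteDimensional
  have : CompleteSpace (F × ℝ) := FiniteDimensional.complete ℝ _
  obtain ⟨K', hK', hKK'⟩ := exists_contDiff_eventuallyEq hΩ hK hu₀
  obtain ⟨r, hr, φ, hφ, hφd⟩ := exists_flow hK' u₀
  -- Start on the affine transversal through `u₀` in the directions `J (F × 0)` and flow for time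
  -- `s`. The derivative at the origin is `J`: on `F` because the flow at time zero is the identity,
  -- on the last factor because `J (0, 1) = K u₀`.
  let j : F × ℝ → E × ℝ := fun p => (u₀ + J (p.1, 0), p.2)
  have hj : ContDiff ℝ ∞ j := (contDiff_const.add (J.contDiff.comp
    (contDiff_fst.prodMk contDiff_const))).prodMk contDiff_snd
  have hj0 : j (0, 0) = (u₀, 0) := by
    simp only [j]
    rw [show ((0 : F), (0 : ℝ)) = 0 from rfl, map_zero, add_zero]
  have hu₀B : (u₀, (0 : ℝ)) ∈ Metric.ball u₀ r ×ˢ Set.Ioo (-r) r :=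
    ⟨Metric.mem_ball_self hr, by simpa using hr, hr⟩
  have hφ0 : φ (u₀, 0) = u₀ := (hφd u₀ (Metric.mem_ball_self hr)).1
  have hBo : IsOpen (Metric.ball u₀ r ×ˢ Set.Ioo (-r) r) := Metric.isOpen_ball.prod isOpen_Ioo
  have hφc : ContinuousAt φ (u₀, 0) := hφ.continuousOn.continuousAt (hBo.mem_nhds hu₀B)
  have hev : ∀ᶠ p in 𝓝 ((0 : F), (0 : ℝ)), j p ∈ Metric.ball u₀ r ×ˢ Set.Ioo (-r) r ∧
      (K' (φ (j p)) = K (φ (j p)) ∧ φ (j p) ∈ Ω) := by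
    have h1 : ContinuousAt j (0, 0) := hj.continuous.continuousAt
    have h2 : ContinuousAt (φ ∘ j) (0, 0) := ContinuousAt.comp (by rw [hj0]; exact hφc) h1
    have h3 : ∀ᶠ u in 𝓝 ((φ ∘ j) (0, 0)), K' u = K u ∧ u ∈ Ω := by
      rw [Function.comp_apply, hj0, hφ0]
      exact hKK'.and (hΩ.mem_nhds hu₀)
    exact (h1.eventually (by rw [hj0]; exact hBo.mem_nhds hu₀B)).and (h2.eventually h3)
  obtain ⟨N, hN, hNo, hN0⟩ := eventually_nhds_iff.1 hev
  have hf : ContDiffOn ℝ ∞ (φ ∘ j) N := hφ.comp hj.contDiffOn fun p hp => (hN p hp).1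
  have hderiv : ∀ p ∈ N, HasDerivAt (fun s => φ (j (p.1, s))) (K (φ (j p))) p.2 := by
    intro p hp
    have h1 := (hφd (j p).1 (hN p hp).1.1).2 (j p).2 (hN p hp).1.2
    rw [← (hN p hp).2.1]
    exact h1
  have hfd : HasFDerivAt (φ ∘ j) (J : (F × ℝ) →L[ℝ] E) (0, 0) := by
    have hd := ((hf.contDiffAt (hNo.mem_nhds hN0)).differentiableAt (by simp)).hasFDerivAt
    refine hd.congr_fderiv ?_
    ext w
    · have h1 : HasFDerivAt (fun x : F => (φ ∘ j) (x, 0))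
        ((fderiv ℝ (φ ∘ j) (0, 0)).comp (ContinuousLinearMap.inl ℝ F ℝ)) 0 :=
        HasFDerivAt.comp (f := fun x : F => (x, (0 : ℝ))) 0 hd (hasFDerivAt_prodMk_left 0 0)
      have h2 : HasFDerivAt (fun x : F => (φ ∘ j) (x, 0))
          ((J : (F × ℝ) →L[ℝ] E).comp (ContinuousLinearMap.inl ℝ F ℝ)) 0 := by
        have h3 : HasFDerivAt (fun x : F => u₀ + J (x, 0))
            ((J : (F × ℝ) →L[ℝ] E).comp (ContinuousLinearMap.inl ℝ F ℝ)) 0 :=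
          (((J : (F × ℝ) →L[ℝ] E).comp (ContinuousLinearMap.inl ℝ F ℝ)).hasFDerivAt).const_add u₀
        refine h3.congr_of_eventuallyEq ?_
        have h4 : ContinuousAt (fun x : F => (x, (0 : ℝ))) 0 := by fun_prop
        filter_upwards [h4.eventually (hNo.mem_nhds hN0)] with x hx
        exact (hφd _ (hN _ hx).1.1).1
      exact DFunLike.congr_fun (h1.unique h2) w
    · have h1 : HasDerivAt (fun s : ℝ => (φ ∘ j) (0, s))
        (fderiv ℝ (φ ∘ j) (0, 0) (0, 1)) 0 :=
        HasFDerivAt.comp_hasDerivAt (f := fun s : ℝ => ((0 : F), s)) 0 hd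
          ((hasDerivAt_const _ _).prodMk (hasDerivAt_id _))
      have h2 := hderiv (0, 0) hN0
      rw [hj0, hφ0, ← hJ] at h2
      simpa using h1.unique h2
  obtain ⟨S, hS0, hSN, hSf, hSs, hSi, -⟩ := exists_smooth_local_inverse hNo hf hN0
    ⟨J, hfd.fderiv.symm⟩
  refine ⟨S, hS0, ?_, ?_, hSs, hSi, ?_⟩
  · rw [hSf, Function.comp_apply, hj0, hφ0]
  · intro u hu
    have h1 := (hN _ (hSN (S.map_target hu))).2.2
    rwa [← Function.comp_apply (f := φ), ← hSf, S.right_inv hu] at h1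
  · intro p hp
    have := hderiv p (hSN hp)
    simpa only [hSf, Function.comp_apply] using this

end Flow

end CartanDuality

end

/-! ### Adapted frames, the characteristic form and the characteristic field. -/

open scoped Manifold ContDiff Topology

noncomputable section

namespace CartanDuality

section Coframes

/-- The linear map with columns `e i y`. -/
def frameMap (e : Fin 5 → E5 → E5) (y : E5) : E5 →L[ℝ] E5 :=
  ∑ i, (EuclideanSpace.proj i : E5 →L[ℝ] ℝ).smulRight (e i y)

/-- The coframe dual to `e`. -/
def coframe (e : Fin 5 → E5 → E5) (i : Fin 5) (y : E5) : E5 →L[ℝ] ℝ :=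
  (EuclideanSpace.proj i : E5 →L[ℝ] ℝ).comp (frameMap e y).inverse

theorem frameMap_apply (e : Fin 5 → E5 → E5) (y v : E5) : frameMap e y v = ∑ i, v i • e i y := by
  simp [frameMap]

theorem frameMap_isInvertible {e : Fin 5 → E5 → E5} {y : E5}
    (h : LinearIndependent ℝ fun i => e i y) : (frameMap e y).IsInvertible := by
  have hinj : Function.Injective (frameMap e y) := by
    rw [injective_iff_map_eq_zero]
    intro v hv
    rw [frameMap_apply] at hv
    ext i
    exact Fintype.linearIndependent_iff.1 h _ hv i
  have hsurj : Function.Surjective (frameMap e y) :=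
    (LinearMap.injective_iff_surjective (f := (frameMap e y).toLinearMap)).1 hinj
  exact ⟨ContinuousLinearEquiv.ofBijective (frameMap e y) (LinearMap.ker_eq_bot.2 hinj)
    (LinearMap.range_eq_top.2 hsurj), by ext; simp⟩

theorem coframe_apply_frame {e : Fin 5 → E5 → E5} {y : E5}
    (h : LinearIndependent ℝ fun i => e i y) (i j : Fin 5) :
    coframe e i y (e j y) = if i = j then 1 else 0 := by
  have h1 : e j y = frameMap e y (EuclideanSpace.single j 1) := by
    rw [frameMap_apply]; simp
  rw [coframe, ContinuousLinearMap.comp_apply, h1, (frameMap_isInvertible h).inverse_apply_eq.2 rfl]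
  simp

theorem sum_coframe_smul {e : Fin 5 → E5 → E5} {y : E5}
    (h : LinearIndependent ℝ fun i => e i y) (v : E5) : ∑ i, coframe e i y v • e i y = v := by
  have h1 := frameMap_apply e y ((frameMap e y).inverse v)
  rw [(frameMap_isInvertible h).inverse_apply_eq.1 rfl |>.symm] at h1
  exact h1.symm

theorem contDiffOn_coframe {e : Fin 5 → E5 → E5} {O : Set E5}
    (he : ∀ i, ContDiffOn ℝ ∞ (e i) O) (h : ∀ y ∈ O, LinearIndependent ℝ fun i => e i y)
    (i : Fin 5) : ContDiffOn ℝ ∞ (coframe e i) O := by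
  have h1 : ContDiffOn ℝ ∞ (frameMap e) O := by
    unfold frameMap
    exact ContDiffOn.sum fun i _ =>
      ((ContinuousLinearMap.smulRightL ℝ E5 E5 (EuclideanSpace.proj i)).contDiff).comp_contDiffOn
        (he i)
  intro y hy
  obtain ⟨A, hA⟩ := frameMap_isInvertible (h y hy)
  have h2 : ContDiffWithinAt ℝ ∞ (fun y => (frameMap e y).inverse) O y := by
    have h3 := contDiffAt_map_inverse (𝕜 := ℝ) (n := ∞) A
    rw [hA] at h3
    exact h3.comp_contDiffWithinAt y (h1 y hy)
  exact contDiffWithinAt_const.clm_comp h2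

end Coframes

/-- A local frame `e 0, …, e 4` of `ℝ⁵` adapted to the `(2,3,5)`-distribution spanned by `e 0` and
`e 1`. -/
structure IsAdaptedFrame (O : Set E5) (e : Fin 5 → E5 → E5) : Prop where
  isOpen : IsOpen O
  smooth : ∀ i, ContDiffOn ℝ ∞ (e i) O
  indep : ∀ y ∈ O, LinearIndependent ℝ fun i => e i y
  bracket01 : ∀ y ∈ O, VectorField.lieBracket ℝ (e 0) (e 1) y = e 2 y
  bracket02 : ∀ y ∈ O, VectorField.lieBracket ℝ (e 0) (e 2) y = e 3 y
  bracket12 : ∀ y ∈ O, VectorField.lieBracket ℝ (e 1) (e 2) y = e 4 y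

/-- The form `ε₄ - t ε₃` that annihilates `e 0`, `e 1`, `e 2` and `e 3 + t e 4`. -/
def annForm (e : Fin 5 → E5 → E5) (t : ℝ) (y : E5) : E5 →L[ℝ] ℝ :=
  coframe e 4 y - t • coframe e 3 y

/-- The form on the projectivized distribution whose kernel is the third derived system. -/
def charForm (e : Fin 5 → E5 → E5) (u : E5 × ℝ) : E5 × ℝ →L[ℝ] ℝ :=
  (annForm e u.2 u.1).comp (ContinuousLinearMap.fst ℝ E5 ℝ)

/-- The vector field `e 0 + t e 1`. -/
def lineField (e : Fin 5 → E5 → E5) (t : ℝ) (y : E5) : E5 := e 0 y + t • e 1 y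

/-- The vector field `e 3 + t e 4`. -/
def topField (e : Fin 5 → E5 → E5) (t : ℝ) (y : E5) : E5 := e 3 y + t • e 4 y

/-- The characteristic vector field, whose integral curves are the lifts of the singular paths. -/
def charField (e : Fin 5 → E5 → E5) (u : E5 × ℝ) : E5 × ℝ :=
  (lineField e u.2 u.1,
    -annForm e u.2 u.1 (VectorField.lieBracket ℝ (lineField e u.2) (topField e u.2) u.1))

namespace IsAdaptedFrame

variable {O : Set E5} {e : Fin 5 → E5 → E5}

theorem coframe_apply (h : IsAdaptedFrame O e) {y : E5} (hy : y ∈ O) (i j : Fin 5) :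
    coframe e i y (e j y) = if i = j then 1 else 0 := coframe_apply_frame (h.indep y hy) i j

theorem differentiableAt (h : IsAdaptedFrame O e) {y : E5} (hy : y ∈ O) (i : Fin 5) :
    DifferentiableAt ℝ (e i) y :=
  ((h.smooth i).contDiffAt (h.isOpen.mem_nhds hy)).differentiableAt (by simp)

theorem contDiffOn_coframe (h : IsAdaptedFrame O e) (i : Fin 5) :
    ContDiffOn ℝ ∞ (coframe e i) O := CartanDuality.contDiffOn_coframe h.smooth h.indep i

theorem differentiableAt_coframe (h : IsAdaptedFrame O e) {y : E5} (hy : y ∈ O) (i : Fin 5) :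
    DifferentiableAt ℝ (coframe e i) y :=
  ((h.contDiffOn_coframe i).contDiffAt (h.isOpen.mem_nhds hy)).differentiableAt (by simp)

theorem annForm_frame (h : IsAdaptedFrame O e) (t : ℝ) {y : E5} (hy : y ∈ O) (i : Fin 5) :
    annForm e t y (e i y) = (if i = 4 then 1 else 0) - t * (if i = 3 then 1 else 0) := by
  simp [annForm, h.coframe_apply hy, eq_comm]

theorem annForm_lineField (h : IsAdaptedFrame O e) (t : ℝ) {y : E5} (hy : y ∈ O) (s : ℝ) :
    annForm e t y (lineField e s y) = 0 := by
  simp [lineField, h.annForm_frame t hy]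

theorem annForm_topField (h : IsAdaptedFrame O e) (t : ℝ) {y : E5} (hy : y ∈ O) :
    annForm e t y (topField e t y) = 0 := by
  simp [topField, h.annForm_frame t hy]

theorem lineField_ne_zero (h : IsAdaptedFrame O e) (t : ℝ) {y : E5} (hy : y ∈ O) :
    lineField e t y ≠ 0 := by
  intro h0
  have := congrArg (coframe e 0 y) h0
  simp [lineField, h.coframe_apply hy] at this

theorem differentiableAt_annForm (h : IsAdaptedFrame O e) (t : ℝ) {y : E5} (hy : y ∈ O) :
    DifferentiableAt ℝ (annForm e t) y :=
  (h.differentiableAt_coframe hy 4).sub ((h.differentiableAt_coframe hy 3).const_smul t)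

theorem contDiffOn_lineField (h : IsAdaptedFrame O e) :
    ContDiffOn ℝ ∞ (fun u : E5 × ℝ => lineField e u.2 u.1) (O ×ˢ Set.univ) :=
  ((h.smooth 0).comp contDiff_fst.contDiffOn fun _ hu => hu.1).add
    (contDiff_snd.contDiffOn.smul ((h.smooth 1).comp contDiff_fst.contDiffOn fun _ hu => hu.1))

theorem contDiffOn_annForm (h : IsAdaptedFrame O e) :
    ContDiffOn ℝ ∞ (fun u : E5 × ℝ => annForm e u.2 u.1) (O ×ˢ Set.univ) :=
  ((h.contDiffOn_coframe 4).comp contDiff_fst.contDiffOn fun _ hu => hu.1).sub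
    (contDiff_snd.contDiffOn.smul
      ((h.contDiffOn_coframe 3).comp contDiff_fst.contDiffOn fun _ hu => hu.1))

theorem contDiffOn_charForm (h : IsAdaptedFrame O e) :
    ContDiffOn ℝ ∞ (charForm e) (O ×ˢ Set.univ) :=
  h.contDiffOn_annForm.clm_comp contDiffOn_const

/-- The bracket with frozen `t` is expanded into terms in which `t` enters explicitly; this makes
the smoothness of `charField` in `(y, t)` jointly visible. -/
theorem lieBracket_lineField_topField (h : IsAdaptedFrame O e) (t : ℝ) {y : E5} (hy : y ∈ O) :
    VectorField.lieBracket ℝ (lineField e t) (topField e t) y =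
      fderiv ℝ (e 3) y (lineField e t y) + t • fderiv ℝ (e 4) y (lineField e t y) -
      (fderiv ℝ (e 0) y (topField e t y) + t • fderiv ℝ (e 1) y (topField e t y)) := by
  have h1 : fderiv ℝ (lineField e t) y = fderiv ℝ (e 0) y + t • fderiv ℝ (e 1) y :=
    ((h.differentiableAt hy 0).hasFDerivAt.add
      ((h.differentiableAt hy 1).hasFDerivAt.const_smul t)).fderiv
  have h2 : fderiv ℝ (topField e t) y = fderiv ℝ (e 3) y + t • fderiv ℝ (e 4) y :=
    ((h.differentiableAt hy 3).hasFDerivAt.add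
      ((h.differentiableAt hy 4).hasFDerivAt.const_smul t)).fderiv
  rw [VectorField.lieBracket, h1, h2]
  simp

theorem isOpen_prod (h : IsAdaptedFrame O e) : IsOpen (O ×ˢ (Set.univ : Set ℝ)) :=
  h.isOpen.prod isOpen_univ

theorem contDiffOn_charField (h : IsAdaptedFrame O e) :
    ContDiffOn ℝ ∞ (charField e) (O ×ˢ Set.univ) := by
  have hl := h.contDiffOn_lineField
  have ht : ContDiffOn ℝ ∞ (fun u : E5 × ℝ => topField e u.2 u.1) (O ×ˢ Set.univ) :=
    ((h.smooth 3).comp contDiff_fst.contDiffOn fun _ hu => hu.1).add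
      (contDiff_snd.contDiffOn.smul ((h.smooth 4).comp contDiff_fst.contDiffOn fun _ hu => hu.1))
  have hd : ∀ i, ContDiffOn ℝ ∞ (fun u : E5 × ℝ => fderiv ℝ (e i) u.1) (O ×ˢ Set.univ) := fun i =>
    ((h.smooth i).fderiv_of_isOpen h.isOpen (m := ∞) (by simp)).comp
      contDiff_fst.contDiffOn fun _ hu => hu.1
  have hs : ContDiffOn ℝ ∞ (fun u : E5 × ℝ => u.2) (O ×ˢ Set.univ) := contDiff_snd.contDiffOn
  have hb : ContDiffOn ℝ ∞ (fun u : E5 × ℝ =>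
      VectorField.lieBracket ℝ (lineField e u.2) (topField e u.2) u.1) (O ×ˢ Set.univ) := by
    refine ((((hd 3).clm_apply hl).add (hs.smul ((hd 4).clm_apply hl))).sub
      (((hd 0).clm_apply ht).add (hs.smul ((hd 1).clm_apply ht)))).congr fun u hu => ?_
    exact h.lieBracket_lineField_topField u.2 hu.1
  exact hl.prodMk (h.contDiffOn_annForm.clm_apply hb).neg

/-- The structure equations of a coframe. -/
theorem dForm_frame (h : IsAdaptedFrame O e) {θ : E5 → E5 →L[ℝ] ℝ} {y : E5} (hy : y ∈ O)
    (hθ : DifferentiableAt ℝ θ y) (c : Fin 5 → ℝ) (hc : ∀ x ∈ O, ∀ i, θ x (e i x) = c i)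
    (i j : Fin 5) : dForm θ y (e i y) (e j y) = -θ y (VectorField.lieBracket ℝ (e i) (e j) y) := by
  have key : ∀ i, fderiv ℝ (fun x => θ x (e i x)) y = 0 := by
    intro i
    have h1 : (fun x => θ x (e i x)) =ᶠ[𝓝 y] fun _ => c i := by
      filter_upwards [h.isOpen.mem_nhds hy] with x hx using hc x hx i
    rw [h1.fderiv_eq]; simp
  rw [dForm_eq hθ (h.differentiableAt hy i) (h.differentiableAt hy j), key, key]
  simp

theorem dForm_annForm_frame (h : IsAdaptedFrame O e) (t : ℝ) {y : E5} (hy : y ∈ O)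
    (i j : Fin 5) : dForm (annForm e t) y (e i y) (e j y) =
      -annForm e t y (VectorField.lieBracket ℝ (e i) (e j) y) :=
  h.dForm_frame hy (h.differentiableAt_annForm t hy) _ (fun _ hx i => h.annForm_frame t hx i) i j

theorem dForm_coframe_frame (h : IsAdaptedFrame O e) (k : Fin 5) {y : E5} (hy : y ∈ O)
    (i j : Fin 5) : dForm (coframe e k) y (e i y) (e j y) =
      -coframe e k y (VectorField.lieBracket ℝ (e i) (e j) y) :=
  h.dForm_frame hy (h.differentiableAt_coframe hy k) _ (fun _ hx i => h.coframe_apply hx k i) i j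

/-- This is d(ε₄ - t ε₃) = (dε₄ - t dε₃) - dt ∧ ε₃; the first part is the exterior derivative on the
base with `t` frozen. -/
theorem dForm_charForm (h : IsAdaptedFrame O e) {u : E5 × ℝ} (hu : u.1 ∈ O) (v w : E5 × ℝ) :
    dForm (charForm e) u v w = dForm (annForm e u.2) u.1 v.1 w.1 - v.2 * coframe e 3 u.1 w.1 +
      w.2 * coframe e 3 u.1 v.1 := by
  have hd : ∀ i, HasFDerivAt (fun u : E5 × ℝ => coframe e i u.1)
      ((fderiv ℝ (coframe e i) u.1).comp (ContinuousLinearMap.fst ℝ E5 ℝ)) u := fun i =>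
    (h.differentiableAt_coframe hu i).hasFDerivAt.comp u hasFDerivAt_fst
  have h1 : HasFDerivAt (fun u : E5 × ℝ => annForm e u.2 u.1) _ u :=
    (hd 4).sub (hasFDerivAt_snd.smul (hd 3))
  have h2 := h1.clm_comp (hasFDerivAt_const (ContinuousLinearMap.fst ℝ E5 ℝ) u)
  have h3 : fderiv ℝ (annForm e u.2) u.1 = fderiv ℝ (coframe e 4) u.1 -
      u.2 • fderiv ℝ (coframe e 3) u.1 :=
    ((h.differentiableAt_coframe hu 4).hasFDerivAt.sub
      ((h.differentiableAt_coframe hu 3).hasFDerivAt.const_smul u.2)).fderiv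
  have h4 : fderiv ℝ (charForm e) u = _ := h2.fderiv
  simp only [dForm, h4, h3]
  simp
  ring

theorem charForm_apply (e : Fin 5 → E5 → E5) (u w : E5 × ℝ) :
    charForm e u w = coframe e 4 u.1 w.1 - u.2 * coframe e 3 u.1 w.1 := by
  simp [charForm, annForm]

theorem sum_coframe (h : IsAdaptedFrame O e) {y : E5} (hy : y ∈ O) (v : E5) :
    v = coframe e 0 y v • e 0 y + coframe e 1 y v • e 1 y + coframe e 2 y v • e 2 y +
      coframe e 3 y v • e 3 y + coframe e 4 y v • e 4 y := by
  have := sum_coframe_smul (h.indep y hy) v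
  rw [Fin.sum_univ_five] at this
  exact this.symm

/-- Vectors in the kernel of the characteristic form. -/
theorem eq_of_charForm_eq_zero (h : IsAdaptedFrame O e) {u w : E5 × ℝ} (hu : u.1 ∈ O)
    (hw : charForm e u w = 0) : w.1 = coframe e 0 u.1 w.1 • e 0 u.1 +
      coframe e 1 u.1 w.1 • e 1 u.1 + coframe e 2 u.1 w.1 • e 2 u.1 +
      coframe e 3 u.1 w.1 • topField e u.2 u.1 := by
  rw [charForm_apply, sub_eq_zero] at hw
  conv_lhs => rw [h.sum_coframe hu w.1, hw]
  rw [topField]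
  module

theorem charForm_charField (h : IsAdaptedFrame O e) {u : E5 × ℝ} (hu : u.1 ∈ O) :
    charForm e u (charField e u) = 0 := h.annForm_lineField u.2 hu u.2

theorem dForm_annForm_lineField (h : IsAdaptedFrame O e) (t : ℝ) {y : E5} (hy : y ∈ O)
    (i : Fin 5) : dForm (annForm e t) y (lineField e t y) (e i y) =
      -(annForm e t y (VectorField.lieBracket ℝ (e 0) (e i) y) +
        t * annForm e t y (VectorField.lieBracket ℝ (e 1) (e i) y)) := by
  rw [lineField, dForm_add_left, dForm_smul_left, h.dForm_annForm_frame t hy,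
    h.dForm_annForm_frame t hy]
  ring

theorem lieBracket_self (V : E5 → E5) (y : E5) : VectorField.lieBracket ℝ V V y = 0 := by
  simp [VectorField.lieBracket]

theorem lieBracket10 (h : IsAdaptedFrame O e) {y : E5} (hy : y ∈ O) :
    VectorField.lieBracket ℝ (e 1) (e 0) y = -e 2 y := by
  rw [VectorField.lieBracket_swap, h.bracket01 y hy]

theorem dForm_annForm_lineField_topField (h : IsAdaptedFrame O e) (t : ℝ) {y : E5} (hy : y ∈ O) :
    dForm (annForm e t) y (lineField e t y) (topField e t y) =
      -annForm e t y (VectorField.lieBracket ℝ (lineField e t) (topField e t) y) := by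
  refine (neg_eq_iff_eq_neg.1 (apply_lieBracket_of_mem_ker (V := lineField e t)
    (W := topField e t) (h.differentiableAt_annForm t hy) ?_ ?_ ?_ ?_).symm)
  · exact (h.differentiableAt hy 0).add ((h.differentiableAt hy 1).const_smul t)
  · exact (h.differentiableAt hy 3).add ((h.differentiableAt hy 4).const_smul t)
  · filter_upwards [h.isOpen.mem_nhds hy] with x hx using h.annForm_lineField t hx t
  · filter_upwards [h.isOpen.mem_nhds hy] with x hx using h.annForm_topField t hx

/-- The characteristic field is in the kernel of the restriction of `d charForm` to the kernel of
`charForm`. -/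
theorem dForm_charField_eq_zero (h : IsAdaptedFrame O e) {u w : E5 × ℝ} (hu : u.1 ∈ O)
    (hw : charForm e u w = 0) : dForm (charForm e) u (charField e u) w = 0 := by
  rw [h.dForm_charForm hu]
  -- It is enough to test on `e 0`, `e 1`, `e 2` and `topField`. On the first two the brackets are
  -- multiples of `e 2`, on the third the bracket is `e 3 + t e 4`, all killed by `annForm`; on
  -- `topField` the vertical component of `charField` is chosen to cancel what remains.
  conv_lhs => rw [h.eq_of_charForm_eq_zero hu hw]
  have h3 : coframe e 3 u.1 (charField e u).1 = 0 := by
    simp [charField, lineField, h.coframe_apply hu]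
  have h3' : coframe e 3 u.1 (topField e u.2 u.1) = 1 := by
    simp [topField, h.coframe_apply hu]
  rw [h3]
  change dForm _ _ (lineField e u.2 u.1) _ - _ * _ + _ = _
  simp only [dForm_add_right, dForm_smul_right, h.dForm_annForm_lineField_topField u.2 hu,
    h.dForm_annForm_lineField u.2 hu, lieBracket_self, h.lieBracket10 hu, h.bracket01 _ hu,
    h.bracket02 _ hu, h.bracket12 _ hu, map_add, map_smul, smul_eq_mul, h.coframe_apply hu, h3',
    map_neg, h.annForm_frame _ hu, charField, map_zero]
  simp
  ring

/-- `d charForm (K, ·)` is a multiple of `charForm`. -/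
theorem dForm_charField (h : IsAdaptedFrame O e) {u : E5 × ℝ} (hu : u.1 ∈ O) (w : E5 × ℝ) :
    dForm (charForm e) u (charField e u) w =
      dForm (charForm e) u (charField e u) (e 4 u.1, 0) * charForm e u w := by
  have h4 : charForm e u (e 4 u.1, 0) = 1 := by simp [charForm_apply, h.coframe_apply hu]
  -- A multiple of `(e 4, 0)`, where the form takes the value one, moves `w` into the kernel.
  have h1 : charForm e u (w + (-charForm e u w) • (e 4 u.1, (0 : ℝ))) = 0 := by
    rw [map_add, map_smul, h4]; simp
  have h2 := h.dForm_charField_eq_zero hu h1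
  rw [dForm_add_right, dForm_smul_right] at h2
  linear_combination h2

/-- The kernel of the restriction of `d charForm` to the kernel of `charForm` is spanned by the
characteristic field. -/
theorem mem_span_charField (h : IsAdaptedFrame O e) {u v : E5 × ℝ} (hu : u.1 ∈ O)
    (hv : charForm e u v = 0) (hvw : ∀ w, charForm e u w = 0 → dForm (charForm e) u v w = 0) :
    ∃ r : ℝ, v = r • charField e u := by
  have hX0 := hvw (0, 1) (by simp [charForm_apply])
  rw [h.dForm_charForm hu] at hX0
  have hz : dForm (annForm e u.2) u.1 v.1 0 = 0 := by simp [dForm]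
  simp only [hz, map_zero, mul_zero, sub_zero, one_mul, zero_add] at hX0
  -- Testing against ∂ₜ has removed the `e 3` coefficient. A multiple of `charField` removes the `e
  -- 0` coefficient; testing the rest against `e 1`, `e 2` and `topField` then kills the `e 2`, the
  -- `e 1` and the vertical component, in this order.
  set r := coframe e 0 u.1 v.1 with hr
  set v' := v + (-r) • charField e u with hv'
  have hv'0 : charForm e u v' = 0 := by
    rw [hv', map_add, map_smul, hv, h.charForm_charField hu]; simp
  have hvw' : ∀ w, charForm e u w = 0 → dForm (charForm e) u v' w = 0 := fun w hw => by
    rw [hv', dForm_add_left, dForm_smul_left, hvw w hw, h.dForm_charField_eq_zero hu hw]; simp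
  have c0 : coframe e 0 u.1 v'.1 = 0 := by
    simp [hv', charField, lineField, h.coframe_apply hu, ← hr]
  have c3 : coframe e 3 u.1 v'.1 = 0 := by
    simp [hv', charField, lineField, h.coframe_apply hu, hX0]
  have hdec := h.eq_of_charForm_eq_zero hu hv'0
  rw [c0, c3, zero_smul, zero_smul, zero_add, add_zero] at hdec
  set p := coframe e 1 u.1 v'.1
  set q := coframe e 2 u.1 v'.1
  have key : ∀ i, dForm (annForm e u.2) u.1 v'.1 (e i u.1) =
      -(p * annForm e u.2 u.1 (VectorField.lieBracket ℝ (e 1) (e i) u.1) +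
        q * annForm e u.2 u.1 (VectorField.lieBracket ℝ (e 2) (e i) u.1)) := by
    intro i
    rw [hdec, dForm_add_left, dForm_smul_left, dForm_smul_left, h.dForm_annForm_frame u.2 hu,
      h.dForm_annForm_frame u.2 hu]
    ring
  have hb21 : VectorField.lieBracket ℝ (e 2) (e 1) u.1 = -e 4 u.1 := by
    rw [VectorField.lieBracket_swap, h.bracket12 _ hu]
  have hq : q = 0 := by
    have h1 := hvw' (e 1 u.1, 0) (by simp [charForm_apply, h.coframe_apply hu])
    rw [h.dForm_charForm hu, key, c3] at h1
    simp only [lieBracket_self, hb21, map_zero, map_neg, h.annForm_frame _ hu,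
      h.coframe_apply hu] at h1
    simpa using h1
  have hp : p = 0 := by
    have h1 := hvw' (e 2 u.1, 0) (by simp [charForm_apply, h.coframe_apply hu])
    rw [h.dForm_charForm hu, key, c3] at h1
    simp only [lieBracket_self, h.bracket12 _ hu, map_zero, h.annForm_frame _ hu,
      h.coframe_apply hu] at h1
    simpa using h1
  have hv1 : v'.1 = 0 := by rw [hdec, hp, hq]; simp
  have hv2 : v'.2 = 0 := by
    have h1 := hvw' (topField e u.2 u.1, 0) (h.annForm_topField u.2 hu)
    rw [h.dForm_charForm hu, hv1] at h1
    have hz' : dForm (annForm e u.2) u.1 0 (topField e u.2 u.1) = 0 := by simp [dForm]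
    rw [hz'] at h1
    simpa [topField, h.coframe_apply hu] using h1
  refine ⟨r, ?_⟩
  have h0 : v' = 0 := Prod.ext hv1 hv2
  rw [hv', neg_smul, ← sub_eq_add_neg, sub_eq_zero] at h0
  exact h0

/-- The source of the Lagrangian property: the tangent planes of the cones will be the images of the
planes spanned by ∂ₜ and `e 1`, and dt ∧ ε₃ vanishes there because ε₃ kills `e 1`. -/
theorem dForm_vertical_frame_one (h : IsAdaptedFrame O e) {u : E5 × ℝ} (hu : u.1 ∈ O) :
    dForm (charForm e) u (0, 1) (e 1 u.1, 0) = 0 := by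
  rw [h.dForm_charForm hu]
  simp [dForm, h.coframe_apply hu]

theorem hasFDerivAt_lineField (h : IsAdaptedFrame O e) {u : E5 × ℝ} (hu : u.1 ∈ O) :
    HasFDerivAt (fun u : E5 × ℝ => lineField e u.2 u.1)
      ((fderiv ℝ (e 0) u.1 + u.2 • fderiv ℝ (e 1) u.1).comp (ContinuousLinearMap.fst ℝ E5 ℝ) +
        (ContinuousLinearMap.snd ℝ E5 ℝ).smulRight (e 1 u.1)) u := by
  have hd : ∀ i, HasFDerivAt (fun u : E5 × ℝ => e i u.1)
      ((fderiv ℝ (e i) u.1).comp (ContinuousLinearMap.fst ℝ E5 ℝ)) u := fun i =>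
    (h.differentiableAt hu i).hasFDerivAt.comp u hasFDerivAt_fst
  refine ((hd 0).add (hasFDerivAt_snd.smul (hd 1))).congr_fderiv ?_
  ext <;> simp

theorem lieBracket_lineField (h : IsAdaptedFrame O e) (t : ℝ) {y : E5} (hy : y ∈ O) (i : Fin 5) :
    VectorField.lieBracket ℝ (lineField e t) (e i) y = VectorField.lieBracket ℝ (e 0) (e i) y +
      t • VectorField.lieBracket ℝ (e 1) (e i) y := by
  have h1 : fderiv ℝ (lineField e t) y = fderiv ℝ (e 0) y + t • fderiv ℝ (e 1) y :=
    ((h.differentiableAt hy 0).hasFDerivAt.add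
      ((h.differentiableAt hy 1).hasFDerivAt.const_smul t)).fderiv
  simp only [VectorField.lieBracket, h1, lineField]
  simp
  module

/-- The bracket of a field that lifts `e 0 + t e 1` with the lift of `e i`. -/
theorem lieBracket_lift_fst (h : IsAdaptedFrame O e) {u : E5 × ℝ} (hu : u.1 ∈ O)
    {f : E5 × ℝ → ℝ} (hf : DifferentiableAt ℝ f u) (i : Fin 5) :
    (VectorField.lieBracket ℝ (fun u : E5 × ℝ => (lineField e u.2 u.1, f u))
      (fun u : E5 × ℝ => (e i u.1, (0 : ℝ))) u).1 =
      VectorField.lieBracket ℝ (lineField e u.2) (e i) u.1 := by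
  have h1 := ((h.hasFDerivAt_lineField hu).prodMk hf.hasFDerivAt).fderiv
  have h2 : HasFDerivAt (fun u : E5 × ℝ => (e i u.1, (0 : ℝ)))
      (((fderiv ℝ (e i) u.1).comp (ContinuousLinearMap.fst ℝ E5 ℝ)).prod 0) u :=
    ((h.differentiableAt hu i).hasFDerivAt.comp u hasFDerivAt_fst).prodMk (hasFDerivAt_const _ _)
  have h3 : fderiv ℝ (lineField e u.2) u.1 = fderiv ℝ (e 0) u.1 + u.2 • fderiv ℝ (e 1) u.1 :=
    ((h.differentiableAt hu 0).hasFDerivAt.add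
      ((h.differentiableAt hu 1).hasFDerivAt.const_smul u.2)).fderiv
  simp only [VectorField.lieBracket, h1, h2.fderiv, h3]
  simp

/-- The bracket of a field that lifts `e 0 + t e 1` with the vertical field. -/
theorem lieBracket_lift_vertical_fst (h : IsAdaptedFrame O e) {u : E5 × ℝ} (hu : u.1 ∈ O)
    {f : E5 × ℝ → ℝ} (hf : DifferentiableAt ℝ f u) :
    (VectorField.lieBracket ℝ (fun u : E5 × ℝ => (lineField e u.2 u.1, f u))
      (fun _ => ((0 : E5), (1 : ℝ))) u).1 = -e 1 u.1 := by
  have h1 := ((h.hasFDerivAt_lineField hu).prodMk hf.hasFDerivAt).fderiv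
  simp only [VectorField.lieBracket, h1]
  simp

end IsAdaptedFrame

end CartanDuality

end

/-! ### Vector fields and their brackets in charts. -/

open scoped Manifold ContDiff Topology

noncomputable section

namespace CartanDuality

section Charts

set_option linter.unusedSectionVars false

variable {H : Type*} [NormedAddCommGroup H] [NormedSpace ℝ H]
  {M : Type*} [TopologicalSpace M] [ChartedSpace H M]

/-- The derivative of a chart. -/
def dchart (φ : OpenPartialHomeomorph M H) (x : M) : TangentSpace 𝓘(ℝ, H) x →L[ℝ] H :=
  mfderiv 𝓘(ℝ, H) 𝓘(ℝ, H) φ x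

/-- The vector field with coordinate expression `v`. -/
def liftField (φ : OpenPartialHomeomorph M H) (v : H → H) (x : M) : TangentSpace 𝓘(ℝ, H) x :=
  (dchart φ x).inverse (v (φ x))

/-- The coordinate expression of the vector field `V`. -/
def coordField (φ : OpenPartialHomeomorph M H) (V : ∀ x : M, TangentSpace 𝓘(ℝ, H) x) (u : H) : H :=
  dchart φ (φ.symm u) (V (φ.symm u))

variable [IsManifold 𝓘(ℝ, H) ∞ M] {φ : OpenPartialHomeomorph M H}

theorem mdifferentiable_of_mem_maximalAtlas (hφ : φ ∈ IsManifold.maximalAtlas 𝓘(ℝ, H) ∞ M) :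
    φ.MDifferentiable 𝓘(ℝ, H) 𝓘(ℝ, H) :=
  ⟨(contMDiffOn_of_mem_maximalAtlas hφ).mdifferentiableOn (by simp),
    (contMDiffOn_symm_of_mem_maximalAtlas hφ).mdifferentiableOn (by simp)⟩

theorem dchart_isInvertible (hφ : φ ∈ IsManifold.maximalAtlas 𝓘(ℝ, H) ∞ M) {x : M}
    (hx : x ∈ φ.source) : (dchart φ x).IsInvertible :=
  ⟨(mdifferentiable_of_mem_maximalAtlas hφ).mfderiv hx, rfl⟩

theorem dchart_injective (hφ : φ ∈ IsManifold.maximalAtlas 𝓘(ℝ, H) ∞ M) {x : M}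
    (hx : x ∈ φ.source) : Function.Injective (dchart φ x) :=
  (dchart_isInvertible hφ hx).injective

theorem dchart_inverse_apply (hφ : φ ∈ IsManifold.maximalAtlas 𝓘(ℝ, H) ∞ M) {x : M}
    (hx : x ∈ φ.source) (v : H) : dchart φ x ((dchart φ x).inverse v) = v :=
  (dchart_isInvertible hφ hx).self_apply_inverse v

theorem inverse_dchart_apply (hφ : φ ∈ IsManifold.maximalAtlas 𝓘(ℝ, H) ∞ M) {x : M}
    (hx : x ∈ φ.source) (v : TangentSpace 𝓘(ℝ, H) x) : (dchart φ x).inverse (dchart φ x v) = v :=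
  (dchart_isInvertible hφ hx).inverse_apply_self v

theorem coordField_liftField (hφ : φ ∈ IsManifold.maximalAtlas 𝓘(ℝ, H) ∞ M) (v : H → H) {u : H}
    (hu : u ∈ φ.target) : coordField φ (liftField φ v) u = v u := by
  rw [coordField, liftField, dchart_inverse_apply hφ (φ.map_target hu), φ.right_inv hu]

theorem liftField_coordField (hφ : φ ∈ IsManifold.maximalAtlas 𝓘(ℝ, H) ∞ M)
    (V : ∀ x : M, TangentSpace 𝓘(ℝ, H) x) {x : M} (hx : x ∈ φ.source) :
    liftField φ (coordField φ V) x = V x := by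
  rw [liftField, coordField, φ.left_inv hx, inverse_dchart_apply hφ hx]

variable [CompleteSpace H]

theorem contMDiffOn_liftField (hφ : φ ∈ IsManifold.maximalAtlas 𝓘(ℝ, H) ∞ M) {v : H → H}
    {O : Set H} (hO : IsOpen O) (hv : ContDiffOn ℝ ∞ v O) :
    ContMDiffOn 𝓘(ℝ, H) 𝓘(ℝ, H).tangent ∞
      (fun x => (⟨x, liftField φ v x⟩ : TangentBundle 𝓘(ℝ, H) M)) (φ.source ∩ φ ⁻¹' O) := by
  intro x hx
  have h1 := contMDiffAt_vectorSpace_iff_contDiffAt.2 (hv.contDiffAt (hO.mem_nhds hx.2))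
  exact (ContMDiffAt.mpullback_vectorField_preimage (n := ∞) h1
    (contMDiffAt_of_mem_maximalAtlas hφ hx.1) (dchart_isInvertible hφ hx.1)
    (by simp)).contMDiffWithinAt

theorem mpullback_symm (hφ : φ ∈ IsManifold.maximalAtlas 𝓘(ℝ, H) ∞ M)
    (V : ∀ x : M, TangentSpace 𝓘(ℝ, H) x) {u : H} (hu : u ∈ φ.target) :
    VectorField.mpullback 𝓘(ℝ, H) 𝓘(ℝ, H) φ.symm V u = coordField φ V u := by
  have he := mdifferentiable_of_mem_maximalAtlas hφ
  rw [VectorField.mpullback_apply, coordField]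
  have hinv : (mfderiv 𝓘(ℝ, H) 𝓘(ℝ, H) φ.symm u).IsInvertible := ⟨he.symm.mfderiv hu, rfl⟩
  refine (ContinuousLinearMap.IsInvertible.inverse_apply_eq hinv).2 ?_
  have h1 := he.symm_comp_deriv (φ.map_target hu)
  rw [φ.right_inv hu] at h1
  exact (DFunLike.congr_fun h1 _).symm

theorem contDiffOn_coordField (hφ : φ ∈ IsManifold.maximalAtlas 𝓘(ℝ, H) ∞ M)
    {V : ∀ x : M, TangentSpace 𝓘(ℝ, H) x} {U : Set M} (hU : IsOpen U)
    (hV : ContMDiffOn 𝓘(ℝ, H) 𝓘(ℝ, H).tangent ∞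
      (fun x => (⟨x, V x⟩ : TangentBundle 𝓘(ℝ, H) M)) U) :
    ContDiffOn ℝ ∞ (coordField φ V) (φ.target ∩ φ.symm ⁻¹' U) := by
  have he := mdifferentiable_of_mem_maximalAtlas hφ
  have h1 : ContDiffOn ℝ ∞ (VectorField.mpullback 𝓘(ℝ, H) 𝓘(ℝ, H) φ.symm V)
      (φ.target ∩ φ.symm ⁻¹' U) := by
    intro u hu
    have h2 := ContMDiffAt.mpullback_vectorField_preimage (n := ∞) (m := ∞)
      (hV.contMDiffAt (hU.mem_nhds hu.2)) (contMDiffAt_symm_of_mem_maximalAtlas hφ hu.1)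
      ⟨he.symm.mfderiv hu.1, rfl⟩ (by simp)
    exact (contMDiffAt_vectorSpace_iff_contDiffAt.1 h2).contDiffWithinAt
  exact h1.congr fun u hu => (mpullback_symm hφ V hu.1).symm

theorem mlieBracket_eq_lieBracket (V W : H → H) (u : H) :
    VectorField.mlieBracket 𝓘(ℝ, H) (M := H) V W u = VectorField.lieBracket ℝ V W u := by
  have h := congrFun (VectorField.mlieBracketWithin_eq_lieBracketWithin (𝕜 := ℝ) (V := V)
    (W := W) (s := Set.univ)) u
  rw [VectorField.lieBracketWithin_univ] at h
  exact h

/-- Naturality of the bracket under pull-back by `φ.symm`. It reduces bracket computations on the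
manifolds to the model space. -/
theorem dchart_mlieBracket (hφ : φ ∈ IsManifold.maximalAtlas 𝓘(ℝ, H) ∞ M)
    {V W : ∀ x : M, TangentSpace 𝓘(ℝ, H) x} {U : Set M} (hU : IsOpen U)
    (hV : ContMDiffOn 𝓘(ℝ, H) 𝓘(ℝ, H).tangent ∞
      (fun x => (⟨x, V x⟩ : TangentBundle 𝓘(ℝ, H) M)) U)
    (hW : ContMDiffOn 𝓘(ℝ, H) 𝓘(ℝ, H).tangent ∞
      (fun x => (⟨x, W x⟩ : TangentBundle 𝓘(ℝ, H) M)) U) {x : M} (hx : x ∈ φ.source)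
    (hxU : x ∈ U) :
    dchart φ x (VectorField.mlieBracket 𝓘(ℝ, H) V W x) =
      VectorField.lieBracket ℝ (coordField φ V) (coordField φ W) (φ x) := by
  have hx' := φ.left_inv hx
  have hu := φ.map_source hx
  have hd : ∀ {V : ∀ x : M, TangentSpace 𝓘(ℝ, H) x}, ContMDiffOn 𝓘(ℝ, H) 𝓘(ℝ, H).tangent ∞
      (fun x => (⟨x, V x⟩ : TangentBundle 𝓘(ℝ, H) M)) U →
      MDifferentiableAt 𝓘(ℝ, H) 𝓘(ℝ, H).tangent
        (fun x => (⟨x, V x⟩ : TangentBundle 𝓘(ℝ, H) M)) (φ.symm (φ x)) := fun h => by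
    rw [hx']
    exact (h.contMDiffAt (hU.mem_nhds hxU)).mdifferentiableAt (by simp)
  have : IsManifold 𝓘(ℝ, H) (minSmoothness ℝ 2) M := by
    rw [minSmoothness_of_isRCLikeNormedField]; infer_instance
  have : IsManifold 𝓘(ℝ, H) (minSmoothness ℝ 2) H := by
    rw [minSmoothness_of_isRCLikeNormedField]; infer_instance
  have h1 := VectorField.mpullback_mlieBracket (n := 2) (hd hV) (hd hW)
    ((contMDiffAt_symm_of_mem_maximalAtlas hφ hu).of_le ENat.LEInfty.out) (by simp)
  rw [mpullback_symm hφ _ hu, coordField, hx'] at h1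
  have h2 : ∀ V : (∀ x : M, TangentSpace 𝓘(ℝ, H) x),
      VectorField.mpullback 𝓘(ℝ, H) 𝓘(ℝ, H) φ.symm V =ᶠ[𝓝 (φ x)] coordField φ V := fun V => by
    filter_upwards [φ.open_target.mem_nhds hu] with u hu' using mpullback_symm hφ V hu'
  rw [h1, (h2 V).mlieBracket_vectorField_eq (h2 W)]
  exact mlieBracket_eq_lieBracket _ _ _

theorem mlieBracket_liftField (hφ : φ ∈ IsManifold.maximalAtlas 𝓘(ℝ, H) ∞ M) {v w : H → H}
    {O : Set H} (hO : IsOpen O) (hv : ContDiffOn ℝ ∞ v O) (hw : ContDiffOn ℝ ∞ w O) {x : M}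
    (hx : x ∈ φ.source) (hxO : φ x ∈ O) :
    VectorField.mlieBracket 𝓘(ℝ, H) (liftField φ v) (liftField φ w) x =
      liftField φ (VectorField.lieBracket ℝ v w) x := by
  apply dchart_injective hφ hx
  rw [dchart_mlieBracket hφ (φ.isOpen_inter_preimage hO) (contMDiffOn_liftField hφ hO hv)
    (contMDiffOn_liftField hφ hO hw) hx ⟨hx, hxO⟩, liftField, dchart_inverse_apply hφ hx]
  have h2 : ∀ v : H → H, coordField φ (liftField φ v) =ᶠ[𝓝 (φ x)] v := fun v => by
    filter_upwards [φ.open_target.mem_nhds (φ.map_source hx)] with u hu' using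
      coordField_liftField hφ v hu'
  exact Filter.EventuallyEq.lieBracket_vectorField_eq (h2 v) (h2 w)

end Charts

end CartanDuality

end

/-! ### Brackets of distributions in coordinates; adapted charts of the projectivized distribution.
-/

open scoped Manifold ContDiff Topology

noncomputable section

namespace CartanDuality

section BracketFields

set_option linter.unusedSectionVars false

variable {H : Type*} [NormedAddCommGroup H] [NormedSpace ℝ H] [CompleteSpace H]
  {M : Type*} [TopologicalSpace M] [ChartedSpace H M] [IsManifold 𝓘(ℝ, H) ∞ M]
  {φ : OpenPartialHomeomorph M H}

/-- An upper bound for the coordinate expression of a bracket of distributions. -/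
theorem dchart_mem_of_mem_bracketField (hφ : φ ∈ IsManifold.maximalAtlas 𝓘(ℝ, H) ∞ M)
    {F G : ∀ x : M, Submodule ℝ (TangentSpace 𝓘(ℝ, H) x)} {F' G' : H → H → Prop}
    (hF : ∀ x ∈ φ.source, ∀ v ∈ F x, F' (φ x) (dchart φ x v))
    (hG : ∀ x ∈ φ.source, ∀ v ∈ G x, G' (φ x) (dchart φ x v)) {x : M} (hx : x ∈ φ.source)
    {P : Submodule ℝ H} (hFP : ∀ v, F' (φ x) v → v ∈ P) (hGP : ∀ v, G' (φ x) v → v ∈ P)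
    (hVW : ∀ V W : H → H, DifferentiableAt ℝ V (φ x) → DifferentiableAt ℝ W (φ x) →
      (∀ᶠ u in 𝓝 (φ x), F' u (V u)) → (∀ᶠ u in 𝓝 (φ x), G' u (W u)) →
      VectorField.lieBracket ℝ V W (φ x) ∈ P)
    {v : TangentSpace 𝓘(ℝ, H) x} (hv : v ∈ bracketField F G x) : dchart φ x v ∈ P := by
  -- The bracket field is a span, so it suffices to bound its generators: the two fields and the
  -- single brackets of sections, which are computed in the chart.
  suffices h : bracketField F G x ≤ P.comap (dchart φ x).toLinearMap from h hv
  refine sup_le (sup_le (fun v hv => hFP _ (hF x hx v hv)) fun v hv => hGP _ (hG x hx v hv)) ?_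
  rw [Submodule.span_le]
  rintro _ ⟨U, V, W, hxU, hV, hW, rfl⟩
  change dchart φ x _ ∈ P
  rw [dchart_mlieBracket hφ hV.isOpen hV.smooth hW.smooth hx hxU]
  have hu : φ x ∈ φ.target ∩ φ.symm ⁻¹' U :=
    ⟨φ.map_source hx, by rwa [Set.mem_preimage, φ.left_inv hx]⟩
  have hn := (φ.isOpen_inter_preimage_symm hV.isOpen).mem_nhds hu
  refine hVW _ _ ((contDiffOn_coordField hφ hV.isOpen hV.smooth).contDiffAt hn |>.differentiableAt
    (by simp)) ((contDiffOn_coordField hφ hV.isOpen hW.smooth).contDiffAt hn |>.differentiableAt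
    (by simp)) ?_ ?_
  · filter_upwards [hn] with u hu
    have h1 := hF _ (φ.map_target hu.1) _ (hV.mem _ hu.2)
    rwa [φ.right_inv hu.1] at h1
  · filter_upwards [hn] with u hu
    have h1 := hG _ (φ.map_target hu.1) _ (hW.mem _ hu.2)
    rwa [φ.right_inv hu.1] at h1

theorem isSectionOn_liftField (hφ : φ ∈ IsManifold.maximalAtlas 𝓘(ℝ, H) ∞ M)
    {F : ∀ x : M, Submodule ℝ (TangentSpace 𝓘(ℝ, H) x)} {v : H → H} {O : Set H} (hO : IsOpen O)
    (hv : ContDiffOn ℝ ∞ v O) (hF : ∀ x ∈ φ.source, φ x ∈ O → liftField φ v x ∈ F x) :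
    IsSectionOn (φ.source ∩ φ ⁻¹' O) F (liftField φ v) where
  isOpen := φ.isOpen_inter_preimage hO
  smooth := contMDiffOn_liftField hφ hO hv
  mem := fun x hx => hF x hx.1 hx.2

theorem liftField_lieBracket_mem (hφ : φ ∈ IsManifold.maximalAtlas 𝓘(ℝ, H) ∞ M)
    {F G : ∀ x : M, Submodule ℝ (TangentSpace 𝓘(ℝ, H) x)} {v w : H → H} {O : Set H}
    (hO : IsOpen O) (hv : ContDiffOn ℝ ∞ v O) (hw : ContDiffOn ℝ ∞ w O)
    (hF : ∀ x ∈ φ.source, φ x ∈ O → liftField φ v x ∈ F x)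
    (hG : ∀ x ∈ φ.source, φ x ∈ O → liftField φ w x ∈ G x) {x : M} (hx : x ∈ φ.source)
    (hxO : φ x ∈ O) : liftField φ (VectorField.lieBracket ℝ v w) x ∈ bracketField F G x := by
  rw [← mlieBracket_liftField hφ hO hv hw hx hxO]
  refine Submodule.mem_sup_right (Submodule.subset_span ?_)
  exact ⟨φ.source ∩ φ ⁻¹' O, liftField φ v, liftField φ w, ⟨hx, hxO⟩,
    isSectionOn_liftField hφ hO hv hF, isSectionOn_liftField hφ hO hw hG, rfl⟩

theorem coordField_apply {x : M} (hx : x ∈ φ.source) (V : ∀ x : M, TangentSpace 𝓘(ℝ, H) x) :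
    coordField φ V (φ x) = dchart φ x (V x) := by
  rw [coordField, φ.left_inv hx]

theorem contDiffOn_lieBracket {v w : H → H} {O : Set H} (hO : IsOpen O)
    (hv : ContDiffOn ℝ ∞ v O) (hw : ContDiffOn ℝ ∞ w O) :
    ContDiffOn ℝ ∞ (VectorField.lieBracket ℝ v w) O :=
  ((hw.fderiv_of_isOpen hO (m := ∞) (by simp)).clm_apply hv).sub
    ((hv.fderiv_of_isOpen hO (m := ∞) (by simp)).clm_apply hw)

end BracketFields

theorem lieBracket_congr_of_isOpen {H : Type*} [NormedAddCommGroup H] [NormedSpace ℝ H]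
    {V V' W W' : H → H} {O : Set H} (hO : IsOpen O) (hV : Set.EqOn V V' O) (hW : Set.EqOn W W' O)
    {u : H} (hu : u ∈ O) : VectorField.lieBracket ℝ V W u = VectorField.lieBracket ℝ V' W' u :=
  Filter.EventuallyEq.lieBracket_vectorField_eq (Filter.mem_of_superset (hO.mem_nhds hu) hV)
    (Filter.mem_of_superset (hO.mem_nhds hu) hW)

/-- The frame generated by two vector fields. -/
def generatedFrame (e₀ e₁ : E5 → E5) : Fin 5 → E5 → E5 :=
  ![e₀, e₁, VectorField.lieBracket ℝ e₀ e₁,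
    VectorField.lieBracket ℝ e₀ (VectorField.lieBracket ℝ e₀ e₁),
    VectorField.lieBracket ℝ e₁ (VectorField.lieBracket ℝ e₀ e₁)]

theorem isAdaptedFrame_generatedFrame {O : Set E5} (hO : IsOpen O) {e₀ e₁ : E5 → E5}
    (h₀ : ContDiffOn ℝ ∞ e₀ O) (h₁ : ContDiffOn ℝ ∞ e₁ O)
    (hi : ∀ y ∈ O, LinearIndependent ℝ fun i => generatedFrame e₀ e₁ i y) :
    IsAdaptedFrame O (generatedFrame e₀ e₁) where
  isOpen := hO
  smooth := by
    have h2 := contDiffOn_lieBracket hO h₀ h₁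
    intro i
    fin_cases i
    · exact h₀
    · exact h₁
    · exact h2
    · exact contDiffOn_lieBracket hO h₀ h2
    · exact contDiffOn_lieBracket hO h₁ h2
  indep := hi
  bracket01 := fun _ _ => rfl
  bracket02 := fun _ _ => rfl
  bracket12 := fun _ _ => rfl

theorem lieBracket_neg_right {H : Type*} [NormedAddCommGroup H] [NormedSpace ℝ H] (V W : H → H)
    (u : H) : VectorField.lieBracket ℝ V (-W) u = -VectorField.lieBracket ℝ V W u := by
  simp only [VectorField.lieBracket, fderiv_neg, Pi.neg_apply, map_neg]
  simp
  abel

/-- Exchanging the two generators. -/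
theorem linearIndependent_generatedFrame_swap {e₀ e₁ : E5 → E5} {y : E5}
    (hi : LinearIndependent ℝ fun i => generatedFrame e₀ e₁ i y) :
    LinearIndependent ℝ fun i => generatedFrame e₁ e₀ i y := by
  have h2 : VectorField.lieBracket ℝ e₁ e₀ = -VectorField.lieBracket ℝ e₀ e₁ := by
    funext x
    rw [VectorField.lieBracket_swap]
    rfl
  rw [Fintype.linearIndependent_iff] at hi ⊢
  intro g hg
  -- The exchange swaps `e 0` with `e 1`, negates `e 2`, and turns `e 3`, `e 4` into `-e 4`, `-e 3`.
  have h3 := hi ![g 1, g 0, -g 2, -g 4, -g 3] (by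
    rw [← hg, Fin.sum_univ_five, Fin.sum_univ_five]
    simp only [generatedFrame, h2, Matrix.cons_val, lieBracket_neg_right, Pi.neg_apply]
    module)
  intro i
  fin_cases i
  · exact h3 1
  · exact h3 0
  · exact neg_eq_zero.1 (h3 2)
  · exact neg_eq_zero.1 (h3 4)
  · exact neg_eq_zero.1 (h3 3)

section Adapted

variable {Y : Type*} [TopologicalSpace Y] [ChartedSpace E5 Y] [IsManifold 𝓘(ℝ, E5) ∞ Y]
  {D : PlaneField Y}

/-- An affine chart `κ` of `P(D)` over the chart `ψ` of `Y`, such that `e` is the coordinate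
expression of a frame adapted to `D`: the line of `κ⁻¹ (y, t)` is spanned by `e 0 + t e 1`. -/
structure IsAdaptedChart (D : PlaneField Y)
    (κ : OpenPartialHomeomorph (ProjSpace D) (E5 × ℝ)) (ψ : OpenPartialHomeomorph Y E5)
    (O : Set E5) (e : Fin 5 → E5 → E5) : Prop where
  mem_atlas : κ ∈ IsManifold.maximalAtlas 𝓘(ℝ, E5 × ℝ) ∞ (ProjSpace D)
  base_mem_atlas : ψ ∈ IsManifold.maximalAtlas 𝓘(ℝ, E5) ∞ Y
  frame : IsAdaptedFrame O e
  subset_target : O ⊆ ψ.target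
  target_eq : κ.target = O ×ˢ Set.univ
  base_mem : ∀ z ∈ κ.source, z.base ∈ ψ.source
  apply_fst : ∀ z ∈ κ.source, (κ z).1 = ψ z.base
  line_eq : ∀ z ∈ κ.source, z.line =
    Submodule.span ℝ {(dchart ψ z.base).inverse (lineField e (κ z).2 (κ z).1)}
  mem_space : ∀ y ∈ ψ.source, ψ y ∈ O → ∀ v, v ∈ D.space y ↔
    ∃ a b : ℝ, dchart ψ y v = a • e 0 (ψ y) + b • e 1 (ψ y)
  mem_source : ∀ z : ProjSpace D, z.base ∈ ψ.source → ψ z.base ∈ O → ∀ t : ℝ,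
    (dchart ψ z.base).inverse (lineField e t (ψ z.base)) ∈ z.line →
    z ∈ κ.source ∧ κ z = (ψ z.base, t)

/-- The affine charts as open partial homeomorphisms. -/
def zchart {U : Set Y} {η : Fin 2 → ∀ y : Y, TangentSpace 𝓘(ℝ, E5) y}
    (h : IsFrameOf U D.space η) (a : Y) (z₀ : ProjSpace D) :
    OpenPartialHomeomorph (ProjSpace D) (E5 × ℝ) :=
  (ProjSpace.atlasCore D).openPartialHomeomorph (ProjSpace.affineChart h a z₀)
    ⟨U, η, h, a, z₀, rfl⟩

theorem zchart_mem_maximalAtlas {U : Set Y} {η : Fin 2 → ∀ y : Y, TangentSpace 𝓘(ℝ, E5) y}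
    (h : IsFrameOf U D.space η) (a : Y) (z₀ : ProjSpace D) :
    zchart h a z₀ ∈ IsManifold.maximalAtlas 𝓘(ℝ, E5 × ℝ) ∞ (ProjSpace D) := by
  refine IsManifold.subset_maximalAtlas ?_
  change zchart h a z₀ ∈ ⋃ (e : PartialEquiv (ProjSpace D) (E5 × ℝ))
    (he : e ∈ (ProjSpace.atlasCore D).atlas), {(ProjSpace.atlasCore D).openPartialHomeomorph e he}
  simp only [Set.mem_iUnion, Set.mem_singleton_iff]
  exact ⟨_, ⟨U, η, h, a, z₀, rfl⟩, rfl⟩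

/-- The coordinate expression of an adapted frame of `D`. -/
theorem linearIndependent_generatedFrame {U : Set Y}
    {η : Fin 2 → ∀ y : Y, TangentSpace 𝓘(ℝ, E5) y} (h : IsFrameOf U D.space η)
    {ψ : OpenPartialHomeomorph Y E5} (hψ : ψ ∈ IsManifold.maximalAtlas 𝓘(ℝ, E5) ∞ Y) {y : E5}
    (hy : y ∈ ψ.target ∩ ψ.symm ⁻¹' U)
    (h5 : LinearIndependent ℝ ![η 0 (ψ.symm y), η 1 (ψ.symm y),
      VectorField.mlieBracket 𝓘(ℝ, E5) (η 0) (η 1) (ψ.symm y),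
      VectorField.mlieBracket 𝓘(ℝ, E5) (η 0)
        (VectorField.mlieBracket 𝓘(ℝ, E5) (η 0) (η 1)) (ψ.symm y),
      VectorField.mlieBracket 𝓘(ℝ, E5) (η 1)
        (VectorField.mlieBracket 𝓘(ℝ, E5) (η 0) (η 1)) (ψ.symm y)]) :
    LinearIndependent ℝ fun i => generatedFrame (coordField ψ (η 0)) (coordField ψ (η 1)) i y := by
  set e₀ := coordField ψ (η 0)
  set e₁ := coordField ψ (η 1)
  set O := ψ.target ∩ ψ.symm ⁻¹' U
  have hO : IsOpen O := ψ.isOpen_inter_preimage_symm h.isOpen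
  have hc : ∀ i, ContDiffOn ℝ ∞ (coordField ψ (η i)) O := fun i =>
    contDiffOn_coordField hψ h.isOpen (h.smooth i)
  set B := VectorField.mlieBracket 𝓘(ℝ, E5) (η 0) (η 1) with hB
  have hBc : ∀ u ∈ O, coordField ψ B u = VectorField.lieBracket ℝ e₀ e₁ u := fun u hu => by
    rw [coordField, hB, dchart_mlieBracket hψ h.isOpen (h.smooth 0) (h.smooth 1)
      (ψ.map_target hu.1) hu.2, ψ.right_inv hu.1]
  have hBl : ∀ x ∈ ψ.source ∩ ψ ⁻¹' O, B x = liftField ψ (VectorField.lieBracket ℝ e₀ e₁) x := by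
    intro x hx
    rw [← liftField_coordField hψ B hx.1, liftField, liftField, hBc _ hx.2]
  have hBs : ContMDiffOn 𝓘(ℝ, E5) 𝓘(ℝ, E5).tangent ∞
      (fun x => (⟨x, B x⟩ : TangentBundle 𝓘(ℝ, E5) Y)) (ψ.source ∩ ψ ⁻¹' O) :=
    (contMDiffOn_liftField hψ hO (contDiffOn_lieBracket hO (hc 0) (hc 1))).congr
      fun x hx => by rw [hBl x hx]
  have hoS : IsOpen (ψ.source ∩ ψ ⁻¹' O) := ψ.isOpen_inter_preimage hO
  have hsub : ψ.source ∩ ψ ⁻¹' O ⊆ U := by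
    rintro x ⟨hx, hx2⟩
    have := hx2.2
    rwa [Set.mem_preimage, ψ.left_inv hx] at this
  have hys : ψ.symm y ∈ ψ.source ∩ ψ ⁻¹' O :=
    ⟨ψ.map_target hy.1, by rwa [Set.mem_preimage, ψ.right_inv hy.1]⟩
  have h2 : ∀ i, dchart ψ (ψ.symm y) (VectorField.mlieBracket 𝓘(ℝ, E5) (η i) B (ψ.symm y)) =
      VectorField.lieBracket ℝ (coordField ψ (η i)) (VectorField.lieBracket ℝ e₀ e₁) y := by
    intro i
    rw [dchart_mlieBracket hψ hoS ((h.smooth i).mono hsub) hBs (ψ.map_target hy.1) hys,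
      ψ.right_inv hy.1]
    exact lieBracket_congr_of_isOpen hO (fun _ _ => rfl) hBc hy
  have h3 := h5.map' (dchart ψ (ψ.symm y)).toLinearMap
    (LinearMap.ker_eq_bot.2 (dchart_injective hψ (ψ.map_target hy.1)))
  suffices h4 : (fun i => generatedFrame e₀ e₁ i y) = (dchart ψ (ψ.symm y)).toLinearMap ∘
      ![η 0 (ψ.symm y), η 1 (ψ.symm y), B (ψ.symm y),
        VectorField.mlieBracket 𝓘(ℝ, E5) (η 0) B (ψ.symm y),
        VectorField.mlieBracket 𝓘(ℝ, E5) (η 1) B (ψ.symm y)] by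
    rw [h4]; exact h3
  funext i
  fin_cases i
  · rfl
  · rfl
  · exact (hBc y hy).symm
  · exact (h2 0).symm
  · exact (h2 1).symm

theorem isAdaptedChart_zchart {U : Set Y} {η : Fin 2 → ∀ y : Y, TangentSpace 𝓘(ℝ, E5) y}
    (h : IsFrameOf U D.space η) (a : Y) (z₀ : ProjSpace D)
    (hi : ∀ y ∈ (chartAt E5 a).target ∩ (chartAt E5 a).symm ⁻¹' U, LinearIndependent ℝ fun i =>
      generatedFrame (coordField (chartAt E5 a) (η 0)) (coordField (chartAt E5 a) (η 1)) i y) :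
    IsAdaptedChart D (zchart h a z₀) (chartAt E5 a)
      ((chartAt E5 a).target ∩ (chartAt E5 a).symm ⁻¹' U)
      (generatedFrame (coordField (chartAt E5 a) (η 0)) (coordField (chartAt E5 a) (η 1))) := by
  set ψ := chartAt E5 a with hψd
  have hψ : ψ ∈ IsManifold.maximalAtlas 𝓘(ℝ, E5) ∞ Y :=
    IsManifold.chart_mem_maximalAtlas a
  have hO : IsOpen (ψ.target ∩ ψ.symm ⁻¹' U) := ψ.isOpen_inter_preimage_symm h.isOpen
  have hline : ∀ y ∈ ψ.source, ∀ t : ℝ, (dchart ψ y).inverse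
      (lineField (generatedFrame (coordField ψ (η 0)) (coordField ψ (η 1))) t (ψ y)) =
      η 0 y + t • η 1 y := by
    intro y hy t
    have h1 : lineField (generatedFrame (coordField ψ (η 0)) (coordField ψ (η 1))) t (ψ y) =
        dchart ψ y (η 0 y + t • η 1 y) := by
      rw [map_add, map_smul, ← coordField_apply hy, ← coordField_apply hy]
      rfl
    rw [h1, inverse_dchart_apply hψ hy]
  refine
    { mem_atlas := zchart_mem_maximalAtlas h a z₀
      base_mem_atlas := hψ
      frame := isAdaptedFrame_generatedFrame hO (contDiffOn_coordField hψ h.isOpen (h.smooth 0))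
        (contDiffOn_coordField hψ h.isOpen (h.smooth 1)) hi
      subset_target := Set.inter_subset_left
      target_eq := ?_
      base_mem := fun z hz => hz.1
      apply_fst := fun z hz => rfl
      line_eq := ?_
      mem_space := ?_
      mem_source := ?_ }
  · ext p
    change (p.1 ∈ ψ.target ∧ ψ.symm p.1 ∈ U) ↔ _
    simp
  · intro z hz
    have hz' : z.base ∈ ψ.source ∧ z.base ∈ U ∧ η 1 z.base ∉ z.line := hz
    obtain ⟨α, β, hab, hl⟩ := ProjSpace.exists_coeff h z hz'.2.1
    have hα := (ProjSpace.notMem_line_iff h z hz'.2.1 hab hl).1 hz'.2.2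
    have hs : (zchart h a z₀ z).2 = β / α := ProjSpace.slope_eq h z hz'.2.1 hα hl
    change z.line = Submodule.span ℝ {(dchart ψ z.base).inverse (lineField _ _ (ψ z.base))}
    rw [hline _ hz'.1, hs, hl]
    have e2 : α • η 0 z.base + β • η 1 z.base = α • (η 0 z.base + (β / α) • η 1 z.base) := by
      rw [smul_add, smul_smul, mul_div_cancel₀ _ hα]
    rw [e2, Submodule.span_singleton_smul_eq (IsUnit.mk0 _ hα)]
  · intro y hy hyO v
    have hyU : y ∈ U := by
      have := hyO.2
      rwa [Set.mem_preimage, ψ.left_inv hy] at this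
    have hr : (Set.range fun i => η i y) = {η 0 y, η 1 y} := by
      ext w; simp [Fin.exists_fin_two, eq_comm]
    rw [← h.span_eq y hyU, hr, Submodule.mem_span_pair]
    refine exists_congr fun p => exists_congr fun q => ?_
    have h1 : p • generatedFrame (coordField ψ (η 0)) (coordField ψ (η 1)) 0 (ψ y) +
        q • generatedFrame (coordField ψ (η 0)) (coordField ψ (η 1)) 1 (ψ y) =
        dchart ψ y (p • η 0 y + q • η 1 y) := by
      rw [map_add, map_smul, map_smul, ← coordField_apply hy, ← coordField_apply hy]
      rfl
    rw [h1, (dchart_injective hψ hy).eq_iff, eq_comm]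
  · intro z hz hzO t ht
    have hzU : z.base ∈ U := by
      have := hzO.2
      rwa [Set.mem_preimage, ψ.left_inv hz] at this
    rw [hline _ hz] at ht
    obtain ⟨α, β, hab, hl⟩ := ProjSpace.exists_coeff h z hzU
    have h1 := ht
    rw [hl] at h1
    have h2 := (ProjSpace.mem_span_comb (s := 1) (t := t) (h.linearIndependent _ hzU) hab).1
      (by rwa [one_smul])
    rw [one_mul] at h2
    have hα : α ≠ 0 := by
      rintro rfl
      rw [mul_zero] at h2
      simp [h2] at hab
    refine ⟨⟨hz, hzU, (ProjSpace.notMem_line_iff h z hzU hab hl).2 hα⟩, Prod.ext rfl ?_⟩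
    have hs : (zchart h a z₀ z).2 = β / α := ProjSpace.slope_eq h z hzU hα hl
    rw [hs, h2, mul_div_cancel_right₀ _ hα]

theorem IsFrameOf.swap {U : Set Y} {η : Fin 2 → ∀ y : Y, TangentSpace 𝓘(ℝ, E5) y}
    (h : IsFrameOf U D.space η) : IsFrameOf U D.space (fun i => η (Equiv.swap 0 1 i)) where
  isOpen := h.isOpen
  smooth := fun i => h.smooth _
  linearIndependent := fun x hx => (h.linearIndependent x hx).comp _ (Equiv.swap 0 1).injective
  span_eq := fun x hx => by
    rw [← h.span_eq x hx]
    exact congrArg _ ((Equiv.swap (0 : Fin 2) 1).surjective.range_comp fun i => η i x)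

/-- Every point of `P(D)` lies in an adapted chart. -/
theorem exists_isAdaptedChart (hD : D.Is235) (z : ProjSpace D) :
    ∃ κ ψ O e, IsAdaptedChart D κ ψ O e ∧ z ∈ κ.source := by
  obtain ⟨U, η, hzU, h, h5⟩ := hD z.base
  set ψ := chartAt E5 z.base with hψd
  have hψ : ψ ∈ IsManifold.maximalAtlas 𝓘(ℝ, E5) ∞ Y := IsManifold.chart_mem_maximalAtlas _
  have hi : ∀ y ∈ ψ.target ∩ ψ.symm ⁻¹' U, LinearIndependent ℝ fun i =>
      generatedFrame (coordField ψ (η 0)) (coordField ψ (η 1)) i y := fun y hy =>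
    linearIndependent_generatedFrame h hψ hy (h5 _ hy.2)
  obtain ⟨α, β, hab, hl⟩ := ProjSpace.exists_coeff h z hzU
  -- The line of the second frame vector is the point at infinity of the affine chart; there the
  -- frame is taken in the other order.
  by_cases hα : α = 0
  · have hβ : β ≠ 0 := by simpa [hα] using hab
    refine ⟨_, _, _, _, isAdaptedChart_zchart h.swap z.base z fun y hy =>
      linearIndependent_generatedFrame_swap (hi y hy), mem_chart_source _ _, hzU, ?_⟩
    refine (ProjSpace.notMem_line_iff (α := β) (β := α) h.swap z hzU (Or.inl hβ) ?_).2 hβ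
    rw [hl, add_comm]
    simp
  · exact ⟨_, _, _, _, isAdaptedChart_zchart h z.base z hi, mem_chart_source _ _, hzU,
      (ProjSpace.notMem_line_iff h z hzU hab hl).2 hα⟩

end Adapted

end CartanDuality

end

/-! ### The derived systems of the prolongation. -/

open scoped Manifold ContDiff Topology

noncomputable section

namespace CartanDuality

namespace IsAdaptedFrame

variable {O : Set E5} {e : Fin 5 → E5 → E5}

theorem coframe_lineField (h : IsAdaptedFrame O e) {y : E5} (hy : y ∈ O) (t : ℝ) (i : Fin 5) :
    coframe e i y (lineField e t y) = (if i = 0 then 1 else 0) + t * (if i = 1 then 1 else 0) := by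
  simp [lineField, h.coframe_apply hy]

theorem coframe_topField (h : IsAdaptedFrame O e) {y : E5} (hy : y ∈ O) (t : ℝ) (i : Fin 5) :
    coframe e i y (topField e t y) = (if i = 3 then 1 else 0) + t * (if i = 4 then 1 else 0) := by
  simp [topField, h.coframe_apply hy]

/-- A form on the base evaluated on the bracket of two fields that it annihilates. -/
theorem coframe_lieBracket_fst (h : IsAdaptedFrame O e) {u : E5 × ℝ} (hu : u.1 ∈ O) (i : Fin 5)
    {V W : E5 × ℝ → E5 × ℝ} (hV : DifferentiableAt ℝ V u) (hW : DifferentiableAt ℝ W u)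
    (hV0 : ∀ᶠ u in 𝓝 u, coframe e i u.1 (V u).1 = 0)
    (hW0 : ∀ᶠ u in 𝓝 u, coframe e i u.1 (W u).1 = 0) :
    coframe e i u.1 (VectorField.lieBracket ℝ V W u).1 =
      -dForm (coframe e i) u.1 (V u).1 (W u).1 := by
  have hd : HasFDerivAt (fun u : E5 × ℝ => coframe e i u.1)
      ((fderiv ℝ (coframe e i) u.1).comp (ContinuousLinearMap.fst ℝ E5 ℝ)) u :=
    (h.differentiableAt_coframe hu i).hasFDerivAt.comp u hasFDerivAt_fst
  have hd2 := hd.clm_comp (hasFDerivAt_const (ContinuousLinearMap.fst ℝ E5 ℝ) u)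
  have h1 := apply_lieBracket_of_mem_ker hd2.differentiableAt hV hW hV0 hW0
  rw [dForm, hd2.fderiv] at h1
  simpa [dForm] using h1

theorem lieBracket_lineField_one (h : IsAdaptedFrame O e) (t : ℝ) {y : E5} (hy : y ∈ O) :
    VectorField.lieBracket ℝ (lineField e t) (e 1) y = e 2 y := by
  rw [h.lieBracket_lineField t hy, h.bracket01 y hy, lieBracket_self]; simp

theorem lieBracket_lineField_two (h : IsAdaptedFrame O e) (t : ℝ) {y : E5} (hy : y ∈ O) :
    VectorField.lieBracket ℝ (lineField e t) (e 2) y = topField e t y := by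
  rw [h.lieBracket_lineField t hy, h.bracket02 y hy, h.bracket12 y hy]; rfl

end IsAdaptedFrame

theorem le_bracketField_left {H : Type*} [NormedAddCommGroup H] [NormedSpace ℝ H]
    {M : Type*} [TopologicalSpace M] [ChartedSpace H M] [IsManifold 𝓘(ℝ, H) ∞ M]
    (F G : ∀ x : M, Submodule ℝ (TangentSpace 𝓘(ℝ, H) x)) (x : M) : F x ≤ bracketField F G x :=
  le_sup_left.trans le_sup_left

theorem le_bracketField_right {H : Type*} [NormedAddCommGroup H] [NormedSpace ℝ H]
    {M : Type*} [TopologicalSpace M] [ChartedSpace H M] [IsManifold 𝓘(ℝ, H) ∞ M]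
    (F G : ∀ x : M, Submodule ℝ (TangentSpace 𝓘(ℝ, H) x)) (x : M) : G x ≤ bracketField F G x :=
  le_sup_right.trans le_sup_left

namespace IsAdaptedChart

variable {Y : Type*} [TopologicalSpace Y] [ChartedSpace E5 Y] [IsManifold 𝓘(ℝ, E5) ∞ Y]
  {D : PlaneField Y} {κ : OpenPartialHomeomorph (ProjSpace D) (E5 × ℝ)}
  {ψ : OpenPartialHomeomorph Y E5} {O : Set E5} {e : Fin 5 → E5 → E5} {z : ProjSpace D}

theorem fst_mem (h : IsAdaptedChart D κ ψ O e) (hz : z ∈ κ.source) : (κ z).1 ∈ O := by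
  have := κ.map_source hz
  rw [h.target_eq] at this
  exact this.1

theorem contMDiffOn_base (h : IsAdaptedChart D κ ψ O e) :
    ContMDiffOn 𝓘(ℝ, E5 × ℝ) 𝓘(ℝ, E5) ∞ (ProjSpace.base : ProjSpace D → Y) κ.source := by
  have h1 : ContMDiffOn 𝓘(ℝ, E5 × ℝ) 𝓘(ℝ, E5) ∞ (fun z => (κ z).1) κ.source :=
    (contDiff_fst.contMDiff (n := ∞)).comp_contMDiffOn
      (contMDiffOn_of_mem_maximalAtlas h.mem_atlas)
  refine ((contMDiffOn_symm_of_mem_maximalAtlas h.base_mem_atlas).comp h1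
    fun z hz => h.subset_target (h.fst_mem hz)).congr fun z hz => ?_
  rw [Function.comp_apply, h.apply_fst z hz, ψ.left_inv (h.base_mem z hz)]

theorem dchart_dproj (h : IsAdaptedChart D κ ψ O e) (hz : z ∈ κ.source)
    (w : TangentSpace 𝓘(ℝ, E5 × ℝ) z) :
    dchart ψ z.base (dproj D z w) = (dchart κ z w).1 := by
  have hb : MDifferentiableAt 𝓘(ℝ, E5 × ℝ) 𝓘(ℝ, E5) (ProjSpace.base : ProjSpace D → Y) z :=
    (h.contMDiffOn_base.contMDiffAt (κ.open_source.mem_nhds hz)).mdifferentiableAt (by simp)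
  have hψ : MDifferentiableAt 𝓘(ℝ, E5) 𝓘(ℝ, E5) ψ z.base :=
    (mdifferentiable_of_mem_maximalAtlas h.base_mem_atlas).mdifferentiableAt (h.base_mem z hz)
  have hκ : MDifferentiableAt 𝓘(ℝ, E5 × ℝ) 𝓘(ℝ, E5 × ℝ) κ z :=
    (mdifferentiable_of_mem_maximalAtlas h.mem_atlas).mdifferentiableAt hz
  have h1 := (hψ.hasMFDerivAt.comp z hb.hasMFDerivAt)
  have h2 := ((ContinuousLinearMap.fst ℝ E5 ℝ).hasMFDerivAt (x := κ z)).comp z hκ.hasMFDerivAt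
  have h3 : (ψ ∘ (ProjSpace.base : ProjSpace D → Y)) =ᶠ[𝓝 z]
      (ContinuousLinearMap.fst ℝ E5 ℝ) ∘ κ := by
    filter_upwards [κ.open_source.mem_nhds hz] with z hz using (h.apply_fst z hz).symm
  have h4 := hasMFDerivAt_unique h1 (h2.congr_of_eventuallyEq h3)
  exact DFunLike.congr_fun h4 w

theorem mem_vertical (h : IsAdaptedChart D κ ψ O e) (hz : z ∈ κ.source)
    (w : TangentSpace 𝓘(ℝ, E5 × ℝ) z) : w ∈ vertical D z ↔ (dchart κ z w).1 = 0 := by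
  rw [← h.dchart_dproj hz, map_eq_zero_iff _ (dchart_injective h.base_mem_atlas (h.base_mem z hz))]
  exact LinearMap.mem_ker

theorem mem_line (h : IsAdaptedChart D κ ψ O e) (hz : z ∈ κ.source)
    (v : TangentSpace 𝓘(ℝ, E5) z.base) : v ∈ z.line ↔
      ∃ c : ℝ, dchart ψ z.base v = c • lineField e (κ z).2 (κ z).1 := by
  have hi := dchart_injective h.base_mem_atlas (h.base_mem z hz)
  rw [h.line_eq z hz, Submodule.mem_span_singleton]
  refine exists_congr fun c => ?_
  rw [← hi.eq_iff, map_smul, dchart_inverse_apply h.base_mem_atlas (h.base_mem z hz), eq_comm]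

theorem mem_prolongation (h : IsAdaptedChart D κ ψ O e) (hz : z ∈ κ.source)
    (w : TangentSpace 𝓘(ℝ, E5 × ℝ) z) : w ∈ prolongation D z ↔
      ∃ c : ℝ, (dchart κ z w).1 = c • lineField e (κ z).2 (κ z).1 := by
  rw [← h.dchart_dproj hz]
  exact h.mem_line hz _

/-- At every point two sections of `E` project to multiples of the same vector `e 0 + t e 1`. So
`dε_i` vanishes on them, and a form that kills `e 0` and `e 1` also kills the projection of their
bracket. -/
theorem coframe_of_mem_derived_one (h : IsAdaptedChart D κ ψ O e) (hz : z ∈ κ.source)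
    {w : TangentSpace 𝓘(ℝ, E5 × ℝ) z} (hw : w ∈ derivedSystem (prolongation D) 1 z) {i : Fin 5}
    (hi0 : i ≠ 0) (hi1 : i ≠ 1) : coframe e i (κ z).1 (dchart κ z w).1 = 0 := by
  have hcof : ∀ u : E5 × ℝ, u.1 ∈ O → ∀ v : E5 × ℝ, (∃ c : ℝ, v.1 = c • lineField e u.2 u.1) →
      coframe e i u.1 v.1 = 0 := by
    rintro u hu v ⟨c, hc⟩
    rw [hc, map_smul, h.frame.coframe_lineField hu]
    simp [hi0, hi1]
  let P : Submodule ℝ (E5 × ℝ) :=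
    LinearMap.ker ((coframe e i (κ z).1).comp (ContinuousLinearMap.fst ℝ E5 ℝ)).toLinearMap
  have hO := (h.frame.isOpen.preimage continuous_fst).mem_nhds (h.fst_mem hz)
  refine dchart_mem_of_mem_bracketField (P := P) h.mem_atlas
    (F' := fun u v => ∃ c : ℝ, v.1 = c • lineField e u.2 u.1)
    (G' := fun u v => ∃ c : ℝ, v.1 = c • lineField e u.2 u.1)
    (fun z hz v hv => (h.mem_prolongation hz v).1 hv)
    (fun z hz v hv => (h.mem_prolongation hz v).1 hv) hz
    (fun v hv => hcof _ (h.fst_mem hz) v hv) (fun v hv => hcof _ (h.fst_mem hz) v hv) ?_ hw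
  intro V W hV hW hV' hW'
  change coframe e i (κ z).1 (VectorField.lieBracket ℝ V W (κ z)).1 = 0
  rw [h.frame.coframe_lieBracket_fst (h.fst_mem hz) i hV hW]
  · obtain ⟨c, hc⟩ := hV'.self_of_nhds
    obtain ⟨d, hd⟩ := hW'.self_of_nhds
    rw [hc, hd, dForm_smul_left, dForm_smul_right, dForm_self]; simp
  · filter_upwards [hV', hO] with u hu hu' using hcof u hu' _ hu
  · filter_upwards [hW', hO] with u hu hu' using hcof u hu' _ hu

/-- On the span of `e 0` and `e 1` the value of `dε_i` is a multiple of `ε_i (e 2)`: bracketing `E`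
with its first derived system produces no base direction beyond `e 2`. -/
theorem coframe_of_mem_derived_two (h : IsAdaptedChart D κ ψ O e) (hz : z ∈ κ.source)
    {w : TangentSpace 𝓘(ℝ, E5 × ℝ) z} (hw : w ∈ derivedSystem (prolongation D) 2 z) {i : Fin 5}
    (hi0 : i ≠ 0) (hi1 : i ≠ 1) (hi2 : i ≠ 2) : coframe e i (κ z).1 (dchart κ z w).1 = 0 := by
  have hcof : ∀ u : E5 × ℝ, u.1 ∈ O → ∀ v : E5 × ℝ, (∃ c : ℝ, v.1 = c • lineField e u.2 u.1) →
      coframe e i u.1 v.1 = 0 := by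
    rintro u hu v ⟨c, hc⟩
    rw [hc, map_smul, h.frame.coframe_lineField hu]
    simp [hi0, hi1]
  let P : Submodule ℝ (E5 × ℝ) :=
    LinearMap.ker ((coframe e i (κ z).1).comp (ContinuousLinearMap.fst ℝ E5 ℝ)).toLinearMap
  have hO := (h.frame.isOpen.preimage continuous_fst).mem_nhds (h.fst_mem hz)
  refine dchart_mem_of_mem_bracketField (P := P) h.mem_atlas
    (F' := fun u v => ∃ c : ℝ, v.1 = c • lineField e u.2 u.1)
    (G' := fun u v => coframe e 2 u.1 v.1 = 0 ∧ coframe e 3 u.1 v.1 = 0 ∧ coframe e 4 u.1 v.1 = 0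
      ∧ coframe e i u.1 v.1 = 0)
    (fun z hz v hv => (h.mem_prolongation hz v).1 hv)
    (fun z hz v hv => ⟨h.coframe_of_mem_derived_one hz hv (by simp) (by simp),
      h.coframe_of_mem_derived_one hz hv (by simp) (by simp),
      h.coframe_of_mem_derived_one hz hv (by simp) (by simp),
      h.coframe_of_mem_derived_one hz hv hi0 hi1⟩) hz
    (fun v hv => hcof _ (h.fst_mem hz) v hv) (fun v hv => hv.2.2.2) ?_ hw
  intro V W hV hW hV' hW'
  change coframe e i (κ z).1 (VectorField.lieBracket ℝ V W (κ z)).1 = 0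
  rw [h.frame.coframe_lieBracket_fst (h.fst_mem hz) i hV hW]
  · obtain ⟨c, hc⟩ := hV'.self_of_nhds
    obtain ⟨h2, h3, h4, -⟩ := hW'.self_of_nhds
    rw [hc, h.frame.sum_coframe (h.fst_mem hz) (W (κ z)).1, h2, h3, h4, lineField]
    simp only [dForm_add_left, dForm_add_right, dForm_smul_left, dForm_smul_right, dForm_self,
      h.frame.dForm_coframe_frame i (h.fst_mem hz), h.frame.bracket01 _ (h.fst_mem hz),
      h.frame.lieBracket10 (h.fst_mem hz), map_neg, h.frame.coframe_apply (h.fst_mem hz), hi2]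
    simp
  · filter_upwards [hV', hO] with u hu hu' using hcof u hu' _ hu
  · filter_upwards [hW'] with u hu using hu.2.2.2

/-- The new direction is `[e 0 + t e 1, e 2] = e 3 + t e 4`, which the form kills. The vertical
components of the two sections play no role, since they are multiplied by ε₃, which vanishes on
both. -/
theorem charForm_of_mem_derived_three (h : IsAdaptedChart D κ ψ O e) (hz : z ∈ κ.source)
    {w : TangentSpace 𝓘(ℝ, E5 × ℝ) z} (hw : w ∈ derivedSystem (prolongation D) 3 z) :
    charForm e (κ z) (dchart κ z w) = 0 := by
  have hcof : ∀ u : E5 × ℝ, u.1 ∈ O → ∀ v : E5 × ℝ, (∃ c : ℝ, v.1 = c • lineField e u.2 u.1) →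
      charForm e u v = 0 := by
    rintro u hu v ⟨c, hc⟩
    rw [IsAdaptedFrame.charForm_apply, hc, map_smul, map_smul, h.frame.coframe_lineField hu,
      h.frame.coframe_lineField hu]
    simp
  have hcof2 : ∀ u : E5 × ℝ, ∀ v : E5 × ℝ, (coframe e 3 u.1 v.1 = 0 ∧ coframe e 4 u.1 v.1 = 0) →
      charForm e u v = 0 := by
    rintro u v ⟨h3, h4⟩
    rw [IsAdaptedFrame.charForm_apply, h3, h4]; simp
  have hu := h.fst_mem hz
  have hO := (h.frame.isOpen.preimage continuous_fst).mem_nhds hu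
  refine dchart_mem_of_mem_bracketField (P := LinearMap.ker (charForm e (κ z)).toLinearMap)
    h.mem_atlas
    (F' := fun u v => ∃ c : ℝ, v.1 = c • lineField e u.2 u.1)
    (G' := fun u v => coframe e 3 u.1 v.1 = 0 ∧ coframe e 4 u.1 v.1 = 0)
    (fun z hz v hv => (h.mem_prolongation hz v).1 hv)
    (fun z hz v hv => ⟨h.coframe_of_mem_derived_two hz hv (by simp) (by simp) (by simp),
      h.coframe_of_mem_derived_two hz hv (by simp) (by simp) (by simp)⟩) hz
    (fun v hv => hcof _ (h.fst_mem hz) v hv) (fun v hv => hcof2 _ v hv) ?_ hw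
  intro V W hV hW hV' hW'
  change charForm e (κ z) _ = 0
  have hch : DifferentiableAt ℝ (charForm e) (κ z) :=
    (h.frame.contDiffOn_charForm.contDiffAt (h.frame.isOpen_prod.mem_nhds
      ⟨hu, trivial⟩)).differentiableAt (by simp)
  rw [apply_lieBracket_of_mem_ker hch hV hW, h.frame.dForm_charForm hu]
  · obtain ⟨c, hc⟩ := hV'.self_of_nhds
    obtain ⟨h3, h4⟩ := hW'.self_of_nhds
    rw [h3, hc, h.frame.sum_coframe hu (W (κ z)).1, h3, h4]
    simp only [dForm_smul_left, dForm_add_right, dForm_smul_right,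
      h.frame.dForm_annForm_lineField _ hu, h.frame.bracket01 _ hu, IsAdaptedFrame.lieBracket_self,
      h.frame.lieBracket10 hu, h.frame.bracket02 _ hu, h.frame.bracket12 _ hu, map_neg,
      h.frame.annForm_frame _ hu, map_smul, h.frame.coframe_lineField hu, map_zero]
    simp
  · filter_upwards [hV', hO] with u hu hu' using hcof u hu' _ hu
  · filter_upwards [hW'] with u hu using hcof2 u _ hu

/-- The lower bound for the derived systems: a bracket with the lift of `e 0 + t e 1`. -/
theorem exists_mem_bracketField (h : IsAdaptedChart D κ ψ O e)
    {G : ∀ z : ProjSpace D, Submodule ℝ (TangentSpace 𝓘(ℝ, E5 × ℝ) z)} {v : E5 × ℝ → E5 × ℝ}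
    (hv : ContDiffOn ℝ ∞ v (O ×ˢ Set.univ)) (hG : ∀ z ∈ κ.source, liftField κ v z ∈ G z)
    (hz : z ∈ κ.source) : ∃ w ∈ bracketField (prolongation D) G z, dchart κ z w =
      VectorField.lieBracket ℝ (fun u : E5 × ℝ => (lineField e u.2 u.1, (0 : ℝ))) v (κ z) := by
  refine ⟨_, liftField_lieBracket_mem h.mem_atlas h.frame.isOpen_prod
    (h.frame.contDiffOn_lineField.prodMk contDiffOn_const) hv ?_ (fun z hz _ => hG z hz) hz
    ⟨h.fst_mem hz, trivial⟩, dchart_inverse_apply h.mem_atlas hz _⟩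
  intro z hz _
  refine (h.mem_prolongation hz _).2 ⟨1, ?_⟩
  rw [liftField, dchart_inverse_apply h.mem_atlas hz, one_smul]

theorem contDiffOn_lift (h : IsAdaptedChart D κ ψ O e) (i : Fin 5) :
    ContDiffOn ℝ ∞ (fun u : E5 × ℝ => (e i u.1, (0 : ℝ))) (O ×ˢ Set.univ) :=
  ((h.frame.smooth i).comp contDiff_fst.contDiffOn fun _ hu => hu.1).prodMk contDiffOn_const

/-- The lift of `e 0 + t e 1` bracketed with ∂ₜ supplies `-e 1`. Only base components need to be
matched, because `E` contains the vertical line. -/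
theorem mem_derived_one (h : IsAdaptedChart D κ ψ O e) (hz : z ∈ κ.source)
    {w : TangentSpace 𝓘(ℝ, E5 × ℝ) z} {a b : ℝ}
    (hw : (dchart κ z w).1 = a • e 0 (κ z).1 + b • e 1 (κ z).1) :
    w ∈ derivedSystem (prolongation D) 1 z := by
  have hv : ∀ z ∈ κ.source, liftField κ (fun _ => ((0 : E5), (1 : ℝ))) z ∈ prolongation D z := by
    intro z hz
    refine (h.mem_prolongation hz _).2 ⟨0, ?_⟩
    rw [liftField, dchart_inverse_apply h.mem_atlas hz, zero_smul]
  obtain ⟨w', hw', hb⟩ := h.exists_mem_bracketField contDiffOn_const hv hz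
  have hb1 := congrArg Prod.fst hb
  rw [h.frame.lieBracket_lift_vertical_fst (h.fst_mem hz) (differentiableAt_const _)] at hb1
  -- As `w'` projects to `-e 1`, this multiple turns `a e 0 + b e 1` into `a (e 0 + t e 1)`.
  have h1 : w - (a * (κ z).2 - b) • w' ∈ prolongation D z := by
    refine (h.mem_prolongation hz _).2 ⟨a, ?_⟩
    rw [map_sub, map_smul, Prod.fst_sub, Prod.smul_fst, hw, hb1, lineField]
    module
  have h2 := Submodule.add_mem _ (le_bracketField_left _ (prolongation D) _ h1)
    (Submodule.smul_mem _ (a * (κ z).2 - b) hw')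
  rw [sub_add_cancel] at h2
  exact h2

/-- The direction `e 2` comes from the bracket of the lift of `e 0 + t e 1` with the lift of `e 1`.
-/
theorem mem_derived_two (h : IsAdaptedChart D κ ψ O e) (hz : z ∈ κ.source)
    {w : TangentSpace 𝓘(ℝ, E5 × ℝ) z} {a b c : ℝ}
    (hw : (dchart κ z w).1 = a • e 0 (κ z).1 + b • e 1 (κ z).1 + c • e 2 (κ z).1) :
    w ∈ derivedSystem (prolongation D) 2 z := by
  have hv : ∀ z ∈ κ.source, liftField κ (fun u => (e 1 u.1, (0 : ℝ))) z ∈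
      derivedSystem (prolongation D) 1 z := by
    intro z hz
    refine h.mem_derived_one hz (a := 0) (b := 1) ?_
    rw [liftField, dchart_inverse_apply h.mem_atlas hz]; simp
  obtain ⟨w', hw', hb⟩ := h.exists_mem_bracketField (h.contDiffOn_lift 1) hv hz
  have hb1 := congrArg Prod.fst hb
  rw [h.frame.lieBracket_lift_fst (h.fst_mem hz) (differentiableAt_const _),
    h.frame.lieBracket_lineField_one _ (h.fst_mem hz)] at hb1
  have h1 : w - c • w' ∈ derivedSystem (prolongation D) 1 z := by
    refine h.mem_derived_one hz (a := a) (b := b) ?_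
    rw [map_sub, map_smul, Prod.fst_sub, Prod.smul_fst, hw, hb1]
    module
  have h2 := Submodule.add_mem _ (le_bracketField_right (prolongation D) _ _ h1)
    (Submodule.smul_mem _ c hw')
  rw [sub_add_cancel] at h2
  exact h2

/-- The third derived system of the prolongation is the kernel of the characteristic form. -/
theorem mem_derived_three (h : IsAdaptedChart D κ ψ O e) (hz : z ∈ κ.source)
    (w : TangentSpace 𝓘(ℝ, E5 × ℝ) z) :
    w ∈ derivedSystem (prolongation D) 3 z ↔ charForm e (κ z) (dchart κ z w) = 0 := by
  refine ⟨h.charForm_of_mem_derived_three hz, fun hw => ?_⟩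
  have hu := h.fst_mem hz
  have hw := h.frame.eq_of_charForm_eq_zero hu hw
  have hv : ∀ z ∈ κ.source, liftField κ (fun u => (e 2 u.1, (0 : ℝ))) z ∈
      derivedSystem (prolongation D) 2 z := by
    intro z hz
    refine h.mem_derived_two hz (a := 0) (b := 0) (c := 1) ?_
    rw [liftField, dchart_inverse_apply h.mem_atlas hz]; simp
  obtain ⟨w', hw', hb⟩ := h.exists_mem_bracketField (h.contDiffOn_lift 2) hv hz
  have hb1 := congrArg Prod.fst hb
  rw [h.frame.lieBracket_lift_fst hu (differentiableAt_const _),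
    h.frame.lieBracket_lineField_two _ hu] at hb1
  set c := coframe e 3 (κ z).1 (dchart κ z w).1
  have h1 : w - c • w' ∈ derivedSystem (prolongation D) 2 z := by
    refine h.mem_derived_two hz (a := coframe e 0 (κ z).1 (dchart κ z w).1)
      (b := coframe e 1 (κ z).1 (dchart κ z w).1) (c := coframe e 2 (κ z).1 (dchart κ z w).1) ?_
    rw [map_sub, map_smul, Prod.fst_sub, Prod.smul_fst, hb1]
    exact sub_eq_iff_eq_add.2 hw
  have h2 := Submodule.add_mem _ (le_bracketField_right (prolongation D) _ _ h1)
    (Submodule.smul_mem _ c hw')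
  rw [sub_add_cancel] at h2
  exact h2

end IsAdaptedChart

end CartanDuality

end

/-! ### Lifts of singular paths are the integral curves of the characteristic field. -/

open scoped Manifold ContDiff Topology

noncomputable section

namespace CartanDuality

section Velocity

variable {M : Type*} [TopologicalSpace M] [ChartedSpace E5 M] [IsManifold 𝓘(ℝ, E5) ∞ M]
  {ψ : OpenPartialHomeomorph M E5} {γ : ℝ → M} {t : ℝ}

/-- The velocity of a curve in a chart. -/
theorem hasDerivAt_chart_comp (hψ : ψ ∈ IsManifold.maximalAtlas 𝓘(ℝ, E5) ∞ M)
    (ht : γ t ∈ ψ.source) (hγ : MDifferentiableAt 𝓘(ℝ, ℝ) 𝓘(ℝ, E5) γ t) :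
    HasDerivAt (fun s => ψ (γ s)) (dchart ψ (γ t) (velocity γ t)) t := by
  have h1 := ((mdifferentiable_of_mem_maximalAtlas hψ).mdifferentiableAt ht).hasMFDerivAt.comp t
    hγ.hasMFDerivAt
  have h2 : HasFDerivAt (fun s => ψ (γ s))
      ((dchart ψ (γ t)).comp (mfderiv 𝓘(ℝ, ℝ) 𝓘(ℝ, E5) γ t) : ℝ →L[ℝ] E5) t := h1.hasFDerivAt
  exact h2.hasDerivAt

end Velocity

namespace IsAdaptedFrame

variable {O : Set E5} {e : Fin 5 → E5 → E5}

theorem lieBracket_comb (h : IsAdaptedFrame O e) (a b : ℝ) {y : E5} (hy : y ∈ O) (i : Fin 5) :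
    VectorField.lieBracket ℝ (fun y => a • e 0 y + b • e 1 y) (e i) y =
      a • VectorField.lieBracket ℝ (e 0) (e i) y + b • VectorField.lieBracket ℝ (e 1) (e i) y := by
  have h1 : fderiv ℝ (fun y => a • e 0 y + b • e 1 y) y = a • fderiv ℝ (e 0) y +
      b • fderiv ℝ (e 1) y :=
    (((h.differentiableAt hy 0).hasFDerivAt.const_smul a).add
      ((h.differentiableAt hy 1).hasFDerivAt.const_smul b)).fderiv
  simp only [VectorField.lieBracket, h1]
  simp
  module

theorem lieBracket_lineField_topField_eq (h : IsAdaptedFrame O e) (t : ℝ) {y : E5} (hy : y ∈ O) :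
    VectorField.lieBracket ℝ (lineField e t) (topField e t) y =
      VectorField.lieBracket ℝ (lineField e t) (e 3) y +
        t • VectorField.lieBracket ℝ (lineField e t) (e 4) y := by
  rw [h.lieBracket_lineField_topField t hy, h.lieBracket_lineField t hy,
    h.lieBracket_lineField t hy]
  simp only [VectorField.lieBracket, lineField, topField]
  simp
  module

end IsAdaptedFrame

namespace IsAdaptedChart

variable {Y : Type*} [TopologicalSpace Y] [ChartedSpace E5 Y] [IsManifold 𝓘(ℝ, E5) ∞ Y]
  {D : PlaneField Y} {κ : OpenPartialHomeomorph (ProjSpace D) (E5 × ℝ)}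
  {ψ : OpenPartialHomeomorph Y E5} {O : Set E5} {e : Fin 5 → E5 → E5} {z : ProjSpace D}

/-- The coordinate expression of the lift of an immersed curve tangent to `D`. -/
theorem eventually_apply_lift (h : IsAdaptedChart D κ ψ O e) {c : ℝ → ProjSpace D} {a b t₀ : ℝ}
    (hc : IsSingularLift D c a b) (ht₀ : t₀ ∈ Set.Ioo a b) (hz : c t₀ ∈ κ.source) :
    ∃ u τ : ℝ → ℝ, ContDiffAt ℝ ∞ τ t₀ ∧ ContDiffAt ℝ ∞ (fun t => ψ (c t).base) t₀ ∧
      ∀ᶠ t in 𝓝 t₀, t ∈ Set.Ioo a b ∧ c t ∈ κ.source ∧ κ (c t) = (ψ (c t).base, τ t) ∧ u t ≠ 0 ∧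
        dchart ψ (c t).base (velocity (fun t => (c t).base) t) =
          u t • lineField e (τ t) (ψ (c t).base) ∧
        HasDerivAt (fun t => ψ (c t).base) (u t • lineField e (τ t) (ψ (c t).base)) t := by
  obtain ⟨⟨hγ, hv, -⟩, hl⟩ := hc
  set γ : ℝ → Y := fun t => (c t).base with hγd
  set y : ℝ → E5 := fun t => ψ (γ t) with hyd
  have hI : ∀ᶠ t in 𝓝 t₀, t ∈ Set.Ioo a b := isOpen_Ioo.mem_nhds ht₀
  have hγat : ContMDiffAt 𝓘(ℝ, ℝ) 𝓘(ℝ, E5) ∞ γ t₀ := hγ.contMDiffAt (isOpen_Ioo.mem_nhds ht₀)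
  have hs0 : γ t₀ ∈ ψ.source := h.base_mem _ hz
  have hs : ∀ᶠ t in 𝓝 t₀, γ t ∈ ψ.source :=
    hγat.continuousAt.preimage_mem_nhds (ψ.open_source.mem_nhds hs0)
  have hyat : ContDiffAt ℝ ∞ y t₀ := by
    rw [← contMDiffAt_iff_contDiffAt]
    exact (contMDiffAt_of_mem_maximalAtlas h.base_mem_atlas hs0).comp t₀ hγat
  have hO0 : y t₀ ∈ O := by
    have := h.fst_mem hz
    rwa [h.apply_fst _ hz] at this
  have hO : ∀ᶠ t in 𝓝 t₀, y t ∈ O :=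
    hyat.continuousAt.preimage_mem_nhds (h.frame.isOpen.mem_nhds hO0)
  have hdy : ∀ᶠ t in 𝓝 t₀, HasDerivAt y (dchart ψ (γ t) (velocity γ t)) t := by
    filter_upwards [hI, hs] with t ht hst
    exact hasDerivAt_chart_comp h.base_mem_atlas hst
      ((hγ.contMDiffAt (isOpen_Ioo.mem_nhds ht)).mdifferentiableAt (by simp))
  -- The frame components of the velocity; `u 0`, `u 1` are the controls, and the lift has slope `u
  -- 1 / u 0`, where `u 0` is nonzero because the lift lies in the affine chart. Since `c` is not
  -- assumed to be continuous, its smoothness has to come from this formula.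
  let u : Fin 5 → ℝ → ℝ := fun i t => coframe e i (y t) (deriv y t)
  have hu : ∀ i, ContDiffAt ℝ ∞ (u i) t₀ := by
    intro i
    exact (((h.frame.contDiffOn_coframe i).contDiffAt (h.frame.isOpen.mem_nhds hO0)).comp t₀
      hyat).clm_apply ((hyat.fderiv_right (m := ∞) (by simp)).clm_apply contDiffAt_const)
  have hu00 : u 0 t₀ ≠ 0 := by
    obtain ⟨r, hr⟩ := (h.mem_line hz _).1 (hl t₀ ht₀)
    have hr0 : r ≠ 0 := by
      rintro rfl
      rw [zero_smul] at hr
      exact (hv t₀ ht₀).1 (dchart_injective h.base_mem_atlas hs0 (by rw [hr, map_zero]))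
    have : u 0 t₀ = r := by
      change coframe e 0 (y t₀) (deriv y t₀) = r
      rw [hdy.self_of_nhds.deriv, hr, map_smul]
      have h2 : y t₀ = (κ (c t₀)).1 := (h.apply_fst _ hz).symm
      rw [h2, h.frame.coframe_lineField (h.fst_mem hz)]
      simp
    rwa [this]
  have hu0 : ∀ᶠ t in 𝓝 t₀, u 0 t ≠ 0 := (hu 0).continuousAt.eventually_ne hu00
  refine ⟨u 0, fun t => u 1 t / u 0 t, (hu 1).div (hu 0) hu00, hyat, ?_⟩
  filter_upwards [hI, hs, hO, hdy, hu0] with t ht hst hOt hdyt hu0t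
  have hdv : dchart ψ (γ t) (velocity γ t) = u 0 t • lineField e (u 1 t / u 0 t) (y t) := by
    obtain ⟨p, q, hpq⟩ := (h.mem_space _ hst hOt _).1 (hv t ht).2
    have h0 : u 0 t = p := by
      change coframe e 0 (y t) (deriv y t) = p
      rw [hdyt.deriv, hpq, map_add, map_smul, map_smul, h.frame.coframe_apply hOt,
        h.frame.coframe_apply hOt]
      simp
    have h1 : u 1 t = q := by
      change coframe e 1 (y t) (deriv y t) = q
      rw [hdyt.deriv, hpq, map_add, map_smul, map_smul, h.frame.coframe_apply hOt,
        h.frame.coframe_apply hOt]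
      simp
    rw [hpq, lineField, smul_add, smul_smul, mul_div_cancel₀ _ hu0t, h0, h1]
  have hmem := h.mem_source (c t) hst hOt (u 1 t / u 0 t) (by
    have h2 : (dchart ψ (c t).base).inverse (lineField e (u 1 t / u 0 t) (ψ (c t).base)) =
        (u 0 t)⁻¹ • velocity γ t := by
      apply dchart_injective h.base_mem_atlas hst
      rw [dchart_inverse_apply h.base_mem_atlas hst, map_smul]
      change _ = (u 0 t)⁻¹ • dchart ψ (γ t) (velocity γ t)
      rw [hdv, inv_smul_smul₀ hu0t]
    rw [h2]
    exact Submodule.smul_mem _ _ (hl t ht))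
  exact ⟨ht, hmem.1, hmem.2, hu0t, hdv, hdv ▸ hdyt⟩

/-- The lift of a singular path is tangent to the characteristic field. -/
theorem hasDerivAt_of_isSingularLift (h : IsAdaptedChart D κ ψ O e) {c : ℝ → ProjSpace D}
    {a b t₀ : ℝ} (hc : IsSingularLift D c a b) (ht₀ : t₀ ∈ Set.Ioo a b) (hz : c t₀ ∈ κ.source) :
    (∀ᶠ t in 𝓝 t₀, c t ∈ κ.source) ∧ ContDiffAt ℝ ∞ (fun t => κ (c t)) t₀ ∧
      ∃ u : ℝ, u ≠ 0 ∧ HasDerivAt (fun t => κ (c t)) (u • charField e (κ (c t₀))) t₀ := by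
  obtain ⟨u, τ, hτ, hy, hev⟩ := h.eventually_apply_lift hc ht₀ hz
  have hκe : (fun t => κ (c t)) =ᶠ[𝓝 t₀] fun t => (ψ (c t).base, τ t) := by
    filter_upwards [hev] with t ht using ht.2.2.1
  refine ⟨hev.mono fun t ht => ht.2.1, (hy.prodMk hτ).congr_of_eventuallyEq hκe, u t₀,
    hev.self_of_nhds.2.2.2.1, ?_⟩
  obtain ⟨⟨hγ, hv, p, hp⟩, hl⟩ := hc
  let γ : ℝ → Y := fun t => (c t).base
  let y : ℝ → E5 := fun t => ψ (γ t)
  -- The covector `p` read in the chart `ψ`.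
  let P : ℝ → E5 → ℝ := fun t v => p t ((dchart ψ (γ t)).inverse v)
  have Padd : ∀ t v w, P t (v + w) = P t v + P t w := fun t v w => by
    simp only [P, map_add]
  have Psmul : ∀ t (r : ℝ) v, P t (r • v) = r * P t v := fun t r v => by
    simp only [P, map_smul, smul_eq_mul]
  have hyO : ∀ t, c t ∈ κ.source → y t ∈ O := fun t ht => by
    have := h.fst_mem ht
    rwa [h.apply_fst _ ht] at this
  have hD : ∀ᶠ t in 𝓝 t₀, P t (e 0 (y t)) = 0 ∧ P t (e 1 (y t)) = 0 := by
    filter_upwards [hev] with t ht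
    have hs := h.base_mem _ ht.2.1
    constructor
    · refine (hp t ht.1).2.1 _ ((h.mem_space _ hs (hyO t ht.2.1) _).2 ⟨1, 0, ?_⟩)
      rw [dchart_inverse_apply h.base_mem_atlas hs]; simp [y, γ]
    · refine (hp t ht.1).2.1 _ ((h.mem_space _ hs (hyO t ht.2.1) _).2 ⟨0, 1, ?_⟩)
      rw [dchart_inverse_apply h.base_mem_atlas hs]; simp [y, γ]
  -- Hamilton's equation tested on the frame fields. The section of `D` through the velocity is
  -- taken with constant coefficients in the frame, which the definition of a singular path permits.
  have hder : ∀ᶠ t in 𝓝 t₀, ∀ i, HasDerivAt (fun s => P s (e i (y s)))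
      (u t * P t (VectorField.lieBracket ℝ (lineField e (τ t)) (e i) (y t))) t := by
    filter_upwards [hev] with t ht i
    have hs := h.base_mem _ ht.2.1
    have hOt := hyO t ht.2.1
    let f : E5 → E5 := fun x => u t • e 0 x + (u t * τ t) • e 1 x
    have hf : ContDiffOn ℝ ∞ f O :=
      ((h.frame.smooth 0).const_smul (u t)).add ((h.frame.smooth 1).const_smul (u t * τ t))
    have hF : IsSectionOn (ψ.source ∩ ψ ⁻¹' O) D.space (liftField ψ f) :=
      isSectionOn_liftField h.base_mem_atlas h.frame.isOpen hf fun x hx hxO =>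
        (h.mem_space x hx hxO _).2 ⟨u t, u t * τ t, dchart_inverse_apply h.base_mem_atlas hx _⟩
    have hV : IsSectionOn (ψ.source ∩ ψ ⁻¹' O) (fun _ => ⊤) (liftField ψ (e i)) :=
      isSectionOn_liftField h.base_mem_atlas h.frame.isOpen (h.frame.smooth i) fun x hx hxO =>
        trivial
    have hFv : liftField ψ f (γ t) = velocity γ t := by
      apply dchart_injective h.base_mem_atlas hs
      rw [liftField]
      refine (dchart_inverse_apply h.base_mem_atlas hs _).trans ?_
      refine Eq.trans ?_ ht.2.2.2.2.1.symm
      simp only [f, lineField, γ]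
      module
    have h1 := (hp t ht.1).2.2 (ψ.source ∩ ψ ⁻¹' O) _ _ ⟨hs, hOt⟩ hF hFv hV
    refine h1.congr_deriv ?_
    rw [mlieBracket_liftField h.base_mem_atlas h.frame.isOpen hf (h.frame.smooth i) hs hOt]
    change P t (VectorField.lieBracket ℝ f (e i) (y t)) = _
    rw [h.frame.lieBracket_comb _ _ hOt, h.frame.lieBracket_lineField _ hOt]
    simp only [Padd, Psmul]
    ring
  have hconst : ∀ {f : ℝ → ℝ} {f' t : ℝ}, (∀ᶠ s in 𝓝 t, f s = 0) → HasDerivAt f f' t → f' = 0 :=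
    fun hf hd => hd.unique ((hasDerivAt_const _ (0 : ℝ)).congr_of_eventuallyEq hf)
  -- Differentiate `p (e 1) = 0`; the bracket of `e 0 + τ e 1` with `e 1` is `e 2`.
  have h2 : ∀ᶠ t in 𝓝 t₀, P t (e 2 (y t)) = 0 := by
    filter_upwards [hD.eventually_nhds, hder, hev] with t hDt hdt ht
    have := hconst (hDt.mono fun s hs => hs.2) (hdt 1)
    rw [h.frame.lieBracket_lineField_one _ (hyO t ht.2.1)] at this
    exact (mul_eq_zero.1 this).resolve_left ht.2.2.2.1
  -- Differentiate `p (e 2) = 0`: now `p` also kills `e 3 + τ e 4`, so it is a multiple of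
  -- `annForm`.
  have h3 : ∀ᶠ t in 𝓝 t₀, P t (e 3 (y t)) = -τ t * P t (e 4 (y t)) := by
    filter_upwards [h2.eventually_nhds, hder, hev] with t h2t hdt ht
    have := hconst h2t (hdt 2)
    rw [h.frame.lieBracket_lineField_two _ (hyO t ht.2.1)] at this
    have := (mul_eq_zero.1 this).resolve_left ht.2.2.2.1
    rw [topField, Padd, Psmul] at this
    linarith
  have ht := hev.self_of_nhds
  have hOt := hyO _ ht.2.1
  set l := P t₀ (e 4 (y t₀)) with hl4
  have hPe : ∀ v, P t₀ v = l * annForm e (τ t₀) (y t₀) v := by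
    intro v
    conv_lhs => rw [h.frame.sum_coframe hOt v]
    simp only [Padd, Psmul, hD.self_of_nhds.1, hD.self_of_nhds.2, h2.self_of_nhds,
      h3.self_of_nhds, annForm, sub_apply, smul_apply, smul_eq_mul]
    ring
  have hl0 : l ≠ 0 := by
    intro h0
    apply (hp t₀ ht.1).1
    ext v
    have h5 := hPe (dchart ψ (γ t₀) v)
    rw [h0, zero_mul] at h5
    have h6 := inverse_dchart_apply h.base_mem_atlas (h.base_mem _ ht.2.1) v
    exact (congrArg (p t₀) h6).symm.trans h5
  have hτd := (hτ.differentiableAt (by simp)).hasDerivAt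
  -- Differentiating `p (e 3) = -τ p (e 4)` determines the derivative of `τ`, which turns out to be
  -- the vertical component of `charField` times the control.
  have hd3 := (hder.self_of_nhds 3).unique
    ((hτd.neg.mul (hder.self_of_nhds 4)).congr_of_eventuallyEq h3)
  have hτ' : deriv τ t₀ = u t₀ * (charField e (κ (c t₀))).2 := by
    rw [ht.2.2.1]
    change _ = u t₀ * -annForm e (τ t₀) (y t₀)
      (VectorField.lieBracket ℝ (lineField e (τ t₀)) (topField e (τ t₀)) (y t₀))
    rw [h.frame.lieBracket_lineField_topField_eq _ hOt, map_add, map_smul, smul_eq_mul]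
    have h4 : annForm e (τ t₀) (y t₀) (e 4 (y t₀)) = 1 := by
      rw [h.frame.annForm_frame _ hOt]; simp
    simp only [Pi.neg_apply, hPe, h4] at hd3
    apply mul_left_cancel₀ hl0
    linear_combination hd3
  rw [hτ'] at hτd
  refine ((ht.2.2.2.2.2.prodMk hτd).congr_of_eventuallyEq hκe).congr_deriv ?_
  rw [ht.2.2.1]
  rfl

/-- The integral curves of the multiples of the characteristic field are lifts of singular paths. -/
theorem isSingularLift_of_hasDerivAt (h : IsAdaptedChart D κ ψ O e) {σ : ℝ → E5 × ℝ} {k : ℝ → ℝ}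
    {a b : ℝ} (hσ : ContDiffOn ℝ ∞ σ (Set.Ioo a b)) (hO : ∀ t ∈ Set.Ioo a b, (σ t).1 ∈ O)
    (hd : ∀ t ∈ Set.Ioo a b, k t ≠ 0 ∧ HasDerivAt σ (k t • charField e (σ t)) t) :
    IsSingularLift D (fun t => κ.symm (σ t)) a b := by
  have hT : ∀ t ∈ Set.Ioo a b, σ t ∈ κ.target := fun t ht => by
    rw [h.target_eq]; exact ⟨hO t ht, trivial⟩
  have hsrc : ∀ t ∈ Set.Ioo a b, κ.symm (σ t) ∈ κ.source := fun t ht => κ.map_target (hT t ht)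
  have hr : ∀ t ∈ Set.Ioo a b, κ (κ.symm (σ t)) = σ t := fun t ht => κ.right_inv (hT t ht)
  set γ : ℝ → Y := fun t => (κ.symm (σ t)).base with hγd
  have hs : ∀ t ∈ Set.Ioo a b, γ t ∈ ψ.source := fun t ht => h.base_mem _ (hsrc t ht)
  have hψ : ∀ t ∈ Set.Ioo a b, ψ (γ t) = (σ t).1 := fun t ht => by
    rw [← hr t ht]; exact (h.apply_fst _ (hsrc t ht)).symm
  have hψO : ∀ t ∈ Set.Ioo a b, ψ (γ t) ∈ O := fun t ht => by rw [hψ t ht]; exact hO t ht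
  have hγ : ContMDiffOn 𝓘(ℝ, ℝ) 𝓘(ℝ, E5) ∞ γ (Set.Ioo a b) :=
    h.contMDiffOn_base.comp ((contMDiffOn_symm_of_mem_maximalAtlas h.mem_atlas).comp
      hσ.contMDiffOn hT) hsrc
  have hvel : ∀ t ∈ Set.Ioo a b, dchart ψ (γ t) (velocity γ t) =
      k t • lineField e (σ t).2 (σ t).1 := by
    intro t ht
    have h1 := hasDerivAt_chart_comp h.base_mem_atlas (hs t ht)
      ((hγ.contMDiffAt (isOpen_Ioo.mem_nhds ht)).mdifferentiableAt (by simp))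
    have h2 : HasDerivAt (fun t => (σ t).1) (k t • lineField e (σ t).2 (σ t).1) t :=
      (hasFDerivAt_fst (p := σ t)).comp_hasDerivAt t (hd t ht).2
    refine h1.unique (h2.congr_of_eventuallyEq ?_)
    filter_upwards [isOpen_Ioo.mem_nhds ht] with s hs using hψ s hs
  have hline : ∀ t ∈ Set.Ioo a b, velocity γ t ∈ (κ.symm (σ t)).line := fun t ht =>
    (h.mem_line (hsrc t ht) _).2 ⟨k t, by rw [hr t ht]; exact hvel t ht⟩
  have hnz : ∀ t ∈ Set.Ioo a b, velocity γ t ≠ 0 := by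
    intro t ht h0
    have h1 := hvel t ht
    rw [h0, map_zero] at h1
    exact (smul_ne_zero (hd t ht).1 (h.frame.lineField_ne_zero _ (hO t ht))) h1.symm
  have hαd : ∀ t ∈ Set.Ioo a b, ContDiffAt ℝ ∞ (charForm e) (σ t) := fun t ht =>
    h.frame.contDiffOn_charForm.contDiffAt (h.frame.isOpen_prod.mem_nhds ⟨hO t ht, trivial⟩)
  -- The speed `k` is not assumed continuous; it is recovered as the `e 0` component of the
  -- velocity.
  have hkc : ContinuousOn k (Set.Ioo a b) := by
    have h1 : ContinuousOn (fun t => coframe e 0 (σ t).1 (deriv σ t).1) (Set.Ioo a b) := by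
      refine ContinuousOn.clm_apply ((h.frame.contDiffOn_coframe 0).continuousOn.comp
        (continuous_fst.comp_continuousOn hσ.continuousOn) hO) ?_
      exact continuous_fst.comp_continuousOn
        (hσ.continuousOn_deriv_of_isOpen isOpen_Ioo (by simp))
    refine h1.congr fun t ht => ?_
    change _ = coframe e 0 (σ t).1 (deriv σ t).1
    rw [(hd t ht).2.deriv]
    change _ = coframe e 0 (σ t).1 (k t • lineField e (σ t).2 (σ t).1)
    rw [map_smul, h.frame.coframe_lineField (hO t ht)]
    simp
  let μ : ℝ → ℝ := fun t => dForm (charForm e) (σ t) (charField e (σ t)) (e 4 (σ t).1, 0)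
  have hμc : ContinuousOn μ (Set.Ioo a b) := by
    have h1 : ContinuousOn (fun t => fderiv ℝ (charForm e) (σ t)) (Set.Ioo a b) :=
      (h.frame.contDiffOn_charForm.continuousOn_fderiv_of_isOpen h.frame.isOpen_prod
        (by simp)).comp hσ.continuousOn fun t ht => ⟨hO t ht, trivial⟩
    have h2 : ContinuousOn (fun t => charField e (σ t)) (Set.Ioo a b) :=
      h.frame.contDiffOn_charField.continuousOn.comp hσ.continuousOn fun t ht => ⟨hO t ht, trivial⟩
    have h3 : ContinuousOn (fun t => (e 4 (σ t).1, (0 : ℝ))) (Set.Ioo a b) :=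
      ((h.frame.smooth 4).continuousOn.comp (continuous_fst.comp_continuousOn hσ.continuousOn)
        hO).prodMk continuousOn_const
    exact ((h1.clm_apply h2).clm_apply h3).sub ((h1.clm_apply h3).clm_apply h2)
  -- Transport along `k K` multiplies the characteristic form by the rate `k μ`, by
  -- `dForm_charField`. The factor `l` undoes this, so that `l` times the form solves Hamilton's
  -- equation.
  obtain ⟨l, hl⟩ := exists_pos_hasDerivAt_mul (hkc.mul hμc).neg
  refine ⟨⟨hγ, fun t ht => ⟨hnz t ht, (κ.symm (σ t)).line_le (hline t ht)⟩,
    fun t => ((l t • annForm e (σ t).2 (σ t).1).comp (dchart ψ (γ t))).toLinearMap, ?_⟩, hline⟩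
  intro t ht
  refine ⟨?_, ?_, ?_⟩
  · intro h0
    have h1 := DFunLike.congr_fun h0 ((dchart ψ (γ t)).inverse (e 4 (σ t).1))
    change l t * annForm e (σ t).2 (σ t).1 (dchart ψ (γ t) _) = 0 at h1
    rw [dchart_inverse_apply h.base_mem_atlas (hs t ht), h.frame.annForm_frame _ (hO t ht)] at h1
    simp [(hl t ht).1.ne'] at h1
  · intro v hv
    obtain ⟨p, q, hpq⟩ := (h.mem_space _ (hs t ht) (hψO t ht) v).1 hv
    change l t * annForm e (σ t).2 (σ t).1 (dchart ψ (γ t) v) = 0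
    rw [hpq, hψ t ht, map_add, map_smul, map_smul, h.frame.annForm_frame _ (hO t ht),
      h.frame.annForm_frame _ (hO t ht)]
    simp
  · intro U F V hU hF hFv hV
    set v := coordField ψ V with hvd
    set f := coordField ψ F with hfd
    have hyt : (σ t).1 ∈ ψ.target ∩ ψ.symm ⁻¹' U := by
      rw [← hψ t ht]
      exact ⟨ψ.map_source (hs t ht), by rwa [Set.mem_preimage, ψ.left_inv (hs t ht)]⟩
    have hOU := ψ.isOpen_inter_preimage_symm hF.isOpen
    have hvs : HasFDerivAt v (fderiv ℝ v (σ t).1) (σ t).1 :=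
      (((contDiffOn_coordField h.base_mem_atlas hV.isOpen hV.smooth).contDiffAt
        (hOU.mem_nhds hyt)).differentiableAt (by simp)).hasFDerivAt
    have hfs : HasFDerivAt f (fderiv ℝ f (σ t).1) (σ t).1 :=
      (((contDiffOn_coordField h.base_mem_atlas hF.isOpen hF.smooth).contDiffAt
        (hOU.mem_nhds hyt)).differentiableAt (by simp)).hasFDerivAt
    have hft : f (σ t).1 = k t • lineField e (σ t).2 (σ t).1 := by
      rw [← hvel t ht, ← hψ t ht, hfd, coordField_apply (hs t ht), hFv]
    have hbr : dchart ψ (γ t) (VectorField.mlieBracket 𝓘(ℝ, E5) F V (γ t)) =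
        VectorField.lieBracket ℝ f v (σ t).1 := by
      rw [dchart_mlieBracket h.base_mem_atlas hF.isOpen hF.smooth hV.smooth (hs t ht) hU, hψ t ht]
    have hcurve : (fun s => ((l s • annForm e (σ s).2 (σ s).1).comp (dchart ψ (γ s))).toLinearMap
        (V (γ s))) =ᶠ[𝓝 t] fun s => l s * charForm e (σ s) (v (σ s).1, 0) := by
      filter_upwards [isOpen_Ioo.mem_nhds ht] with s hs'
      change l s * annForm e (σ s).2 (σ s).1 (dchart ψ (γ s) (V (γ s))) = _
      rw [← coordField_apply (hs s hs'), hψ s hs']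
      rfl
    have hσd := (hd t ht).2
    have hα := ((hαd t ht).differentiableAt (by simp)).hasFDerivAt.comp_hasDerivAt t hσd
    have hσ1 : HasDerivAt (fun t => (σ t).1) (k t • lineField e (σ t).2 (σ t).1) t :=
      (hasFDerivAt_fst (p := σ t)).comp_hasDerivAt t hσd
    have hv1 : HasDerivAt (fun s => v (σ s).1)
        (fderiv ℝ v (σ t).1 (k t • lineField e (σ t).2 (σ t).1)) t :=
      hvs.comp_hasDerivAt_of_eq t hσ1 rfl
    have hv0 := hv1.prodMk (hasDerivAt_const t (0 : ℝ))
    have hmain := ((hl t ht).2.mul (hα.clm_apply hv0)).congr_of_eventuallyEq hcurve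
    refine hmain.congr_deriv ?_
    change _ = l t * annForm e (σ t).2 (σ t).1 (dchart ψ (γ t) _)
    rw [hbr]
    -- the form with constant parameter annihilates `f`
    have hfr : fderiv ℝ (annForm e (σ t).2) (σ t).1 (v (σ t).1) (f (σ t).1) +
        annForm e (σ t).2 (σ t).1 (fderiv ℝ f (σ t).1 (v (σ t).1)) = 0 := by
      have h1 := (h.frame.differentiableAt_annForm (σ t).2 (hO t ht)).hasFDerivAt.clm_apply hfs
      have h2 : (fun y => annForm e (σ t).2 y (f y)) =ᶠ[𝓝 (σ t).1] fun _ => (0 : ℝ) := by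
        filter_upwards [hOU.mem_nhds hyt, h.frame.isOpen.mem_nhds (hO t ht)] with y hy hyO
        have hDf := hF.mem _ hy.2
        obtain ⟨p, q, hpq⟩ := (h.mem_space _ (ψ.map_target hy.1)
          (by rwa [ψ.right_inv hy.1]) _).1 hDf
        rw [ψ.right_inv hy.1] at hpq
        rw [hfd, coordField, hpq, map_add, map_smul, map_smul, h.frame.annForm_frame _ hyO,
          h.frame.annForm_frame _ hyO]
        simp
      have h3 := DFunLike.congr_fun (h1.unique ((hasFDerivAt_const (0 : ℝ) _).congr_of_eventuallyEq
        h2)) (v (σ t).1)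
      simp at h3
      linarith
    have hsym := h.frame.dForm_charField (hO t ht) (v (σ t).1, 0)
    -- For a test vector without vertical component the variable `t` in ε₄ - t ε₃ may be frozen, so
    -- the identity on the base obtained above can be used.
    have hdf : ∀ w : E5 × ℝ, w.2 = 0 → ∀ w', fderiv ℝ (charForm e) (σ t) w w' =
        fderiv ℝ (annForm e (σ t).2) (σ t).1 w.1 w'.1 := by
      intro w hw w'
      have hd : ∀ i, HasFDerivAt (fun u : E5 × ℝ => coframe e i u.1)
          ((fderiv ℝ (coframe e i) (σ t).1).comp (ContinuousLinearMap.fst ℝ E5 ℝ)) (σ t) := fun i =>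
        (h.frame.differentiableAt_coframe (hO t ht) i).hasFDerivAt.comp (σ t) hasFDerivAt_fst
      have h1 : HasFDerivAt (fun u : E5 × ℝ => annForm e u.2 u.1) _ (σ t) :=
        (hd 4).sub (hasFDerivAt_snd.smul (hd 3))
      have h2 := h1.clm_comp (hasFDerivAt_const (ContinuousLinearMap.fst ℝ E5 ℝ) (σ t))
      have h3 : fderiv ℝ (annForm e (σ t).2) (σ t).1 = fderiv ℝ (coframe e 4) (σ t).1 -
          (σ t).2 • fderiv ℝ (coframe e 3) (σ t).1 :=
        ((h.frame.differentiableAt_coframe (hO t ht) 4).hasFDerivAt.sub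
          ((h.frame.differentiableAt_coframe (hO t ht) 3).hasFDerivAt.const_smul (σ t).2)).fderiv
      have h4 : fderiv ℝ (charForm e) (σ t) = _ := h2.fderiv
      rw [h4, h3]
      simp [hw]
    have hv2 := hdf (v (σ t).1, 0) rfl (charField e (σ t))
    have hc1 : (charField e (σ t)).1 = lineField e (σ t).2 (σ t).1 := rfl
    rw [hft, map_smul, smul_eq_mul] at hfr
    rw [hc1] at hv2
    rw [dForm, hv2] at hsym
    change -(k t * dForm (charForm e) (σ t) (charField e (σ t)) (e 4 (σ t).1, 0)) * l t *
      charForm e (σ t) (v (σ t).1, 0) + l t * (fderiv ℝ (charForm e) (σ t)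
      (k t • charField e (σ t)) (v (σ t).1, 0) + annForm e (σ t).2 (σ t).1
      (fderiv ℝ v (σ t).1 (k t • lineField e (σ t).2 (σ t).1))) = _
    rw [VectorField.lieBracket, hft, map_sub]
    simp only [map_smul, smul_apply, smul_eq_mul]
    linear_combination l t * k t * hsym + l t * hfr

end IsAdaptedChart

end CartanDuality

end

/-! ### Flow boxes and the existence of path-space projections. -/

open scoped Manifold ContDiff Topology

noncomputable section

namespace CartanDuality

section Inverse

variable {E F : Type*} [NormedAddCommGroup E] [NormedSpace ℝ E] [NormedAddCommGroup F]
  [NormedSpace ℝ F] {S : OpenPartialHomeomorph E F}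

theorem fderiv_symm_fderiv (hS : ContDiffOn ℝ ∞ S S.source) (hS' : ContDiffOn ℝ ∞ S.symm S.target)
    {p : E} (hp : p ∈ S.source) (v : E) : fderiv ℝ S.symm (S p) (fderiv ℝ S p v) = v := by
  have h1 := ((hS.contDiffAt (S.open_source.mem_nhds hp)).differentiableAt (by simp)).hasFDerivAt
  have h2 := ((hS'.contDiffAt (S.open_target.mem_nhds (S.map_source hp))).differentiableAt
    (by simp)).hasFDerivAt
  have h3 : S.symm ∘ S =ᶠ[𝓝 p] id := by
    filter_upwards [S.open_source.mem_nhds hp] with x hx using S.left_inv hx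
  exact DFunLike.congr_fun (((h2.comp p h1).unique ((hasFDerivAt_id p).congr_of_eventuallyEq h3))) v

theorem fderiv_fderiv_symm (hS : ContDiffOn ℝ ∞ S S.source) (hS' : ContDiffOn ℝ ∞ S.symm S.target)
    {p : E} (hp : p ∈ S.source) (w : F) : fderiv ℝ S p (fderiv ℝ S.symm (S p) w) = w := by
  have h1 := fderiv_symm_fderiv (S := S.symm) hS' hS (S.map_source hp) w
  rw [S.left_inv hp] at h1
  exact h1

end Inverse

section Box

variable {Y : Type*} [TopologicalSpace Y] [ChartedSpace E5 Y] [IsManifold 𝓘(ℝ, E5) ∞ Y]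
  {D : PlaneField Y}

/-- The points of `P(D)` with coordinates in `N × (a, b)`, in the coordinates `S⁻¹ ∘ κ`. -/
def boxSet (κ : OpenPartialHomeomorph (ProjSpace D) (E5 × ℝ))
    (S : OpenPartialHomeomorph (E5 × ℝ) (E5 × ℝ)) (N : Set E5) (a b : ℝ) : Set (ProjSpace D) :=
  (κ.trans S.symm).source ∩ (κ.trans S.symm) ⁻¹' (N ×ˢ Set.Ioo a b)

theorem isOpen_boxSet (κ : OpenPartialHomeomorph (ProjSpace D) (E5 × ℝ))
    (S : OpenPartialHomeomorph (E5 × ℝ) (E5 × ℝ)) {N : Set E5} (hN : IsOpen N) (a b : ℝ) :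
    IsOpen (boxSet κ S N a b) :=
  (κ.trans S.symm).isOpen_inter_preimage (hN.prod isOpen_Ioo)

theorem mem_boxSet {κ : OpenPartialHomeomorph (ProjSpace D) (E5 × ℝ)}
    {S : OpenPartialHomeomorph (E5 × ℝ) (E5 × ℝ)} {N : Set E5} {a b : ℝ} {z : ProjSpace D} :
    z ∈ boxSet κ S N a b ↔ z ∈ κ.source ∧ κ z ∈ S.target ∧ (S.symm (κ z)).1 ∈ N ∧
      (S.symm (κ z)).2 ∈ Set.Ioo a b := by
  simp [boxSet, and_assoc]

/-- The point of the box with coordinates `p`. -/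
theorem symm_mem_boxSet {κ : OpenPartialHomeomorph (ProjSpace D) (E5 × ℝ)}
    {S : OpenPartialHomeomorph (E5 × ℝ) (E5 × ℝ)} (hT : S.target ⊆ κ.target) {N : Set E5} {a b : ℝ}
    {p : E5 × ℝ} (hp : p ∈ S.source) (h1 : p.1 ∈ N) (h2 : p.2 ∈ Set.Ioo a b) :
    κ.symm (S p) ∈ boxSet κ S N a b ∧ κ (κ.symm (S p)) = S p ∧
      S.symm (κ (κ.symm (S p))) = p := by
  have hr := κ.right_inv (hT (S.map_source hp))
  refine ⟨mem_boxSet.2 ⟨κ.map_target (hT (S.map_source hp)), ?_⟩, hr, ?_⟩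
  · rw [hr, S.left_inv hp]
    exact ⟨S.map_source hp, h1, h2⟩
  · rw [hr, S.left_inv hp]

variable {κ : OpenPartialHomeomorph (ProjSpace D) (E5 × ℝ)}
  {ψ : OpenPartialHomeomorph Y E5} {O : Set E5} {e : Fin 5 → E5 → E5} {z : ProjSpace D}

/-- The lines `{x} × (a, b)` of a box that straightens the characteristic field are lifts of
singular paths. -/
theorem IsAdaptedChart.exists_isSingularLift_box (h : IsAdaptedChart D κ ψ O e)
    {S : OpenPartialHomeomorph (E5 × ℝ) (E5 × ℝ)} (hT : S.target ⊆ κ.target)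
    (hS : ContDiffOn ℝ ∞ S S.source) (hd : ∀ p ∈ S.source, ∃ k : ℝ, k ≠ 0 ∧
      HasDerivAt (fun s => S (p.1, s)) (k • charField e (S p)) p.2) {N : Set E5} {a b : ℝ}
    (hN : N ×ˢ Set.Ioo a b ⊆ S.source) (hz : z ∈ boxSet κ S N a b) :
    ∃ c, IsSingularLift D c a b ∧ c '' Set.Ioo a b =
      {z' ∈ boxSet κ S N a b | (S.symm (κ z')).1 = (S.symm (κ z)).1} := by
  obtain ⟨hzs, hzT, hz1, hz2⟩ := mem_boxSet.1 hz
  set x := (S.symm (κ z)).1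
  have hxs : ∀ t ∈ Set.Ioo a b, (x, t) ∈ S.source := fun t ht => hN ⟨hz1, ht⟩
  -- Off the interval the speed gets the dummy value zero.
  have hk : ∀ t, ∃ k : ℝ, t ∈ Set.Ioo a b → k ≠ 0 ∧
      HasDerivAt (fun s => S (x, s)) (k • charField e (S (x, t))) t := by
    intro t
    by_cases ht : t ∈ Set.Ioo a b
    · obtain ⟨k, hk⟩ := hd _ (hxs t ht)
      exact ⟨k, fun _ => hk⟩
    · exact ⟨0, fun h => absurd h ht⟩
  choose k hk using hk
  refine ⟨fun t => κ.symm (S (x, t)), h.isSingularLift_of_hasDerivAt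
    (hS.comp (contDiff_const.prodMk contDiff_id).contDiffOn hxs) ?_ hk, ?_⟩
  · intro t ht
    have := hT (S.map_source (hxs t ht))
    rw [h.target_eq] at this
    exact this.1
  · ext z'
    constructor
    · rintro ⟨t, ht, rfl⟩
      obtain ⟨h1, h2, h3⟩ := symm_mem_boxSet hT (hxs t ht) hz1 ht
      refine ⟨h1, ?_⟩
      change (S.symm (κ (κ.symm (S (x, t))))).1 = x
      rw [h3]
    · rintro ⟨hz', hx⟩
      obtain ⟨h1, h2, h3, h4⟩ := mem_boxSet.1 hz'
      refine ⟨(S.symm (κ z')).2, h4, ?_⟩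
      change κ.symm (S (x, (S.symm (κ z')).2)) = z'
      rw [← hx, Prod.mk.eta, S.right_inv h2, κ.left_inv h1]

/-- Every point of `P(D)` has a neighbourhood that projects to a space of singular paths. -/
theorem exists_isPathSpace (hD : D.Is235) (z₀ : ProjSpace D) :
    ∃ (W : Set (ProjSpace D)) (π : ProjSpace D → E5), z₀ ∈ W ∧ IsPathSpace D W π := by
  obtain ⟨κ, ψ, O, e, h, hz₀⟩ := exists_isAdaptedChart hD z₀
  have hK : ContDiffOn ℝ ∞ (charField e) κ.target := by
    rw [h.target_eq]; exact h.frame.contDiffOn_charField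
  have hne : charField e (κ z₀) ≠ 0 := fun h0 =>
    h.frame.lineField_ne_zero (κ z₀).2 (h.fst_mem hz₀) (congrArg Prod.fst h0)
  -- The image of `E5 × 0` under `J` is a complement to the characteristic direction, the
  -- transversal that parametrizes the paths.
  obtain ⟨J, hJ⟩ := SeparatingDual.exists_continuousLinearEquiv_apply_eq (R := ℝ)
    (x := ((0 : E5), (1 : ℝ))) (by simp) hne
  obtain ⟨S, h0, hS0, hT, hS, hS', hd⟩ :=
    exists_straightening κ.open_target hK (κ.map_source hz₀) J hJ
  -- The neighbourhood is shrunk to a product with an interval, so that every fibre is one connected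
  -- path.
  obtain ⟨N, hN, T, hTn, hNT⟩ := mem_nhds_prod_iff.1 (S.open_source.mem_nhds h0)
  obtain ⟨N', hN'N, hN', h0N'⟩ := mem_nhds_iff.1 hN
  obtain ⟨r, hr, hrT⟩ := Metric.mem_nhds_iff.1 hTn
  rw [Real.ball_eq_Ioo, zero_sub, zero_add] at hrT
  have hsub : N' ×ˢ Set.Ioo (-r) r ⊆ S.source := (Set.prod_mono hN'N hrT).trans hNT
  refine ⟨boxSet κ S N' (-r) r, fun z => (S.symm (κ z)).1, ?_, isOpen_boxSet κ S hN' _ _, ?_, ?_,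
    fun z hz => ?_⟩
  · refine mem_boxSet.2 ⟨hz₀, ?_⟩
    rw [← hS0, S.left_inv h0]
    exact ⟨S.map_source h0, h0N', by simpa using hr⟩
  · have h1 : ContMDiffOn 𝓘(ℝ, E5 × ℝ) 𝓘(ℝ, E5 × ℝ) ∞ (fun z => S.symm (κ z))
        (boxSet κ S N' (-r) r) :=
      hS'.contMDiffOn.comp ((contMDiffOn_of_mem_maximalAtlas h.mem_atlas).mono fun z hz =>
        (mem_boxSet.1 hz).1) fun z hz => (mem_boxSet.1 hz).2.1
    exact (contDiff_fst.contMDiff (n := ∞)).comp_contMDiffOn h1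
  · intro z hz x
    obtain ⟨hzs, hzT, -⟩ := mem_boxSet.1 hz
    have hκ := ((mdifferentiable_of_mem_maximalAtlas h.mem_atlas).mdifferentiableAt hzs).hasMFDerivAt
    have hSd := ((hS'.contDiffAt (S.open_target.mem_nhds hzT)).differentiableAt
      (by simp)).hasFDerivAt
    have h1 := (((ContinuousLinearMap.fst ℝ E5 ℝ).hasFDerivAt.comp (κ z) hSd).hasMFDerivAt).comp z hκ
    have h2 : ∀ w, dpi D (fun z => (S.symm (κ z)).1) z w =
        (fderiv ℝ S.symm (κ z) (dchart κ z w)).1 := fun w => DFunLike.congr_fun h1.mfderiv w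
    refine ⟨(dchart κ z).inverse (fderiv ℝ S (S.symm (κ z)) (x, 0)), ?_⟩
    rw [h2, dchart_inverse_apply h.mem_atlas hzs]
    have h3 := fderiv_symm_fderiv hS hS' (S.map_target hzT) (x, 0)
    rw [S.right_inv hzT] at h3
    exact congrArg Prod.fst h3
  · obtain ⟨c, hc, hc'⟩ := h.exists_isSingularLift_box hT hS
      (fun p hp => ⟨1, one_ne_zero, by simpa using hd p hp⟩) hsub hz
    exact ⟨c, -r, r, hc, hc'⟩

end Box

end CartanDuality

end

/-! ### Submersions along the characteristic field, and the chain of brackets. -/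

open scoped Manifold ContDiff Topology

noncomputable section

namespace CartanDuality

/-- `ϖ` is a submersion of the open set `Ω` whose fibres are tangent to the characteristic field. -/
structure IsCharProjection (O : Set E5) (e : Fin 5 → E5 → E5) (Ω : Set (E5 × ℝ))
    (ϖ : E5 × ℝ → E5) : Prop where
  frame : IsAdaptedFrame O e
  isOpen : IsOpen Ω
  fst_mem : ∀ u ∈ Ω, u.1 ∈ O
  smooth : ContDiffOn ℝ ∞ ϖ Ω
  surjective : ∀ u ∈ Ω, Function.Surjective (fderiv ℝ ϖ u)
  apply_charField : ∀ u ∈ Ω, fderiv ℝ ϖ u (charField e u) = 0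

theorem charField_ne_zero {O : Set E5} {e : Fin 5 → E5 → E5} (h : IsAdaptedFrame O e)
    {u : E5 × ℝ} (hu : u.1 ∈ O) : charField e u ≠ 0 :=
  fun h0 => h.lineField_ne_zero u.2 hu (congrArg Prod.fst h0)

namespace IsCharProjection

variable {O : Set E5} {e : Fin 5 → E5 → E5} {Ω : Set (E5 × ℝ)} {ϖ : E5 × ℝ → E5}

/-- The dimensions 6 and 5 leave a kernel of dimension one, which contains the nonzero vector
`charField`. -/
theorem exists_eq_smul (h : IsCharProjection O e Ω ϖ) {u : E5 × ℝ} (hu : u ∈ Ω) {w : E5 × ℝ}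
    (hw : fderiv ℝ ϖ u w = 0) : ∃ r : ℝ, w = r • charField e u := by
  let L : E5 × ℝ →ₗ[ℝ] E5 := (fderiv ℝ ϖ u).toLinearMap
  have h1 := L.finrank_range_add_finrank_ker
  rw [LinearMap.range_eq_top.2 (h.surjective u hu), finrank_top] at h1
  simp only [finrank_euclideanSpace, Fintype.card_fin, Module.finrank_prod,
    Module.finrank_self] at h1
  have h2 : Module.finrank ℝ (LinearMap.ker L) = 1 := by omega
  have h3 := (finrank_eq_one_iff_of_nonzero' (⟨charField e u, h.apply_charField u hu⟩ :
    LinearMap.ker L) (by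
      intro h0
      exact charField_ne_zero h.frame (h.fst_mem u hu) (congrArg Subtype.val h0))).1 h2
  obtain ⟨c, hc⟩ := h3 ⟨w, hw⟩
  exact ⟨c, (congrArg Subtype.val hc).symm⟩

theorem contDiffAt (h : IsCharProjection O e Ω ϖ) {u : E5 × ℝ} (hu : u ∈ Ω) :
    ContDiffAt ℝ ∞ ϖ u := h.smooth.contDiffAt (h.isOpen.mem_nhds hu)

theorem contDiffAt_charField (h : IsCharProjection O e Ω ϖ) {u : E5 × ℝ} (hu : u ∈ Ω) :
    ContDiffAt ℝ ∞ (charField e) u :=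
  h.frame.contDiffOn_charField.contDiffAt (h.frame.isOpen_prod.mem_nhds ⟨h.fst_mem u hu, trivial⟩)

/-- The derivative of `Dϖ V` along the characteristic field. -/
theorem fderiv_apply_field (h : IsCharProjection O e Ω ϖ) {u : E5 × ℝ} (hu : u ∈ Ω)
    {V : E5 × ℝ → E5 × ℝ} (hV : DifferentiableAt ℝ V u) :
    fderiv ℝ (fun u => fderiv ℝ ϖ u (V u)) u (charField e u) =
      fderiv ℝ ϖ u (VectorField.lieBracket ℝ (charField e) V u) := by
  have hd : HasFDerivAt (fderiv ℝ ϖ) (fderiv ℝ (fderiv ℝ ϖ) u) u :=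
    (((h.contDiffAt hu).fderiv_right (m := ∞) (by simp)).differentiableAt
      (by simp)).hasFDerivAt
  have hK := ((h.contDiffAt_charField hu).differentiableAt (by simp)).hasFDerivAt
  have h1 := hd.clm_apply hK
  -- Differentiating `Dϖ K = 0` in the direction `V` replaces `D²ϖ (V, K)` by `-Dϖ (DK V)`; with the
  -- symmetry of `D²ϖ` the bracket appears.
  have h2 : (fun u => fderiv ℝ ϖ u (charField e u)) =ᶠ[𝓝 u] fun _ => (0 : E5) := by
    filter_upwards [h.isOpen.mem_nhds hu] with x hx using h.apply_charField x hx
  have h3 := DFunLike.congr_fun (h1.unique ((hasFDerivAt_const (0 : E5) u).congr_of_eventuallyEq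
    h2)) (V u)
  have h4 := (hd.clm_apply hV.hasFDerivAt).fderiv
  have hsym := ((h.contDiffAt hu).of_le (m := 2) ENat.LEInfty.out).isSymmSndFDerivAt (by simp)
  rw [h4, VectorField.lieBracket, map_sub]
  simp at h3 ⊢
  rw [hsym.eq (V u) (charField e u)] at h3
  rw [eq_neg_of_add_eq_zero_left h3]
  abel

/-- The images under `Dϖ` of the fields `∂ₜ`, `e 1`, `e 2`, `e 3 + t e 4`. -/
def transverseField (e : Fin 5 → E5 → E5) (i : Fin 4) (u : E5 × ℝ) : E5 × ℝ :=
  ![(0, 1), (e 1 u.1, 0), (e 2 u.1, 0), (topField e u.2 u.1, 0)] i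

theorem contDiffOn_transverseField (h : IsAdaptedFrame O e) (i : Fin 4) :
    ContDiffOn ℝ ∞ (transverseField e i) (O ×ˢ Set.univ) := by
  have he : ∀ i, ContDiffOn ℝ ∞ (fun u : E5 × ℝ => e i u.1) (O ×ˢ Set.univ) := fun i =>
    (h.smooth i).comp contDiff_fst.contDiffOn fun _ hu => hu.1
  fin_cases i
  · exact contDiffOn_const
  · exact (he 1).prodMk contDiffOn_const
  · exact (he 2).prodMk contDiffOn_const
  · exact ((he 3).add (contDiff_snd.contDiffOn.smul (he 4))).prodMk contDiffOn_const

/-- A relation between the images means that a combination of the four fields is a multiple of K.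
Only K has an `e 0` component, so the multiple is zero, and the four fields are independent. -/
theorem linearIndependent_transverseField (h : IsCharProjection O e Ω ϖ) {u : E5 × ℝ}
    (hu : u ∈ Ω) : LinearIndependent ℝ fun i => fderiv ℝ ϖ u (transverseField e i u) := by
  have hO := h.fst_mem u hu
  rw [Fintype.linearIndependent_iff]
  intro g hg
  have h1 : fderiv ℝ ϖ u (∑ i, g i • transverseField e i u) = 0 := by
    rw [map_sum, ← hg]; simp
  obtain ⟨r, hr⟩ := h.exists_eq_smul hu h1
  have hr1 := congrArg Prod.fst hr
  have hr2 := congrArg Prod.snd hr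
  simp [Fin.sum_univ_four, transverseField, charField] at hr1 hr2
  have hc : ∀ i, coframe e i u.1 (g 1 • e 1 u.1 + g 2 • e 2 u.1 + g 3 • topField e u.2 u.1) =
      r * coframe e i u.1 (lineField e u.2 u.1) := fun i => by rw [hr1]; simp
  simp only [map_add, map_smul, smul_eq_mul, h.frame.coframe_apply hO,
    h.frame.coframe_lineField hO, h.frame.coframe_topField hO] at hc
  have h0 := hc 0
  have h1 := hc 1
  have h2 := hc 2
  have h3 := hc 3
  simp at h0 h1 h2 h3
  rw [← h0] at h1 hr2
  simp at h1 hr2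
  intro i
  fin_cases i
  · exact hr2
  · exact h1
  · exact h2
  · exact h3

/-- The brackets of the characteristic field with the transverse fields. -/
theorem fderiv_transverse_zero (h : IsCharProjection O e Ω ϖ) {u : E5 × ℝ} (hu : u ∈ Ω) :
    fderiv ℝ ϖ u (VectorField.lieBracket ℝ (charField e) (transverseField e 0) u) =
      -fderiv ℝ ϖ u (transverseField e 1 u) +
      (VectorField.lieBracket ℝ (charField e) (transverseField e 0) u).2 •
        fderiv ℝ ϖ u (transverseField e 0 u) := by
  have hf : DifferentiableAt ℝ (fun u => (charField e u).2) u :=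
    ((h.contDiffAt_charField hu).differentiableAt (by simp)).snd
  have h1 := h.frame.lieBracket_lift_vertical_fst (h.fst_mem u hu) hf
  rw [← map_neg, ← map_smul, ← map_add]
  congr 1
  refine Prod.ext ?_ ?_
  · simp only [transverseField]
    refine h1.trans ?_
    simp
  · simp [transverseField]

/-- Modulo ∂ₜ only the base component of the bracket counts, and that is the bracket with frozen
parameter. The vertical component of `charField` thus affects only the coefficient of ∂ₜ. -/
theorem fderiv_transverse_lift (h : IsCharProjection O e Ω ϖ) {u : E5 × ℝ} (hu : u ∈ Ω)
    (i : Fin 5) {v : E5} (hv : VectorField.lieBracket ℝ (lineField e u.2) (e i) u.1 = v) :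
    fderiv ℝ ϖ u (VectorField.lieBracket ℝ (charField e) (fun u => (e i u.1, (0 : ℝ))) u) =
      fderiv ℝ ϖ u (v, 0) +
      (VectorField.lieBracket ℝ (charField e) (fun u => (e i u.1, (0 : ℝ))) u).2 •
        fderiv ℝ ϖ u (transverseField e 0 u) := by
  have hf : DifferentiableAt ℝ (fun u => (charField e u).2) u :=
    ((h.contDiffAt_charField hu).differentiableAt (by simp)).snd
  have h1 := h.frame.lieBracket_lift_fst (h.fst_mem u hu) hf i
  rw [← map_smul, ← map_add]
  congr 1
  refine Prod.ext ?_ ?_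
  · refine (h1.trans hv).trans ?_
    simp [transverseField]
  · simp [transverseField]

end IsCharProjection

section Manifold

set_option linter.unusedSectionVars false

variable {Y : Type*} [TopologicalSpace Y] [ChartedSpace E5 Y] [IsManifold 𝓘(ℝ, E5) ∞ Y]
  {D : PlaneField Y} {κ : OpenPartialHomeomorph (ProjSpace D) (E5 × ℝ)}
  {ψ : OpenPartialHomeomorph Y E5} {O : Set E5} {e : Fin 5 → E5 → E5}
  {X : Type*} [TopologicalSpace X] [ChartedSpace E5 X] [IsManifold 𝓘(ℝ, E5) ∞ X]
  {φ : OpenPartialHomeomorph X E5} {W : Set (ProjSpace D)} {π : ProjSpace D → X}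

theorem IsPathSpace.contMDiffOn_chart (hπ : IsPathSpace D W π)
    (hφ : φ ∈ IsManifold.maximalAtlas 𝓘(ℝ, E5) ∞ X)
    (hκ : κ ∈ IsManifold.maximalAtlas 𝓘(ℝ, E5 × ℝ) ∞ (ProjSpace D)) :
    ContDiffOn ℝ ∞ (fun u => φ (π (κ.symm u)))
      (κ.target ∩ κ.symm ⁻¹' (W ∩ π ⁻¹' φ.source)) := by
  rw [← contMDiffOn_iff_contDiffOn]
  exact (contMDiffOn_of_mem_maximalAtlas hφ).comp (hπ.smooth.comp
    ((contMDiffOn_symm_of_mem_maximalAtlas hκ).mono Set.inter_subset_left)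
    fun u hu => hu.2.1) fun u hu => hu.2.2

/-- The differential of `π` in charts. -/
theorem IsPathSpace.dchart_dpi (hπ : IsPathSpace D W π)
    (hφ : φ ∈ IsManifold.maximalAtlas 𝓘(ℝ, E5) ∞ X)
    (hκ : κ ∈ IsManifold.maximalAtlas 𝓘(ℝ, E5 × ℝ) ∞ (ProjSpace D)) {z : ProjSpace D}
    (hz : z ∈ κ.source) (hzW : z ∈ W) (hzφ : π z ∈ φ.source)
    (w : TangentSpace 𝓘(ℝ, E5 × ℝ) z) : dchart φ (π z) (dpi D π z w) =
      fderiv ℝ (fun u => φ (π (κ.symm u))) (κ z) (dchart κ z w) := by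
  have hU : IsOpen (κ.target ∩ κ.symm ⁻¹' (W ∩ π ⁻¹' φ.source)) :=
    κ.isOpen_inter_preimage_symm
      (hπ.smooth.continuousOn.isOpen_inter_preimage hπ.isOpen φ.open_source)
  have hu : κ z ∈ κ.target ∩ κ.symm ⁻¹' (W ∩ π ⁻¹' φ.source) :=
    ⟨κ.map_source hz, by rw [Set.mem_preimage, κ.left_inv hz]; exact ⟨hzW, hzφ⟩⟩
  have h1 := (((hπ.contMDiffOn_chart hφ hκ).contDiffAt (hU.mem_nhds hu)).differentiableAt
    (by simp)).hasFDerivAt.hasMFDerivAt.comp z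
    ((mdifferentiable_of_mem_maximalAtlas hκ).mdifferentiableAt hz).hasMFDerivAt
  have h2 := ((mdifferentiable_of_mem_maximalAtlas hφ).mdifferentiableAt hzφ).hasMFDerivAt.comp z
    ((hπ.smooth.contMDiffAt (hπ.isOpen.mem_nhds hzW)).mdifferentiableAt (by simp)).hasMFDerivAt
  have h3 : (φ ∘ π) =ᶠ[𝓝 z] (fun u => φ (π (κ.symm u))) ∘ κ := by
    filter_upwards [κ.open_source.mem_nhds hz] with z hz
    simp only [Function.comp_apply, κ.left_inv hz]
  exact DFunLike.congr_fun (hasMFDerivAt_unique h2 (h1.congr_of_eventuallyEq h3)) w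

/-- The coordinate expression of the projection to a space of singular paths. -/
theorem IsPathSpace.isCharProjection (hπ : IsPathSpace D W π) (h : IsAdaptedChart D κ ψ O e)
    (hφ : φ ∈ IsManifold.maximalAtlas 𝓘(ℝ, E5) ∞ X) {W₁ : Set (ProjSpace D)} (hW₁ : IsOpen W₁)
    (hW₁s : W₁ ⊆ W ∩ π ⁻¹' φ.source) :
    IsCharProjection O e (κ.target ∩ κ.symm ⁻¹' W₁) (fun u => φ (π (κ.symm u))) where
  frame := h.frame
  isOpen := κ.isOpen_inter_preimage_symm hW₁
  fst_mem := fun u hu => by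
    have := hu.1
    rw [h.target_eq] at this
    exact this.1
  smooth := (hπ.contMDiffOn_chart hφ h.mem_atlas).mono
    (Set.inter_subset_inter_right _ (Set.preimage_mono hW₁s))
  surjective := by
    intro u hu v
    have hz := κ.map_target hu.1
    obtain ⟨hzW, hzφ⟩ := hW₁s hu.2
    obtain ⟨w, hw⟩ := hπ.submersive _ hzW ((dchart φ (π (κ.symm u))).inverse v)
    refine ⟨dchart κ (κ.symm u) w, ?_⟩
    have h1 := hπ.dchart_dpi hφ h.mem_atlas hz hzW hzφ w
    rw [hw, dchart_inverse_apply hφ hzφ, κ.right_inv hu.1] at h1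
    exact h1.symm
  apply_charField := by
    intro u hu
    have hz := κ.map_target hu.1
    obtain ⟨hzW, hzφ⟩ := hW₁s hu.2
    -- The fibre through the point is a singular lift, whose velocity is a nonzero multiple of
    -- `charField`, while the projection is constant on it.
    obtain ⟨c, a, b, hc, him⟩ := hπ.fibre _ hzW
    have hzm : κ.symm u ∈ c '' Set.Ioo a b := by rw [him]; exact ⟨hzW, rfl⟩
    obtain ⟨t₀, ht₀, hct⟩ := hzm
    obtain ⟨hev, -, r, hr, hd⟩ := h.hasDerivAt_of_isSingularLift hc ht₀ (by rwa [hct])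
    have hu' : κ (c t₀) = u := by rw [hct, κ.right_inv hu.1]
    have hϖ := ((((hπ.contMDiffOn_chart hφ h.mem_atlas).mono
      (Set.inter_subset_inter_right _ (Set.preimage_mono hW₁s))).contDiffAt
      ((κ.isOpen_inter_preimage_symm hW₁).mem_nhds hu)).differentiableAt (by simp)).hasFDerivAt
    have h1 := hϖ.comp_hasDerivAt_of_eq t₀ hd hu'.symm
    have h2 : ((fun u => φ (π (κ.symm u))) ∘ fun t => κ (c t)) =ᶠ[𝓝 t₀]
        fun _ => φ (π (κ.symm u)) := by
      filter_upwards [hev, isOpen_Ioo.mem_nhds ht₀] with t ht htI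
      have h3 : c t ∈ c '' Set.Ioo a b := ⟨t, htI, rfl⟩
      rw [him] at h3
      simp only [Function.comp_apply, κ.left_inv ht, h3.2]
    have h4 := h1.unique ((hasDerivAt_const t₀ _).congr_of_eventuallyEq h2)
    rw [map_smul, hu'] at h4
    exact (smul_eq_zero.1 h4).resolve_left hr

end Manifold

end CartanDuality

end

/-! ### Moving frames, and cones over curves. -/

open scoped Manifold ContDiff Topology

noncomputable section

namespace CartanDuality

section Triangular

variable {V : Type*} [NormedAddCommGroup V] [NormedSpace ℝ V]

/-- A triangular change of a linearly independent family. -/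
theorem linearIndependent_of_triangular {v w : Fin 4 → V} (hv : LinearIndependent ℝ v)
    {a₀ a₁ b₁ a₂ b₂ c₂ a₃ b₃ c₃ d₃ : ℝ} (h0 : w 0 = a₀ • v 0) (h1 : w 1 = a₁ • v 0 + b₁ • v 1)
    (h2 : w 2 = a₂ • v 0 + b₂ • v 1 + c₂ • v 2)
    (h3 : w 3 = a₃ • v 0 + b₃ • v 1 + c₃ • v 2 + d₃ • v 3)
    (ha : a₀ ≠ 0) (hb : b₁ ≠ 0) (hc : c₂ ≠ 0) (hd : d₃ ≠ 0) : LinearIndependent ℝ w := by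
  rw [Fintype.linearIndependent_iff] at hv ⊢
  intro g hg
  have h := hv ![g 0 * a₀ + g 1 * a₁ + g 2 * a₂ + g 3 * a₃, g 1 * b₁ + g 2 * b₂ + g 3 * b₃,
    g 2 * c₂ + g 3 * c₃, g 3 * d₃] (by
      rw [← hg, Fin.sum_univ_four, Fin.sum_univ_four, h0, h1, h2, h3]
      simp only [Matrix.cons_val]
      module)
  have e3 : g 3 = 0 := (mul_eq_zero.1 (h 3)).resolve_right hd
  have e2 : g 2 = 0 := by
    have := h 2
    simp only [Matrix.cons_val, e3, zero_mul, add_zero] at this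
    exact (mul_eq_zero.1 this).resolve_right hc
  have e1 : g 1 = 0 := by
    have := h 1
    simp only [Matrix.cons_val, e3, e2, zero_mul, add_zero] at this
    exact (mul_eq_zero.1 this).resolve_right hb
  have e0 : g 0 = 0 := by
    have := h 0
    simp only [Matrix.cons_val, e3, e2, e1, zero_mul, add_zero] at this
    exact (mul_eq_zero.1 this).resolve_right ha
  intro i
  fin_cases i
  exacts [e0, e1, e2, e3]

theorem eventually_hasDerivAt {f : ℝ → V} {t₀ : ℝ} (hf : ContDiffAt ℝ ∞ f t₀) :
    ∀ᶠ t in 𝓝 t₀, HasDerivAt f (deriv f t) t := by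
  filter_upwards [(hf.of_le (m := 1) (by simp)).eventually (by simp)] with t ht
  exact (ht.differentiableAt (by simp)).hasDerivAt

theorem contDiffAt_deriv {f : ℝ → V} {t₀ : ℝ} (hf : ContDiffAt ℝ ∞ f t₀) :
    ContDiffAt ℝ ∞ (deriv f) t₀ :=
  (hf.fderiv_right (m := ∞) (by simp)).clm_apply contDiffAt_const

theorem contDiffAt_comp_const_add {f : ℝ → V} {s : ℝ} (hf : ContDiffAt ℝ ∞ f s) :
    ContDiffAt ℝ ∞ (fun t => f (s + t)) 0 :=
  ContDiffAt.comp (f := fun t : ℝ => s + t) (g := f) 0 (by simpa using hf)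
    (contDiffAt_const.add contDiffAt_id)

/-- The first derivatives of a multiple of `f₀`, for a moving frame with
`fⱼ' = mⱼ fⱼ₊₁ + aⱼ f₀`. -/
theorem linearIndependent_iteratedDeriv {c : ℝ → V} {f : Fin 4 → ℝ → V}
    {ρ m₀ m₁ m₂ a₀ a₁ a₂ : ℝ → ℝ} {t₀ : ℝ}
    (hρ : ContDiffAt ℝ ∞ ρ t₀) (hm₀ : ContDiffAt ℝ ∞ m₀ t₀) (hm₁ : ContDiffAt ℝ ∞ m₁ t₀)
    (ha₀ : ContDiffAt ℝ ∞ a₀ t₀) (ha₁ : ContDiffAt ℝ ∞ a₁ t₀)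
    (hf₀ : ∀ᶠ t in 𝓝 t₀, HasDerivAt (f 0) (m₀ t • f 1 t + a₀ t • f 0 t) t)
    (hf₁ : ∀ᶠ t in 𝓝 t₀, HasDerivAt (f 1) (m₁ t • f 2 t + a₁ t • f 0 t) t)
    (hf₂ : ∀ᶠ t in 𝓝 t₀, HasDerivAt (f 2) (m₂ t • f 3 t + a₂ t • f 0 t) t)
    (hc : ∀ᶠ t in 𝓝 t₀, c t = ρ t • f 0 t) (hρ0 : ρ t₀ ≠ 0) (hm₀0 : m₀ t₀ ≠ 0)
    (hm₁0 : m₁ t₀ ≠ 0) (hm₂0 : m₂ t₀ ≠ 0) (hf : LinearIndependent ℝ fun i => f i t₀) :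
    LinearIndependent ℝ fun i : Fin 4 => iteratedDeriv i c t₀ := by
  -- These are the coefficients of the successive derivatives of `c` in the moving frame. The
  -- leading ones are `ρ`, `ρ m₀`, `ρ m₀ m₁`, `ρ m₀ m₁ m₂`, so the change of family is triangular;
  -- only the values of `m₂` and `a₂` at `t₀` enter.
  let A₁ : ℝ → ℝ := fun t => ρ t * a₀ t + deriv ρ t
  let B₁ : ℝ → ℝ := fun t => ρ t * m₀ t
  have hA₁ : ContDiffAt ℝ ∞ A₁ t₀ := (hρ.mul ha₀).add (contDiffAt_deriv hρ)
  have hB₁ : ContDiffAt ℝ ∞ B₁ t₀ := hρ.mul hm₀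
  let A₂ : ℝ → ℝ := fun t => A₁ t * a₀ t + deriv A₁ t + B₁ t * a₁ t
  let B₂ : ℝ → ℝ := fun t => A₁ t * m₀ t + deriv B₁ t
  let C₂ : ℝ → ℝ := fun t => B₁ t * m₁ t
  have hA₂ : ContDiffAt ℝ ∞ A₂ t₀ :=
    ((hA₁.mul ha₀).add (contDiffAt_deriv hA₁)).add (hB₁.mul ha₁)
  have hB₂ : ContDiffAt ℝ ∞ B₂ t₀ := (hA₁.mul hm₀).add (contDiffAt_deriv hB₁)
  have hC₂ : ContDiffAt ℝ ∞ C₂ t₀ := hB₁.mul hm₁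
  have h1 : deriv c =ᶠ[𝓝 t₀] fun t => A₁ t • f 0 t + B₁ t • f 1 t := by
    filter_upwards [hc.eventually_nhds, eventually_hasDerivAt hρ, hf₀] with t hct hρt h0
    rw [Filter.EventuallyEq.deriv_eq hct]
    refine (hρt.smul h0).deriv.trans ?_
    simp only [A₁, B₁]
    module
  have h2 : deriv (deriv c) =ᶠ[𝓝 t₀] fun t => A₂ t • f 0 t + B₂ t • f 1 t + C₂ t • f 2 t := by
    filter_upwards [h1.eventually_nhds, eventually_hasDerivAt hA₁, eventually_hasDerivAt hB₁, hf₀,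
      hf₁] with t hct hAt hBt h0 h1
    rw [Filter.EventuallyEq.deriv_eq hct]
    refine ((hAt.smul h0).add (hBt.smul h1)).deriv.trans ?_
    simp only [A₂, B₂, C₂]
    module
  have h3 : deriv (deriv (deriv c)) t₀ =
      (A₂ t₀ * a₀ t₀ + deriv A₂ t₀ + B₂ t₀ * a₁ t₀ + C₂ t₀ * a₂ t₀) • f 0 t₀ +
      (A₂ t₀ * m₀ t₀ + deriv B₂ t₀) • f 1 t₀ + (B₂ t₀ * m₁ t₀ + deriv C₂ t₀) • f 2 t₀ +
      (C₂ t₀ * m₂ t₀) • f 3 t₀ := by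
    rw [Filter.EventuallyEq.deriv_eq h2]
    refine (((((eventually_hasDerivAt hA₂).self_of_nhds.smul hf₀.self_of_nhds).add
      ((eventually_hasDerivAt hB₂).self_of_nhds.smul hf₁.self_of_nhds))).add
      ((eventually_hasDerivAt hC₂).self_of_nhds.smul hf₂.self_of_nhds)).deriv.trans ?_
    module
  have e0 : iteratedDeriv 0 c t₀ = ρ t₀ • f 0 t₀ := by simpa using hc.self_of_nhds
  have e1 : iteratedDeriv 1 c t₀ = A₁ t₀ • f 0 t₀ + B₁ t₀ • f 1 t₀ := by
    rw [iteratedDeriv_one]; exact h1.self_of_nhds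
  have e2 : iteratedDeriv 2 c t₀ = A₂ t₀ • f 0 t₀ + B₂ t₀ • f 1 t₀ + C₂ t₀ • f 2 t₀ := by
    rw [iteratedDeriv_succ, iteratedDeriv_one]; exact h2.self_of_nhds
  have e3 : iteratedDeriv 3 c t₀ = deriv (deriv (deriv c)) t₀ := by
    rw [iteratedDeriv_succ, iteratedDeriv_succ, iteratedDeriv_one]
  exact linearIndependent_of_triangular hf e0 e1 e2 (e3.trans h3) hρ0 (mul_ne_zero hρ0 hm₀0)
    (mul_ne_zero (mul_ne_zero hρ0 hm₀0) hm₁0)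
    (mul_ne_zero (mul_ne_zero (mul_ne_zero hρ0 hm₀0) hm₁0) hm₂0)

end Triangular

section ConeOverCurve

/-- The cone over the curve `k : (a, b) → ℝ⁵`. -/
def curveCone (k : ℝ → E5) (a b : ℝ) : Set E5 := {v | ∃ s ∈ Set.Ioo a b, ∃ r : ℝ, v = r • k s}

variable {k : ℝ → E5} {a b : ℝ} {l₀ l₁ : E5 →L[ℝ] ℝ}

/-- A smooth curve in the cone, off the vertex, is a multiple of a reparametrization of the given
curve. -/
theorem exists_reparametrization (hk : ContDiffOn ℝ ∞ k (Set.Ioo a b))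
    (h0 : ∀ s ∈ Set.Ioo a b, l₀ (k s) ≠ 0) (h1 : ∀ s ∈ Set.Ioo a b, l₁ (k s) = s * l₀ (k s))
    {c : ℝ → E5} (hc : ContDiffAt ℝ ∞ c 0) (hcm : ∀ᶠ t in 𝓝 0, c t ∈ curveCone k a b \ {0}) :
    ∃ ρ τ : ℝ → ℝ, ContDiffAt ℝ ∞ ρ 0 ∧ ContDiffAt ℝ ∞ τ 0 ∧
      ∀ᶠ t in 𝓝 0, τ t ∈ Set.Ioo a b ∧ ρ t ≠ 0 ∧ c t = ρ t • k (τ t) := by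
  -- The parameter of a point of the cone is the quotient `l₁ / l₀`, a smooth function; the factor
  -- is then found by comparing the values of `l₀`.
  have hev : ∀ᶠ t in 𝓝 (0 : ℝ), l₀ (c t) ≠ 0 ∧ l₁ (c t) / l₀ (c t) ∈ Set.Ioo a b ∧
      c t = (l₀ (c t) / l₀ (k (l₁ (c t) / l₀ (c t)))) • k (l₁ (c t) / l₀ (c t)) := by
    filter_upwards [hcm] with t ht
    obtain ⟨⟨s, hs, r, hr⟩, hne⟩ := ht
    have hr0 : r ≠ 0 := by
      rintro rfl
      rw [zero_smul] at hr
      exact hne hr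
    have e0 : l₀ (c t) = r * l₀ (k s) := by rw [hr, map_smul, smul_eq_mul]
    have e1 : l₁ (c t) = r * (s * l₀ (k s)) := by rw [hr, map_smul, smul_eq_mul, h1 s hs]
    have e2 : l₁ (c t) / l₀ (c t) = s := by
      rw [e0, e1]; field_simp [h0 s hs]
    refine ⟨by rw [e0]; exact mul_ne_zero hr0 (h0 s hs), by rwa [e2], ?_⟩
    rw [e2, e0, mul_div_cancel_right₀ _ (h0 s hs), hr]
  have hl : ∀ l : E5 →L[ℝ] ℝ, ContDiffAt ℝ ∞ (fun t => l (c t)) 0 := fun l =>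
    l.contDiff.contDiffAt.comp 0 hc
  have hτ := (hl l₁).div (hl l₀) hev.self_of_nhds.1
  refine ⟨fun t => l₀ (c t) / l₀ (k (l₁ (c t) / l₀ (c t))), fun t => l₁ (c t) / l₀ (c t),
    (hl l₀).div (l₀.contDiff.contDiffAt.comp 0
      ((hk.contDiffAt (isOpen_Ioo.mem_nhds hev.self_of_nhds.2.1)).comp 0 hτ))
      (h0 _ hev.self_of_nhds.2.1), hτ, ?_⟩
  filter_upwards [hev] with t ht
  exact ⟨ht.2.1, div_ne_zero ht.1 (h0 _ ht.2.1), ht.2.2⟩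

/-- The functional `l₁ - s l₀` kills `k s`, while differentiating `l₁ k = s l₀ k` shows that its
value on the derivative is `l₀ (k s)`, which is nonzero. -/
theorem linearIndependent_curve_deriv (hk : ContDiffOn ℝ ∞ k (Set.Ioo a b))
    (h0 : ∀ s ∈ Set.Ioo a b, l₀ (k s) ≠ 0) (h1 : ∀ s ∈ Set.Ioo a b, l₁ (k s) = s * l₀ (k s))
    {s : ℝ} (hs : s ∈ Set.Ioo a b) : LinearIndependent ℝ ![k s, deriv k s] := by
  have hd : HasDerivAt k (deriv k s) s :=
    ((hk.contDiffAt (isOpen_Ioo.mem_nhds hs)).differentiableAt (by simp)).hasDerivAt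
  have hl := fun l : E5 →L[ℝ] ℝ => l.hasFDerivAt.comp_hasDerivAt s hd
  have h2 : (fun s => l₁ (k s)) =ᶠ[𝓝 s] fun s => s * l₀ (k s) := by
    filter_upwards [isOpen_Ioo.mem_nhds hs] with s hs using h1 s hs
  have h3 := (hl l₁).unique (((hasDerivAt_id s).mul (hl l₀)).congr_of_eventuallyEq h2)
  simp only [Function.comp_apply, id, one_mul] at h3
  rw [LinearIndependent.pair_iff]
  intro p q hpq
  have e0 := congrArg l₀ hpq
  have e1 := congrArg l₁ hpq
  simp only [map_add, map_smul, smul_eq_mul, map_zero] at e0 e1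
  have hq : q * l₀ (k s) = 0 := by
    rw [h1 s hs, h3] at e1
    linear_combination e1 - s * e0
  have hq0 := (mul_eq_zero.1 hq).resolve_right (h0 s hs)
  rw [hq0, zero_mul, add_zero] at e0
  exact ⟨(mul_eq_zero.1 e0).resolve_right (h0 s hs), hq0⟩

theorem smul_mem_curveCone_diff (h0 : ∀ s ∈ Set.Ioo a b, l₀ (k s) ≠ 0) {s r : ℝ}
    (hs : s ∈ Set.Ioo a b) (hr : r ≠ 0) : r • k s ∈ curveCone k a b \ {0} := by
  refine ⟨⟨s, hs, r, rfl⟩, fun h => ?_⟩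
  refine (smul_ne_zero hr ?_) h
  intro hk
  apply h0 s hs
  rw [hk, map_zero]

/-- The tangent space of a cone over a curve. -/
theorem tangentTo_curveCone (hk : ContDiffOn ℝ ∞ k (Set.Ioo a b))
    (h0 : ∀ s ∈ Set.Ioo a b, l₀ (k s) ≠ 0) (h1 : ∀ s ∈ Set.Ioo a b, l₁ (k s) = s * l₀ (k s))
    {s r : ℝ} (hs : s ∈ Set.Ioo a b) (hr : r ≠ 0) :
    tangentTo (curveCone k a b \ {0}) (r • k s) = Submodule.span ℝ {k s, deriv k s} := by
  have hks : ContDiffAt ℝ ∞ k s := hk.contDiffAt (isOpen_Ioo.mem_nhds hs)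
  have hd : HasDerivAt k (deriv k s) s := (hks.differentiableAt (by simp)).hasDerivAt
  apply le_antisymm
  · rw [tangentTo, Submodule.span_le]
    rintro w ⟨c, hc, hcm, hc0, rfl⟩
    obtain ⟨ρ, τ, hρ, hτ, hev⟩ := exists_reparametrization hk h0 h1 hc hcm
    -- The slope `l₁ / l₀` identifies the parameter at the base point.
    have hτs : τ 0 = s := by
      obtain ⟨hτ0, hρ0, hcρ⟩ := hev.self_of_nhds
      rw [hc0] at hcρ
      have e0 := congrArg l₀ hcρ
      have e1 := congrArg l₁ hcρ
      simp only [map_smul, smul_eq_mul, h1 _ hs, h1 _ hτ0] at e0 e1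
      have h2 : r * l₀ (k s) * (s - τ 0) = 0 := by linear_combination e1 - τ 0 * e0
      have h3 := (mul_eq_zero.1 h2).resolve_left (mul_ne_zero hr (h0 s hs))
      linarith
    have h2 : HasDerivAt k (deriv k s) (τ 0) := by rw [hτs]; exact hd
    have h3 := (hρ.differentiableAt (by simp)).hasDerivAt.smul
      (h2.scomp 0 (hτ.differentiableAt (by simp)).hasDerivAt)
    have h4 : c =ᶠ[𝓝 0] fun t => ρ t • k (τ t) := hev.mono fun t ht => ht.2.2
    rw [h4.deriv_eq]
    refine Set.mem_of_eq_of_mem h3.deriv ?_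
    change _ ∈ Submodule.span ℝ {k s, deriv k s}
    simp only [Function.comp_apply, hτs]
    exact Submodule.add_mem _ (Submodule.smul_mem _ _ (Submodule.smul_mem _ _
      (Submodule.subset_span (by simp))))
      (Submodule.smul_mem _ _ (Submodule.subset_span (by simp)))
  · rw [Submodule.span_le]
    rintro w (rfl | rfl)
    · refine Submodule.subset_span ⟨fun t => (r + t) • k s,
        (contDiffAt_const.add contDiffAt_id).smul contDiffAt_const, ?_, by simp, ?_⟩
      · have : ContinuousAt (fun t : ℝ => r + t) 0 := by fun_prop
        filter_upwards [this.eventually_ne (by simpa using hr)] with t ht using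
          smul_mem_curveCone_diff h0 hs ht
      · have h2 := (((hasDerivAt_id (0 : ℝ)).const_add r).smul_const (k s)).deriv
        rw [one_smul] at h2
        exact h2
    · have h2 : HasDerivAt (fun t => r • k (s + t)) (r • deriv k s) 0 := by
        have h3 : HasDerivAt k (deriv k s) (s + 0) := by rwa [add_zero]
        have h4 := (h3.scomp 0 ((hasDerivAt_id (0 : ℝ)).const_add s)).const_smul r
        rwa [one_smul] at h4
      have h5 : r • deriv k s ∈ tangentTo (curveCone k a b \ {0}) (r • k s) := by
        refine Submodule.subset_span ⟨fun t => r • k (s + t), ?_, ?_, by simp, h2.deriv⟩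
        · exact (contDiffAt_comp_const_add hks).const_smul r
        · have : ContinuousAt (fun t : ℝ => s + t) 0 := by fun_prop
          filter_upwards [this.preimage_mem_nhds (isOpen_Ioo.mem_nhds (by simpa using hs))]
            with t ht using smul_mem_curveCone_diff h0 ht hr
      have h6 := Submodule.smul_mem _ r⁻¹ h5
      rwa [inv_smul_smul₀ hr] at h6

theorem exists_isParametrizationAt (hk : ContDiffOn ℝ ∞ k (Set.Ioo a b))
    (h0 : ∀ s ∈ Set.Ioo a b, l₀ (k s) ≠ 0) (h1 : ∀ s ∈ Set.Ioo a b, l₁ (k s) = s * l₀ (k s))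
    {s r : ℝ} (hs : s ∈ Set.Ioo a b) (hr : r ≠ 0) :
    ∃ c, IsParametrizationAt (curveCone k a b) (r • k s) c := by
  have hks : ContDiffAt ℝ ∞ k s := hk.contDiffAt (isOpen_Ioo.mem_nhds hs)
  have hd : HasDerivAt k (deriv k s) (s + 0) := by
    rw [add_zero]; exact (hks.differentiableAt (by simp)).hasDerivAt
  have h2 : HasDerivAt (fun t => r • k (s + t)) (r • deriv k s) 0 := by
    have h4 := (hd.scomp 0 ((hasDerivAt_id (0 : ℝ)).const_add s)).const_smul r
    rwa [one_smul] at h4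
  refine ⟨fun t => r • k (s + t), ?_, ?_, by simp, ?_⟩
  · exact (contDiffAt_comp_const_add hks).const_smul r
  · have : ContinuousAt (fun t : ℝ => s + t) 0 := by fun_prop
    filter_upwards [this.preimage_mem_nhds (isOpen_Ioo.mem_nhds (by simpa using hs))]
      with t ht using smul_mem_curveCone_diff h0 ht hr
  · rw [h2.deriv]
    simp only [add_zero]
    have h3 := LinearIndependent.pair_iff.1 (linearIndependent_curve_deriv hk h0 h1 hs)
    refine LinearIndependent.pair_iff.2 fun p q hpq => ?_
    have h4 := h3 (p * r) (q * r) (by rw [← hpq]; module)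
    exact ⟨(mul_eq_zero.1 h4.1).resolve_right hr, (mul_eq_zero.1 h4.2).resolve_right hr⟩

/-- Non-degeneracy depends neither on the lift nor on the parameter: `c = ρ • (k ∘ τ)`, and the
derivatives of `k` composed with `τ` form a moving frame with all speeds equal to `τ'`. -/
theorem linearIndependent_iteratedDeriv_of_isParametrizationAt
    (hk : ContDiffOn ℝ ∞ k (Set.Ioo a b))
    (h0 : ∀ s ∈ Set.Ioo a b, l₀ (k s) ≠ 0) (h1 : ∀ s ∈ Set.Ioo a b, l₁ (k s) = s * l₀ (k s))
    (hli : ∀ s ∈ Set.Ioo a b, LinearIndependent ℝ fun i : Fin 4 => iteratedDeriv i k s)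
    {v : E5} {c : ℝ → E5} (hc : IsParametrizationAt (curveCone k a b) v c) :
    LinearIndependent ℝ fun i : Fin 4 => iteratedDeriv i c 0 := by
  obtain ⟨hcs, hcm, hc0, hcd⟩ := hc
  obtain ⟨ρ, τ, hρ, hτ, hev⟩ := exists_reparametrization hk h0 h1 hcs hcm
  have hkd : ∀ i : ℕ, ∀ s ∈ Set.Ioo a b, HasDerivAt (iteratedDeriv i k) (iteratedDeriv (i + 1) k s)
      s := by
    intro i s hs
    rw [iteratedDeriv_succ]
    refine DifferentiableAt.hasDerivAt ?_
    have h2 : DifferentiableOn ℝ (iteratedDerivWithin i k (Set.Ioo a b)) (Set.Ioo a b) :=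
      ContDiffOn.differentiableOn_iteratedDerivWithin hk (by norm_cast; exact WithTop.coe_lt_top _)
        (uniqueDiffOn_Ioo a b)
    have h3 : iteratedDeriv i k =ᶠ[𝓝 s] iteratedDerivWithin i k (Set.Ioo a b) := by
      filter_upwards [isOpen_Ioo.mem_nhds hs] with t ht
      exact (iteratedDerivWithin_of_isOpen isOpen_Ioo ht).symm
    exact ((h2 s hs).differentiableAt (isOpen_Ioo.mem_nhds hs)).congr_of_eventuallyEq h3
  have hder : ∀ i : ℕ, ∀ᶠ t in 𝓝 (0 : ℝ), HasDerivAt (fun t => iteratedDeriv i k (τ t))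
      (deriv τ t • iteratedDeriv (i + 1) k (τ t) + (0 : ℝ) • iteratedDeriv 0 k (τ t)) t := by
    intro i
    filter_upwards [hev, eventually_hasDerivAt hτ] with t ht hτt
    rw [zero_smul, add_zero]
    exact (hkd i _ ht.1).scomp t hτt
  -- If `τ` were stationary, `deriv c 0` would be proportional to `c 0`, against the regularity of
  -- the parametrization.
  have hτ0 : deriv τ 0 ≠ 0 := by
    intro h2
    have h3 := (hρ.differentiableAt (by simp)).hasDerivAt.smul (hder 0).self_of_nhds
    have h4 : c =ᶠ[𝓝 0] fun t => ρ t • iteratedDeriv 0 k (τ t) := hev.mono fun t ht => by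
      rw [iteratedDeriv_zero]; exact ht.2.2
    have h5 := h4.deriv_eq.trans h3.deriv
    rw [h2] at h5
    have h6 := LinearIndependent.pair_iff.1 hcd (deriv ρ 0) (-ρ 0) (by
      rw [h5, h4.self_of_nhds]
      module)
    exact hev.self_of_nhds.2.1 (neg_eq_zero.1 h6.2)
  refine linearIndependent_iteratedDeriv (f := fun i t => iteratedDeriv i k (τ t)) hρ
    (contDiffAt_deriv hτ) (contDiffAt_deriv hτ) contDiffAt_const contDiffAt_const (hder 0) (hder 1)
    (hder 2) ?_ hev.self_of_nhds.2.1 hτ0 hτ0 hτ0 (hli _ hev.self_of_nhds.1)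
  filter_upwards [hev] with t ht
  rw [ht.2.2]
  simp

end ConeOverCurve

end CartanDuality

end

/-! ### Boxes whose path parameter is the slope of the projected vertical direction. -/

open scoped Manifold ContDiff Topology

noncomputable section

namespace CartanDuality

/-- Functionals dual to two linearly independent vectors. -/
theorem exists_dual_pair {f₀ f₁ : E5} (h : LinearIndependent ℝ ![f₀, f₁]) :
    ∃ l₀ l₁ : E5 →L[ℝ] ℝ, l₀ f₀ = 1 ∧ l₀ f₁ = 0 ∧ l₁ f₀ = 0 ∧ l₁ f₁ = 1 := by
  let L : ℝ × ℝ →ₗ[ℝ] E5 := (LinearMap.toSpanSingleton ℝ E5 f₀).coprod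
    (LinearMap.toSpanSingleton ℝ E5 f₁)
  have hL : LinearMap.ker L = ⊥ := by
    rw [LinearMap.ker_eq_bot']
    rintro ⟨p, q⟩ hpq
    have := LinearIndependent.pair_iff.1 h p q (by simpa [L] using hpq)
    exact Prod.ext this.1 this.2
  obtain ⟨g, hg⟩ := L.exists_leftInverse_of_injective hL
  have h0 : g f₀ = (1, 0) := by simpa [L] using DFunLike.congr_fun hg (1, 0)
  have h1 : g f₁ = (0, 1) := by simpa [L] using DFunLike.congr_fun hg (0, 1)
  exact ⟨((LinearMap.fst ℝ ℝ ℝ).comp g).toContinuousLinearMap,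
    ((LinearMap.snd ℝ ℝ ℝ).comp g).toContinuousLinearMap, by simp [h0], by simp [h1], by simp [h0],
    by simp [h1]⟩

/-- Coordinates `(x, s)` that straighten the projection `ϖ` and such that `s` is the slope of the
image of the vertical vector with respect to the functionals `l₀` and `l₁`. -/
structure IsCharBox (e : Fin 5 → E5 → E5) (Ω : Set (E5 × ℝ)) (ϖ : E5 × ℝ → E5)
    (S : OpenPartialHomeomorph (E5 × ℝ) (E5 × ℝ)) (k : E5 × ℝ → ℝ) (l₀ l₁ : E5 →L[ℝ] ℝ) :
    Prop where
  target_subset : S.target ⊆ Ω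
  smooth : ContDiffOn ℝ ∞ S S.source
  smooth_symm : ContDiffOn ℝ ∞ S.symm S.target
  apply_proj : ∀ p ∈ S.source, ϖ (S p) = p.1
  smooth_speed : ContDiffOn ℝ ∞ k S.source
  speed_ne_zero : ∀ p ∈ S.source, k p ≠ 0
  fderiv_vertical : ∀ p ∈ S.source, fderiv ℝ S p (0, 1) = k p • charField e (S p)
  ne_zero : ∀ p ∈ S.source, l₀ (fderiv ℝ ϖ (S p) (0, 1)) ≠ 0
  slope_eq : ∀ p ∈ S.source, l₁ (fderiv ℝ ϖ (S p) (0, 1)) = p.2 * l₀ (fderiv ℝ ϖ (S p) (0, 1))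

namespace IsCharProjection

variable {O : Set E5} {e : Fin 5 → E5 → E5} {Ω : Set (E5 × ℝ)} {ϖ : E5 × ℝ → E5}

theorem contDiffOn_fderiv (h : IsCharProjection O e Ω ϖ) : ContDiffOn ℝ ∞ (fderiv ℝ ϖ) Ω :=
  h.smooth.fderiv_of_isOpen h.isOpen (by simp)

/-- Along K the derivative of `Dϖ ∂ₜ` at `u₀` is `-f₁` modulo `f₀`, so the slope `σ` of `Dϖ ∂ₜ` has
derivative -1 there. Hence `(ϖ, σ)` is a local diffeomorphism near `u₀`, and its inverse is the box.
-/
theorem exists_isCharBox (h : IsCharProjection O e Ω ϖ) {u₀ : E5 × ℝ} (hu₀ : u₀ ∈ Ω) :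
    ∃ S k l₀ l₁ f₀ f₁, IsCharBox e Ω ϖ S k l₀ l₁ ∧ (ϖ u₀, 0) ∈ S.source ∧ S (ϖ u₀, 0) = u₀ ∧
      fderiv ℝ ϖ u₀ (0, 1) = f₀ ∧ l₀ f₀ = 1 ∧ l₀ f₁ = 0 ∧ l₁ f₀ = 0 ∧ l₁ f₁ = 1 := by
  have hli := h.linearIndependent_transverseField hu₀
  set f₀ := fderiv ℝ ϖ u₀ (transverseField e 0 u₀) with hf₀
  set f₁ := fderiv ℝ ϖ u₀ (transverseField e 1 u₀) with hf₁
  have hli2 : LinearIndependent ℝ ![f₀, f₁] := by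
    have := hli.comp ![0, 1] (by decide)
    convert this using 1
    funext i
    fin_cases i <;> rfl
  obtain ⟨l₀, l₁, h00, h01, h10, h11⟩ := exists_dual_pair hli2
  let q : E5 × ℝ → E5 := fun u => fderiv ℝ ϖ u (transverseField e 0 u)
  have hq : ContDiffOn ℝ ∞ q Ω := h.contDiffOn_fderiv.clm_apply
    ((contDiffOn_transverseField h.frame 0).mono fun u hu => ⟨h.fst_mem u hu, trivial⟩)
  have hl : ∀ l : E5 →L[ℝ] ℝ, ContDiffOn ℝ ∞ (fun u => l (q u)) Ω := fun l =>
    l.contDiff.comp_contDiffOn hq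
  let Ω' : Set (E5 × ℝ) := Ω ∩ (fun u => l₀ (q u)) ⁻¹' {0}ᶜ
  have hΩ' : IsOpen Ω' := (hl l₀).continuousOn.isOpen_inter_preimage h.isOpen
    isOpen_compl_singleton
  have hu₀' : u₀ ∈ Ω' := ⟨hu₀, by
    change l₀ f₀ ≠ 0
    rw [h00]; exact one_ne_zero⟩
  let σ : E5 × ℝ → ℝ := fun u => l₁ (q u) / l₀ (q u)
  have hσ : ContDiffOn ℝ ∞ σ Ω' := ((hl l₁).mono Set.inter_subset_left).div
    ((hl l₀).mono Set.inter_subset_left) fun u hu => hu.2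
  have hσd : ∀ u ∈ Ω', HasFDerivAt σ (fderiv ℝ σ u) u := fun u hu =>
    ((hσ.contDiffAt (hΩ'.mem_nhds hu)).differentiableAt (by simp)).hasFDerivAt
  have hϖd : ∀ u ∈ Ω', HasFDerivAt ϖ (fderiv ℝ ϖ u) u := fun u hu =>
    ((h.contDiffAt hu.1).differentiableAt (by simp)).hasFDerivAt
  -- the derivative of the slope along the characteristic field
  have hσK : fderiv ℝ σ u₀ (charField e u₀) ≠ 0 := by
    have hqd : HasFDerivAt q (fderiv ℝ q u₀) u₀ :=
      ((hq.contDiffAt (h.isOpen.mem_nhds hu₀)).differentiableAt (by simp)).hasFDerivAt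
    have hqK : fderiv ℝ q u₀ (charField e u₀) = -f₁ +
        (VectorField.lieBracket ℝ (charField e) (transverseField e 0) u₀).2 • f₀ := by
      have hV : DifferentiableAt ℝ (transverseField e 0) u₀ :=
        ((contDiffOn_transverseField h.frame 0).contDiffAt (h.frame.isOpen_prod.mem_nhds
          ⟨h.fst_mem u₀ hu₀, trivial⟩)).differentiableAt (by simp)
      exact (h.fderiv_apply_field hu₀ hV).trans (h.fderiv_transverse_zero hu₀)
    have hmul : (fun u => σ u * l₀ (q u)) =ᶠ[𝓝 u₀] fun u => l₁ (q u) := by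
      filter_upwards [hΩ'.mem_nhds hu₀'] with u hu
      exact div_mul_cancel₀ _ hu.2
    have e1 := ((hσd u₀ hu₀').mul (l₀.hasFDerivAt.comp u₀ hqd)).unique
      ((l₁.hasFDerivAt.comp u₀ hqd).congr_of_eventuallyEq hmul)
    have e2 := DFunLike.congr_fun e1 (charField e u₀)
    have hq0 : q u₀ = f₀ := rfl
    have hσ0 : σ u₀ = 0 := by simp [σ, hq0, h10]
    simp [hq0, hσ0, h00, h10, h11, hqK] at e2
    rw [e2]
    norm_num
  have hΨ : ContDiffOn ℝ ∞ (fun u => (ϖ u, σ u)) Ω' :=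
    (h.smooth.mono Set.inter_subset_left).prodMk hσ
  have hΨd : ∀ u ∈ Ω', fderiv ℝ (fun u => (ϖ u, σ u)) u = (fderiv ℝ ϖ u).prod (fderiv ℝ σ u) :=
    fun u hu => ((hϖd u hu).prodMk (hσd u hu)).fderiv
  have hinv : (fderiv ℝ (fun u => (ϖ u, σ u)) u₀).IsInvertible := by
    rw [hΨd u₀ hu₀']
    have hinj : Function.Injective ((fderiv ℝ ϖ u₀).prod (fderiv ℝ σ u₀)) := by
      rw [injective_iff_map_eq_zero]
      intro w hw
      obtain ⟨r, rfl⟩ := h.exists_eq_smul hu₀ (congrArg Prod.fst hw)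
      have h2 : fderiv ℝ σ u₀ (r • charField e u₀) = 0 := congrArg Prod.snd hw
      rw [map_smul, smul_eq_mul] at h2
      rw [(mul_eq_zero.1 h2).resolve_right hσK, zero_smul]
    have hsurj : Function.Surjective ((fderiv ℝ ϖ u₀).prod (fderiv ℝ σ u₀)) :=
      (LinearMap.injective_iff_surjective
        (f := ((fderiv ℝ ϖ u₀).prod (fderiv ℝ σ u₀)).toLinearMap)).1 hinj
    exact ⟨ContinuousLinearEquiv.ofBijective _ (LinearMap.ker_eq_bot.2 hinj)
      (LinearMap.range_eq_top.2 hsurj), by ext <;> simp⟩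
  obtain ⟨Ψ, hu₀Ψ, hΨs, hΨe, hΨ1, hΨ2, hΨi⟩ := exists_smooth_local_inverse hΩ' hΨ hu₀' hinv
  have hne : ∀ u ∈ Ψ.source, fderiv ℝ σ u (charField e u) ≠ 0 := by
    intro u hu h0
    have h1 := hΨi u hu
    rw [hΨd u (hΨs hu)] at h1
    refine charField_ne_zero h.frame (h.fst_mem u (hΨs hu).1) (h1.injective ?_)
    rw [map_zero]
    exact Prod.ext (h.apply_charField u (hΨs hu).1) h0
  have hfst : ∀ u, (Ψ u).1 = ϖ u := fun u => by rw [hΨe]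
  have hsnd : ∀ u, (Ψ u).2 = σ u := fun u => by rw [hΨe]
  have hsrc : ∀ p ∈ Ψ.target, Ψ.symm p ∈ Ψ.source := fun p hp => Ψ.map_target hp
  have hu₀v : Ψ u₀ = (ϖ u₀, 0) := by
    rw [hΨe]
    refine Prod.ext rfl ?_
    change l₁ f₀ / l₀ f₀ = 0
    rw [h10, zero_div]
  have hσK' : ContDiffOn ℝ ∞ (fun u => fderiv ℝ σ u (charField e u)) Ω' :=
    (hσ.fderiv_of_isOpen hΩ' (m := ∞) (by simp)).clm_apply
      (h.frame.contDiffOn_charField.mono fun u hu => ⟨h.fst_mem u hu.1, trivial⟩)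
  -- On a line of the box `σ` is the parameter itself, so the speed relative to K is the reciprocal
  -- of the derivative of `σ` along K.
  refine ⟨Ψ.symm, fun p => (fderiv ℝ σ (Ψ.symm p) (charField e (Ψ.symm p)))⁻¹, l₀, l₁, f₀, f₁,
    { target_subset := fun u hu => (hΨs hu).1
      smooth := hΨ2
      smooth_symm := hΨ1
      apply_proj := fun p hp => by rw [← hfst, Ψ.right_inv hp]
      smooth_speed := (hσK'.comp hΨ2 fun p hp => hΨs (hsrc p hp)).inv fun p hp =>
        hne _ (hsrc p hp)
      speed_ne_zero := fun p hp => inv_ne_zero (hne _ (hsrc p hp))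
      fderiv_vertical := ?_
      ne_zero := fun p hp => (hΨs (hsrc p hp)).2
      slope_eq := ?_ }, ?_, ?_, rfl, h00, h01, h10, h11⟩
  · intro p hp
    have h1 := fderiv_symm_fderiv (S := Ψ.symm) hΨ2 hΨ1 hp (0, 1)
    have h2 : fderiv ℝ Ψ (Ψ.symm p) = (fderiv ℝ ϖ (Ψ.symm p)).prod (fderiv ℝ σ (Ψ.symm p)) := by
      rw [← hΨd _ (hΨs (hsrc p hp))]
      congr 1
      funext u
      exact hΨe u
    rw [OpenPartialHomeomorph.symm_symm, h2] at h1
    obtain ⟨r, hr⟩ := h.exists_eq_smul (hΨs (hsrc p hp)).1 (congrArg Prod.fst h1)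
    have h3 : fderiv ℝ σ (Ψ.symm p) (fderiv ℝ Ψ.symm p (0, 1)) = 1 := congrArg Prod.snd h1
    rw [hr, map_smul, smul_eq_mul] at h3
    rw [hr, eq_inv_of_mul_eq_one_left h3]
  · intro p hp
    have h1 := hsnd (Ψ.symm p)
    rw [Ψ.right_inv hp] at h1
    rw [h1]
    exact (div_mul_cancel₀ _ (hΨs (hsrc p hp)).2).symm
  · rw [← hu₀v]
    exact Ψ.map_source hu₀Ψ
  · rw [← hu₀v, Ψ.left_inv hu₀Ψ]

end IsCharProjection

namespace IsCharBox

variable {O : Set E5} {e : Fin 5 → E5 → E5} {Ω : Set (E5 × ℝ)} {ϖ : E5 × ℝ → E5}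
  {S : OpenPartialHomeomorph (E5 × ℝ) (E5 × ℝ)} {k : E5 × ℝ → ℝ} {l₀ l₁ : E5 →L[ℝ] ℝ}
  {p : E5 × ℝ}

theorem mem (hS : IsCharBox e Ω ϖ S k l₀ l₁) (hp : p ∈ S.source) : S p ∈ Ω :=
  hS.target_subset (S.map_source hp)

theorem contDiffAt (hS : IsCharBox e Ω ϖ S k l₀ l₁) (hp : p ∈ S.source) : ContDiffAt ℝ ∞ S p :=
  hS.smooth.contDiffAt (S.open_source.mem_nhds hp)

theorem hasFDerivAt (hS : IsCharBox e Ω ϖ S k l₀ l₁) (hp : p ∈ S.source) :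
    HasFDerivAt S (fderiv ℝ S p) p := ((hS.contDiffAt hp).differentiableAt (by simp)).hasFDerivAt

theorem hasDerivAt (hS : IsCharBox e Ω ϖ S k l₀ l₁) (hp : p ∈ S.source) :
    HasDerivAt (fun s => S (p.1, s)) (k p • charField e (S p)) p.2 := by
  rw [← hS.fderiv_vertical p hp]
  exact (hS.hasFDerivAt hp).comp_hasDerivAt_of_eq p.2
    ((hasDerivAt_const p.2 p.1).prodMk (hasDerivAt_id p.2)) rfl

/-- The image under `Dϖ` of the `i`-th transverse field. -/
def transverse (e : Fin 5 → E5 → E5) (ϖ : E5 × ℝ → E5)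
    (S : OpenPartialHomeomorph (E5 × ℝ) (E5 × ℝ)) (i : Fin 4) (p : E5 × ℝ) : E5 :=
  fderiv ℝ ϖ (S p) (IsCharProjection.transverseField e i (S p))

theorem contDiffOn_transverse (hS : IsCharBox e Ω ϖ S k l₀ l₁) (h : IsCharProjection O e Ω ϖ)
    (i : Fin 4) : ContDiffOn ℝ ∞ (transverse e ϖ S i) S.source :=
  (h.contDiffOn_fderiv.clm_apply ((IsCharProjection.contDiffOn_transverseField h.frame i).mono
    fun u hu => ⟨h.fst_mem u hu, trivial⟩)).comp hS.smooth fun _ hp => hS.mem hp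

theorem hasDerivAt_transverse (hS : IsCharBox e Ω ϖ S k l₀ l₁) (h : IsCharProjection O e Ω ϖ)
    (i : Fin 4) (hp : p ∈ S.source) : HasDerivAt (fun s => transverse e ϖ S i (p.1, s))
      (k p • fderiv ℝ ϖ (S p) (VectorField.lieBracket ℝ (charField e)
        (IsCharProjection.transverseField e i) (S p))) p.2 := by
  have hV := (IsCharProjection.contDiffOn_transverseField h.frame i)
  have hVd : DifferentiableAt ℝ (IsCharProjection.transverseField e i) (S p) :=
    (hV.contDiffAt (h.frame.isOpen_prod.mem_nhds ⟨h.fst_mem _ (hS.mem hp), trivial⟩)).differentiableAt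
      (by simp)
  have h1 : HasFDerivAt (fun u => fderiv ℝ ϖ u (IsCharProjection.transverseField e i u))
      (fderiv ℝ (fun u => fderiv ℝ ϖ u (IsCharProjection.transverseField e i u)) (S p)) (S p) :=
    (((h.contDiffOn_fderiv.clm_apply (hV.mono
      fun u hu => ⟨h.fst_mem u hu, trivial⟩)).contDiffAt (h.isOpen.mem_nhds
        (hS.mem hp))).differentiableAt (by simp)).hasFDerivAt
  rw [← h.fderiv_apply_field (hS.mem hp) hVd, ← map_smul]
  exact h1.comp_hasDerivAt_of_eq p.2 (hS.hasDerivAt hp) rfl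

/-- The coefficients of the derivatives of the transverse fields. -/
theorem hasDerivAt_transverse' (hS : IsCharBox e Ω ϖ S k l₀ l₁) (h : IsCharProjection O e Ω ϖ) :
    ∃ a : Fin 4 → E5 × ℝ → ℝ, (∀ i, ContDiffOn ℝ ∞ (a i) S.source) ∧ ∀ p ∈ S.source,
      HasDerivAt (fun s => transverse e ϖ S 0 (p.1, s))
        (-k p • transverse e ϖ S 1 p + a 0 p • transverse e ϖ S 0 p) p.2 ∧
      HasDerivAt (fun s => transverse e ϖ S 1 (p.1, s))
        (k p • transverse e ϖ S 2 p + a 1 p • transverse e ϖ S 0 p) p.2 ∧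
      HasDerivAt (fun s => transverse e ϖ S 2 (p.1, s))
        (k p • transverse e ϖ S 3 p + a 2 p • transverse e ϖ S 0 p) p.2 := by
  refine ⟨fun i p => k p * (VectorField.lieBracket ℝ (charField e)
    (IsCharProjection.transverseField e i) (S p)).2, fun i => ?_, fun p hp => ⟨?_, ?_, ?_⟩⟩
  · exact hS.smooth_speed.mul (contDiff_snd.comp_contDiffOn
      ((contDiffOn_lieBracket h.frame.isOpen_prod h.frame.contDiffOn_charField
        (IsCharProjection.contDiffOn_transverseField h.frame i)).comp hS.smooth fun p hp =>
          ⟨h.fst_mem _ (hS.mem hp), trivial⟩))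
  · refine (hS.hasDerivAt_transverse h 0 hp).congr_deriv ?_
    rw [h.fderiv_transverse_zero (hS.mem hp)]
    simp only [transverse]
    module
  · refine (hS.hasDerivAt_transverse h 1 hp).congr_deriv ?_
    have h1 := h.fderiv_transverse_lift (hS.mem hp) 1
      (h.frame.lieBracket_lineField_one _ (h.fst_mem _ (hS.mem hp)))
    refine (congrArg (k p • ·) h1).trans ?_
    simp only [transverse, smul_add, smul_smul]
    rfl
  · refine (hS.hasDerivAt_transverse h 2 hp).congr_deriv ?_
    have h1 := h.fderiv_transverse_lift (hS.mem hp) 2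
      (h.frame.lieBracket_lineField_two _ (h.fst_mem _ (hS.mem hp)))
    refine (congrArg (k p • ·) h1).trans ?_
    simp only [transverse, smul_add, smul_smul]
    rfl

theorem contDiffOn_slice {f : E5 × ℝ → E5} {N : Set E5} {a b : ℝ} {T : Set (E5 × ℝ)}
    (hf : ContDiffOn ℝ ∞ f T) (hN : N ×ˢ Set.Ioo a b ⊆ T) {x : E5} (hx : x ∈ N) :
    ContDiffOn ℝ ∞ (fun s => f (x, s)) (Set.Ioo a b) :=
  hf.comp (contDiff_const.prodMk contDiff_id).contDiffOn fun _ hs => hN ⟨hx, hs⟩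

/-- The cones of tangents are non-degenerate. -/
theorem linearIndependent_iteratedDeriv (hS : IsCharBox e Ω ϖ S k l₀ l₁)
    (h : IsCharProjection O e Ω ϖ) (hp : p ∈ S.source) (A : E5 ≃L[ℝ] E5) :
    LinearIndependent ℝ fun i : Fin 4 =>
      iteratedDeriv i (fun s => A (transverse e ϖ S 0 (p.1, s))) p.2 := by
  obtain ⟨a, ha, hd⟩ := hS.hasDerivAt_transverse' h
  have hev : ∀ᶠ s in 𝓝 p.2, (p.1, s) ∈ S.source :=
    (Continuous.prodMk_right p.1).continuousAt.preimage_mem_nhds (S.open_source.mem_nhds hp)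
  have hsl : ∀ {f : E5 × ℝ → ℝ}, ContDiffOn ℝ ∞ f S.source →
      ContDiffAt ℝ ∞ (fun s => f (p.1, s)) p.2 := fun hf =>
    ContDiffAt.comp p.2 (hf.contDiffAt (S.open_source.mem_nhds hp))
      (contDiffAt_const.prodMk contDiffAt_id)
  have hA : ∀ {f : ℝ → E5} {f' : E5} {s : ℝ}, HasDerivAt f f' s →
      HasDerivAt (fun s => A (f s)) (A f') s := fun hf => A.hasFDerivAt.comp_hasDerivAt _ hf
  -- The brackets with K lead from ∂ₜ to `-e 1`, from `e 1` to `e 2` and from `e 2` to `e 3 + t e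
  -- 4`, each modulo ∂ₜ and the kernel of the projection. This is the moving frame with speeds `-k`,
  -- `k`, `k`; the linear map `A` does not affect it.
  refine CartanDuality.linearIndependent_iteratedDeriv (ρ := fun _ => 1)
    (m₀ := fun s => -k (p.1, s)) (m₁ := fun s => k (p.1, s)) (m₂ := fun s => k (p.1, s))
    (a₀ := fun s => a 0 (p.1, s)) (a₁ := fun s => a 1 (p.1, s)) (a₂ := fun s => a 2 (p.1, s))
    (f := fun i s => A (transverse e ϖ S i (p.1, s))) contDiffAt_const (hsl hS.smooth_speed.neg)
    (hsl hS.smooth_speed) (hsl (ha 0)) (hsl (ha 1)) ?_ ?_ ?_ ?_ one_ne_zero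
    (neg_ne_zero.2 (hS.speed_ne_zero p hp)) (hS.speed_ne_zero p hp) (hS.speed_ne_zero p hp) ?_
  · filter_upwards [hev] with s hs
    rw [← map_smul, ← map_smul, ← map_add]
    exact hA (hd _ hs).1
  · filter_upwards [hev] with s hs
    rw [← map_smul, ← map_smul, ← map_add]
    exact hA (hd _ hs).2.1
  · filter_upwards [hev] with s hs
    rw [← map_smul, ← map_smul, ← map_add]
    exact hA (hd _ hs).2.2
  · filter_upwards with s
    rw [one_smul]
  · exact (h.linearIndependent_transverseField (hS.mem hp)).map' A.toLinearMap
      (LinearMap.ker_eq_bot.2 A.injective)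

end IsCharBox

end CartanDuality

end

/-! ### Kernels of one-forms, their Levi forms, and the form induced on the path space. -/

open scoped Manifold ContDiff Topology

noncomputable section

namespace CartanDuality

section HyperplaneField

set_option linter.unusedSectionVars false

variable {X : Type*} [TopologicalSpace X] [ChartedSpace E5 X] [IsManifold 𝓘(ℝ, E5) ∞ X]
  {φ : OpenPartialHomeomorph X E5} {η : E5 → E5 →L[ℝ] ℝ} {N : Set E5}
  {D' : ∀ x : X, Submodule ℝ (TangentSpace 𝓘(ℝ, E5) x)}

/-- The projection of `v` to the kernel of `η`, along `n`. -/
def kerProj (η : E5 → E5 →L[ℝ] ℝ) (n v y : E5) : E5 := v - (η y v / η y n) • n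

theorem apply_kerProj {n v y : E5} (h : η y n ≠ 0) : η y (kerProj η n v y) = 0 := by
  rw [kerProj, map_sub, map_smul, smul_eq_mul, div_mul_cancel₀ _ h, sub_self]

theorem contDiffOn_kerProj (hη : ContDiffOn ℝ ∞ η N) (n v : E5) :
    ContDiffOn ℝ ∞ (kerProj η n v) (N ∩ (fun y => η y n) ⁻¹' {0}ᶜ) := by
  have h : ∀ v, ContDiffOn ℝ ∞ (fun y => η y v) (N ∩ (fun y => η y n) ⁻¹' {0}ᶜ) := fun v =>
    (hη.mono Set.inter_subset_left).clm_apply contDiffOn_const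
  exact contDiffOn_const.sub (((h v).div (h n) fun y hy => hy.2).smul contDiffOn_const)

theorem isOpen_kerProj (hN : IsOpen N) (hη : ContDiffOn ℝ ∞ η N) (n : E5) :
    IsOpen (N ∩ (fun y => η y n) ⁻¹' {0}ᶜ) :=
  (hη.continuousOn.clm_apply continuousOn_const).isOpen_inter_preimage hN isOpen_compl_singleton

theorem exists_apply_eq_one {l : E5 →L[ℝ] ℝ} (hl : l ≠ 0) : ∃ n, l n = 1 := by
  obtain ⟨v, hv⟩ : ∃ v, l v ≠ 0 := by
    by_contra! h
    exact hl (ContinuousLinearMap.ext h)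
  exact ⟨(l v)⁻¹ • v, by rw [map_smul, smul_eq_mul, inv_mul_cancel₀ hv]⟩

/-- The constant extension of a vector, corrected along `n`, stays in the kernel. This provides
sections with any prescribed value in the kernel at a point. -/
theorem isSectionOn_kerProj (hφ : φ ∈ IsManifold.maximalAtlas 𝓘(ℝ, E5) ∞ X) (hN : IsOpen N)
    (hη : ContDiffOn ℝ ∞ η N)
    (hD : ∀ x ∈ φ.source, φ x ∈ N → ∀ v, v ∈ D' x ↔ η (φ x) (dchart φ x v) = 0) (n v : E5) :
    IsSectionOn (φ.source ∩ φ ⁻¹' (N ∩ (fun y => η y n) ⁻¹' {0}ᶜ)) D'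
      (liftField φ (kerProj η n v)) :=
  isSectionOn_liftField hφ (isOpen_kerProj hN hη n) (contDiffOn_kerProj hη n v)
    fun x hx hxO => (hD x hx hxO.1 _).2 (by
      rw [liftField, dchart_inverse_apply hφ hx, apply_kerProj hxO.2])

/-- The kernel of a nowhere zero form is a distribution of rank four. -/
theorem isDistributionOn_ker (hφ : φ ∈ IsManifold.maximalAtlas 𝓘(ℝ, E5) ∞ X) (hN : IsOpen N)
    (hη : ContDiffOn ℝ ∞ η N) (hη0 : ∀ y ∈ N, η y ≠ 0)
    (hD : ∀ x ∈ φ.source, φ x ∈ N → ∀ v, v ∈ D' x ↔ η (φ x) (dchart φ x v) = 0) :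
    IsDistributionOn 4 (φ.source ∩ φ ⁻¹' N) D' := by
  intro x₀ hx₀
  obtain ⟨n, hn⟩ := exists_apply_eq_one (hη0 _ hx₀.2)
  let K : Submodule ℝ E5 := LinearMap.ker (η (φ x₀)).toLinearMap
  have hK : Module.finrank ℝ K = 4 := by
    have h1 := (η (φ x₀)).toLinearMap.finrank_range_add_finrank_ker
    have h2 : LinearMap.range (η (φ x₀)).toLinearMap = ⊤ :=
      LinearMap.range_eq_top.2 fun r => ⟨r • n, by simp [hn]⟩
    rw [h2, finrank_top] at h1
    simp only [finrank_euclideanSpace, Fintype.card_fin, Module.finrank_self] at h1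
    change 1 + Module.finrank ℝ K = 5 at h1
    omega
  let B := Module.finBasisOfFinrankEq ℝ K hK
  have hB0 : ∀ i, η (φ x₀) (B i : E5) = 0 := fun i => (B i).2
  -- A basis of the kernel at `φ x₀`, pushed along `n` into the kernels at nearby points, where it
  -- remains a basis.
  let v : Fin 4 → E5 → E5 := fun i => kerProj η n (B i : E5)
  have hsum : ∀ (g : Fin 4 → ℝ) (y : E5), ∑ i, g i • v i y = ∑ i, g i • (B i : E5) -
      (∑ i, g i * (η y (B i) / η y n)) • n := fun g y => by
    simp only [v, kerProj, smul_sub, Finset.sum_sub_distrib, Finset.sum_smul, smul_smul]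
  refine ⟨φ.source ∩ φ ⁻¹' (N ∩ (fun y => η y n) ⁻¹' {0}ᶜ), fun i => liftField φ (v i),
    ⟨hx₀.1, hx₀.2, by simp [hn]⟩, ?_⟩
  have hsec := fun i => isSectionOn_kerProj hφ hN hη hD n (B i : E5)
  refine ⟨(hsec 0).isOpen, fun i => (hsec i).smooth, fun x hx => ?_, fun x hx => ?_⟩
  · rw [Fintype.linearIndependent_iff]
    intro g hg
    have h1 := congrArg (dchart φ x) hg
    rw [map_sum, map_zero] at h1
    simp only [map_smul, liftField, dchart_inverse_apply hφ hx.1] at h1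
    have h2 := hsum g (φ x)
    rw [h1] at h2
    -- The form at `φ x₀` kills the vectors `B i` and is one on `n`, so it isolates the coefficient
    -- of `n`.
    have h3 := congrArg (η (φ x₀)) h2
    simp only [map_zero, map_sub, map_sum, map_smul, hB0, hn, smul_eq_mul, mul_zero,
      Finset.sum_const_zero, zero_sub, mul_one] at h3
    rw [neg_eq_zero.1 h3.symm, zero_smul, sub_zero] at h2
    refine Fintype.linearIndependent_iff.1 B.linearIndependent g ?_
    ext1
    rw [← Submodule.subtype_apply, map_sum]
    exact h2.symm
  · apply le_antisymm
    · rw [Submodule.span_le]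
      rintro _ ⟨i, rfl⟩
      exact (hsec i).mem x hx
    · intro w hw
      have hw0 := (hD x hx.1 hx.2.1 w).1 hw
      set w' : E5 := dchart φ x w with hw'
      let u : K := ⟨w' - η (φ x₀) w' • n, by
        change η (φ x₀) _ = 0
        rw [map_sub, map_smul, hn, smul_eq_mul, mul_one, sub_self]⟩
      have hu : ∑ i, B.repr u i • (B i : E5) = w' - η (φ x₀) w' • n := by
        have := congrArg Subtype.val (B.sum_repr u)
        rw [← Submodule.subtype_apply, map_sum] at this
        exact this
      have h2 := hsum (B.repr u) (φ x)
      rw [hu, sub_sub, ← add_smul] at h2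
      have h3 := congrArg (η (φ x)) h2
      have h4 : η (φ x) (∑ i, B.repr u i • v i (φ x)) = 0 := by
        rw [map_sum]
        exact Finset.sum_eq_zero fun i _ => by
          rw [map_smul, apply_kerProj hx.2.2, smul_zero]
      rw [h4, map_sub, hw0, map_smul, zero_sub, smul_eq_mul] at h3
      have h5 := (mul_eq_zero.1 (neg_eq_zero.1 h3.symm)).resolve_right hx.2.2
      rw [h5, zero_smul, sub_zero] at h2
      have h6 : w = ∑ i, B.repr u i • liftField φ (v i) x := by
        apply dchart_injective hφ hx.1
        rw [map_sum]
        simp only [map_smul, liftField, dchart_inverse_apply hφ hx.1]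
        exact h2.symm
      rw [h6]
      exact Submodule.sum_mem _ fun i _ => Submodule.smul_mem _ _ (Submodule.subset_span ⟨i, rfl⟩)

/-- The Levi form of the kernel of a form is the restriction of its exterior derivative. -/
theorem leviOrthogonal_iff (hφ : φ ∈ IsManifold.maximalAtlas 𝓘(ℝ, E5) ∞ X) (hN : IsOpen N)
    (hη : ContDiffOn ℝ ∞ η N) (hη0 : ∀ y ∈ N, η y ≠ 0)
    (hD : ∀ x ∈ φ.source, φ x ∈ N → ∀ v, v ∈ D' x ↔ η (φ x) (dchart φ x v) = 0) {x : X}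
    (hx : x ∈ φ.source) (hxN : φ x ∈ N) {v w : TangentSpace 𝓘(ℝ, E5) x} (hv : v ∈ D' x)
    (hw : w ∈ D' x) : LeviOrthogonal D' x v w ↔
      dForm η (φ x) (dchart φ x v) (dchart φ x w) = 0 := by
  -- For sections of the kernel the class of the bracket depends only on their values at `x`, so all
  -- pairs of sections give the same condition.
  have key : ∀ (U : Set X) (V W : ∀ x : X, TangentSpace 𝓘(ℝ, E5) x), x ∈ U → IsSectionOn U D' V →
      IsSectionOn U D' W → V x = v → W x = w → (VectorField.mlieBracket 𝓘(ℝ, E5) V W x ∈ D' x ↔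
        dForm η (φ x) (dchart φ x v) (dchart φ x w) = 0) := by
    intro U V W hxU hV hW hVx hWx
    have hn := (φ.isOpen_inter_preimage_symm hV.isOpen).mem_nhds
      (⟨φ.map_source hx, by rwa [Set.mem_preimage, φ.left_inv hx]⟩ :
        φ x ∈ φ.target ∩ φ.symm ⁻¹' U)
    have h0 : ∀ {V : ∀ x : X, TangentSpace 𝓘(ℝ, E5) x}, IsSectionOn U D' V →
        ∀ᶠ y in 𝓝 (φ x), η y (coordField φ V y) = 0 := by
      intro V hV
      filter_upwards [hn, hN.mem_nhds hxN] with y hy hyN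
      have h1 := (hD _ (φ.map_target hy.1) (by rwa [φ.right_inv hy.1]) _).1 (hV.mem _ hy.2)
      rwa [φ.right_inv hy.1] at h1
    rw [hD x hx hxN, dchart_mlieBracket hφ hV.isOpen hV.smooth hW.smooth hx hxU,
      apply_lieBracket_of_mem_ker
        ((hη.contDiffAt (hN.mem_nhds hxN)).differentiableAt (by simp))
        (((contDiffOn_coordField hφ hV.isOpen hV.smooth).contDiffAt hn).differentiableAt (by simp))
        (((contDiffOn_coordField hφ hW.isOpen hW.smooth).contDiffAt hn).differentiableAt (by simp))
        (h0 hV) (h0 hW), coordField_apply hx, coordField_apply hx, hVx, hWx, neg_eq_zero]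
  constructor
  · intro h
    -- The definition quantifies over sections with the given values; some such pair has to exist
    -- for it to say anything.
    obtain ⟨n, hn⟩ := exists_apply_eq_one (hη0 _ hxN)
    have hat : ∀ v ∈ D' x, liftField φ (kerProj η n (dchart φ x v)) x = v := fun v hv => by
      have h1 : kerProj η n (dchart φ x v) (φ x) = dchart φ x v := by
        rw [kerProj, (hD x hx hxN v).1 hv, zero_div, zero_smul, sub_zero]
      rw [liftField, h1, inverse_dchart_apply hφ hx]
    have hV := isSectionOn_kerProj hφ hN hη hD n (dchart φ x v)
    have hW := isSectionOn_kerProj hφ hN hη hD n (dchart φ x w)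
    have hxU : x ∈ φ.source ∩ φ ⁻¹' (N ∩ (fun y => η y n) ⁻¹' {0}ᶜ) := ⟨hx, hxN, by simp [hn]⟩
    exact (key _ _ _ hxU hV hW (hat v hv) (hat w hw)).1
      (h _ _ _ hxU hV hW (hat v hv) (hat w hw))
  · intro h U V W hxU hV hW hVx hWx
    exact (key U V W hxU hV hW hVx hWx).2 h

end HyperplaneField

namespace IsCharBox

variable {O : Set E5} {e : Fin 5 → E5 → E5} {Ω : Set (E5 × ℝ)} {ϖ : E5 × ℝ → E5}
  {S : OpenPartialHomeomorph (E5 × ℝ) (E5 × ℝ)} {k : E5 × ℝ → ℝ} {l₀ l₁ : E5 →L[ℝ] ℝ}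
  {p : E5 × ℝ}

/-- The form on the space of singular paths induced by the characteristic form at the points of
parameter `p.2`. -/
def boxForm (e : Fin 5 → E5 → E5) (S : OpenPartialHomeomorph (E5 × ℝ) (E5 × ℝ)) (p : E5 × ℝ) :
    E5 →L[ℝ] ℝ :=
  ((charForm e (S p)).comp (fderiv ℝ S p)).comp (ContinuousLinearMap.inl ℝ E5 ℝ)

theorem contDiffAt_charForm (hS : IsCharBox e Ω ϖ S k l₀ l₁) (h : IsCharProjection O e Ω ϖ)
    (hp : p ∈ S.source) : ContDiffAt ℝ ∞ (charForm e) (S p) :=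
  h.frame.contDiffOn_charForm.contDiffAt (h.frame.isOpen_prod.mem_nhds
    ⟨h.fst_mem _ (hS.mem hp), trivial⟩)

theorem contDiffOn_boxForm (hS : IsCharBox e Ω ϖ S k l₀ l₁) (h : IsCharProjection O e Ω ϖ) :
    ContDiffOn ℝ ∞ (boxForm e S) S.source :=
  ((h.frame.contDiffOn_charForm.comp hS.smooth fun p hp =>
    (⟨h.fst_mem _ (hS.mem hp), trivial⟩ : S p ∈ O ×ˢ Set.univ)).clm_comp
      (hS.smooth.fderiv_of_isOpen S.open_source (by simp))).clm_comp contDiffOn_const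

/-- The line direction of the box is a multiple of K, which the form kills. So the pull-back has no
`ds` term and is a family, in `s`, of forms on the path space. -/
theorem charForm_fderiv (hS : IsCharBox e Ω ϖ S k l₀ l₁) (h : IsCharProjection O e Ω ϖ)
    (hp : p ∈ S.source) (w : E5 × ℝ) :
    charForm e (S p) (fderiv ℝ S p w) = boxForm e S p w.1 := by
  have h1 : w = (w.1, 0) + w.2 • ((0 : E5), (1 : ℝ)) := by ext <;> simp
  conv_lhs => rw [h1, map_add, map_smul, hS.fderiv_vertical p hp, map_add, map_smul, map_smul,
    h.frame.charForm_charField (h.fst_mem _ (hS.mem hp)), smul_zero, smul_zero, add_zero]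
  rfl

theorem fderiv_proj_fderiv (hS : IsCharBox e Ω ϖ S k l₀ l₁) (h : IsCharProjection O e Ω ϖ)
    (hp : p ∈ S.source) (w : E5 × ℝ) : fderiv ℝ ϖ (S p) (fderiv ℝ S p w) = w.1 := by
  have h1 := ((h.contDiffAt (hS.mem hp)).differentiableAt (by simp)).hasFDerivAt.comp p
    (hS.hasFDerivAt hp)
  have h2 : (ϖ ∘ S) =ᶠ[𝓝 p] Prod.fst := by
    filter_upwards [S.open_source.mem_nhds hp] with q hq using hS.apply_proj q hq
  exact DFunLike.congr_fun (h1.unique (hasFDerivAt_fst.congr_of_eventuallyEq h2)) w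

theorem boxForm_fderiv_proj (hS : IsCharBox e Ω ϖ S k l₀ l₁) (h : IsCharProjection O e Ω ϖ)
    (hp : p ∈ S.source) (v : E5 × ℝ) :
    boxForm e S p (fderiv ℝ ϖ (S p) v) = charForm e (S p) v := by
  have h1 := fderiv_fderiv_symm hS.smooth hS.smooth_symm hp v
  rw [← h1, hS.fderiv_proj_fderiv h hp, hS.charForm_fderiv h hp]

theorem boxForm_ne_zero (hS : IsCharBox e Ω ϖ S k l₀ l₁) (h : IsCharProjection O e Ω ϖ)
    (hp : p ∈ S.source) : boxForm e S p ≠ 0 := by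
  intro h0
  have h1 := hS.boxForm_fderiv_proj h hp (e 4 (S p).1, 0)
  rw [h0, IsAdaptedFrame.charForm_apply, h.frame.coframe_apply (h.fst_mem _ (hS.mem hp)),
    h.frame.coframe_apply (h.fst_mem _ (hS.mem hp))] at h1
  simp at h1

theorem hasFDerivAt_boxForm (hS : IsCharBox e Ω ϖ S k l₀ l₁) (h : IsCharProjection O e Ω ϖ)
    (hp : p ∈ S.source) : HasFDerivAt (boxForm e S) (fderiv ℝ (boxForm e S) p) p :=
  (((hS.contDiffOn_boxForm h).contDiffAt (S.open_source.mem_nhds hp)).differentiableAt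
    (by simp)).hasFDerivAt

/-- The exterior derivative of the pull-back of the characteristic form. -/
theorem dForm_charForm_fderiv (hS : IsCharBox e Ω ϖ S k l₀ l₁) (h : IsCharProjection O e Ω ϖ)
    (hp : p ∈ S.source) (v w : E5 × ℝ) :
    dForm (charForm e) (S p) (fderiv ℝ S p v) (fderiv ℝ S p w) =
      fderiv ℝ (boxForm e S) p v w.1 - fderiv ℝ (boxForm e S) p w v.1 := by
  rw [← dForm_pullback ((hS.contDiffAt_charForm h hp).differentiableAt (by simp))
    ((hS.contDiffAt hp).of_le ENat.LEInfty.out)]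
  have h1 : (fun q => (charForm e (S q)).comp (fderiv ℝ S q)) =ᶠ[𝓝 p]
      fun q => (boxForm e S q).comp (ContinuousLinearMap.fst ℝ E5 ℝ) := by
    filter_upwards [S.open_source.mem_nhds hp] with q hq
    exact ContinuousLinearMap.ext fun w => hS.charForm_fderiv h hq w
  have h2 := ((hS.hasFDerivAt_boxForm h hp).clm_comp
    (hasFDerivAt_const (ContinuousLinearMap.fst ℝ E5 ℝ) p)).congr_of_eventuallyEq h1
  rw [dForm, h2.fderiv]
  simp

/-- Because dα(K, ·) is a multiple of α, moving along a path only rescales the induced form. -/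
theorem fderiv_boxForm_vertical (hS : IsCharBox e Ω ϖ S k l₀ l₁) (h : IsCharProjection O e Ω ϖ)
    (hp : p ∈ S.source) (w : E5) : fderiv ℝ (boxForm e S) p (0, 1) w =
      k p * dForm (charForm e) (S p) (charField e (S p)) (e 4 (S p).1, 0) * boxForm e S p w := by
  have h1 := hS.dForm_charForm_fderiv h hp (0, 1) (w, 0)
  rw [hS.fderiv_vertical p hp, dForm_smul_left,
    h.frame.dForm_charField (h.fst_mem _ (hS.mem hp)), hS.charForm_fderiv h hp] at h1
  simp at h1
  rw [← h1, mul_assoc]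

theorem hasDerivAt_boxForm (hS : IsCharBox e Ω ϖ S k l₀ l₁) (h : IsCharProjection O e Ω ϖ)
    (hp : p ∈ S.source) (w : E5) : HasDerivAt (fun s => boxForm e S (p.1, s) w)
      (k p * dForm (charForm e) (S p) (charField e (S p)) (e 4 (S p).1, 0) * boxForm e S p w)
      p.2 := by
  rw [← hS.fderiv_boxForm_vertical h hp]
  have h1 := (hS.hasFDerivAt_boxForm h hp).comp_hasDerivAt_of_eq p.2
    ((hasDerivAt_const p.2 p.1).prodMk (hasDerivAt_id p.2)) rfl
  have h2 := h1.clm_apply (hasDerivAt_const p.2 w)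
  simpa using h2

/-- The kernel of the induced form does not depend on the parameter. -/
theorem boxForm_eq_zero_iff (hS : IsCharBox e Ω ϖ S k l₀ l₁) (h : IsCharProjection O e Ω ϖ)
    {x : E5} {a b : ℝ} (hx : ∀ s ∈ Set.Ioo a b, (x, s) ∈ S.source) {s t : ℝ}
    (hs : s ∈ Set.Ioo a b) (ht : t ∈ Set.Ioo a b) (w : E5) :
    boxForm e S (x, s) w = 0 ↔ boxForm e S (x, t) w = 0 := by
  have hcx : ContinuousOn (fun s : ℝ => S (x, s)) (Set.Ioo a b) :=
    S.continuousOn.comp (Continuous.prodMk_right x).continuousOn hx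
  have hmem : ∀ s ∈ Set.Ioo a b, S (x, s) ∈ O ×ˢ Set.univ := fun s hs =>
    ⟨h.fst_mem _ (hS.mem (hx s hs)), trivial⟩
  have hm : ContinuousOn (fun s => k (x, s) * dForm (charForm e) (S (x, s))
      (charField e (S (x, s))) (e 4 (S (x, s)).1, 0)) (Set.Ioo a b) := by
    have h1 : ContinuousOn (fun s => fderiv ℝ (charForm e) (S (x, s))) (Set.Ioo a b) :=
      (h.frame.contDiffOn_charForm.continuousOn_fderiv_of_isOpen h.frame.isOpen_prod
        (by simp)).comp hcx hmem
    have h2 : ContinuousOn (fun s => charField e (S (x, s))) (Set.Ioo a b) :=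
      h.frame.contDiffOn_charField.continuousOn.comp hcx hmem
    have h3 : ContinuousOn (fun s => (e 4 (S (x, s)).1, (0 : ℝ))) (Set.Ioo a b) :=
      ((h.frame.smooth 4).continuousOn.comp (continuous_fst.comp_continuousOn hcx)
        fun s hs => (hmem s hs).1).prodMk continuousOn_const
    exact (hS.smooth_speed.continuousOn.comp (Continuous.prodMk_right x).continuousOn hx).mul
      (((h1.clm_apply h2).clm_apply h3).sub ((h1.clm_apply h3).clm_apply h2))
  -- For each fixed `w` the value on `w` solves a scalar linear equation, so it vanishes everywhere
  -- on the path or nowhere.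
  have hd : ∀ s ∈ Set.Ioo a b, HasDerivAt (fun s => boxForm e S (x, s) w)
      ((k (x, s) * dForm (charForm e) (S (x, s)) (charField e (S (x, s))) (e 4 (S (x, s)).1, 0)) *
        boxForm e S (x, s) w) s := fun s hs => hS.hasDerivAt_boxForm h (hx s hs) w
  exact ⟨fun h0 => eq_zero_of_hasDerivAt_mul hm hd hs h0 t ht,
    fun h0 => eq_zero_of_hasDerivAt_mul hm hd ht h0 s hs⟩

/-- The exterior derivative of the induced form, on its kernel. -/
theorem dForm_boxForm (hS : IsCharBox e Ω ϖ S k l₀ l₁) (h : IsCharProjection O e Ω ϖ)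
    (hp : p ∈ S.source) {v w : E5 × ℝ} (hv : charForm e (S p) v = 0)
    (hw : charForm e (S p) w = 0) : dForm (fun y => boxForm e S (y, p.2)) p.1
      (fderiv ℝ ϖ (S p) v) (fderiv ℝ ϖ (S p) w) = dForm (charForm e) (S p) v w := by
  -- The form on a slice `s = const` and the form on the box differ in the exterior derivative by an
  -- `s`-derivative term. That term is proportional to the form and disappears on its kernel.
  have hb : ∀ v', charForm e (S p) (fderiv ℝ S p v') = 0 → ∀ r : ℝ,
      fderiv ℝ (boxForm e S) p (0, r) v'.1 = 0 := by
    intro v' hv' r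
    have h1 : ((0 : E5), r) = r • ((0 : E5), (1 : ℝ)) := by simp
    rw [h1, map_smul, smul_apply, hS.fderiv_boxForm_vertical h hp, ← hS.charForm_fderiv h hp, hv']
    simp
  have hfr : fderiv ℝ (fun y => boxForm e S (y, p.2)) p.1 =
      (fderiv ℝ (boxForm e S) p).comp (ContinuousLinearMap.inl ℝ E5 ℝ) := by
    have h1 : HasFDerivAt (fun y : E5 => (y, p.2)) (ContinuousLinearMap.inl ℝ E5 ℝ) p.1 :=
      hasFDerivAt_prodMk_left p.1 p.2
    exact ((hS.hasFDerivAt_boxForm h hp).comp p.1 h1).fderiv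
  have hv2 := fderiv_fderiv_symm hS.smooth hS.smooth_symm hp v
  have hw2 := fderiv_fderiv_symm hS.smooth hS.smooth_symm hp w
  set v' := fderiv ℝ S.symm (S p) v
  set w' := fderiv ℝ S.symm (S p) w
  rw [← hv2] at hv ⊢
  rw [← hw2] at hw ⊢
  rw [hS.fderiv_proj_fderiv h hp, hS.fderiv_proj_fderiv h hp, hS.dForm_charForm_fderiv h hp, dForm,
    hfr]
  have hsplit : ∀ v' : E5 × ℝ, v' = (v'.1, 0) + (0, v'.2) := fun v' => by ext <;> simp
  conv_rhs => rw [hsplit v', hsplit w', map_add, map_add, add_apply, add_apply]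
  simp only [Prod.fst_add, add_zero]
  rw [hb v' hv, hb w' hw]
  simp

end IsCharBox

end CartanDuality

end

/-! ### Homogeneous perturbations of the identity that straighten cones. -/

open scoped Manifold ContDiff Topology

noncomputable section

namespace CartanDuality

section Perturbation

/-- The homogeneous perturbation of the identity `v ↦ v - l₀ v Q (y, v / l₀ v)`. -/
def coneMap (l₀ : E5 →L[ℝ] ℝ) (Q : E5 × E5 → E5) (y v : E5) : E5 :=
  v - l₀ v • Q (y, (l₀ v)⁻¹ • v)

/-- The conditions on `Q` under which `coneMap l₀ Q` is a family of homeomorphisms. -/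
structure IsConePerturbation (l₀ l₁ : E5 →L[ℝ] ℝ) (N : Set E5) (Q : E5 × E5 → E5) : Prop where
  isOpen : IsOpen N
  smooth : ContDiffOn ℝ ∞ Q (N ×ˢ Set.univ)
  bounded : ∃ B : ℝ, ∀ y ∈ N, ∀ g, l₀ g = 1 → B ≤ ‖g‖ → Q (y, g) = 0
  apply_zero : ∀ y g, l₀ (Q (y, g)) = 0
  apply_one : ∀ y g, l₁ (Q (y, g)) = 0
  lipschitz : ∀ y ∈ N, ∀ g g', l₀ (g - g') = 0 → l₁ (g - g') = 0 →
    ‖Q (y, g) - Q (y, g')‖ ≤ 1 / 2 * ‖g - g'‖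

variable {l₀ l₁ : E5 →L[ℝ] ℝ} {N : Set E5} {Q : E5 × E5 → E5}

theorem coneMap_smul (l₀ : E5 →L[ℝ] ℝ) (Q : E5 × E5 → E5) (y : E5) (r : ℝ) (v : E5) :
    coneMap l₀ Q y (r • v) = r • coneMap l₀ Q y v := by
  by_cases hr : r = 0
  · simp [hr, coneMap]
  · have h1 : (l₀ (r • v))⁻¹ • r • v = (l₀ v)⁻¹ • v := by
      rw [map_smul, smul_eq_mul, smul_smul, mul_inv, mul_comm r⁻¹, mul_assoc, inv_mul_cancel₀ hr,
        mul_one]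
    rw [coneMap, coneMap, h1, map_smul, smul_sub, smul_smul, smul_eq_mul]

namespace IsConePerturbation

/-- The perturbation. -/
theorem norm_sub_le (h : IsConePerturbation l₀ l₁ N Q) {y : E5} (hy : y ∈ N) {v v' : E5}
    (h0 : l₀ (v - v') = 0) (h1 : l₁ (v - v') = 0) :
    ‖l₀ v • Q (y, (l₀ v)⁻¹ • v) - l₀ v' • Q (y, (l₀ v')⁻¹ • v')‖ ≤ 1 / 2 * ‖v - v'‖ := by
  have e : l₀ v = l₀ v' := by rwa [map_sub, sub_eq_zero] at h0
  -- The bound on the slice `l₀ = 1` extends to all other slices by homogeneity; on `l₀ = 0` the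
  -- perturbation is zero.
  rw [e, ← smul_sub, norm_smul]
  by_cases hl : l₀ v' = 0
  · rw [hl, norm_zero, zero_mul]; positivity
  · have h2 := h.lipschitz y hy ((l₀ v')⁻¹ • v) ((l₀ v')⁻¹ • v')
      (by rw [← smul_sub, map_smul, h0, smul_zero]) (by rw [← smul_sub, map_smul, h1, smul_zero])
    rw [← smul_sub, norm_smul, norm_inv] at h2
    have h3 : 0 < ‖l₀ v'‖ := norm_pos_iff.2 hl
    calc ‖l₀ v'‖ * ‖Q (y, (l₀ v')⁻¹ • v) - Q (y, (l₀ v')⁻¹ • v')‖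
        ≤ ‖l₀ v'‖ * (1 / 2 * (‖l₀ v'‖⁻¹ * ‖v - v'‖)) := by gcongr
      _ = 1 / 2 * ‖v - v'‖ := by field_simp

/-- Points with the same image differ by an element of ker l₀ ∩ ker l₁, since the perturbation only
has values there, and along this space it contracts by one half. -/
theorem coneMap_injective (h : IsConePerturbation l₀ l₁ N Q) {y : E5} (hy : y ∈ N) :
    Function.Injective (coneMap l₀ Q y) := by
  intro v v' hvv
  have e : v - v' = l₀ v • Q (y, (l₀ v)⁻¹ • v) - l₀ v' • Q (y, (l₀ v')⁻¹ • v') := by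
    simp only [coneMap] at hvv
    rw [sub_eq_sub_iff_add_eq_add] at hvv
    rw [sub_eq_sub_iff_add_eq_add, hvv, add_comm]
  have h0 : l₀ (v - v') = 0 := by rw [e]; simp [h.apply_zero]
  have h1 : l₁ (v - v') = 0 := by rw [e]; simp [h.apply_one]
  have h2 := h.norm_sub_le hy h0 h1
  rw [← e] at h2
  have h3 : ‖v - v'‖ = 0 := by linarith [norm_nonneg (v - v')]
  exact sub_eq_zero.1 (norm_eq_zero.1 h3)

/-- A preimage of `w` is `w + f` with `f` in ker l₀ ∩ ker l₁ a fixed point of the perturbation, so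
the contraction principle applies in that space. -/
theorem coneMap_surjective (h : IsConePerturbation l₀ l₁ N Q) {y : E5} (hy : y ∈ N) :
    Function.Surjective (coneMap l₀ Q y) := by
  intro w
  let F : Submodule ℝ E5 := LinearMap.ker l₀.toLinearMap ⊓ LinearMap.ker l₁.toLinearMap
  let T : F → F := fun f => ⟨l₀ (w + f) • Q (y, (l₀ (w + f))⁻¹ • (w + f)), by
    change l₀ _ = 0
    rw [map_smul, h.apply_zero, smul_zero], by
    change l₁ _ = 0
    rw [map_smul, h.apply_one, smul_zero]⟩
  have hT : ContractingWith (1 / 2) T := by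
    refine ⟨by norm_num, LipschitzWith.of_dist_le_mul fun f f' => ?_⟩
    have hf : ∀ f f' : F, (w + (f : E5)) - (w + f') = ((f - f' : F) : E5) := fun f f' => by
      simp
    have h1 := h.norm_sub_le hy (v := w + f) (v' := w + f') (by rw [hf]; exact (f - f').2.1)
      (by rw [hf]; exact (f - f').2.2)
    rw [hf] at h1
    have h2 : dist (T f) (T f') = ‖l₀ (w + f) • Q (y, (l₀ (w + f))⁻¹ • (w + f)) -
        l₀ (w + f') • Q (y, (l₀ (w + f'))⁻¹ • (w + f'))‖ := by
      rw [dist_eq_norm]; rfl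
    have h3 : dist f f' = ‖((f - f' : F) : E5)‖ := by rw [dist_eq_norm]; rfl
    rw [h2, h3]
    refine h1.trans (le_of_eq ?_)
    norm_num
  have hx := hT.fixedPoint_isFixedPt
  set f := hT.fixedPoint T
  refine ⟨w + f, ?_⟩
  have h2 : l₀ (w + f) • Q (y, (l₀ (w + f))⁻¹ • (w + f)) = (f : E5) := congrArg Subtype.val hx
  rw [coneMap, h2, add_sub_cancel_right]

theorem isOpen_domain (h : IsConePerturbation l₀ l₁ N Q) :
    IsOpen {q : E5 × E5 | q.1 ∈ N ∧ q.2 ≠ 0} :=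
  (h.isOpen.preimage continuous_fst).inter (isOpen_ne.preimage continuous_snd)

/-- The critical place is the hyperplane `l₀ = 0`. Near a nonzero vector of it `v / l₀ v` is large,
where `Q` vanishes, so the perturbation is locally zero; the vertex has to be excluded. -/
theorem contDiffOn_perturbation (h : IsConePerturbation l₀ l₁ N Q) :
    ContDiffOn ℝ ∞ (fun q : E5 × E5 => l₀ q.2 • Q (q.1, (l₀ q.2)⁻¹ • q.2))
      {q | q.1 ∈ N ∧ q.2 ≠ 0} := by
  rintro ⟨y, v⟩ ⟨hy, hv⟩
  apply ContDiffAt.contDiffWithinAt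
  have hl : ContDiff ℝ ∞ (fun q : E5 × E5 => l₀ q.2) := l₀.contDiff.comp contDiff_snd
  by_cases hl0 : l₀ v = 0
  · obtain ⟨B, hB⟩ := h.bounded
    have hc : Continuous fun q : E5 × E5 => |l₀ q.2| * B - ‖q.2‖ := by
      have := hl.continuous
      fun_prop
    have h1 : ∀ᶠ q : E5 × E5 in 𝓝 (y, v), |l₀ q.2| * B - ‖q.2‖ < 0 := by
      refine hc.continuousAt.eventually_lt continuousAt_const ?_
      change |l₀ v| * B - ‖v‖ < 0
      rw [hl0, abs_zero, zero_mul, zero_sub, neg_lt_zero]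
      exact norm_pos_iff.2 hv
    have h2 : (fun q : E5 × E5 => l₀ q.2 • Q (q.1, (l₀ q.2)⁻¹ • q.2)) =ᶠ[𝓝 (y, v)] fun _ => 0 := by
      filter_upwards [h1, (h.isOpen.preimage continuous_fst).mem_nhds hy] with q hq hqN
      by_cases hq0 : l₀ q.2 = 0
      · rw [hq0, zero_smul]
      · rw [hB q.1 hqN _ (by rw [map_smul, smul_eq_mul, inv_mul_cancel₀ hq0]) ?_, smul_zero]
        rw [norm_smul, norm_inv, Real.norm_eq_abs, inv_mul_eq_div, le_div_iff₀ (abs_pos.2 hq0)]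
        linarith
    exact contDiffAt_const.congr_of_eventuallyEq h2
  · have h1 : ContDiffAt ℝ ∞ (fun q : E5 × E5 => (q.1, (l₀ q.2)⁻¹ • q.2)) (y, v) :=
      contDiffAt_fst.prodMk ((hl.contDiffAt.inv hl0).smul contDiffAt_snd)
    exact hl.contDiffAt.smul (ContDiffAt.comp (y, v) (h.smooth.contDiffAt
      ((h.isOpen.prod isOpen_univ).mem_nhds ⟨hy, trivial⟩)) h1)

theorem contDiffOn_coneMap (h : IsConePerturbation l₀ l₁ N Q) :
    ContDiffOn ℝ ∞ (fun q : E5 × E5 => coneMap l₀ Q q.1 q.2) {q | q.1 ∈ N ∧ q.2 ≠ 0} :=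
  contDiff_snd.contDiffOn.sub h.contDiffOn_perturbation

/-- A kernel vector is `(0, w)` with `w` equal to the derivative of the perturbation along `w`. Then
`w` lies in ker l₀ ∩ ker l₁ and the contraction gives `‖w‖ ≤ ‖w‖ / 2`. -/
theorem isInvertible_fderiv (h : IsConePerturbation l₀ l₁ N Q) {q : E5 × E5} (hq : q.1 ∈ N)
    (hq0 : q.2 ≠ 0) :
    (fderiv ℝ (fun q : E5 × E5 => (q.1, coneMap l₀ Q q.1 q.2)) q).IsInvertible := by
  set R : E5 × E5 → E5 := fun q => l₀ q.2 • Q (q.1, (l₀ q.2)⁻¹ • q.2) with hR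
  have hRd : HasFDerivAt R (fderiv ℝ R q) q :=
    ((h.contDiffOn_perturbation.contDiffAt (h.isOpen_domain.mem_nhds
      ⟨hq, hq0⟩)).differentiableAt (by simp)).hasFDerivAt
  have hd : HasFDerivAt (fun q : E5 × E5 => (q.1, coneMap l₀ Q q.1 q.2)) _ q :=
    hasFDerivAt_fst.prodMk (hasFDerivAt_snd.sub hRd)
  rw [hd.fderiv]
  set L := (ContinuousLinearMap.fst ℝ E5 E5).prod (ContinuousLinearMap.snd ℝ E5 E5 - fderiv ℝ R q)
  have hF : ∀ (l : E5 →L[ℝ] ℝ), (∀ y g, l (Q (y, g)) = 0) → ∀ w, l (fderiv ℝ R q w) = 0 := by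
    intro l hl w
    have h1 := l.hasFDerivAt.comp q hRd
    have h2 : l ∘ R = fun _ => 0 := by
      funext q
      simp [hR, hl]
    rw [h2] at h1
    exact (DFunLike.congr_fun (h1.unique (hasFDerivAt_const (0 : ℝ) q)) w)
  have hinj : Function.Injective L := by
    rw [injective_iff_map_eq_zero]
    rintro ⟨w₁, w⟩ hw
    have hw1 : w₁ = 0 := congrArg Prod.fst hw
    subst hw1
    have hw2 : w - fderiv ℝ R q (0, w) = 0 := congrArg Prod.snd hw
    rw [sub_eq_zero] at hw2
    have e0 : l₀ w = 0 := by rw [hw2]; exact hF l₀ h.apply_zero _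
    have e1 : l₁ w = 0 := by rw [hw2]; exact hF l₁ h.apply_one _
    have hcurve : HasDerivAt (fun t : ℝ => R (q.1, q.2 + t • w)) (fderiv ℝ R q (0, w)) 0 := by
      have h1 : HasDerivAt (fun t : ℝ => (q.1, q.2 + t • w)) ((0 : E5), (1 : ℝ) • w) 0 :=
        (hasDerivAt_const _ _).prodMk (((hasDerivAt_id (0 : ℝ)).smul_const w).const_add q.2)
      rw [one_smul] at h1
      exact hRd.comp_hasDerivAt_of_eq 0 h1 (by simp)
    have hle := hcurve.le_of_lip' (C := 1 / 2 * ‖w‖) (by positivity) (by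
      filter_upwards with t
      have e2 : q.2 + t • w - (q.2 + (0 : ℝ) • w) = t • w := by simp
      have h2 := h.norm_sub_le hq (v := q.2 + t • w) (v' := q.2 + (0 : ℝ) • w)
        (by rw [e2, map_smul, e0, smul_zero]) (by rw [e2, map_smul, e1, smul_zero])
      rw [e2, norm_smul] at h2
      refine h2.trans (le_of_eq ?_)
      rw [sub_zero]; ring)
    rw [← hw2] at hle
    have h3 : ‖w‖ = 0 := by linarith [norm_nonneg w]
    rw [norm_eq_zero.1 h3]
    rfl
  have hsurj : Function.Surjective L :=
    (LinearMap.injective_iff_surjective (f := L.toLinearMap)).1 hinj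
  exact ⟨ContinuousLinearEquiv.ofBijective L (LinearMap.ker_eq_bot.2 hinj)
    (LinearMap.range_eq_top.2 hsurj), by ext <;> simp⟩

theorem coneMap_zero (l₀ : E5 →L[ℝ] ℝ) (Q : E5 × E5 → E5) (y : E5) : coneMap l₀ Q y 0 = 0 := by
  simp [coneMap]

/-- The inverse family of homeomorphisms. -/
theorem exists_inverse (h : IsConePerturbation l₀ l₁ N Q) : ∃ U : E5 → E5 → E5,
    (∀ y ∈ N, ∀ v, U y (coneMap l₀ Q y v) = v) ∧ (∀ y ∈ N, ∀ w, coneMap l₀ Q y (U y w) = w) ∧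
      ContDiffOn ℝ ∞ (fun q : E5 × E5 => U q.1 q.2) {q | q.1 ∈ N ∧ q.2 ≠ 0} := by
  have hex : ∀ y w, ∃ v, y ∈ N → coneMap l₀ Q y v = w := by
    intro y w
    by_cases hy : y ∈ N
    · obtain ⟨v, hv⟩ := h.coneMap_surjective hy w
      exact ⟨v, fun _ => hv⟩
    · exact ⟨0, fun h => absurd h hy⟩
  choose U hU using hex
  refine ⟨U, fun y hy v => h.coneMap_injective hy (hU y _ hy), fun y hy w => hU y w hy, ?_⟩
  rintro ⟨y, w⟩ ⟨hy, hw⟩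
  apply ContDiffAt.contDiffWithinAt
  set v := U y w with hv
  have hvw : coneMap l₀ Q y v = w := hU y w hy
  have hv0 : v ≠ 0 := by
    intro h0
    rw [h0, coneMap_zero] at hvw
    exact hw hvw.symm
  obtain ⟨Ψ, hmem, hsub, hΨ, -, hΨs, -⟩ := exists_smooth_local_inverse h.isOpen_domain
    (contDiff_fst.contDiffOn.prodMk h.contDiffOn_coneMap) (u₀ := (y, v)) ⟨hy, hv0⟩
    (h.isInvertible_fderiv (q := (y, v)) hy hv0)
  have hT : (y, w) ∈ Ψ.target := by
    have := Ψ.map_source hmem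
    rw [hΨ] at this
    simpa only [hvw] using this
  have heq : (fun q : E5 × E5 => U q.1 q.2) =ᶠ[𝓝 (y, w)] fun q => (Ψ.symm q).2 := by
    filter_upwards [Ψ.open_target.mem_nhds hT] with q hq
    have h1 := Ψ.right_inv hq
    rw [hΨ] at h1
    obtain ⟨h2, h3⟩ : (Ψ.symm q).1 = q.1 ∧ coneMap l₀ Q (Ψ.symm q).1 (Ψ.symm q).2 = q.2 :=
      Prod.ext_iff.1 h1
    have h4 : (Ψ.symm q).1 ∈ N := (hsub (Ψ.map_target hq)).1
    rw [h2] at h3 h4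
    exact h.coneMap_injective h4 ((hU _ _ h4).trans h3.symm)
  exact ((hΨs.contDiffAt (Ψ.open_target.mem_nhds hT)).snd).congr_of_eventuallyEq heq

end IsConePerturbation

/-- A family of homogeneous homeomorphisms that straightens the cones over the curves
`s ↦ f₀ + s f₁ + G (y, s)`, where `G` is small. -/
theorem exists_coneTriviality : ∃ δ > 0, ∀ (l₀ l₁ : E5 →L[ℝ] ℝ) (f₀ f₁ : E5), l₀ f₀ = 1 →
    l₀ f₁ = 0 → l₁ f₀ = 0 → l₁ f₁ = 1 → ∀ (N : Set E5) (ε : ℝ) (G : E5 × ℝ → E5), IsOpen N →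
    0 < ε → ContDiffOn ℝ ∞ G (N ×ˢ Set.Ioo (-(3 * ε)) (3 * ε)) →
    (∀ p, l₀ (G p) = 0) → (∀ p, l₁ (G p) = 0) →
    (∀ p ∈ N ×ˢ Set.Ioo (-(3 * ε)) (3 * ε), ‖G p‖ ≤ δ) →
    ∃ T U : E5 → E5 → E5, (∀ y ∈ N, ∀ v, U y (T y v) = v) ∧ (∀ y ∈ N, ∀ w, T y (U y w) = w) ∧
      (∀ y ∈ N, ∀ (r : ℝ) (v : E5), T y (r • v) = r • T y v) ∧
      ContDiffOn ℝ ∞ (fun q : E5 × E5 => T q.1 q.2) {q | q.1 ∈ N ∧ q.2 ≠ 0} ∧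
      ContDiffOn ℝ ∞ (fun q : E5 × E5 => U q.1 q.2) {q | q.1 ∈ N ∧ q.2 ≠ 0} ∧
      ∀ y ∈ N, ∀ s ∈ Set.Ioo (-ε) ε, T y (f₀ + s • f₁ + G (y, s)) = f₀ + s • f₁ := by
  -- The cut-off transverse to the plane of `f₀`, `f₁` is fixed first, so that its Lipschitz
  -- constant, and with it `δ`, is independent of the box and of the curves.
  let β : ContDiffBump (0 : E5) := ⟨1, 2, one_pos, one_lt_two⟩
  obtain ⟨C, hC⟩ := (β.contDiff (n := 1)).lipschitzWith_of_hasCompactSupport β.hasCompactSupport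
    one_ne_zero
  -- The bound 1 keeps the curves where `β` equals one; the other bound makes the perturbation
  -- contract by one half.
  refine ⟨min 1 (1 / (2 * (C + 1))), by positivity, ?_⟩
  intro l₀ l₁ f₀ f₁ h00 h01 h10 h11 N ε G hN hε hG hG0 hG1 hGδ
  -- Equal to one up to `ε` and zero from `2 ε` on, while `G` is smooth up to `3 ε`.
  let χ : ContDiffBump (0 : ℝ) := ⟨ε, 2 * ε, hε, by linarith⟩
  let P : E5 →L[ℝ] E5 := ContinuousLinearMap.id ℝ E5 - l₀.smulRight f₀ - l₁.smulRight f₁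
  have hP : ∀ v, P v = v - l₀ v • f₀ - l₁ v • f₁ := fun v => by simp [P]
  -- At a point `f₀ + s f₁ + G (y, s)` with `|s| < ε` both cut-offs are one and `Q` is `G (y, s)`,
  -- so `coneMap` subtracts exactly the deviation from the line.
  let Q : E5 × E5 → E5 := fun q => (χ (l₁ q.2) * β (P q.2)) • G (q.1, l₁ q.2)
  have hχ0 : ∀ s : ℝ, 2 * ε ≤ |s| → χ s = 0 := fun s hs =>
    χ.zero_of_le_dist (by rwa [Real.dist_eq, sub_zero])
  have hmemI : ∀ s : ℝ, |s| < 3 * ε → s ∈ Set.Ioo (-(3 * ε)) (3 * ε) := fun s hs => abs_lt.1 hs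
  have hQ : IsConePerturbation l₀ l₁ N Q := by
    refine ⟨hN, ?_, ?_, fun y g => by simp [Q, hG0], fun y g => by simp [Q, hG1], ?_⟩
    · rintro ⟨y, g⟩ ⟨hy, -⟩
      apply ContDiffAt.contDiffWithinAt
      have hl1 : ContDiff ℝ ∞ fun q : E5 × E5 => l₁ q.2 := l₁.contDiff.comp contDiff_snd
      rcases lt_or_ge (|l₁ g|) (3 * ε) with hs | hs
      · refine ((χ.contDiff.comp hl1).mul (β.contDiff.comp
          (P.contDiff.comp contDiff_snd))).contDiffAt.smul (ContDiffAt.comp (y, g) ?_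
          (contDiff_fst.prodMk hl1).contDiffAt)
        exact hG.contDiffAt ((hN.prod isOpen_Ioo).mem_nhds ⟨hy, hmemI _ hs⟩)
      · have h1 : ∀ᶠ q : E5 × E5 in 𝓝 (y, g), 2 * ε < |l₁ q.2| :=
          continuousAt_const.eventually_lt (hl1.continuous.abs.continuousAt) (by
            change 2 * ε < |l₁ g|; linarith)
        refine (contDiffAt_const (c := (0 : E5))).congr_of_eventuallyEq ?_
        filter_upwards [h1] with q hq
        simp only [Q, hχ0 _ hq.le, zero_mul, zero_smul]
    -- If `l₁ g` is within the support of `χ`, a norm this large forces `‖P g‖ ≥ 2`, where `β`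
    -- vanishes.
    · refine ⟨‖f₀‖ + 2 * ε * ‖f₁‖ + 2, fun y hy g hg hB => ?_⟩
      rcases lt_or_ge (|l₁ g|) (2 * ε) with hs | hs
      · have h1 : 2 ≤ ‖P g‖ := by
          have h2 : g = f₀ + l₁ g • f₁ + P g := by rw [hP, hg, one_smul]; abel
          have h3 : ‖g‖ ≤ ‖f₀‖ + |l₁ g| * ‖f₁‖ + ‖P g‖ := by
            conv_lhs => rw [h2]
            refine (norm_add_le _ _).trans ?_
            gcongr
            refine (norm_add_le _ _).trans ?_
            rw [norm_smul, Real.norm_eq_abs]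
          have h4 : |l₁ g| * ‖f₁‖ ≤ 2 * ε * ‖f₁‖ := by gcongr
          linarith
        have h5 : β (P g) = 0 := β.zero_of_le_dist (by rwa [dist_zero_right])
        simp only [Q, h5, mul_zero, zero_smul]
      · simp only [Q, hχ0 _ hs, zero_mul, zero_smul]
    · intro y hy g g' e0 e1
      have e : l₁ g = l₁ g' := by rwa [map_sub, sub_eq_zero] at e1
      have e' : l₀ g = l₀ g' := by rwa [map_sub, sub_eq_zero] at e0
      have h1 : Q (y, g) - Q (y, g') =
          (χ (l₁ g') * (β (P g) - β (P g'))) • G (y, l₁ g') := by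
        simp only [Q, e]
        module
      have hPP : P g - P g' = g - g' := by
        rw [hP, hP, e, e']; abel
      rcases lt_or_ge (|l₁ g'|) (2 * ε) with hs | hs
      · rw [h1, norm_smul, norm_mul]
        have h2 : ‖χ (l₁ g')‖ ≤ 1 := by
          rw [Real.norm_eq_abs, abs_of_nonneg χ.nonneg]; exact χ.le_one
        have h3 : ‖β (P g) - β (P g')‖ ≤ C * ‖g - g'‖ := by
          have := hC.norm_sub_le (P g) (P g')
          rwa [hPP] at this
        have h4 : ‖G (y, l₁ g')‖ ≤ 1 / (2 * (C + 1)) :=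
          (hGδ _ ⟨hy, hmemI _ (by linarith)⟩).trans (min_le_right _ _)
        calc ‖χ (l₁ g')‖ * ‖β (P g) - β (P g')‖ * ‖G (y, l₁ g')‖
            ≤ 1 * (C * ‖g - g'‖) * (1 / (2 * (C + 1))) := by gcongr
          _ = (C / (C + 1)) * (1 / 2 * ‖g - g'‖) := by field_simp
          _ ≤ 1 * (1 / 2 * ‖g - g'‖) := by
              gcongr
              rw [div_le_one (by positivity)]
              linarith
          _ = 1 / 2 * ‖g - g'‖ := one_mul _
      · rw [h1, hχ0 _ hs, zero_mul, zero_smul, norm_zero]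
        positivity
  obtain ⟨U, hU1, hU2, hU3⟩ := hQ.exists_inverse
  refine ⟨coneMap l₀ Q, U, hU1, hU2, fun y _ => coneMap_smul l₀ Q y, hQ.contDiffOn_coneMap, hU3,
    ?_⟩
  intro y hy s hs
  have hs' : |s| < ε := abs_lt.2 hs
  have e0 : l₀ (f₀ + s • f₁ + G (y, s)) = 1 := by simp [h00, h01, hG0]
  have e1 : l₁ (f₀ + s • f₁ + G (y, s)) = s := by simp [h10, h11, hG1]
  have e2 : P (f₀ + s • f₁ + G (y, s)) = G (y, s) := by
    rw [hP, e0, e1]; module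
  have h1 : χ s = 1 := χ.one_of_mem_closedBall (by
    rw [Metric.mem_closedBall, Real.dist_eq, sub_zero]; exact hs'.le)
  have h2 : β (G (y, s)) = 1 := β.one_of_mem_closedBall (by
    rw [Metric.mem_closedBall, dist_zero_right]
    exact (hGδ _ ⟨hy, hmemI _ (by linarith)⟩).trans (min_le_left _ _))
  rw [coneMap, e0, inv_one, one_smul, one_smul]
  simp only [Q, e1, e2, h1, h2, mul_one, one_smul]
  abel

/-- The model cone, over a segment. -/
theorem isSubmanifold_curveCone {l₀ l₁ : E5 →L[ℝ] ℝ} {f₀ f₁ : E5} (h00 : l₀ f₀ = 1)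
    (h01 : l₀ f₁ = 0) (h10 : l₁ f₀ = 0) (h11 : l₁ f₁ = 1) (a b : ℝ) :
    IsSubmanifold 2 (curveCone (fun s => f₀ + s • f₁) a b \ {0}) := by
  have hl : ∀ s : ℝ, l₀ (f₀ + s • f₁) = 1 := fun s => by simp [h00, h01]
  have hl1 : ∀ s : ℝ, l₁ (f₀ + s • f₁) = s := fun s => by simp [h10, h11]
  -- Over the open set `l₀ ≠ 0`, `l₁ / l₀ ∈ (a, b)` the cone is the plane of `f₀`, `f₁` itself, so
  -- the identity serves as a chart.
  let Ω₀ : Set E5 := {v | l₀ v ≠ 0}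
  have hΩ₀ : IsOpen Ω₀ := isOpen_ne.preimage l₀.continuous
  let Ω : Set E5 := Ω₀ ∩ (fun v => l₁ v / l₀ v) ⁻¹' Set.Ioo a b
  have hΩ : IsOpen Ω := (l₁.continuous.continuousOn.div l₀.continuous.continuousOn
    fun v hv => hv).isOpen_inter_preimage hΩ₀ isOpen_Ioo
  have hmem : ∀ v ∈ curveCone (fun s => f₀ + s • f₁) a b \ {0}, v ∈ Ω := by
    rintro v ⟨⟨s, hs, r, rfl⟩, hv⟩
    have hr : r ≠ 0 := by
      rintro rfl
      exact hv (zero_smul _ _)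
    have e0 : l₀ (r • (f₀ + s • f₁)) = r := by rw [map_smul, hl, smul_eq_mul, mul_one]
    have e1 : l₁ (r • (f₀ + s • f₁)) = r * s := by rw [map_smul, hl1, smul_eq_mul]
    refine ⟨?_, ?_⟩
    · change l₀ _ ≠ 0
      rwa [e0]
    · change l₁ (r • (f₀ + s • f₁)) / l₀ (r • (f₀ + s • f₁)) ∈ Set.Ioo a b
      rwa [e0, e1, mul_div_cancel_left₀ _ hr]
  have hli : LinearIndependent ℝ ![f₀, f₁] := by
    rw [LinearIndependent.pair_iff]
    intro p q hpq
    have e0 := congrArg l₀ hpq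
    have e1 := congrArg l₁ hpq
    simp [h00, h01] at e0
    simp [h10, h11] at e1
    exact ⟨e0, e1⟩
  intro v hv
  refine ⟨OpenPartialHomeomorph.ofSet Ω hΩ, Submodule.span ℝ (Set.range ![f₀, f₁]), hmem v hv,
    contDiff_id.contDiffOn, contDiff_id.contDiffOn, ?_, ?_⟩
  · rw [finrank_span_eq_card hli, Fintype.card_fin]
  · intro w hw
    have hw' : w ∈ Ω := hw
    change w ∈ _ ↔ w ∈ Submodule.span ℝ (Set.range ![f₀, f₁])
    have hr : Set.range ![f₀, f₁] = {f₀, f₁} := by simp [Set.pair_comm]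
    rw [hr, Submodule.mem_span_pair]
    constructor
    · rintro ⟨⟨s, hs, r, rfl⟩, -⟩
      exact ⟨r, r * s, by module⟩
    · rintro ⟨p, q, rfl⟩
      have e0 : l₀ (p • f₀ + q • f₁) = p := by simp [h00, h01]
      have e1 : l₁ (p • f₀ + q • f₁) = q := by simp [h10, h11]
      obtain ⟨hp, hq⟩ := hw'
      change l₀ (p • f₀ + q • f₁) ≠ 0 at hp
      change l₁ (p • f₀ + q • f₁) / l₀ (p • f₀ + q • f₁) ∈ Set.Ioo a b at hq
      rw [e0] at hp hq
      rw [e1] at hq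
      refine ⟨⟨q / p, hq, p, ?_⟩, fun h0 => ?_⟩
      · rw [smul_add, smul_smul, mul_div_cancel₀ _ hp]
      · apply hp
        rw [← e0, (h0 : _ = (0 : E5)), map_zero]

end Perturbation

end CartanDuality

end

/-! ### From families of maps of the model space to local trivialities of the tangent bundle. -/

open scoped Manifold ContDiff Topology

noncomputable section

namespace CartanDuality

section Triviality

variable {X : Type*} [TopologicalSpace X] [ChartedSpace E5 X] [IsManifold 𝓘(ℝ, E5) ∞ X]
  {φ : OpenPartialHomeomorph X E5} {N : Set E5}

theorem contMDiffOn_dchart (hφ : φ ∈ IsManifold.maximalAtlas 𝓘(ℝ, E5) ∞ X) :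
    ContMDiffOn 𝓘(ℝ, E5).tangent 𝓘(ℝ, E5 × E5) ∞
      (fun q : TangentBundle 𝓘(ℝ, E5) X => (φ q.1, (dchart φ q.1 q.2 : E5)))
      {q | q.1 ∈ φ.source} := by
  have h1 := (contMDiffOn_of_mem_maximalAtlas hφ).contMDiffOn_tangentMapWithin (m := ∞) (by simp)
    φ.open_source.uniqueMDiffOn
  have h2 : ContMDiffOn 𝓘(ℝ, E5).tangent 𝓘(ℝ, E5) ∞
      (fun q : TangentBundle 𝓘(ℝ, E5) X => (dchart φ q.1 q.2 : E5)) {q | q.1 ∈ φ.source} := by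
    refine ((contMDiff_snd_tangentBundle_modelSpace E5 𝓘(ℝ, E5)).comp_contMDiffOn h1).congr
      fun q hq => ?_
    exact (DFunLike.congr_fun (mfderivWithin_of_isOpen φ.open_source hq) q.2).symm
  exact ((contMDiffOn_of_mem_maximalAtlas hφ).comp (Bundle.contMDiff_proj _).contMDiffOn
    (fun q hq => hq)).prodMk_space h2

theorem contMDiffOn_dchart_inverse (hφ : φ ∈ IsManifold.maximalAtlas 𝓘(ℝ, E5) ∞ X) :
    ContMDiffOn 𝓘(ℝ, E5 × E5) 𝓘(ℝ, E5).tangent ∞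
      (fun q : E5 × E5 => (⟨φ.symm q.1, (dchart φ (φ.symm q.1)).inverse q.2⟩ :
        TangentBundle 𝓘(ℝ, E5) X)) (φ.target ×ˢ Set.univ) := by
  have h1 := (contMDiffOn_symm_of_mem_maximalAtlas hφ).contMDiffOn_tangentMapWithin (m := ∞)
    (by simp) φ.open_target.uniqueMDiffOn
  have h2 : ContMDiff 𝓘(ℝ, E5 × E5) 𝓘(ℝ, E5).tangent ∞
      (fun q : E5 × E5 => (⟨q.1, q.2⟩ : TangentBundle 𝓘(ℝ, E5) E5)) := by
    have h3 := contMDiff_tangentBundleModelSpaceHomeomorph_symm (I := 𝓘(ℝ, E5)) (n := ∞)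
    rw [modelWithCornersSelf_prod]
    exact h3
  refine (h1.comp h2.contMDiffOn fun q hq => hq.1).congr fun q hq => ?_
  simp only [Function.comp_apply, tangentMapWithin]
  rw [mfderivWithin_of_isOpen φ.open_target hq.1]
  congr 1
  have he := mdifferentiable_of_mem_maximalAtlas hφ
  refine (ContinuousLinearMap.IsInvertible.inverse_apply_eq
    (dchart_isInvertible hφ (φ.map_target hq.1))).2 ?_
  exact (DFunLike.congr_fun (he.comp_symm_deriv hq.1) _).symm

/-- A family of homogeneous homeomorphisms of the model space induces a local triviality. -/
theorem isConeTriviality (hφ : φ ∈ IsManifold.maximalAtlas 𝓘(ℝ, E5) ∞ X) (hN : IsOpen N)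
    {T U : E5 → E5 → E5} (hUT : ∀ y ∈ N, ∀ v, U y (T y v) = v) (hTU : ∀ y ∈ N, ∀ w, T y (U y w) = w)
    (hT : ∀ y ∈ N, ∀ (r : ℝ) (v : E5), T y (r • v) = r • T y v)
    (hTs : ContDiffOn ℝ ∞ (fun q : E5 × E5 => T q.1 q.2) {q | q.1 ∈ N ∧ q.2 ≠ 0})
    (hUs : ContDiffOn ℝ ∞ (fun q : E5 × E5 => U q.1 q.2) {q | q.1 ∈ N ∧ q.2 ≠ 0}) :
    IsConeTriviality (φ.source ∩ φ ⁻¹' N) (fun x v => T (φ x) (dchart φ x v))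
      (fun x w => (dchart φ x).inverse (U (φ x) w)) where
  isOpen := φ.isOpen_inter_preimage hN
  left_inv := fun x hx v => by
    rw [hUT _ hx.2, inverse_dchart_apply hφ hx.1]
  right_inv := fun x hx w => by
    rw [dchart_inverse_apply hφ hx.1, hTU _ hx.2]
  map_smul := fun x hx r v => by rw [_root_.map_smul, hT _ hx.2]
  smooth := by
    refine (contMDiffOn_iff_contDiffOn.2 hTs).comp
      ((contMDiffOn_dchart hφ).mono fun q hq => hq.1.1) fun q hq => ⟨hq.1.2, fun h0 => hq.2 ?_⟩
    exact dchart_injective hφ hq.1.1 (h0.trans (map_zero _).symm)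
  smooth_inv := by
    have h1 : ContMDiffOn (𝓘(ℝ, E5).prod 𝓘(ℝ, E5)) 𝓘(ℝ, E5) ∞ (fun q : X × E5 => φ q.1)
        {q | q.1 ∈ φ.source ∩ φ ⁻¹' N ∧ q.2 ≠ 0} :=
      (contMDiffOn_of_mem_maximalAtlas hφ).comp contMDiffOn_fst fun q hq => hq.1.1
    have h2 : ContMDiffOn (𝓘(ℝ, E5).prod 𝓘(ℝ, E5)) 𝓘(ℝ, E5) ∞
        (fun q : X × E5 => U (φ q.1) q.2) {q | q.1 ∈ φ.source ∩ φ ⁻¹' N ∧ q.2 ≠ 0} :=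
      (contMDiffOn_iff_contDiffOn.2 hUs).comp (h1.prodMk_space contMDiffOn_snd)
        fun q hq => ⟨hq.1.2, hq.2⟩
    refine ((contMDiffOn_dchart_inverse hφ).comp (h1.prodMk_space h2)
      fun q hq => ⟨φ.map_source hq.1.1, trivial⟩).congr fun q hq => ?_
    -- The fibre depends on the base point, so `φ.symm (φ q.1) = q.1` has to be substituted in the
    -- total space.
    have h3 : ∀ x, x = q.1 → (⟨q.1, (dchart φ q.1).inverse (U (φ q.1) q.2)⟩ :
        TangentBundle 𝓘(ℝ, E5) X) = ⟨x, (dchart φ x).inverse (U (φ q.1) q.2)⟩ := by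
      rintro x rfl; rfl
    exact h3 _ (φ.left_inv hq.1.1)

end Triviality

end CartanDuality

end

/-! ### Small boxes in a given path space. -/

open scoped Manifold ContDiff Topology

noncomputable section

namespace CartanDuality

section PathBox

set_option linter.unusedSectionVars false

variable {Y : Type*} [TopologicalSpace Y] [ChartedSpace E5 Y] [IsManifold 𝓘(ℝ, E5) ∞ Y]
  {X : Type*} [TopologicalSpace X] [ChartedSpace E5 X] [IsManifold 𝓘(ℝ, E5) ∞ X]

/-- An open set of `P(D)` with coordinates `(x, s)`, where `x` are the coordinates of the path, for
the chart `φ` of the space of paths, and `s` is a parameter on the paths with values in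
`(-ε, ε)`. -/
structure IsPathBox (D : PlaneField Y) (W : Set (ProjSpace D)) (π : ProjSpace D → X)
    (κ : OpenPartialHomeomorph (ProjSpace D) (E5 × ℝ)) (ψ : OpenPartialHomeomorph Y E5) (O : Set E5)
    (e : Fin 5 → E5 → E5) (φ : OpenPartialHomeomorph X E5) (W₁ : Set (ProjSpace D))
    (S : OpenPartialHomeomorph (E5 × ℝ) (E5 × ℝ)) (k : E5 × ℝ → ℝ) (l₀ l₁ : E5 →L[ℝ] ℝ)
    (N : Set E5) (ε : ℝ) : Prop where
  path : IsPathSpace D W π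
  chart : IsAdaptedChart D κ ψ O e
  mem_atlas : φ ∈ IsManifold.maximalAtlas 𝓘(ℝ, E5) ∞ X
  isOpen : IsOpen W₁
  subset : W₁ ⊆ W ∩ π ⁻¹' φ.source
  box : IsCharBox e (κ.target ∩ κ.symm ⁻¹' W₁) (fun u => φ (π (κ.symm u))) S k l₀ l₁
  isOpen_coord : IsOpen N
  pos : 0 < ε
  prod_subset : N ×ˢ Set.Ioo (-ε) ε ⊆ S.source

namespace IsPathBox

variable {D : PlaneField Y} {W : Set (ProjSpace D)} {π : ProjSpace D → X}
  {κ : OpenPartialHomeomorph (ProjSpace D) (E5 × ℝ)} {ψ : OpenPartialHomeomorph Y E5} {O : Set E5}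
  {e : Fin 5 → E5 → E5} {φ : OpenPartialHomeomorph X E5} {W₁ : Set (ProjSpace D)}
  {S : OpenPartialHomeomorph (E5 × ℝ) (E5 × ℝ)} {k : E5 × ℝ → ℝ} {l₀ l₁ : E5 →L[ℝ] ℝ}
  {N : Set E5} {ε : ℝ} {z : ProjSpace D} {y : E5} {s : ℝ} {x : X}

theorem proj (h : IsPathBox D W π κ ψ O e φ W₁ S k l₀ l₁ N ε) :
    IsCharProjection O e (κ.target ∩ κ.symm ⁻¹' W₁) (fun u => φ (π (κ.symm u))) :=
  h.path.isCharProjection h.chart h.mem_atlas h.isOpen h.subset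

theorem target_subset (h : IsPathBox D W π κ ψ O e φ W₁ S k l₀ l₁ N ε) : S.target ⊆ κ.target :=
  h.box.target_subset.trans Set.inter_subset_left

theorem zero_mem (h : IsPathBox D W π κ ψ O e φ W₁ S k l₀ l₁ N ε) : (0 : ℝ) ∈ Set.Ioo (-ε) ε :=
  ⟨neg_lt_zero.2 h.pos, h.pos⟩

theorem boxSet_subset (h : IsPathBox D W π κ ψ O e φ W₁ S k l₀ l₁ N ε) :
    boxSet κ S N (-ε) ε ⊆ W₁ := by
  intro z hz
  obtain ⟨h1, h2, -⟩ := mem_boxSet.1 hz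
  have h3 := (h.box.target_subset h2).2
  rwa [Set.mem_preimage, κ.left_inv h1] at h3

theorem mem_path (h : IsPathBox D W π κ ψ O e φ W₁ S k l₀ l₁ N ε)
    (hz : z ∈ boxSet κ S N (-ε) ε) : z ∈ W := (h.subset (h.boxSet_subset hz)).1

theorem mem_chart (_h : IsPathBox D W π κ ψ O e φ W₁ S k l₀ l₁ N ε)
    (hz : z ∈ boxSet κ S N (-ε) ε) : z ∈ κ.source := (mem_boxSet.1 hz).1

theorem apply_mem (h : IsPathBox D W π κ ψ O e φ W₁ S k l₀ l₁ N ε)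
    (hz : z ∈ boxSet κ S N (-ε) ε) : π z ∈ φ.source := (h.subset (h.boxSet_subset hz)).2

theorem fst_eq (h : IsPathBox D W π κ ψ O e φ W₁ S k l₀ l₁ N ε)
    (hz : z ∈ boxSet κ S N (-ε) ε) : (S.symm (κ z)).1 = φ (π z) := by
  obtain ⟨h1, h2, -⟩ := mem_boxSet.1 hz
  have h3 := h.box.apply_proj _ (S.map_target h2)
  rw [S.right_inv h2, κ.left_inv h1] at h3
  exact h3.symm

theorem coord_mem (h : IsPathBox D W π κ ψ O e φ W₁ S k l₀ l₁ N ε)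
    (hz : z ∈ boxSet κ S N (-ε) ε) : φ (π z) ∈ N := by
  rw [← h.fst_eq hz]
  exact (mem_boxSet.1 hz).2.2.1

theorem exists_param (h : IsPathBox D W π κ ψ O e φ W₁ S k l₀ l₁ N ε)
    (hz : z ∈ boxSet κ S N (-ε) ε) : ∃ s ∈ Set.Ioo (-ε) ε, κ z = S (φ (π z), s) := by
  refine ⟨(S.symm (κ z)).2, (mem_boxSet.1 hz).2.2.2, ?_⟩
  rw [← h.fst_eq hz]
  exact (S.right_inv (mem_boxSet.1 hz).2.1).symm

theorem mem_source (h : IsPathBox D W π κ ψ O e φ W₁ S k l₀ l₁ N ε) (hy : y ∈ N)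
    (hs : s ∈ Set.Ioo (-ε) ε) : (y, s) ∈ S.source := h.prod_subset ⟨hy, hs⟩

/-- The point with given coordinates. -/
theorem exists_point (h : IsPathBox D W π κ ψ O e φ W₁ S k l₀ l₁ N ε) (hx : x ∈ φ.source)
    (hxN : φ x ∈ N) (hs : s ∈ Set.Ioo (-ε) ε) :
    ∃ z ∈ boxSet κ S N (-ε) ε, κ z = S (φ x, s) ∧ π z = x := by
  obtain ⟨h1, h2, h3⟩ := symm_mem_boxSet h.target_subset (p := (φ x, s)) (h.mem_source hxN hs) hxN hs
  refine ⟨_, h1, h2, φ.injOn (h.apply_mem h1) hx ?_⟩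
  rw [← h.fst_eq h1, h3]

theorem image_boxSet (h : IsPathBox D W π κ ψ O e φ W₁ S k l₀ l₁ N ε) :
    π '' boxSet κ S N (-ε) ε = φ.source ∩ φ ⁻¹' N := by
  apply Set.Subset.antisymm
  · rintro _ ⟨z, hz, rfl⟩
    exact ⟨h.apply_mem hz, h.coord_mem hz⟩
  · rintro x ⟨hx, hxN⟩
    obtain ⟨z, hz, -, hzx⟩ := h.exists_point hx hxN h.zero_mem
    exact ⟨z, hz, hzx⟩

/-- A fibre in the box is a full line of it, over an interval, and hence again a single path; an
arbitrary smaller open set could disconnect the fibres. -/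
theorem isPathSpace (h : IsPathBox D W π κ ψ O e φ W₁ S k l₀ l₁ N ε) :
    IsPathSpace D (boxSet κ S N (-ε) ε) π where
  isOpen := isOpen_boxSet κ S h.isOpen_coord _ _
  smooth := h.path.smooth.mono fun _ hz => h.mem_path hz
  submersive := fun z hz => h.path.submersive z (h.mem_path hz)
  fibre := by
    intro z hz
    obtain ⟨c, hc, him⟩ := h.chart.exists_isSingularLift_box h.target_subset h.box.smooth
      (fun p hp => ⟨k p, h.box.speed_ne_zero p hp, h.box.hasDerivAt hp⟩) h.prod_subset hz
    refine ⟨c, -ε, ε, hc, him.trans ?_⟩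
    ext z'
    refine and_congr_right fun hz' => ?_
    rw [h.fst_eq hz, h.fst_eq hz']
    exact φ.injOn.eq_iff (h.apply_mem hz') (h.apply_mem hz)

theorem dchart_dpi (h : IsPathBox D W π κ ψ O e φ W₁ S k l₀ l₁ N ε)
    (hz : z ∈ boxSet κ S N (-ε) ε) (w : TangentSpace 𝓘(ℝ, E5 × ℝ) z) :
    dchart φ (π z) (dpi D π z w) =
      fderiv ℝ (fun u => φ (π (κ.symm u))) (κ z) (dchart κ z w) :=
  h.path.dchart_dpi h.mem_atlas h.chart.mem_atlas (h.mem_chart hz) (h.mem_path hz)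
    (h.apply_mem hz) w

/-- The third derived system is induced by the form `boxForm`. -/
theorem mem_derived_three (h : IsPathBox D W π κ ψ O e φ W₁ S k l₀ l₁ N ε)
    (hz : z ∈ boxSet κ S N (-ε) ε) (hs : s ∈ Set.Ioo (-ε) ε) (w : TangentSpace 𝓘(ℝ, E5 × ℝ) z) :
    w ∈ derivedSystem (prolongation D) 3 z ↔
      IsCharBox.boxForm e S (φ (π z), s) (dchart φ (π z) (dpi D π z w)) = 0 := by
  obtain ⟨t, ht, hzt⟩ := h.exists_param hz
  rw [h.chart.mem_derived_three (h.mem_chart hz),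
    h.box.boxForm_eq_zero_iff h.proj (fun s hs => h.mem_source (h.coord_mem hz) hs) hs ht,
    h.dchart_dpi hz, hzt, h.box.boxForm_fderiv_proj h.proj (h.mem_source (h.coord_mem hz) ht)]

theorem mem_map_derived_three (h : IsPathBox D W π κ ψ O e φ W₁ S k l₀ l₁ N ε)
    (hz : z ∈ boxSet κ S N (-ε) ε) (hs : s ∈ Set.Ioo (-ε) ε) (v : TangentSpace 𝓘(ℝ, E5) (π z)) :
    v ∈ (derivedSystem (prolongation D) 3 z).map (dpi D π z).toLinearMap ↔
      IsCharBox.boxForm e S (φ (π z), s) (dchart φ (π z) v) = 0 := by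
  constructor
  · rintro ⟨w, hw, rfl⟩
    exact (h.mem_derived_three hz hs w).1 hw
  · intro hv
    obtain ⟨w, rfl⟩ := h.path.submersive z (h.mem_path hz) v
    exact ⟨w, (h.mem_derived_three hz hs w).2 hv, rfl⟩

end IsPathBox

/-- The existence of arbitrarily small boxes, for which the curves of tangents of the projected
vertical vectors are arbitrarily close to lines. -/
theorem IsPathSpace.exists_isPathBox {D : PlaneField Y} (hD : D.Is235) {W : Set (ProjSpace D)}
    {π : ProjSpace D → X} (hπ : IsPathSpace D W π) {z₀ : ProjSpace D} (hz₀ : z₀ ∈ W)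
    {V : Set (ProjSpace D)} (hV : V ∈ 𝓝 z₀) {δ : ℝ} (hδ : 0 < δ) :
    ∃ κ ψ O e φ W₁ S k l₀ l₁ N ε f₀ f₁, IsPathBox D W π κ ψ O e φ W₁ S k l₀ l₁ N ε ∧
      z₀ ∈ boxSet κ S N (-ε) ε ∧ W₁ ⊆ V ∧ l₀ f₀ = 1 ∧ l₀ f₁ = 0 ∧ l₁ f₀ = 0 ∧ l₁ f₁ = 1 ∧
      N ×ˢ Set.Ioo (-(3 * ε)) (3 * ε) ⊆ S.source ∧ ∀ p ∈ N ×ˢ Set.Ioo (-(3 * ε)) (3 * ε),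
        ‖(l₀ (IsCharBox.transverse e (fun u => φ (π (κ.symm u))) S 0 p))⁻¹ •
          IsCharBox.transverse e (fun u => φ (π (κ.symm u))) S 0 p - f₀ - p.2 • f₁‖ ≤ δ := by
  obtain ⟨κ, ψ, O, e, h, hzκ⟩ := exists_isAdaptedChart hD z₀
  let φ := chartAt E5 (π z₀)
  have hφ : φ ∈ IsManifold.maximalAtlas 𝓘(ℝ, E5) ∞ X := IsManifold.chart_mem_maximalAtlas _
  have hφz : π z₀ ∈ φ.source := mem_chart_source E5 (π z₀)
  let W₁ := (W ∩ π ⁻¹' φ.source) ∩ interior V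
  have hW₁ : IsOpen W₁ := (hπ.smooth.continuousOn.isOpen_inter_preimage hπ.isOpen
    φ.open_source).inter isOpen_interior
  have hzW₁ : z₀ ∈ W₁ := ⟨⟨hz₀, hφz⟩, mem_interior_iff_mem_nhds.2 hV⟩
  have hW₁s : W₁ ⊆ W ∩ π ⁻¹' φ.source := Set.inter_subset_left
  have hP := hπ.isCharProjection h hφ hW₁ hW₁s
  have hu₀ : κ z₀ ∈ κ.target ∩ κ.symm ⁻¹' W₁ :=
    ⟨κ.map_source hzκ, by rwa [Set.mem_preimage, κ.left_inv hzκ]⟩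
  obtain ⟨S, k, l₀, l₁, f₀, f₁, hS, hmem, hSu, hf₀, h00, h01, h10, h11⟩ := hP.exists_isCharBox hu₀
  set ϖ : E5 × ℝ → E5 := fun u => φ (π (κ.symm u)) with hϖ
  set p₀ : E5 × ℝ := (ϖ (κ z₀), 0) with hp₀
  -- The deviation of the normalized curve of tangents from the line `f₀ + s f₁`. It vanishes at the
  -- base point, so by continuity it is below `δ` on a small box.
  let g : E5 × ℝ → E5 := fun p => (l₀ (IsCharBox.transverse e ϖ S 0 p))⁻¹ •
    IsCharBox.transverse e ϖ S 0 p - f₀ - p.2 • f₁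
  have hne : ∀ p ∈ S.source, l₀ (IsCharBox.transverse e ϖ S 0 p) ≠ 0 := hS.ne_zero
  have hT := hS.contDiffOn_transverse hP 0
  have hg : ContinuousOn g S.source :=
    ((((l₀.continuous.comp_continuousOn hT.continuousOn).inv₀ hne).smul
      hT.continuousOn).sub continuousOn_const).sub
        (continuous_snd.continuousOn.smul continuousOn_const)
  have hg0 : g p₀ = 0 := by
    have h1 : IsCharBox.transverse e ϖ S 0 p₀ = f₀ := by
      rw [← hf₀, ← hSu]; rfl
    change (l₀ (IsCharBox.transverse e ϖ S 0 p₀))⁻¹ • IsCharBox.transverse e ϖ S 0 p₀ - f₀ -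
      (0 : ℝ) • f₁ = 0
    rw [h1, h00, inv_one, one_smul, sub_self, zero_smul, sub_zero]
  have hopen : IsOpen (S.source ∩ g ⁻¹' Metric.ball 0 δ) :=
    hg.isOpen_inter_preimage S.open_source Metric.isOpen_ball
  have hp₀m : p₀ ∈ S.source ∩ g ⁻¹' Metric.ball 0 δ :=
    ⟨hmem, by rw [Set.mem_preimage, hg0]; exact Metric.mem_ball_self hδ⟩
  obtain ⟨N, I, hN, hI, hxN, h0I, hNI⟩ := isOpen_prod_iff.1 hopen p₀.1 p₀.2 hp₀m
  obtain ⟨r, hr, hrI⟩ := Metric.isOpen_iff.1 hI 0 h0I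
  -- The box has parameter range `ε = r / 3`, since the estimate is needed on an interval three
  -- times as long, to leave room for the cut-off.
  have h3 : Set.Ioo (-(3 * (r / 3))) (3 * (r / 3)) ⊆ I := by
    rintro s ⟨hs1, hs2⟩
    apply hrI
    rw [Metric.mem_ball, Real.dist_eq, sub_zero, abs_lt]
    constructor <;> linarith
  have h4 : N ×ˢ Set.Ioo (-(3 * (r / 3))) (3 * (r / 3)) ⊆ S.source ∩ g ⁻¹' Metric.ball 0 δ :=
    (Set.prod_mono le_rfl h3).trans hNI
  have h5 : Set.Ioo (-(r / 3)) (r / 3) ⊆ Set.Ioo (-(3 * (r / 3))) (3 * (r / 3)) :=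
    Set.Ioo_subset_Ioo (by linarith) (by linarith)
  have hbox : IsPathBox D W π κ ψ O e φ W₁ S k l₀ l₁ N (r / 3) :=
    ⟨hπ, h, hφ, hW₁, hW₁s, hS, hN, by positivity,
      (Set.prod_mono le_rfl h5).trans (h4.trans Set.inter_subset_left)⟩
  refine ⟨κ, ψ, O, e, φ, W₁, S, k, l₀, l₁, N, r / 3, f₀, f₁, hbox, ?_,
    Set.inter_subset_right.trans interior_subset, h00, h01, h10, h11,
    h4.trans Set.inter_subset_left, fun p hp => ?_⟩
  · have h6 := (symm_mem_boxSet hbox.target_subset (p := p₀) hmem hxN hbox.zero_mem).1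
    rwa [hSu, κ.left_inv hzκ] at h6
  · have h6 := (h4 hp).2
    rw [Set.mem_preimage, mem_ball_zero_iff] at h6
    exact h6.le

end PathBox

end CartanDuality

end

/-! ### The contact structure on the path space. -/

open scoped Manifold ContDiff Topology

noncomputable section

namespace CartanDuality

section PathField

set_option linter.unusedSectionVars false

variable {Y : Type*} [TopologicalSpace Y] [ChartedSpace E5 Y] [IsManifold 𝓘(ℝ, E5) ∞ Y]
  {X : Type*} [TopologicalSpace X] [ChartedSpace E5 X] [IsManifold 𝓘(ℝ, E5) ∞ X]

/-- The field of subspaces on the space of paths spanned by the projections of the third derived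
system. -/
def pathField (D : PlaneField Y) (W : Set (ProjSpace D)) (π : ProjSpace D → X) (x : X) :
    Submodule ℝ (TangentSpace 𝓘(ℝ, E5) x) :=
  Submodule.span ℝ {v | ∃ z ∈ W, ∃ w ∈ derivedSystem (prolongation D) 3 z,
    (⟨x, v⟩ : TangentBundle 𝓘(ℝ, E5) X) = ⟨π z, dpi D π z w⟩}

variable {D : PlaneField Y} {W : Set (ProjSpace D)} {π : ProjSpace D → X}

/-- Lifts are not assumed continuous: continuity comes from their coordinate expression. It is
needed for the connectedness argument along the fibres. -/
theorem IsSingularLift.continuousAt (hD : D.Is235) {c : ℝ → ProjSpace D} {a b t : ℝ}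
    (hc : IsSingularLift D c a b) (ht : t ∈ Set.Ioo a b) : ContinuousAt c t := by
  obtain ⟨κ, ψ, O, e, h, hzκ⟩ := exists_isAdaptedChart hD (c t)
  obtain ⟨h1, h2, -⟩ := h.hasDerivAt_of_isSingularLift hc ht hzκ
  have h3 := (κ.continuousAt_symm (κ.map_source hzκ)).comp_of_eq h2.continuousAt rfl
  refine h3.congr ?_
  filter_upwards [h1] with s hs using κ.left_inv hs

/-- The projection of the third derived system is constant along the paths. -/
theorem IsPathSpace.mem_map_derived_three_iff (hD : D.Is235) (hπ : IsPathSpace D W π)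
    {z z' : ProjSpace D} (hz : z ∈ W) (hz' : z' ∈ W) (h : π z' = π z) (v : E5) :
    v ∈ ((derivedSystem (prolongation D) 3 z).map (dpi D π z).toLinearMap : Submodule ℝ E5) ↔
      v ∈ ((derivedSystem (prolongation D) 3 z').map (dpi D π z').toLinearMap :
        Submodule ℝ E5) := by
  obtain ⟨c, a, b, hc, him⟩ := hπ.fibre z hz
  have hcm : ∀ t ∈ Set.Ioo a b, c t ∈ W ∧ π (c t) = π z := fun t ht => by
    have h1 : c t ∈ c '' Set.Ioo a b := ⟨t, ht, rfl⟩
    rwa [him] at h1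
  obtain ⟨t, ht, rfl⟩ : z ∈ c '' Set.Ioo a b := by rw [him]; exact ⟨hz, rfl⟩
  obtain ⟨t', ht', rfl⟩ : z' ∈ c '' Set.Ioo a b := by rw [him]; exact ⟨hz', h⟩
  -- The fibre is parametrized by an interval, so local constancy is enough. Nearby points of the
  -- fibre lie in one box, where a single form at `s = 0` describes the projected subspace at both.
  refine isPreconnected_Ioo.induction₂ (fun t t' => v ∈
    ((derivedSystem (prolongation D) 3 (c t)).map (dpi D π (c t)).toLinearMap : Submodule ℝ E5) ↔
      v ∈ ((derivedSystem (prolongation D) 3 (c t')).map (dpi D π (c t')).toLinearMap :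
        Submodule ℝ E5)) ?_ (fun _ _ _ _ _ _ h1 h2 => h1.trans h2) (fun _ _ _ _ h1 => h1.symm)
    ht ht'
  intro s hs
  obtain ⟨κ, ψ, O, e, φ, W₁, S, k, l₀, l₁, N, ε, f₀, f₁, hB, hmem, -⟩ :=
    hπ.exists_isPathBox hD (hcm s hs).1 Filter.univ_mem one_pos
  have h1 := (hc.continuousAt hD hs).preimage_mem_nhds
    ((isOpen_boxSet κ S hB.isOpen_coord _ _).mem_nhds hmem)
  filter_upwards [mem_nhdsWithin_of_mem_nhds h1, self_mem_nhdsWithin] with r hr hrI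
  -- The vector `v` is regarded in two tangent spaces whose base points are only propositionally
  -- equal.
  have h2 : ∀ x, x = π (c s) → (IsCharBox.boxForm e S (φ (π (c s)), 0) (dchart φ (π (c s)) v) = 0 ↔
      IsCharBox.boxForm e S (φ x, 0) (dchart φ x v) = 0) := by
    rintro x rfl; rfl
  exact (hB.mem_map_derived_three hmem hB.zero_mem v).trans
    ((h2 _ ((hcm r hrI).2.trans (hcm s hs).2.symm)).trans
      (hB.mem_map_derived_three hr hB.zero_mem v).symm)

/-- All points over `π z` project the third derived system to the same subspace, so the span in the
definition of `pathField` adds nothing. -/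
theorem IsPathSpace.pathField_eq (hD : D.Is235) (hπ : IsPathSpace D W π) {z : ProjSpace D}
    (hz : z ∈ W) : pathField D W π (π z) =
      (derivedSystem (prolongation D) 3 z).map (dpi D π z).toLinearMap := by
  apply le_antisymm
  · rw [pathField, Submodule.span_le]
    rintro v ⟨z', hz', w, hw, hv⟩
    have h1 : π z = π z' := congrArg Bundle.TotalSpace.proj hv
    have h2 : (v : E5) = (dpi D π z' w : E5) := by
      have h3 : ∀ q q' : TangentBundle 𝓘(ℝ, E5) X, q = q' → (q.2 : E5) = (q'.2 : E5) := by
        rintro q _ rfl; rfl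
      exact h3 _ _ hv
    refine (hπ.mem_map_derived_three_iff hD hz hz' h1.symm v).2 ?_
    rw [h2]
    exact ⟨w, hw, rfl⟩
  · rintro _ ⟨w, hw, rfl⟩
    exact Submodule.subset_span ⟨z, hz, w, hw, rfl⟩

namespace IsPathBox

variable {κ : OpenPartialHomeomorph (ProjSpace D) (E5 × ℝ)} {ψ : OpenPartialHomeomorph Y E5}
  {O : Set E5} {e : Fin 5 → E5 → E5} {φ : OpenPartialHomeomorph X E5} {W₁ : Set (ProjSpace D)}
  {S : OpenPartialHomeomorph (E5 × ℝ) (E5 × ℝ)} {k : E5 × ℝ → ℝ} {l₀ l₁ : E5 →L[ℝ] ℝ}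
  {N : Set E5} {ε : ℝ} {z : ProjSpace D} {s : ℝ} {x : X}

theorem mem_pathField (h : IsPathBox D W π κ ψ O e φ W₁ S k l₀ l₁ N ε) (hD : D.Is235)
    (hs : s ∈ Set.Ioo (-ε) ε) (hx : x ∈ φ.source) (hxN : φ x ∈ N)
    (v : TangentSpace 𝓘(ℝ, E5) x) :
    v ∈ pathField D W π x ↔ IsCharBox.boxForm e S (φ x, s) (dchart φ x v) = 0 := by
  obtain ⟨z, hz, -, rfl⟩ := h.exists_point hx hxN h.zero_mem
  rw [h.path.pathField_eq hD (h.mem_path hz)]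
  exact h.mem_map_derived_three hz hs v

theorem comap_pathField (h : IsPathBox D W π κ ψ O e φ W₁ S k l₀ l₁ N ε) (hD : D.Is235)
    (hz : z ∈ boxSet κ S N (-ε) ε) : (pathField D W π (π z)).comap (dpi D π z).toLinearMap =
      derivedSystem (prolongation D) 3 z := by
  ext w
  rw [Submodule.mem_comap, h.mem_derived_three hz h.zero_mem]
  exact h.mem_pathField hD h.zero_mem (h.apply_mem hz) (h.coord_mem hz) _

theorem contDiffOn_form (h : IsPathBox D W π κ ψ O e φ W₁ S k l₀ l₁ N ε)
    (hs : s ∈ Set.Ioo (-ε) ε) : ContDiffOn ℝ ∞ (fun y => IsCharBox.boxForm e S (y, s)) N :=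
  (h.box.contDiffOn_boxForm h.proj).comp (contDiff_id.prodMk contDiff_const).contDiffOn
    fun _ hy => h.mem_source hy hs

theorem form_ne_zero (h : IsPathBox D W π κ ψ O e φ W₁ S k l₀ l₁ N ε)
    (hs : s ∈ Set.Ioo (-ε) ε) : ∀ y ∈ N, IsCharBox.boxForm e S (y, s) ≠ 0 := fun _ hy =>
  h.box.boxForm_ne_zero h.proj (h.mem_source hy hs)

theorem isDistributionOn (h : IsPathBox D W π κ ψ O e φ W₁ S k l₀ l₁ N ε) (hD : D.Is235) :
    IsDistributionOn 4 (φ.source ∩ φ ⁻¹' N) (pathField D W π) :=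
  isDistributionOn_ker h.mem_atlas h.isOpen_coord (h.contDiffOn_form h.zero_mem)
    (h.form_ne_zero h.zero_mem) fun _ hx hxN => h.mem_pathField hD h.zero_mem hx hxN

/-- The Levi form of the induced field, in terms of vectors tangent to `P(D)`. -/
theorem leviOrthogonal_iff (h : IsPathBox D W π κ ψ O e φ W₁ S k l₀ l₁ N ε) (hD : D.Is235)
    (hs : s ∈ Set.Ioo (-ε) ε) (hx : x ∈ φ.source) (hxN : φ x ∈ N)
    {v w : TangentSpace 𝓘(ℝ, E5) x} {v' w' : E5 × ℝ}
    (hv : charForm e (S (φ x, s)) v' = 0) (hw : charForm e (S (φ x, s)) w' = 0)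
    (hvv : dchart φ x v = fderiv ℝ (fun u => φ (π (κ.symm u))) (S (φ x, s)) v')
    (hww : dchart φ x w = fderiv ℝ (fun u => φ (π (κ.symm u))) (S (φ x, s)) w') :
    LeviOrthogonal (pathField D W π) x v w ↔ dForm (charForm e) (S (φ x, s)) v' w' = 0 := by
  have hp := h.mem_source hxN hs
  have hm : ∀ {v : TangentSpace 𝓘(ℝ, E5) x} {v' : E5 × ℝ}, charForm e (S (φ x, s)) v' = 0 →
      dchart φ x v = fderiv ℝ (fun u => φ (π (κ.symm u))) (S (φ x, s)) v' →
      v ∈ pathField D W π x := fun h1 h2 => by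
    rw [h.mem_pathField hD hs hx hxN, h2, h.box.boxForm_fderiv_proj h.proj hp, h1]
  rw [CartanDuality.leviOrthogonal_iff h.mem_atlas h.isOpen_coord (h.contDiffOn_form hs)
    (h.form_ne_zero hs) (fun _ hx hxN => h.mem_pathField hD hs hx hxN) hx hxN (hm hv hvv)
    (hm hw hww), hvv, hww]
  exact Eq.congr_left (h.box.dForm_boxForm h.proj hp hv hw)

/-- A radical vector of the Levi form lifts to a radical vector of dα on ker α. Such a lift is a
multiple of `charField`, which the projection kills. -/
theorem eq_zero_of_leviOrthogonal (h : IsPathBox D W π κ ψ O e φ W₁ S k l₀ l₁ N ε) (hD : D.Is235)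
    (hx : x ∈ φ.source) (hxN : φ x ∈ N) {v : TangentSpace 𝓘(ℝ, E5) x}
    (hv : v ∈ pathField D W π x)
    (hvw : ∀ w ∈ pathField D W π x, LeviOrthogonal (pathField D W π) x v w) : v = 0 := by
  have hp := h.mem_source hxN h.zero_mem
  have hmem := h.box.mem hp
  obtain ⟨v', hv'⟩ := h.proj.surjective _ hmem (dchart φ x v)
  have hv0 : charForm e (S (φ x, 0)) v' = 0 := by
    rw [← h.box.boxForm_fderiv_proj h.proj hp, hv']
    exact (h.mem_pathField hD h.zero_mem hx hxN v).1 hv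
  obtain ⟨r, hr⟩ := h.chart.frame.mem_span_charField (h.proj.fst_mem _ hmem) hv0 fun w' hw' => by
    have h1 := dchart_inverse_apply h.mem_atlas hx
      (fderiv ℝ (fun u => φ (π (κ.symm u))) (S (φ x, 0)) w')
    refine (h.leviOrthogonal_iff hD h.zero_mem hx hxN hv0 hw' hv'.symm h1).1 (hvw _ ?_)
    rw [h.mem_pathField hD h.zero_mem hx hxN, h1, h.box.boxForm_fderiv_proj h.proj hp, hw']
  apply dchart_injective h.mem_atlas hx
  rw [map_zero, ← hv', hr, map_smul, h.proj.apply_charField _ hmem, smul_zero]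

theorem isContactOn (h : IsPathBox D W π κ ψ O e φ W₁ S k l₀ l₁ N ε) (hD : D.Is235) :
    IsContactOn (φ.source ∩ φ ⁻¹' N) (pathField D W π) :=
  ⟨h.isDistributionOn hD, fun _ hx _ hv hvw => h.eq_zero_of_leviOrthogonal hD hx.1 hx.2 hv hvw⟩

end IsPathBox

theorem IsPathSpace.isContactOn (hD : D.Is235) (hπ : IsPathSpace D W π) :
    IsContactOn (π '' W) (pathField D W π) := by
  have key : ∀ x ∈ π '' W, ∃ U, x ∈ U ∧ IsContactOn U (pathField D W π) := by
    rintro _ ⟨z, hz, rfl⟩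
    obtain ⟨κ, ψ, O, e, φ, W₁, S, k, l₀, l₁, N, ε, f₀, f₁, hB, hmem, -⟩ :=
      hπ.exists_isPathBox hD hz Filter.univ_mem one_pos
    exact ⟨φ.source ∩ φ ⁻¹' N, ⟨hB.apply_mem hmem, hB.coord_mem hmem⟩, hB.isContactOn hD⟩
  refine ⟨fun x hx => ?_, fun x hx => ?_⟩
  · obtain ⟨U, hxU, hU⟩ := key x hx
    exact hU.1 x hxU
  · obtain ⟨U, hxU, hU⟩ := key x hx
    exact hU.2 x hxU

theorem IsPathSpace.comap_pathField (hD : D.Is235) (hπ : IsPathSpace D W π) {z : ProjSpace D}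
    (hz : z ∈ W) : (pathField D W π (π z)).comap (dpi D π z).toLinearMap =
      derivedSystem (prolongation D) 3 z := by
  obtain ⟨κ, ψ, O, e, φ, W₁, S, k, l₀, l₁, N, ε, f₀, f₁, hB, hmem, -⟩ :=
    hπ.exists_isPathBox hD hz Filter.univ_mem one_pos
  exact hB.comap_pathField hD hmem

end PathField

end CartanDuality

end

/-! ### The cones of tangents: non-degeneracy and the Lagrangian property. -/

open scoped Manifold ContDiff Topology

noncomputable section

namespace CartanDuality

section PathCone

set_option linter.unusedSectionVars false

variable {Y : Type*} [TopologicalSpace Y] [ChartedSpace E5 Y] [IsManifold 𝓘(ℝ, E5) ∞ Y]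
  {X : Type*} [TopologicalSpace X] [ChartedSpace E5 X] [IsManifold 𝓘(ℝ, E5) ∞ X]

/-- The cones and their tangent spaces are formed in `E5` without reference to the chart `φ`; the
automorphism `A` carries them to the curves computed in coordinates. -/
theorem exists_dchart_equiv {φ : OpenPartialHomeomorph X E5}
    (hφ : φ ∈ IsManifold.maximalAtlas 𝓘(ℝ, E5) ∞ X) {x : X} (hx : x ∈ φ.source) :
    ∃ A : E5 ≃L[ℝ] E5, ∀ v : TangentSpace 𝓘(ℝ, E5) x, dchart φ x v = A v := by
  obtain ⟨M, hM⟩ := dchart_isInvertible hφ hx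
  exact ⟨M, fun v => (DFunLike.congr_fun hM v).symm⟩

namespace IsPathBox

variable {D : PlaneField Y} {W : Set (ProjSpace D)} {π : ProjSpace D → X}
  {κ : OpenPartialHomeomorph (ProjSpace D) (E5 × ℝ)} {ψ : OpenPartialHomeomorph Y E5}
  {O : Set E5} {e : Fin 5 → E5 → E5} {φ : OpenPartialHomeomorph X E5} {W₁ : Set (ProjSpace D)}
  {S : OpenPartialHomeomorph (E5 × ℝ) (E5 × ℝ)} {k : E5 × ℝ → ℝ} {l₀ l₁ : E5 →L[ℝ] ℝ}
  {N : Set E5} {ε : ℝ} {z : ProjSpace D} {s : ℝ} {x : X}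

/-- The cone of tangents, in coordinates, is the cone over a curve. -/
theorem mem_fibreAt (h : IsPathBox D W π κ ψ O e φ W₁ S k l₀ l₁ N ε) (hx : x ∈ φ.source)
    (hxN : φ x ∈ N) (v : TangentSpace 𝓘(ℝ, E5) x) :
    v ∈ fibreAt (coneField D (boxSet κ S N (-ε) ε) π) x ↔ ∃ s ∈ Set.Ioo (-ε) ε, ∃ r : ℝ,
      dchart φ x v = r • IsCharBox.transverse e (fun u => φ (π (κ.symm u))) S 0 (φ x, s) := by
  constructor
  · rintro ⟨z, hz, ξ, hξ, hv⟩
    have h1 : ∀ (x' : X) (v' : TangentSpace 𝓘(ℝ, E5) x'), (⟨x, v⟩ : TangentBundle 𝓘(ℝ, E5) X) =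
        ⟨x', v'⟩ → x = x' ∧ φ x = φ x' ∧ dchart φ x v = dchart φ x' v' := by
      rintro x' v' h
      cases h
      exact ⟨rfl, rfl, rfl⟩
    obtain ⟨-, hφx, hvv⟩ := h1 _ _ hv
    obtain ⟨s, hs, hzs⟩ := h.exists_param hz
    refine ⟨s, hs, (dchart κ z ξ).2, ?_⟩
    have h2 := (h.chart.mem_vertical (h.mem_chart hz) ξ).1 hξ
    have h3 : dchart κ z ξ = (dchart κ z ξ).2 • ((0 : E5), (1 : ℝ)) := by
      refine Prod.ext ?_ ?_
      · rw [h2]; simp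
      · simp
    rw [hvv, h.dchart_dpi hz, h3, map_smul, hzs, hφx]
    simp [IsCharBox.transverse, IsCharProjection.transverseField]
  · rintro ⟨s, hs, r, hr⟩
    obtain ⟨z, hz, hzs, rfl⟩ := h.exists_point hx hxN hs
    have h1 := dchart_inverse_apply h.chart.mem_atlas (h.mem_chart hz) (r • ((0 : E5), (1 : ℝ)))
    refine ⟨z, hz, (dchart κ z).inverse (r • ((0 : E5), (1 : ℝ))),
      (h.chart.mem_vertical (h.mem_chart hz) _).2 (by rw [h1]; simp), ?_⟩
    congr 1
    apply dchart_injective h.mem_atlas hx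
    rw [h.dchart_dpi hz, h1, map_smul, hzs]
    exact hr

/-- The curve of directions of the cone at `x`, with respect to the linear coordinates `A`. -/
theorem fibreAt_eq (h : IsPathBox D W π κ ψ O e φ W₁ S k l₀ l₁ N ε) (hx : x ∈ φ.source)
    (hxN : φ x ∈ N) {A : E5 ≃L[ℝ] E5} (hA : ∀ v : TangentSpace 𝓘(ℝ, E5) x, dchart φ x v = A v) :
    fibreAt (coneField D (boxSet κ S N (-ε) ε) π) x = curveCone (fun s => A.symm
      (IsCharBox.transverse e (fun u => φ (π (κ.symm u))) S 0 (φ x, s))) (-ε) ε := by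
  ext v
  refine (h.mem_fibreAt hx hxN v).trans ?_
  refine exists_congr fun s => and_congr_right fun hs => exists_congr fun r => ?_
  rw [hA v, ← map_smul, ContinuousLinearEquiv.eq_symm_apply]

variable {A : E5 ≃L[ℝ] E5}

theorem contDiffOn_curve (h : IsPathBox D W π κ ψ O e φ W₁ S k l₀ l₁ N ε) (hxN : φ x ∈ N)
    (A : E5 ≃L[ℝ] E5) : ContDiffOn ℝ ∞ (fun s => A.symm
      (IsCharBox.transverse e (fun u => φ (π (κ.symm u))) S 0 (φ x, s))) (Set.Ioo (-ε) ε) :=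
  A.symm.contDiff.comp_contDiffOn (IsCharBox.contDiffOn_slice
    (h.box.contDiffOn_transverse h.proj 0) h.prod_subset hxN)

theorem apply_curve_ne_zero (h : IsPathBox D W π κ ψ O e φ W₁ S k l₀ l₁ N ε) (hxN : φ x ∈ N)
    (A : E5 ≃L[ℝ] E5) : ∀ s ∈ Set.Ioo (-ε) ε, l₀.comp (A : E5 →L[ℝ] E5) (A.symm
      (IsCharBox.transverse e (fun u => φ (π (κ.symm u))) S 0 (φ x, s))) ≠ 0 := by
  intro s hs
  rw [ContinuousLinearMap.comp_apply, ContinuousLinearEquiv.coe_coe, A.apply_symm_apply]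
  exact h.box.ne_zero _ (h.mem_source hxN hs)

theorem apply_curve_slope (h : IsPathBox D W π κ ψ O e φ W₁ S k l₀ l₁ N ε) (hxN : φ x ∈ N)
    (A : E5 ≃L[ℝ] E5) : ∀ s ∈ Set.Ioo (-ε) ε, l₁.comp (A : E5 →L[ℝ] E5) (A.symm
      (IsCharBox.transverse e (fun u => φ (π (κ.symm u))) S 0 (φ x, s))) =
      s * l₀.comp (A : E5 →L[ℝ] E5) (A.symm
        (IsCharBox.transverse e (fun u => φ (π (κ.symm u))) S 0 (φ x, s))) := by
  intro s hs
  rw [ContinuousLinearMap.comp_apply, ContinuousLinearMap.comp_apply,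
    ContinuousLinearEquiv.coe_coe, A.apply_symm_apply]
  exact h.box.slope_eq _ (h.mem_source hxN hs)

theorem isNondegenerateOn (h : IsPathBox D W π κ ψ O e φ W₁ S k l₀ l₁ N ε) :
    IsNondegenerateOn (φ.source ∩ φ ⁻¹' N) (coneField D (boxSet κ S N (-ε) ε) π) := by
  rintro x ⟨hx, hxN⟩
  obtain ⟨A, hA⟩ := exists_dchart_equiv h.mem_atlas hx
  rw [h.fibreAt_eq hx hxN hA]
  have h0 := h.apply_curve_ne_zero hxN A
  refine ⟨⟨_, smul_mem_curveCone_diff h0 h.zero_mem one_ne_zero⟩, ?_⟩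
  rintro v ⟨⟨s, hs, r, rfl⟩, hv⟩
  have hr : r ≠ 0 := by
    rintro rfl
    exact hv (zero_smul _ _)
  refine ⟨exists_isParametrizationAt (h.contDiffOn_curve hxN A) h0 (h.apply_curve_slope hxN A) hs
    hr, fun c hc => linearIndependent_iteratedDeriv_of_isParametrizationAt
      (h.contDiffOn_curve hxN A) h0 (h.apply_curve_slope hxN A) (fun s hs => ?_) hc⟩
  exact h.box.linearIndependent_iteratedDeriv h.proj (h.mem_source hxN hs) A.symm

/-- The plane spanned by the images of the vertical vectors and of the second field of the frame. -/
theorem isotropic (h : IsPathBox D W π κ ψ O e φ W₁ S k l₀ l₁ N ε) (hD : D.Is235)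
    (hs : s ∈ Set.Ioo (-ε) ε) (hx : x ∈ φ.source) (hxN : φ x ∈ N)
    {v w : TangentSpace 𝓘(ℝ, E5) x} {p q p' q' : ℝ}
    (hv : dchart φ x v = p • IsCharBox.transverse e (fun u => φ (π (κ.symm u))) S 0 (φ x, s) +
      q • IsCharBox.transverse e (fun u => φ (π (κ.symm u))) S 1 (φ x, s))
    (hw : dchart φ x w = p' • IsCharBox.transverse e (fun u => φ (π (κ.symm u))) S 0 (φ x, s) +
      q' • IsCharBox.transverse e (fun u => φ (π (κ.symm u))) S 1 (φ x, s)) :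
    v ∈ pathField D W π x ∧ LeviOrthogonal (pathField D W π) x v w := by
  have hp := h.mem_source hxN hs
  have hO := h.proj.fst_mem _ (h.box.mem hp)
  have h0 : ∀ p q : ℝ, charForm e (S (φ x, s)) (p • ((0 : E5), (1 : ℝ)) +
      q • (e 1 (S (φ x, s)).1, (0 : ℝ))) = 0 := fun p q => by
    rw [IsAdaptedFrame.charForm_apply]
    simp [h.chart.frame.coframe_apply hO]
  have h1 : ∀ {v : E5} {p q : ℝ},
      v = p • IsCharBox.transverse e (fun u => φ (π (κ.symm u))) S 0 (φ x, s) +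
      q • IsCharBox.transverse e (fun u => φ (π (κ.symm u))) S 1 (φ x, s) →
      v = fderiv ℝ (fun u => φ (π (κ.symm u))) (S (φ x, s)) (p • ((0 : E5), (1 : ℝ)) +
        q • (e 1 (S (φ x, s)).1, (0 : ℝ))) := fun hv => by
    rw [hv, map_add, map_smul, map_smul]
    rfl
  refine ⟨?_, (h.leviOrthogonal_iff hD hs hx hxN (h0 p q) (h0 p' q') (h1 hv) (h1 hw)).2 ?_⟩
  · rw [h.mem_pathField hD hs hx hxN, h1 hv, h.box.boxForm_fderiv_proj h.proj hp, h0]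
  · have h2 := h.chart.frame.dForm_vertical_frame_one hO
    have h3 := dForm_swap (charForm e) (S (φ x, s)) (e 1 (S (φ x, s)).1, 0) (0, 1)
    rw [h2] at h3
    simp only [dForm_add_left, dForm_add_right, dForm_smul_left, dForm_smul_right, dForm_self, h2,
      h3]
    simp

/-- The tangent plane of the cone is spanned by the generating curve and its derivative. The latter
is the image of `-k e 1` plus a multiple of the curve, so the plane is the image of the span of ∂ₜ
and `e 1`. -/
theorem isLagrangian (h : IsPathBox D W π κ ψ O e φ W₁ S k l₀ l₁ N ε) (hD : D.Is235)
    (hx : x ∈ φ.source) (hxN : φ x ∈ N) {v : E5}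
    (hv : v ∈ fibreAt (coneField D (boxSet κ S N (-ε) ε) π) x \ {0}) :
    IsLagrangian (pathField D W π) x
      (tangentTo (fibreAt (coneField D (boxSet κ S N (-ε) ε) π) x \ {0}) v) := by
  obtain ⟨A, hA⟩ := exists_dchart_equiv h.mem_atlas hx
  rw [h.fibreAt_eq hx hxN hA] at hv ⊢
  have h0 := h.apply_curve_ne_zero hxN A
  have h1 := h.apply_curve_slope hxN A
  have hk := h.contDiffOn_curve hxN A
  obtain ⟨⟨s, hs, r, rfl⟩, hv⟩ := hv
  have hr : r ≠ 0 := by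
    rintro rfl
    exact hv (zero_smul _ _)
  rw [tangentTo_curveCone hk h0 h1 hs hr]
  have hli := linearIndependent_curve_deriv hk h0 h1 hs
  obtain ⟨a, -, hd⟩ := h.box.hasDerivAt_transverse' h.proj
  have hderiv := (A.symm.hasFDerivAt.comp_hasDerivAt s (hd _ (h.mem_source hxN hs)).1).deriv
  have key : ∀ v ∈ Submodule.span ℝ {A.symm (IsCharBox.transverse e (fun u => φ (π (κ.symm u))) S 0
      (φ x, s)), deriv (fun s => A.symm (IsCharBox.transverse e (fun u => φ (π (κ.symm u))) S 0
        (φ x, s))) s}, ∃ p q : ℝ, A v = p • IsCharBox.transverse e (fun u => φ (π (κ.symm u))) S 0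
          (φ x, s) + q • IsCharBox.transverse e (fun u => φ (π (κ.symm u))) S 1 (φ x, s) := by
    intro v hv
    obtain ⟨p, q, rfl⟩ := Submodule.mem_span_pair.1 hv
    refine ⟨p + q * a 0 (φ x, s), -(q * k (φ x, s)), ?_⟩
    have h2 : A (deriv (fun s => A.symm (IsCharBox.transverse e (fun u => φ (π (κ.symm u))) S 0
        (φ x, s))) s) = -k (φ x, s) • IsCharBox.transverse e (fun u => φ (π (κ.symm u))) S 1
          (φ x, s) + a 0 (φ x, s) • IsCharBox.transverse e (fun u => φ (π (κ.symm u))) S 0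
            (φ x, s) := by
      refine (congrArg A hderiv).trans ?_
      exact A.apply_symm_apply _
    rw [map_add, map_smul, map_smul, A.apply_symm_apply, h2]
    module
  refine ⟨fun v hv => ?_, ?_, fun v hv w hw => ?_⟩
  · obtain ⟨p, q, hpq⟩ := key v hv
    exact (h.isotropic hD hs hx hxN ((hA v).trans hpq) ((hA v).trans hpq)).1
  · have h2 := finrank_span_eq_card hli
    have h3 : Set.range ![A.symm (IsCharBox.transverse e (fun u => φ (π (κ.symm u))) S 0 (φ x, s)),
        deriv (fun s => A.symm (IsCharBox.transverse e (fun u => φ (π (κ.symm u))) S 0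
          (φ x, s))) s] = {A.symm (IsCharBox.transverse e (fun u => φ (π (κ.symm u))) S 0 (φ x, s)),
        deriv (fun s => A.symm (IsCharBox.transverse e (fun u => φ (π (κ.symm u))) S 0
          (φ x, s))) s} := by simp [Set.pair_comm]
    rw [h3, Fintype.card_fin] at h2
    exact h2
  · obtain ⟨p, q, hpq⟩ := key v hv
    obtain ⟨p', q', hpq'⟩ := key w hw
    exact (h.isotropic hD hs hx hxN ((hA v).trans hpq) ((hA w).trans hpq')).2

theorem fibreAt_subset (h : IsPathBox D W π κ ψ O e φ W₁ S k l₀ l₁ N ε) (hD : D.Is235)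
    (hx : x ∈ φ.source) (hxN : φ x ∈ N) {v : TangentSpace 𝓘(ℝ, E5) x}
    (hv : v ∈ fibreAt (coneField D (boxSet κ S N (-ε) ε) π) x) : v ∈ pathField D W π x := by
  obtain ⟨s, hs, r, hr⟩ := (h.mem_fibreAt hx hxN v).1 hv
  have h1 : dchart φ x v = r • IsCharBox.transverse e (fun u => φ (π (κ.symm u))) S 0 (φ x, s) +
      (0 : ℝ) • IsCharBox.transverse e (fun u => φ (π (κ.symm u))) S 1 (φ x, s) := by
    rw [hr, zero_smul, add_zero]
  exact (h.isotropic hD hs hx hxN h1 h1).1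

end IsPathBox

end PathCone

end CartanDuality

end

/-! ### The cone structure and the conclusion. -/

open scoped Manifold ContDiff Topology

noncomputable section

namespace CartanDuality

section ConeStructure

set_option linter.unusedSectionVars false

variable {Y : Type*} [TopologicalSpace Y] [ChartedSpace E5 Y] [IsManifold 𝓘(ℝ, E5) ∞ Y]
  {X : Type*} [TopologicalSpace X] [ChartedSpace E5 X] [IsManifold 𝓘(ℝ, E5) ∞ X]
  {D : PlaneField Y} {W : Set (ProjSpace D)} {π : ProjSpace D → X}
  {κ : OpenPartialHomeomorph (ProjSpace D) (E5 × ℝ)} {ψ : OpenPartialHomeomorph Y E5}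
  {O : Set E5} {e : Fin 5 → E5 → E5} {φ : OpenPartialHomeomorph X E5} {W₁ : Set (ProjSpace D)}
  {S : OpenPartialHomeomorph (E5 × ℝ) (E5 × ℝ)} {k : E5 × ℝ → ℝ} {l₀ l₁ : E5 →L[ℝ] ℝ}
  {N : Set E5} {ε : ℝ}

theorem smul_mem_curveCone {k : ℝ → E5} {a b : ℝ} {v : E5} (hv : v ∈ curveCone k a b) (r : ℝ) :
    r • v ∈ curveCone k a b := by
  obtain ⟨s, hs, t, rfl⟩ := hv
  exact ⟨s, hs, r * t, smul_smul _ _ _⟩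

/-- The model is the sector of slopes in `(-ε, ε)` in the plane of `f₀`, `f₁`. The map `T` takes the
generators normalized by `l₀ = 1` to `f₀ + s f₁`, and homogeneity extends this to the cones. -/
theorem IsPathBox.isConeStructureOn (h : IsPathBox D W π κ ψ O e φ W₁ S k l₀ l₁ N ε)
    {f₀ f₁ : E5} (h00 : l₀ f₀ = 1) (h01 : l₀ f₁ = 0) (h10 : l₁ f₀ = 0) (h11 : l₁ f₁ = 1)
    {T U : E5 → E5 → E5} (hUT : ∀ y ∈ N, ∀ v, U y (T y v) = v) (hTU : ∀ y ∈ N, ∀ w, T y (U y w) = w)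
    (hT : ∀ y ∈ N, ∀ (r : ℝ) (v : E5), T y (r • v) = r • T y v)
    (hTs : ContDiffOn ℝ ∞ (fun q : E5 × E5 => T q.1 q.2) {q | q.1 ∈ N ∧ q.2 ≠ 0})
    (hUs : ContDiffOn ℝ ∞ (fun q : E5 × E5 => U q.1 q.2) {q | q.1 ∈ N ∧ q.2 ≠ 0})
    (hline : ∀ y ∈ N, ∀ s ∈ Set.Ioo (-ε) ε,
      T y ((l₀ (IsCharBox.transverse e (fun u => φ (π (κ.symm u))) S 0 (y, s)))⁻¹ •
        IsCharBox.transverse e (fun u => φ (π (κ.symm u))) S 0 (y, s)) = f₀ + s • f₁) :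
    IsConeStructureOn (φ.source ∩ φ ⁻¹' N) (coneField D (boxSet κ S N (-ε) ε) π) := by
  refine ⟨curveCone (fun s => f₀ + s • f₁) (-ε) ε, fun r _ v hv => smul_mem_curveCone hv r,
    ⟨2, isSubmanifold_curveCone h00 h01 h10 h11 _ _⟩, fun x hx => ⟨φ.source ∩ φ ⁻¹' N, _, _, hx,
      le_rfl, isConeTriviality h.mem_atlas h.isOpen_coord hUT hTU hT hTs hUs, ?_⟩⟩
  rintro x ⟨hx, hxN⟩
  have hne : ∀ s ∈ Set.Ioo (-ε) ε,
      l₀ (IsCharBox.transverse e (fun u => φ (π (κ.symm u))) S 0 (φ x, s)) ≠ 0 := fun s hs =>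
    h.box.ne_zero _ (h.mem_source hxN hs)
  have hline' : ∀ s ∈ Set.Ioo (-ε) ε, ∀ r : ℝ,
      T (φ x) (r • IsCharBox.transverse e (fun u => φ (π (κ.symm u))) S 0 (φ x, s)) =
        (r * l₀ (IsCharBox.transverse e (fun u => φ (π (κ.symm u))) S 0 (φ x, s))) •
          (f₀ + s • f₁) := fun s hs r => by
    rw [← hline _ hxN s hs, ← hT _ hxN, smul_smul, mul_assoc, mul_inv_cancel₀ (hne s hs), mul_one]
  ext w
  constructor
  · rintro ⟨v, hv, rfl⟩
    obtain ⟨s, hs, r, hr⟩ := (h.mem_fibreAt hx hxN v).1 hv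
    exact ⟨s, hs, _, (congrArg (T (φ x)) hr).trans (hline' s hs r)⟩
  · rintro ⟨s, hs, r, rfl⟩
    have h1 := dchart_inverse_apply h.mem_atlas hx
      ((r * (l₀ (IsCharBox.transverse e (fun u => φ (π (κ.symm u))) S 0 (φ x, s)))⁻¹) •
        IsCharBox.transverse e (fun u => φ (π (κ.symm u))) S 0 (φ x, s))
    refine ⟨_, (h.mem_fibreAt hx hxN _).2 ⟨s, hs, _, h1⟩, ?_⟩
    refine (congrArg (T (φ x)) h1).trans ((hline' s hs _).trans ?_)
    rw [mul_assoc, inv_mul_cancel₀ (hne s hs), mul_one]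

/-- Every point has arbitrarily small neighbourhoods such that the cone field of tangents is a
non-degenerate Lagrangian cone structure. -/
theorem IsPathSpace.exists_isLagrangianConeStructureOn (hD : D.Is235) (hπ : IsPathSpace D W π)
    {z₀ : ProjSpace D} (hz₀ : z₀ ∈ W) {V : Set (ProjSpace D)} (hV : V ∈ 𝓝 z₀) :
    ∃ W' : Set (ProjSpace D), z₀ ∈ W' ∧ W' ⊆ W ∩ V ∧ IsPathSpace D W' π ∧ IsOpen (π '' W') ∧
      IsLagrangianConeStructureOn (π '' W') (coneField D W' π) (pathField D W π) ∧
      IsNondegenerateOn (π '' W') (coneField D W' π) := by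
  -- The constant `δ` precedes the choice of the box, which is then made small enough for it.
  obtain ⟨δ, hδ, hcone⟩ := exists_coneTriviality
  obtain ⟨κ, ψ, O, e, φ, W₁, S, k, l₀, l₁, N, ε, f₀, f₁, h, hmem, hW₁V, h00, h01, h10, h11, h3, hG⟩ :=
    hπ.exists_isPathBox hD hz₀ hV hδ
  let c : E5 × ℝ → E5 := IsCharBox.transverse e (fun u => φ (π (κ.symm u))) S 0
  have hne : ∀ p ∈ S.source, l₀ (c p) ≠ 0 := h.box.ne_zero
  have hsl : ∀ p ∈ S.source, l₁ (c p) = p.2 * l₀ (c p) := h.box.slope_eq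
  -- Extended by zero off the box, so that `l₀ G = l₁ G = 0` holds everywhere; inside, these two
  -- identities express the normalization and the choice of the slope as parameter.
  let G : E5 × ℝ → E5 := S.source.indicator fun p => (l₀ (c p))⁻¹ • c p - f₀ - p.2 • f₁
  have hGS : ∀ p ∈ S.source, G p = (l₀ (c p))⁻¹ • c p - f₀ - p.2 • f₁ := fun p hp =>
    Set.indicator_of_mem hp _
  have hGn : ∀ p ∉ S.source, G p = 0 := fun p hp => Set.indicator_of_notMem hp _
  have hc := h.box.contDiffOn_transverse h.proj 0
  have hGs : ContDiffOn ℝ ∞ G S.source :=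
    (((((l₀.contDiff.comp_contDiffOn hc).inv hne).smul hc).sub contDiffOn_const).sub
      (contDiff_snd.contDiffOn.smul contDiffOn_const)).congr hGS
  have hG0 : ∀ p, l₀ (G p) = 0 := fun p => by
    by_cases hp : p ∈ S.source
    · rw [hGS p hp, map_sub, map_sub, map_smul, map_smul, h00, h01, smul_eq_mul,
        inv_mul_cancel₀ (hne p hp)]
      simp
    · rw [hGn p hp, map_zero]
  have hG1 : ∀ p, l₁ (G p) = 0 := fun p => by
    by_cases hp : p ∈ S.source
    · rw [hGS p hp, map_sub, map_sub, map_smul, map_smul, h10, h11, hsl p hp, smul_eq_mul,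
        mul_left_comm, inv_mul_cancel₀ (hne p hp)]
      simp
    · rw [hGn p hp, map_zero]
  obtain ⟨T, U, hUT, hTU, hT, hTs, hUs, hline⟩ := hcone l₀ l₁ f₀ f₁ h00 h01 h10 h11 N ε G
    h.isOpen_coord h.pos (hGs.mono h3) hG0 hG1 fun p hp => by
      rw [hGS p (h3 hp)]; exact hG p hp
  refine ⟨boxSet κ S N (-ε) ε, hmem, fun z hz => ⟨h.mem_path hz, hW₁V (h.boxSet_subset hz)⟩,
    h.isPathSpace, ?_⟩
  rw [h.image_boxSet]
  refine ⟨φ.isOpen_inter_preimage h.isOpen_coord, ?_, h.isNondegenerateOn⟩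
  refine ⟨h.isConeStructureOn h00 h01 h10 h11 hUT hTU hT hTs hUs fun y hy s hs => ?_,
    h.isContactOn hD, fun x hx v hv => h.fibreAt_subset hD hx.1 hx.2 hv,
    fun x hx v hv => h.isLagrangian hD hx.1 hx.2 hv⟩
  have h1 := hline y hy s hs
  rw [hGS _ (h.mem_source hy hs)] at h1
  refine (congrArg (T y) ?_).trans h1
  change (l₀ (c (y, s)))⁻¹ • c (y, s) = f₀ + s • f₁ + ((l₀ (c (y, s)))⁻¹ • c (y, s) - f₀ - s • f₁)
  abel

end ConeStructure

end CartanDuality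

end

theorem lemma2p4 {Y : Type*} [TopologicalSpace Y] [T2Space Y] [ChartedSpace E5 Y]
    [IsManifold 𝓘(ℝ, E5) ∞ Y] (D : PlaneField Y) (hD : D.Is235) :
    (∀ z₀ : ProjSpace D, ∃ (W : Set (ProjSpace D)) (π : ProjSpace D → E5),
      z₀ ∈ W ∧ IsPathSpace D W π) ∧
    ∀ (X : Type*) [TopologicalSpace X] [T2Space X] [ChartedSpace E5 X]
      [IsManifold 𝓘(ℝ, E5) ∞ X] (W : Set (ProjSpace D)) (π : ProjSpace D → X),
      IsPathSpace D W π →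
      ∃ D' : ∀ x : X, Submodule ℝ (TangentSpace 𝓘(ℝ, E5) x),
        IsContactOn (π '' W) D' ∧
        (∀ z ∈ W, (D' (π z)).comap (dpi D π z).toLinearMap =
          derivedSystem (prolongation D) 3 z) ∧
        ∀ z₀ ∈ W, ∀ V ∈ 𝓝 z₀, ∃ W' : Set (ProjSpace D), z₀ ∈ W' ∧ W' ⊆ W ∩ V ∧
          IsPathSpace D W' π ∧ IsOpen (π '' W') ∧
          IsLagrangianConeStructureOn (π '' W') (coneField D W' π) D' ∧
          IsNondegenerateOn (π '' W') (coneField D W' π) := by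
  refine ⟨exists_isPathSpace hD, fun X _ _ _ _ W π hπ => ?_⟩
  exact ⟨pathField D W π, hπ.isContactOn hD, fun z hz => hπ.comap_pathField hD hz,
    fun z₀ hz₀ V hV => hπ.exists_isLagrangianConeStructureOn hD hz₀ hV⟩
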